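/- Throughout, $R$ is a commutative ring, $|x|$ denotes degree, $s^{\pm1}$ shifts degree by $\pm1$, and all signs $\pm$ below are Koszul signs (unless given explicitly). For a (co)augmented $M$, $\overline M$ is the augmentation ideal, respectively the kernel of the counit. **Notation.** For a coaugmented DG-coalgebra $(C,d,\nabla)$ the cobar construction is $\Omega C=(T(s^{-1}\overline C),d_\Omega)$, with the concatenation product and the derivation $d_\Omega(s^{-1}c)=-s^{-1}dc+(s^{-1}\otimes s^{-1})\overline\nabla c$. For an augmented DG-algebra $\Lambda$ the bar construction is $\mathrm B\Lambda=T^c(s\overline\Lambda)$ with the deconcatenation coproduct and the coderivation with components $-sds^{-1}$ and $s\mu_\Lambda(s^{-1}\otimes s^{-1})$. We write $[c_1|\dots|c_n]=s^{-1}c_1\otimes\dots\otimes s^{-1}c_n$. *Homotopy G-coalgebra*: a $1$-reduced DG-coalgebra $C$ (that is, $C_{<0}=0$, $C_0=R$, $C_1=0$) with a coproduct making $\Omega C$ a DG-bialgebra, such that the components $E^{i,j}:s^{-1}\overline C\to(s^{-1}\overline C)^{\otimes i}\otimes(s^{-1}\overline C)^{\otimes j}$ vanish for $i\ge1$, $j\ge2$.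 *Homotopy G-algebra*: a connected DG-algebra $\Lambda$ with a product $\mu_E$ on $\mathrm B\Lambda$ making $\mathrm B\Lambda$ an associative unital DG-bialgebra, such that the components $E_{i,j}(a_1,\dots,a_i;b_1,\dots,b_j)\in\overline\Lambda$ of $(sa_1\otimes\cdots\otimes sa_i)\cdot(sb_1\otimes\cdots\otimes sb_j)$ vanish for $i\ge2$, $j\ge1$. Put $\{a;b\}=E_{1,1}(a;b)-(-1)^{(|a|+1)(|b|+1)}E_{1,1}(b;a)$, where $E_{1,1}$ is extended by zero to the unit. *Homotopy BV-algebra*: a homotopy G-algebra $\Lambda$ with a linear map $\Delta:\Lambda\to\Lambda$ of degree $1$ such that $d\Delta=-\Delta d$, $\Delta^2=0$ and, for some linear map $H:\Lambda\otimes\Lambda\to\Lambda$ of degree $2$ and all homogeneous $a,b$, $$\{a;b\}=(-1)^{|a|}\bigl(\Delta(ab)-\Delta(a)b-(-1)^{|a|}a\Delta(b)\bigr)+dH(a;b)+H(da;b)-(-1)^{|a|}H(a;db).$$ *Baues' coproduct.* For a $1$-reduced simplicial set $Y$ let $C_*(Y)$ be the normalized chains over $R$ with the Alexander–Whitney coproduct.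 Then $\nabla_0:\Omega C_*(Y)\to\Omega C_*(Y)\otimes\Omega C_*(Y)$ is the multiplicative map with $$\nabla_0[\sigma]=\sum_{b=\{b_1<\dots<b_r\}\subseteq\{1,\dots,n-1\}}(-1)^{\zeta}\,[\sigma(0,\dots,b_1)|\sigma(b_1,\dots,b_2)|\cdots|\sigma(b_r,\dots,n)]\otimes[\sigma(0,b,n)],$$ $\zeta=\sum_{i=1}^r(r+1-i)(b_i-b_{i-1})-r(r+1)/2$, $b_0=0$, for $\sigma\in Y_n$, $n\ge2$; one-dimensional entries are omitted (read as the unit) and degenerate entries of dimension $\ge2$ are zero. *Suspension.* For a simplicial set $X$ with one vertex $*$, $\Sigma X$ has as $n$-simplices the pairs $(i,x)$ with $1\le i\le n$, $x\in X_{n-i}$, together with $a_n=s_0^n a_0$, modulo $(i,s_0^{n-i}*)=a_n$. It satisfies $d_0(1,x)=a_n$ for $x\in X_n$, $d_1(1,x)=a_0$ for $x\in X_0$, $d_{j+1}(1,x)=(1,d_jx)$ for $x\in X_n$, $n>0$, $s_0(i,x)=(i+1,x)$ and $s_{j+1}(1,x)=(1,s_jx)$, and these identities determine all its operators. *Kadeishvili's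 operations and the Connes–Moscovici operator.* Let $\mathcal H$ be a DG-bialgebra. For $a\in\mathcal H$ put $a\cdot[b_1|\dots|b_m]=\sum\pm[a^1b_1|\dots|a^mb_m]$ (iterated coproduct of $a$), where $a\cdot[b]=(-1)^{|a|}[ab]$ and the further signs are Koszul signs. On $\Omega\mathcal H$, for $x=[a_1|\dots|a_n]$, $$E_{1,k}(x;y_1,\dots,y_k)=\sum_{1\le i_1<\dots<i_k\le n}\pm[a_1|\dots|a_{i_1-1}]\otimes(a_{i_1}\cdot y_1)\otimes\dots\otimes(a_{i_k}\cdot y_k)\otimes[a_{i_k+1}|\dots|a_n],$$ the sign being $\prod_j(-1)^{|a_{i_j}|}$ times the Koszul sign for moving each $sy_j$ to the right of $[a_{i_j}]$; so $E_{1,1}([a];[b])=[ab]$. If $\mathcal H$ has an antipode $S$ with $S^2=\mathrm{id}$, the Connes–Moscovici operator on $\Omega\mathcal H$ is zero on tensors of length $\le1$, and on tensors of length $n\ge2$ it is $\Delta=\sum_{i=0}^{n-1}\pi_n\tau_n^i$, where $\tau_n[a_1|\dots|a_n]=(-1)^{(|a_1|-1)\sum_{i\ge2}(|a_i|-1)}[a_2|\dots|a_n|a_1]$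 and $\pi_n[a_1|\dots|a_n]=S(a_1)\cdot[a_2|\dots|a_n]=\sum\pm[S(a_1^{n-1})a_2|\dots|S(a_1^1)a_n]$. **Theorem.** Let $X$ be a simplicial set with exactly one vertex, let $\Sigma^2X$ be its double simplicial suspension and $C=C_*(\Sigma^2X)$. 1. Baues' coproduct $\nabla_0$ makes $C$ a homotopy G-coalgebra, and its operations are trivial: $E^{i,j}=0$ for all $i,j\ge1$ (in particular $E^{k,1}=0$ and $E^{1,k}=0$ for $k\ge1$). Hence $\nabla_0$ is the shuffle coproduct $\nabla_0[c_1|\dots|c_n]=\sum_{I_0\sqcup I_1=\{1,\dots,n\}}\pm[c_{I_0}]\otimes[c_{I_1}]$. 2. With $\nabla_0$, $\Omega C$ is a DG-Hopf algebra whose antipode $S$ satisfies $S^2=\mathrm{id}$. The double cobar construction $\Omega^2C=\Omega(\Omega C,\nabla_0)$, with a product on $\mathrm B\Omega^2C$ whose operations $E_{1,k}$, $k\ge1$, are Kadeishvili's, is a homotopy G-algebra, and with the Connes–Moscovici operator as BV-operator it is a homotopy BV-algebra. -/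

import Mathlib

open CategoryTheory Simplicial Opposite

universe u v

namespace DoubleCobar

namespace Suspension

/-- The number of vertices of `⦋m⦌` that a monotone map `f` sends strictly below `i`. -/
def cut {m n : ℕ} (f : ⦋m⦌ ⟶ ⦋n⦌) (i : ℕ) : ℕ :=
  (Finset.univ.filter fun j : Fin (m + 1) => (f.toOrderHom j : ℕ) < i).card

theorem lt_cut_iff {m n : ℕ} (f : ⦋m⦌ ⟶ ⦋n⦌) (i : ℕ) (j : Fin (m + 1)) :
    (j : ℕ) < cut f i ↔ (f.toOrderHom j : ℕ) < i := by
  unfold cut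
  constructor
  · intro h
    by_contra hc
    have : (Finset.univ.filter fun j : Fin (m + 1) => (f.toOrderHom j : ℕ) < i) ⊆
        Finset.Iio j := by
      intro k hk
      simp only [Finset.mem_filter, Finset.mem_univ, true_and] at hk
      rw [Finset.mem_Iio]
      by_contra hkj
      have : f.toOrderHom j ≤ f.toOrderHom k := f.toOrderHom.monotone (not_lt.mp hkj)
      have : (f.toOrderHom j : ℕ) ≤ f.toOrderHom k := this
      omega
    have := Finset.card_le_card this
    rw [Fin.card_Iio] at this
    omega
  · intro h
    have : Finset.Iic j ⊆
        (Finset.univ.filter fun j : Fin (m + 1) => (f.toOrderHom j : ℕ) < i) := by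
      intro k hk
      simp only [Finset.mem_filter, Finset.mem_univ, true_and]
      have : f.toOrderHom k ≤ f.toOrderHom j := f.toOrderHom.monotone (Finset.mem_Iic.mp hk)
      have : (f.toOrderHom k : ℕ) ≤ f.toOrderHom j := this
      omega
    have := Finset.card_le_card this
    rw [Fin.card_Iic] at this
    omega

theorem cut_eq_of {m n : ℕ} (f : ⦋m⦌ ⟶ ⦋n⦌) (i k : ℕ) (hk : k ≤ m + 1)
    (h : ∀ j : Fin (m + 1), (j : ℕ) < k ↔ (f.toOrderHom j : ℕ) < i) : cut f i = k := by
  have hc : cut f i ≤ m + 1 := by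
    unfold cut
    exact (Finset.card_le_univ _).trans (by simp)
  by_contra hne
  rcases lt_or_gt_of_ne hne with hlt | hlt
  · have h1 := h ⟨cut f i, by omega⟩
    rw [← lt_cut_iff] at h1
    simp at h1
    omega
  · have h1 := h ⟨k, by omega⟩
    rw [← lt_cut_iff] at h1
    simp at h1
    omega

/-- The restriction of `f : ⦋m⦌ ⟶ ⦋n⦌` to the vertices that are not sent below `i`, with source
and target renumbered from `0` (when such vertices exist). -/
def upper {m n : ℕ} (f : ⦋m⦌ ⟶ ⦋n⦌) (i : ℕ) : ⦋m - cut f i⦌ ⟶ ⦋n - i⦌ :=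
  SimplexCategory.mkHom
    ⟨fun j => ⟨(f.toOrderHom ⟨min (cut f i + j) m, Nat.lt_succ_of_le (min_le_right _ _)⟩ : ℕ) - i, by
        have := (f.toOrderHom ⟨min (cut f i + j) m, Nat.lt_succ_of_le (min_le_right _ _)⟩).2
        change _ < n + 1 at this
        change _ < n - i + 1
        omega⟩, by
      intro a b hab
      have hab' : (a : ℕ) ≤ b := hab
      have : f.toOrderHom ⟨min (cut f i + a) m, Nat.lt_succ_of_le (min_le_right _ _)⟩ ≤
          f.toOrderHom ⟨min (cut f i + b) m, Nat.lt_succ_of_le (min_le_right _ _)⟩ :=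
        f.toOrderHom.monotone (by simp only [Fin.mk_le_mk]; omega)
      have : (f.toOrderHom ⟨min (cut f i + a) m, Nat.lt_succ_of_le (min_le_right _ _)⟩ : ℕ) ≤
          f.toOrderHom ⟨min (cut f i + b) m, Nat.lt_succ_of_le (min_le_right _ _)⟩ := this
      simp only [Fin.mk_le_mk]
      omega⟩

theorem upper_val {m n : ℕ} (f : ⦋m⦌ ⟶ ⦋n⦌) (i : ℕ) (j : Fin (m - cut f i + 1)) :
    ((upper f i).toOrderHom j : ℕ) =
      (f.toOrderHom ⟨min (cut f i + j) m, Nat.lt_succ_of_le (min_le_right _ _)⟩ : ℕ) - i := rfl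

/-- A pair `(i, x)` with `1 ≤ i ≤ n` and `x` an `(n - i)`-simplex of `X`: the vertices
`0, …, i - 1` lie at the cone point and the remaining ones span `x`. -/
structure Cell (X : SSet.{u}) (n : ℕ) where
  i : ℕ
  pos : 1 ≤ i
  le : i ≤ n
  x : X _⦋n - i⦌

theorem Cell.ext_map {X : SSet.{u}} {n k : ℕ} (y : X _⦋k⦌) {a b : ℕ} (hab : a = b)
    (ha : 1 ≤ a) (ha' : a ≤ n) (hb : 1 ≤ b) (hb' : b ≤ n)
    (f : ⦋n - a⦌ ⟶ ⦋k⦌) (g : ⦋n - b⦌ ⟶ ⦋k⦌)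
    (hfg : ∀ (j : ℕ) (h1 : j < n - a + 1) (h2 : j < n - b + 1),
      f.toOrderHom ⟨j, h1⟩ = g.toOrderHom ⟨j, h2⟩) :
    (⟨a, ha, ha', X.map f.op y⟩ : Cell X n) = ⟨b, hb, hb', X.map g.op y⟩ := by
  subst hab
  have : f = g := by
    ext j : 3
    exact hfg j j.2 j.2
  rw [this]

/-- The totally degenerate simplex on the base vertex, `s₀ⁿ(*)`. -/
def baseSimplex (X : SSet.{u}) (x₀ : X _⦋0⦌) (n : ℕ) : X _⦋n⦌ :=
  X.map (SimplexCategory.const ⦋n⦌ ⦋0⦌ 0).op x₀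

theorem map_baseSimplex (X : SSet.{u}) (x₀ : X _⦋0⦌) {m n : ℕ} (f : ⦋m⦌ ⟶ ⦋n⦌) :
    X.map f.op (baseSimplex X x₀ n) = baseSimplex X x₀ m := by
  unfold baseSimplex
  rw [← CategoryTheory.comp_apply, ← Functor.map_comp, ← op_comp]
  rfl

/-- The simplicial operators on cells; `none` stands for the totally degenerate base simplex. -/
def pull {X : SSet.{u}} {m n : ℕ} (f : ⦋m⦌ ⟶ ⦋n⦌) : Option (Cell X n) → Option (Cell X m) :=
  fun c => match c with
  | none => none
  | some c =>
      if h : 1 ≤ cut f c.i ∧ cut f c.i ≤ m then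
        some ⟨cut f c.i, h.1, h.2, X.map (upper f c.i).op c.x⟩
      else none

theorem pull_id {X : SSet.{u}} {n : ℕ} (c : Option (Cell X n)) : pull (𝟙 ⦋n⦌) c = c := by
  rcases c with _ | ⟨i, h1, h2, x⟩
  · rfl
  · have hc : cut (𝟙 ⦋n⦌) i = i := cut_eq_of _ _ _ (by omega) (fun j => Iff.rfl)
    have hx : (⟨i, h1, h2, x⟩ : Cell X n) = ⟨i, h1, h2, X.map (𝟙 ⦋n - i⦌ : _ ⟶ _).op x⟩ := by
      rw [op_id, X.map_id]; rfl
    simp only [pull]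
    rw [dif_pos (by omega)]
    congr 1
    refine Eq.trans ?_ hx.symm
    refine Cell.ext_map x hc _ _ _ _ _ _ ?_
    intro j hj hj'
    apply Fin.ext
    rw [upper_val]
    change min (cut (𝟙 ⦋n⦌) i + j) n - i = j
    omega

theorem pull_comp {X : SSet.{u}} {l m n : ℕ} (g : ⦋l⦌ ⟶ ⦋m⦌) (f : ⦋m⦌ ⟶ ⦋n⦌)
    (c : Option (Cell X n)) : pull (g ≫ f) c = pull g (pull f c) := by
  rcases c with _ | ⟨i, h1, h2, x⟩
  · rfl
  · have hle : ∀ {a b : ℕ} (h : ⦋a⦌ ⟶ ⦋b⦌) (k : ℕ), cut h k ≤ a + 1 := fun h k => by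
      unfold cut
      exact (Finset.card_le_univ _).trans (by simp)
    have hc : cut (g ≫ f) i = cut g (cut f i) :=
      cut_eq_of _ _ _ (hle _ _) (fun j => by
        rw [lt_cut_iff, lt_cut_iff]; rfl)
    simp only [pull]
    by_cases hf : 1 ≤ cut f i ∧ cut f i ≤ m
    · rw [dif_pos hf]
      by_cases hg : 1 ≤ cut g (cut f i) ∧ cut g (cut f i) ≤ l
      · rw [dif_pos (by rw [hc]; exact hg)]
        simp only
        rw [dif_pos hg]
        congr 1
        have := Cell.ext_map x hc (by omega) (by omega) hg.1 hg.2
          (upper (g ≫ f) i) (upper g (cut f i) ≫ upper f i) (by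
            intro j hj hj'
            apply Fin.ext
            rw [upper_val]
            change _ = ((upper f i).toOrderHom ((upper g (cut f i)).toOrderHom ⟨j, hj'⟩) : ℕ)
            rw [upper_val]
            simp only [upper_val]
            change (f.toOrderHom (g.toOrderHom ⟨min (cut (g ≫ f) i + j) l, _⟩) : ℕ) - i = _
            congr 3
            apply Fin.ext
            have hj2 : j ≤ l - cut g (cut f i) := by omega
            have hmin : min (cut g (cut f i) + j) l = cut g (cut f i) + j := by omega
            have hlt : cut g (cut f i) + j < l + 1 := by omega
            have h3 := lt_cut_iff g (cut f i) ⟨cut g (cut f i) + j, hlt⟩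
            simp only at h3
            have h4 := (g.toOrderHom ⟨cut g (cut f i) + j, hlt⟩).2
            simp only [hc, hmin]
            change _ < m + 1 at h4
            omega)
        rw [this]
        congr 1
        rw [op_comp, Functor.map_comp]
        rfl
      · rw [dif_neg (by rw [hc]; exact hg)]
        simp only
        rw [dif_neg hg]
    · rw [dif_neg hf]
      simp only
      rw [dif_neg]
      rw [hc]
      intro hg
      apply hf
      constructor
      · have := (lt_cut_iff g (cut f i) ⟨0, Nat.succ_pos l⟩).1 hg.1
        omega
      · have := (lt_cut_iff g (cut f i) ⟨l, Nat.lt_succ_self l⟩).not.1 (not_lt.2 hg.2)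
        have h4 := (g.toOrderHom ⟨l, Nat.lt_succ_self l⟩).2
        change _ < m + 1 at h4
        omega

/-- The cells `(i, s₀ⁿ⁻ⁱ(*))`, which are identified with the base simplex. -/
def IsBase {X : SSet.{u}} (x₀ : X _⦋0⦌) {n : ℕ} : Option (Cell X n) → Prop :=
  fun c => match c with
  | none => True
  | some c => c.x = baseSimplex X x₀ (n - c.i)

theorem IsBase.pull {X : SSet.{u}} {x₀ : X _⦋0⦌} {m n : ℕ} (f : ⦋m⦌ ⟶ ⦋n⦌)
    {c : Option (Cell X n)} (hc : IsBase x₀ c) : IsBase x₀ (pull f c) := by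
  rcases c with _ | c
  · trivial
  · simp only [Suspension.pull]
    split_ifs with h
    · change X.map _ c.x = _
      rw [show c.x = _ from hc, map_baseSimplex]
    · trivial

/-- The identification `(i, s₀ⁿ⁻ⁱ(*)) = s₀ⁿ(a₀)`. -/
def rel {X : SSet.{u}} (x₀ : X _⦋0⦌) (n : ℕ) : Setoid (Option (Cell X n)) where
  r a b := a = b ∨ (IsBase x₀ a ∧ IsBase x₀ b)
  iseqv :=
    { refl := fun _ => Or.inl rfl
      symm := by
        rintro a b (h | h)
        · exact Or.inl h.symm
        · exact Or.inr h.symm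
      trans := by
        rintro a b c (rfl | h) (rfl | h')
        · exact Or.inl rfl
        · exact Or.inr h'
        · exact Or.inr h
        · exact Or.inr ⟨h.1, h'.2⟩ }

end Suspension

open Suspension in
/-- The simplicial suspension of a simplicial set `X` with base vertex `x₀`. Its `n`-simplices are
the pairs `(i, x)` with `i ≥ 1` and `x ∈ X_{n-i}` together with `a_n = s₀ⁿ(a₀)`, modulo
`(i, s₀ⁿ⁻ⁱ(*)) = a_n`. A simplicial operator acts on `(i, x)` by counting the vertices that are
sent to the cone point and by the induced operator on `x`; faces that avoid the cone point, or
consist of it only, are base simplices. So `d₀(1, x) = a_n`, `d_{j+1}(1, x) = (1, d_j x)`,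
`s₀(i, x) = (i + 1, x)` and `s_{j+1}(1, x) = (1, s_j x)`. -/
def suspension (X : SSet.{u}) (x₀ : X _⦋0⦌) : SSet.{u} where
  obj n := Quotient (rel x₀ n.unop.len)
  map {n m} f := TypeCat.ofHom (Quotient.map (pull (m := m.unop.len) (n := n.unop.len) f.unop) (by
    rintro a b (rfl | h)
    · exact Or.inl rfl
    · exact Or.inr ⟨h.1.pull _, h.2.pull _⟩))
  map_id n := by
    ext a
    induction a using Quotient.inductionOn with
    | h a => exact congrArg (Quotient.mk _) (pull_id a)
  map_comp {n m l} f g := by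
    ext a
    induction a using Quotient.inductionOn with
    | h a =>
      exact congrArg (Quotient.mk _)
        (pull_comp (l := l.unop.len) (m := m.unop.len) (n := n.unop.len) g.unop f.unop a)

/-- The vertex `a₀` of the suspension. -/
def suspensionBase (X : SSet.{u}) (x₀ : X _⦋0⦌) : (suspension X x₀) _⦋0⦌ :=
  Quotient.mk (Suspension.rel x₀ 0) none

noncomputable section

/-! ## Free graded modules with a homogeneous basis

A free module with basis `α` is `α →₀ R`; the tensor product of the modules on `α` and `β` is the
module on `α × β`, and the tensor algebra on the module on `α` is the module on the words
`List α`. -/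

section Free

variable (R : Type v) [CommRing R]

/-- The sign `(-1)ⁿ`. -/
def sgn (n : ℤ) : R := ((n.negOnePow : ℤˣ) : ℤ)

variable {R} {α β γ δ : Type*}

/-- The linear map with prescribed values on the basis. -/
abbrev lin {M : Type*} [AddCommGroup M] [Module R M] (f : α → M) : (α →₀ R) →ₗ[R] M :=
  Finsupp.linearCombination R f

/-- The pure tensor `u ⊗ v`. -/
def tmul (u : α →₀ R) (v : β →₀ R) : α × β →₀ R :=
  finsuppTensorFinsupp' R α β (TensorProduct.tmul R u v)

/-- The tensor product `f ⊗ g` of two linear maps (no Koszul sign is inserted). -/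
def tmap (f : (α →₀ R) →ₗ[R] (γ →₀ R)) (g : (β →₀ R) →ₗ[R] (δ →₀ R)) :
    (α × β →₀ R) →ₗ[R] (γ × δ →₀ R) :=
  lin fun p => tmul (f (Finsupp.single p.1 1)) (g (Finsupp.single p.2 1))

/-- The associativity isomorphism of the tensor product. -/
def assoc : ((α × β) × γ →₀ R) →ₗ[R] (α × β × γ →₀ R) :=
  Finsupp.lmapDomain R R (Equiv.prodAssoc α β γ)

/-- `f` is homogeneous of degree `k`. -/
def HasDegree (da : α → ℤ) (db : β → ℤ) (k : ℤ) (f : (α →₀ R) →ₗ[R] (β →₀ R)) : Prop :=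
  ∀ a b, f (Finsupp.single a 1) b ≠ 0 → db b = da a + k

/-- Concatenation of words: the product of the tensor algebra. -/
def concat : (List α × List α →₀ R) →ₗ[R] (List α →₀ R) :=
  Finsupp.lmapDomain R R fun p => p.1 ++ p.2

/-- Deconcatenation of words: the coproduct of the tensor coalgebra. -/
def deconcat : (List α →₀ R) →ₗ[R] (List α × List α →₀ R) :=
  lin fun w => ∑ i ∈ Finset.range (w.length + 1), Finsupp.single (w.take i, w.drop i) 1

/-- The projection of the tensor (co)algebra onto words of length one. -/
def letters : (List α →₀ R) →ₗ[R] (α →₀ R) :=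
  Finsupp.lcomapDomain (fun a => [a]) List.singleton_injective

/-- The unshuffle of a word in letters of degree `deg`: the sum over all ways to distribute the
letters, in order, into two words, with the Koszul sign. -/
def unshuffle (deg : α → ℤ) : List α → (List α × List α →₀ R) := fun w =>
  match w with
  | [] => Finsupp.single ([], []) 1
  | a :: w =>
      lin (fun p : List α × List α => Finsupp.single (a :: p.1, p.2) (1 : R) +
        sgn R (deg a * (p.1.map deg).sum) • Finsupp.single (p.1, a :: p.2) 1) (unshuffle deg w)

/-- The shuffle coproduct of the tensor algebra. -/
def shuffleCoproduct (deg : α → ℤ) : (List α →₀ R) →ₗ[R] (List α × List α →₀ R) :=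
  lin (unshuffle deg)

end Free

/-! ## Differential graded algebras, coalgebras, bialgebras -/

/-- The data of a free graded module with homogeneous basis `B`, an operator `d`, and a
distinguished basis element `one`, which spans the image of the unit or coaugmentation. The
coordinate at `one` is the augmentation or counit, and the remaining basis elements span its
kernel. -/
structure DGMod (R : Type v) [CommRing R] where
  B : Type u
  deg : B → ℤ
  one : B
  d : (B →₀ R) →ₗ[R] (B →₀ R)

namespace DGMod

variable {R : Type v} [CommRing R]

/-- The basis of the augmentation ideal, or of the kernel of the counit. -/
abbrev Red (M : DGMod.{u} R) : Type u := {b : M.B // b ≠ M.one}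

/-- The underlying module. -/
abbrev V (M : DGMod.{u} R) : Type (max u v) := M.B →₀ R

/-- A basis element, as an element of the module. -/
abbrev e (M : DGMod.{u} R) (b : M.B) : M.V := Finsupp.single b 1

/-- The projection onto the augmentation ideal along `one`. -/
def red (M : DGMod.{u} R) : M.V →ₗ[R] (M.Red →₀ R) := Finsupp.lsubtypeDomain {b | b ≠ M.one}

/-- The inclusion of the augmentation ideal. -/
def incl (M : DGMod.{u} R) : (M.Red →₀ R) →ₗ[R] M.V := Finsupp.lmapDomain R R Subtype.val

/-- The projection onto the augmentation ideal, followed by the inclusion as words of length one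
in the tensor (co)algebra. -/
def word (M : DGMod.{u} R) : M.V →ₗ[R] (List M.Red →₀ R) :=
  (Finsupp.lmapDomain R R fun a => [a]) ∘ₗ M.red

/-- The augmentation or counit. -/
def counit (M : DGMod.{u} R) : M.V →ₗ[R] R := Finsupp.lapply M.one

/-- The tensor product, with differential `d ⊗ 1 + 1 ⊗ d` (with the Koszul sign). -/
def tensor (M N : DGMod.{u} R) : DGMod.{u} R where
  B := M.B × N.B
  deg p := M.deg p.1 + N.deg p.2
  one := (M.one, N.one)
  d := lin fun p => tmul (M.d (M.e p.1)) (N.e p.2) +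
    sgn R (M.deg p.1) • tmul (M.e p.1) (N.d (N.e p.2))

/-- `M` is a complex with (co)augmentation. -/
structure IsComplex (M : DGMod.{u} R) : Prop where
  deg_one : M.deg M.one = 0
  degree : HasDegree M.deg M.deg (-1) M.d
  d_d : ∀ x, M.d (M.d x) = 0
  d_one : M.d (M.e M.one) = 0
  counit_d : ∀ x, M.counit (M.d x) = 0

/-- `n`-reduced: the only basis element of degree `≤ n` is `one`. For `n = 0` this is
connectedness. -/
def IsReduced (M : DGMod.{u} R) (n : ℤ) : Prop := ∀ b, b ≠ M.one → n < M.deg b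

/-- `f` is a chain map of degree `k`. -/
structure IsDGMap (M N : DGMod.{u} R) (k : ℤ) (f : M.V →ₗ[R] N.V) : Prop where
  degree : HasDegree M.deg N.deg k f
  comm : ∀ x, N.d (f x) = sgn R k • f (M.d x)

/-- `mul` makes `M` an augmented associative unital DG-algebra. -/
structure IsDGAlgebra (M : DGMod.{u} R) (mul : (M.B × M.B →₀ R) →ₗ[R] M.V) : Prop where
  complex : M.IsComplex
  dgMap : IsDGMap (M.tensor M) M 0 mul
  one_mul : ∀ x, mul (tmul (M.e M.one) x) = x
  mul_one : ∀ x, mul (tmul x (M.e M.one)) = x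
  mul_assoc : ∀ x y z, mul (tmul (mul (tmul x y)) z) = mul (tmul x (mul (tmul y z)))
  counit_mul : ∀ x y, M.counit (mul (tmul x y)) = M.counit x * M.counit y

/-- `Δ` makes `M` a coaugmented coassociative counital DG-coalgebra. -/
structure IsDGCoalgebra (M : DGMod.{u} R) (Δ : M.V →ₗ[R] (M.B × M.B →₀ R)) : Prop where
  complex : M.IsComplex
  dgMap : IsDGMap M (M.tensor M) 0 Δ
  counit_left : ∀ x, lin (fun p : M.B × M.B => M.counit (M.e p.1) • M.e p.2) (Δ x) = x
  counit_right : ∀ x, lin (fun p : M.B × M.B => M.counit (M.e p.2) • M.e p.1) (Δ x) = x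
  coassoc : ∀ x, assoc (tmap Δ LinearMap.id (Δ x)) = tmap LinearMap.id Δ (Δ x)
  map_one : Δ (M.e M.one) = tmul (M.e M.one) (M.e M.one)

/-- The product `(a ⊗ b)(a' ⊗ b') = (-1)^{|b||a'|} aa' ⊗ bb'` of the tensor square. -/
def mulTensor (M : DGMod.{u} R) (mul : (M.B × M.B →₀ R) →ₗ[R] M.V) :
    ((M.B × M.B) × (M.B × M.B) →₀ R) →ₗ[R] (M.B × M.B →₀ R) :=
  lin fun q => sgn R (M.deg q.1.2 * M.deg q.2.1) •
    tmul (mul (Finsupp.single (q.1.1, q.2.1) 1)) (mul (Finsupp.single (q.1.2, q.2.2) 1))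

structure IsDGBialgebra (M : DGMod.{u} R) (mul : (M.B × M.B →₀ R) →ₗ[R] M.V)
    (Δ : M.V →ₗ[R] (M.B × M.B →₀ R)) : Prop where
  algebra : M.IsDGAlgebra mul
  coalgebra : M.IsDGCoalgebra Δ
  comul_mul : ∀ x y, Δ (mul (tmul x y)) = M.mulTensor mul (tmul (Δ x) (Δ y))

/-- `S` is an antipode: a chain map that is a two-sided convolution inverse of the identity. -/
structure IsAntipode (M : DGMod.{u} R) (mul : (M.B × M.B →₀ R) →ₗ[R] M.V)
    (Δ : M.V →ₗ[R] (M.B × M.B →₀ R)) (S : M.V →ₗ[R] M.V) : Prop where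
  dgMap : IsDGMap M M 0 S
  left_inv : ∀ x, mul (tmap S LinearMap.id (Δ x)) = M.counit x • M.e M.one
  right_inv : ∀ x, mul (tmap LinearMap.id S (Δ x)) = M.counit x • M.e M.one

/-- An involutive DG-Hopf algebra. -/
structure IsInvolutiveDGHopf (M : DGMod.{u} R) (mul : (M.B × M.B →₀ R) →ₗ[R] M.V)
    (Δ : M.V →ₗ[R] (M.B × M.B →₀ R)) (S : M.V →ₗ[R] M.V) : Prop where
  bialgebra : M.IsDGBialgebra mul Δ
  antipode : M.IsAntipode mul Δ S
  involutive : ∀ x, S (S x) = x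

/-! ## Cobar and bar constructions -/

/-- The cobar differential on a generator: `s⁻¹c ↦ -s⁻¹(dc) + (s⁻¹ ⊗ s⁻¹)∇̄c`. -/
def cobarGen (M : DGMod.{u} R) (Δ : M.V →ₗ[R] (M.B × M.B →₀ R)) (c : M.Red) :
    List M.Red →₀ R :=
  -M.word (M.d (M.e c)) +
    lin (fun p : M.B × M.B =>
      sgn R (M.deg p.1) • concat (tmul (M.word (M.e p.1)) (M.word (M.e p.2)))) (Δ (M.e c))

/-- The cobar differential on words, as a derivation. -/
def cobarD (M : DGMod.{u} R) (Δ : M.V →ₗ[R] (M.B × M.B →₀ R)) :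
    List M.Red → (List M.Red →₀ R) := fun w =>
  match w with
  | [] => 0
  | c :: w => concat (tmul (M.cobarGen Δ c) (Finsupp.single w 1)) +
      sgn R (M.deg c - 1) • concat (tmul (Finsupp.single [c] 1) (cobarD M Δ w))

/-- The cobar construction of a coaugmented coalgebra `(M, Δ)`: the word `[c₁, …, cₙ]` stands for
`s⁻¹c₁ ⊗ ⋯ ⊗ s⁻¹cₙ`. Its product is `concat`. -/
def cobar (M : DGMod.{u} R) (Δ : M.V →ₗ[R] (M.B × M.B →₀ R)) : DGMod.{u} R where
  B := List M.Red
  deg w := (w.map fun c => M.deg c - 1).sum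
  one := []
  d := lin (M.cobarD Δ)

/-- The bar differential on words: the coderivation with components
`-s d s⁻¹ + s mul (s⁻¹ ⊗ s⁻¹)`. -/
def barD (M : DGMod.{u} R) (mul : (M.B × M.B →₀ R) →ₗ[R] M.V) :
    List M.Red → (List M.Red →₀ R) := fun w =>
  match w with
  | [] => 0
  | a :: w => -concat (tmul (M.word (M.d (M.e a))) (Finsupp.single w 1)) +
      (match w with
        | [] => 0
        | b :: w' => sgn R (M.deg a + 1) •
            concat (tmul (M.word (mul (Finsupp.single (a.1, b.1) 1))) (Finsupp.single w' 1))) +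
      sgn R (M.deg a + 1) • concat (tmul (Finsupp.single [a] 1) (barD M mul w))

/-- The bar construction of an augmented algebra `(M, mul)`: the word `[a₁, …, aₙ]` stands for
`sa₁ ⊗ ⋯ ⊗ saₙ`. Its coproduct is `deconcat`. -/
def bar (M : DGMod.{u} R) (mul : (M.B × M.B →₀ R) →ₗ[R] M.V) : DGMod.{u} R where
  B := List M.Red
  deg w := (w.map fun a => M.deg a + 1).sum
  one := []
  d := lin (M.barD mul)

/-! ## Homotopy G-coalgebras, homotopy G-algebras, homotopy BV-algebras -/

/-- The operation `E^{i,j} : s⁻¹C̄ → (s⁻¹C̄)^{⊗i} ⊗ (s⁻¹C̄)^{⊗j}` of a coproduct `D` on the cobar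
construction: the component of `D(s⁻¹c)` on pairs of words of lengths `i` and `j`. -/
def coOp (M : DGMod.{u} R) (D : (List M.Red →₀ R) →ₗ[R] (List M.Red × List M.Red →₀ R))
    (i j : ℕ) (c : M.Red) : List M.Red × List M.Red →₀ R :=
  (D (Finsupp.single [c] 1)).filter fun p => p.1.length = i ∧ p.2.length = j

/-- The coproduct `D` on the cobar construction makes the DG-coalgebra `(M, Δ)` a homotopy
G-coalgebra. -/
structure IsHomotopyGCoalgebra (M : DGMod.{u} R) (Δ : M.V →ₗ[R] (M.B × M.B →₀ R))
    (D : (List M.Red →₀ R) →ₗ[R] (List M.Red × List M.Red →₀ R)) : Prop where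
  coalgebra : M.IsDGCoalgebra Δ
  reduced : M.IsReduced 1
  bialgebra : (M.cobar Δ).IsDGBialgebra concat D
  coOp_eq_zero : ∀ i j, 1 ≤ i → 2 ≤ j → ∀ c, M.coOp D i j c = 0

/-- The operation `E_{i,j}(x₁, …, xᵢ; y₁, …, yⱼ)` of a product `μ` on the bar construction: the
component of length one of `(sx₁ ⊗ ⋯ ⊗ sxᵢ) · (sy₁ ⊗ ⋯ ⊗ syⱼ)`, without the suspension. -/
def op (M : DGMod.{u} R) (μ : (List M.Red × List M.Red →₀ R) →ₗ[R] (List M.Red →₀ R))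
    (xs ys : List M.Red) : M.V :=
  M.incl (letters (μ (Finsupp.single (xs, ys) 1)))

/-- The product `μ` on the bar construction makes the DG-algebra `(M, mul)` a homotopy
G-algebra. -/
structure IsHomotopyGAlgebra (M : DGMod.{u} R) (mul : (M.B × M.B →₀ R) →ₗ[R] M.V)
    (μ : (List M.Red × List M.Red →₀ R) →ₗ[R] (List M.Red →₀ R)) : Prop where
  algebra : M.IsDGAlgebra mul
  connected : M.IsReduced 0
  bialgebra : (M.bar mul).IsDGBialgebra μ deconcat
  op_eq_zero : ∀ xs ys : List M.Red, 2 ≤ xs.length → 1 ≤ ys.length → M.op μ xs ys = 0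

/-- The operation `E_{1,1}`, extended by zero to the unit. -/
def op11 (M : DGMod.{u} R) (μ : (List M.Red × List M.Red →₀ R) →ₗ[R] (List M.Red →₀ R)) :
    (M.B × M.B →₀ R) →ₗ[R] M.V :=
  M.incl ∘ₗ letters ∘ₗ μ ∘ₗ tmap M.word M.word

/-- The bracket `{a; b} = E_{1,1}(a; b) - (-1)^{(|a|+1)(|b|+1)} E_{1,1}(b; a)` of two basis
elements. -/
def bracket (M : DGMod.{u} R) (μ : (List M.Red × List M.Red →₀ R) →ₗ[R] (List M.Red →₀ R))
    (a b : M.B) : M.V :=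
  M.op11 μ (Finsupp.single (a, b) 1) -
    sgn R ((M.deg a + 1) * (M.deg b + 1)) • M.op11 μ (Finsupp.single (b, a) 1)

/-- `(M, mul, μ)` is a homotopy G-algebra and `D` is a BV-operator on it: a square-zero chain map
of degree one whose deviation from being a derivation of the product is the bracket, up to the
boundary of a homotopy `H` of degree two. -/
structure IsHomotopyBVAlgebra (M : DGMod.{u} R) (mul : (M.B × M.B →₀ R) →ₗ[R] M.V)
    (μ : (List M.Red × List M.Red →₀ R) →ₗ[R] (List M.Red →₀ R)) (D : M.V →ₗ[R] M.V) :
    Prop where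
  homotopyG : M.IsHomotopyGAlgebra mul μ
  dgMap : IsDGMap M M 1 D
  square_zero : ∀ x, D (D x) = 0
  bracket_eq : ∃ H : (M.B × M.B →₀ R) →ₗ[R] M.V,
    HasDegree (M.tensor M).deg M.deg 2 H ∧
    ∀ a b : M.B, M.bracket μ a b =
      sgn R (M.deg a) • (D (mul (tmul (M.e a) (M.e b))) - mul (tmul (D (M.e a)) (M.e b)) -
        sgn R (M.deg a) • mul (tmul (M.e a) (D (M.e b)))) +
      (M.d (H (tmul (M.e a) (M.e b))) + H (tmul (M.d (M.e a)) (M.e b)) -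
        sgn R (M.deg a) • H (tmul (M.e a) (M.d (M.e b))))

/-! ## Operations on the cobar construction of a bialgebra -/

/-- The diagonal operation of `a ∈ M` on the words of the cobar construction,
`[b₁, …, bₙ] ↦ ∑ ± [φ(a¹)b₁, …, φ(aⁿ)bₙ]`, with the iterated coproduct of `a` for `Δ` and the
Koszul sign for `φ` of degree `0` and `a · s⁻¹b = (-1)^{|a|} s⁻¹(φ(a)b)`. -/
def diagAct (M : DGMod.{u} R) (mul : (M.B × M.B →₀ R) →ₗ[R] M.V)
    (Δ : M.V →ₗ[R] (M.B × M.B →₀ R)) (φ : M.V →ₗ[R] M.V) :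
    List M.Red → (M.V →ₗ[R] (List M.Red →₀ R)) := fun w =>
  match w with
  | [] => lin fun a => M.counit (M.e a) • Finsupp.single [] 1
  | b :: w =>
      (lin fun p : M.B × M.B => sgn R (M.deg p.1 + M.deg p.2 * (M.deg b - 1)) •
        concat (tmul (M.word (mul (tmul (φ (M.e p.1)) (M.e b))))
          (diagAct M mul Δ φ w (M.e p.2)))) ∘ₗ Δ

/-- The sum `∑_{i₁ < ⋯ < i_k} ± a₁ ⊗ ⋯ ⊗ a_{i₁} ⋄ y₁ ⊗ ⋯ ⊗ a_{i_k} ⋄ y_k ⊗ ⋯ ⊗ aₙ` for a word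
`a₁ ⊗ ⋯ ⊗ aₙ` and words `y₁, …, y_k` of the cobar construction, where `⋄` is the diagonal
operation: the operation `E_{1,k}` on the cobar construction of a bialgebra. The sign is the
Koszul sign for moving `s y_j` to its place, together with `(-1)^{|a|}` for each insertion, so
that `E_{1,1}(s⁻¹a; s⁻¹b) = s⁻¹(ab)`. -/
def kadeishvili (M : DGMod.{u} R) (mul : (M.B × M.B →₀ R) →ₗ[R] M.V)
    (Δ : M.V →ₗ[R] (M.B × M.B →₀ R)) :
    List M.Red → List (List M.Red) → (List M.Red →₀ R) := fun x ys =>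
  match x, ys with
  | [], [] => Finsupp.single [] 1
  | [], _ :: _ => 0
  | a :: x, ys =>
      concat (tmul (Finsupp.single [a] 1) (kadeishvili M mul Δ x ys)) +
      (match ys with
        | [] => 0
        | y :: ys' =>
            sgn R (((M.cobar Δ).deg y + 1) * (M.cobar Δ).deg x + M.deg a) •
              concat (tmul (M.diagAct mul Δ LinearMap.id y (M.e a))
                (kadeishvili M mul Δ x ys')))

/-- The coproduct followed by the symmetry `a ⊗ b ↦ (-1)^{|a||b|} b ⊗ a`. -/
def twist (M : DGMod.{u} R) (Δ : M.V →ₗ[R] (M.B × M.B →₀ R)) : M.V →ₗ[R] (M.B × M.B →₀ R) :=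
  (lin fun p : M.B × M.B => sgn R (M.deg p.1 * M.deg p.2) • Finsupp.single (p.2, p.1) 1) ∘ₗ Δ

/-- The cyclic permutation `s⁻¹a₁ ⊗ ⋯ ⊗ s⁻¹aₙ ↦ ± s⁻¹a₂ ⊗ ⋯ ⊗ s⁻¹aₙ ⊗ s⁻¹a₁`, with the Koszul
sign. -/
def cyc (M : DGMod.{u} R) (Δ : M.V →ₗ[R] (M.B × M.B →₀ R)) :
    (List M.Red →₀ R) →ₗ[R] (List M.Red →₀ R) :=
  lin fun w => match w with
    | [] => Finsupp.single [] 1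
    | a :: w => sgn R ((M.deg a - 1) * (M.cobar Δ).deg w) • Finsupp.single (w ++ [a]) 1

/-- The map `s⁻¹a₁ ⊗ ⋯ ⊗ s⁻¹aₙ ↦ ∑ ± s⁻¹S(a₁ⁿ⁻¹)a₂ ⊗ ⋯ ⊗ s⁻¹S(a₁¹)aₙ`. -/
def cmPi (M : DGMod.{u} R) (mul : (M.B × M.B →₀ R) →ₗ[R] M.V)
    (Δ : M.V →ₗ[R] (M.B × M.B →₀ R)) (S : M.V →ₗ[R] M.V) :
    (List M.Red →₀ R) →ₗ[R] (List M.Red →₀ R) :=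
  lin fun w => match w with
    | [] => 0
    | a :: w => M.diagAct mul (M.twist Δ) S w (M.e a)

/-- The Connes–Moscovici operator on the cobar construction of a bialgebra with antipode `S`. -/
def connesMoscovici (M : DGMod.{u} R) (mul : (M.B × M.B →₀ R) →ₗ[R] M.V)
    (Δ : M.V →ₗ[R] (M.B × M.B →₀ R)) (S : M.V →ₗ[R] M.V) :
    (List M.Red →₀ R) →ₗ[R] (List M.Red →₀ R) :=
  lin fun w => if w.length < 2 then 0 else
    ∑ i ∈ Finset.range w.length, M.cmPi mul Δ S (((M.cyc Δ) ^ i) (Finsupp.single w 1))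

end DGMod

/-! ## Normalized chains of a simplicial set and Baues' coproduct -/

section Chains

variable (R : Type v) [CommRing R] (Y : SSet.{u})

open Classical in
/-- The class of a simplex in the normalized chains: zero if it is degenerate. -/
def nd (τ : Σ n : ℕ, Y _⦋n⦌) : (Σ n : ℕ, Y.nonDegenerate n) →₀ R :=
  if h : τ.2 ∈ Y.nonDegenerate τ.1 then Finsupp.single ⟨τ.1, τ.2, h⟩ 1 else 0

/-- The normalized chain complex of `Y`, coaugmented by the vertex `y₀`. -/
def chains (y₀ : Y _⦋0⦌) : DGMod.{u} R where
  B := Σ n : ℕ, Y.nonDegenerate n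
  deg b := b.1
  one := ⟨0, y₀, by simp⟩
  d := lin fun b => match b with
    | ⟨0, _⟩ => 0
    | ⟨n + 1, σ⟩ => ∑ i : Fin (n + 2), sgn R (i : ℕ) • nd R Y ⟨n, Y.δ i σ.1⟩

variable {Y}

/-- The face `i_T^* σ` of `σ` spanned by a nonempty set `T` of vertices. (The value for `T = ∅` is
never used.) -/
def subface {n : ℕ} (σ : Y _⦋n⦌) (T : Finset (Fin (n + 1))) : Σ k : ℕ, Y _⦋k⦌ :=
  if h : T.Nonempty then
    ⟨T.card - 1, Y.map (SimplexCategory.mkHom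
      (T.orderEmbOfFin (Nat.sub_add_cancel h.card_pos).symm).toOrderHom).op σ⟩
  else ⟨n, σ⟩

/-- The Alexander–Whitney coproduct `σ ↦ ∑ σ(0, …, i) ⊗ σ(i, …, n)`. -/
def alexanderWhitney (y₀ : Y _⦋0⦌) :
    (chains R Y y₀).V →ₗ[R] ((chains R Y y₀).B × (chains R Y y₀).B →₀ R) :=
  lin fun b => ∑ i : Fin (b.1 + 1),
    tmul (nd R Y (subface b.2.1 (Finset.Iic i))) (nd R Y (subface b.2.1 (Finset.Ici i)))

/-- The element `[τ]` of the cobar construction of a simplex `τ` of positive dimension: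
`s⁻¹τ` in dimension `≥ 2` (zero if `τ` is degenerate), and the unit in dimension one. -/
def brk (y₀ : Y _⦋0⦌) (τ : Σ k : ℕ, Y _⦋k⦌) : List (chains R Y y₀).Red →₀ R :=
  if τ.1 = 1 then Finsupp.single [] 1 else (chains R Y y₀).word (nd R Y τ)

/-- `∑_{i=1}^{r} (r + 1 - i) dᵢ` for a list `d₁, …, d_{r+1}`. -/
def weight : List ℤ → ℤ := fun l =>
  match l with
  | [] => 0
  | d :: l => l.length * d + weight l

/-- Baues' coproduct on a generator `[σ]`: the sum over `b = {b₁ < ⋯ < b_r} ⊆ {1, …, n - 1}` of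
`(-1)^ζ [σ(0, …, b₁) | σ(b₁, …, b₂) | ⋯ | σ(b_r, …, n)] ⊗ [σ(0, b, n)]`, where
`ζ = ∑_{i=1}^{r} (r + 1 - i) (bᵢ - bᵢ₋₁) - r(r + 1)/2` and `b₀ = 0`. -/
def bauesGen (y₀ : Y _⦋0⦌) {n : ℕ} (σ : Y _⦋n⦌) :
    List (chains R Y y₀).Red × List (chains R Y y₀).Red →₀ R :=
  ∑ b ∈ (Finset.Ioo 0 (Fin.last n)).powerset,
    let T : Finset (Fin (n + 1)) := insert 0 (insert (Fin.last n) b)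
    let L : List (Fin (n + 1)) := T.sort
    sgn R (weight (L.zipWith (fun p q => ((q : ℕ) : ℤ) - ((p : ℕ) : ℤ)) L.tail) -
        ((b.card * (b.card + 1) / 2 : ℕ) : ℤ)) •
      tmul
        ((L.zipWith (fun p q => brk R y₀ (subface σ (Finset.Icc p q))) L.tail).foldr
          (fun u v => concat (tmul u v)) (Finsupp.single [] 1))
        (brk R y₀ (subface σ T))

/-- Baues' coproduct on the words of the cobar construction, by multiplicativity. -/
def bauesWord (y₀ : Y _⦋0⦌) : List (chains R Y y₀).Red →
    (List (chains R Y y₀).Red × List (chains R Y y₀).Red →₀ R) := fun w =>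
  match w with
  | [] => Finsupp.single ([], []) 1
  | c :: w => ((chains R Y y₀).cobar (alexanderWhitney R y₀)).mulTensor concat
      (tmul (bauesGen R y₀ c.1.2.1) (bauesWord y₀ w))

/-- Baues' coproduct on the cobar construction of the normalized chains of a `1`-reduced
simplicial set. -/
def baues (y₀ : Y _⦋0⦌) : (List (chains R Y y₀).Red →₀ R) →ₗ[R]
    (List (chains R Y y₀).Red × List (chains R Y y₀).Red →₀ R) :=
  lin (bauesWord R y₀)

end Chains

end

end DoubleCobar

open DoubleCobar CategoryTheory Simplicial

/-! A simplex of the double suspension that is neither degenerate nor the base vertex is `(1, (1,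
x))`, with the two suspension points as vertices `0` and `1`. A face that omits one of them
collapses to the base simplex (`map_cone_of_pos`, `map_cone_cone_of_ne_one`). In the
Alexander–Whitney coproduct only the two extreme terms survive, so every reduced chain is primitive,
and `ΩC` is a tensor algebra `T(V)` whose differential is linear on `V`. In Baues' sum the right
factor vanishes unless `b` is empty or contains `1`; if `b` contains `1` without being everything,
some left factor of dimension at least two omits `0`. Two terms are left (`bauesGen_eq`), so `V` is
primitive for Baues' coproduct, which is therefore the shuffle coproduct. Its antipode reverses
words up to sign, hence is an involution.

From there on only `T(V)` matters, with the shuffle coproduct, a linear differential `δ` and `V` in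
degrees at least two. A letter `v` is primitive, so its diagonal action on the cobar construction of
`T(V)` is a derivation, `leftDer`; words act by composites of these (`diag_id`), and antipodes of
words by composites in the reverse order (`diag_antipode`). Up to sign each letter `s⁻¹(v₁⋯vᵣ)` is
obtained from `s⁻¹vᵣ` by applying such derivations. So an identity on the double cobar construction
needs three checks: for concatenation, for `leftDer`, and for the letters `s⁻¹v`. The differential
enters through `cobarDiff_leftDer`: its commutator with `leftDer d v` is the action of `δ v` plus
the graded commutator with `s⁻¹v`.

For the homotopy G-structure, operations `E₁ₖ` are turned recursively into a product on the bar
construction that is compatible with deconcatenation. It is associative when the brace relation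
holds (`barMul_assoc`), and a chain map when the operations distribute over the product and have the
expected boundary (`barDiff_barMul`). Kadeishvili's operations are convolution products over the
letters of the first argument (`kad_cat`). They commute with `leftDer`, since inserting arguments
and acting from the left do not interfere; this gives the brace relation (`kad_kad`) and the
boundary formula (`kadDiff`).

For the BV-operator, the cyclic sum is extended to `cmPair d u w`, the sum of `S(a)` acting on `q w
p` over the factorizations `u = p a q`; the Connes–Moscovici operator is the case `w = 1`.
Integration by parts (`cmPair_leftDer`) makes the operator vanish on the image of every `leftDer`,
and so on its own values. The boundary of `cmPair d u w` contains the commutator of `u` and `w`,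
which vanishes for `w = 1`; hence the operator is a chain map up to the sign of its degree.
Inserting a further argument `y` into `q` gives `cmBrace`. Its boundary (`brDiff`) contains `E₁₁`
together with the halves of the operator applied to a product, so its antisymmetrization, corrected
by one `E₁₁`-term, is the homotopy `H` (`kadOne_bracket`). -/

namespace DoubleCobar

open Finsupp (single)

noncomputable section

/-! ### Signs in the ground ring -/

section Signs

variable {R : Type v} [CommRing R]

theorem sgn_add (a b : ℤ) : sgn R (a + b) = sgn R a * sgn R b := by
  simp [sgn, Int.negOnePow_add]

theorem sgn_zero : sgn R 0 = 1 := by simp [sgn]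

theorem sgn_one : sgn R 1 = -1 := by simp [sgn]

theorem sgn_neg (a : ℤ) : sgn R (-a) = sgn R a := by simp [sgn, Int.negOnePow_neg]

theorem sgn_sub (a b : ℤ) : sgn R (a - b) = sgn R a * sgn R b := by
  rw [sub_eq_add_neg, sgn_add, sgn_neg]

theorem sgn_mul_self (a : ℤ) : sgn R a * sgn R a = 1 := by
  rw [← sgn_add]; simp [sgn, Int.negOnePow_even _ (Even.add_self a)]

theorem sgn_mul_cancel (a : ℤ) (x : R) : sgn R a * (sgn R a * x) = x := by
  rw [← mul_assoc, sgn_mul_self, one_mul]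

theorem sgn_arg_comm (a b : ℤ) : sgn R (a * b) = sgn R (b * a) := by rw [mul_comm]

/-- The integers `a²` and `a` have the same parity. Squares of degrees appear when an element is
moved past a copy of itself. -/
theorem sgn_arg_self (a : ℤ) : sgn R (a * a) = sgn R a := by
  unfold sgn
  rw [(Int.negOnePow_eq_iff _ _).2]
  rcases Int.even_or_odd a with h | h
  · exact (h.mul_left a).sub h
  · exact (h.mul h).sub_odd h

theorem sgn_smul_smul {M : Type*} [AddCommGroup M] [Module R M] (a : ℤ) (x : M) :
    sgn R a • sgn R a • x = x := by
  rw [smul_smul, sgn_mul_self, one_smul]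

theorem sgn_even {a : ℤ} (h : Even a) : sgn R a = 1 := by
  simp [sgn, Int.negOnePow_even _ h]

end Signs

/-! ### Linear algebra on free modules: tensors, homogeneous elements, grading signs -/

section Linear

variable {R : Type v} [CommRing R] {α β γ : Type*}

theorem lin_single {M : Type*} [AddCommGroup M] [Module R M] (f : α → M) (a : α) :
    lin (R := R) f (single a 1) = f a := by
  simp [lin]

theorem ext_single {M : Type*} [AddCommGroup M] [Module R M] {f g : (α →₀ R) →ₗ[R] M}
    (h : ∀ a, f (single a 1) = g (single a 1)) : f = g :=
  Finsupp.lhom_ext' fun a => LinearMap.ext_ring (h a)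

/-- The usual way of proving an identity below: both sides are written as linear maps of one
variable, so that only basis elements have to be checked. -/
theorem eq_of_single {M : Type*} [AddCommGroup M] [Module R M] (f g : (α →₀ R) →ₗ[R] M)
    (h : ∀ a, f (single a 1) = g (single a 1)) (x : α →₀ R) : f x = g x :=
  LinearMap.congr_fun (ext_single h) x

-- Coefficients are split off in the scalar case, so the last case has coefficient `1`, the form on
-- which the maps defined by `lin` compute.
@[elab_as_elim]
theorem linear_induction {p : (α →₀ R) → Prop} (x : α →₀ R) (zero : p 0)
    (add : ∀ x y, p x → p y → p (x + y)) (smul : ∀ (c : R) x, p x → p (c • x))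
    (single : ∀ a, p (Finsupp.single a 1)) : p x := by
  induction x using Finsupp.induction_linear with
  | zero => exact zero
  | add x y hx hy => exact add x y hx hy
  | single a c =>
    rw [← mul_one c, ← smul_eq_mul, ← Finsupp.smul_single]
    exact smul c _ (single a)

/-- The tensor product of elements, as a bilinear map. -/
def tmulL : (α →₀ R) →ₗ[R] (β →₀ R) →ₗ[R] (α × β →₀ R) :=
  (TensorProduct.mk R (α →₀ R) (β →₀ R)).compr₂ (finsuppTensorFinsupp' R α β).toLinearMap

theorem tmulL_apply (x : α →₀ R) (y : β →₀ R) : tmulL x y = tmul x y := rfl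

theorem tmul_add (x : α →₀ R) (y z : β →₀ R) : tmul x (y + z) = tmul x y + tmul x z :=
  map_add (tmulL x) y z
theorem tmul_neg (x : α →₀ R) (y : β →₀ R) : tmul x (-y) = -tmul x y := map_neg (tmulL x) y
theorem tmul_sub (x : α →₀ R) (y z : β →₀ R) : tmul x (y - z) = tmul x y - tmul x z :=
  map_sub (tmulL x) y z
theorem tmul_smul (x : α →₀ R) (c : R) (y : β →₀ R) : tmul x (c • y) = c • tmul x y :=
  map_smul (tmulL x) c y
theorem tmul_zero (x : α →₀ R) : tmul x (0 : β →₀ R) = 0 := map_zero (tmulL x)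
theorem add_tmul (x y : α →₀ R) (z : β →₀ R) : tmul (x + y) z = tmul x z + tmul y z :=
  map_add (tmulL.flip z) x y
theorem neg_tmul (x : α →₀ R) (z : β →₀ R) : tmul (-x) z = -tmul x z := map_neg (tmulL.flip z) x
theorem sub_tmul (x y : α →₀ R) (z : β →₀ R) : tmul (x - y) z = tmul x z - tmul y z :=
  map_sub (tmulL.flip z) x y
theorem smul_tmul (c : R) (x : α →₀ R) (z : β →₀ R) : tmul (c • x) z = c • tmul x z :=
  map_smul (tmulL.flip z) c x
theorem zero_tmul (z : β →₀ R) : tmul (0 : α →₀ R) z = 0 := map_zero (tmulL.flip z)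
theorem tmul_single (a : α) (b : β) :
    tmul (single a (1 : R)) (single b 1) = single (a, b) 1 := by
  simp [tmul]

theorem tmul_apply (x : α →₀ R) (y : β →₀ R) (a : α) (b : β) :
    tmul x y (a, b) = x a * y b := by
  simp [tmul]

theorem tmap_single {γ δ : Type*} (f : (α →₀ R) →ₗ[R] (γ →₀ R)) (g : (β →₀ R) →ₗ[R] (δ →₀ R))
    (a : α) (b : β) :
    tmap f g (single (a, b) 1) = tmul (f (single a 1)) (g (single b 1)) := lin_single _ _

theorem tmap_tmul {γ δ : Type*} (f : (α →₀ R) →ₗ[R] (γ →₀ R)) (g : (β →₀ R) →ₗ[R] (δ →₀ R))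
    (x : α →₀ R) (y : β →₀ R) : tmap f g (tmul x y) = tmul (f x) (g y) := by
  have h : (tmap f g) ∘ₗ (tmulL.flip y) = (tmulL.flip (g y)) ∘ₗ f := by
    refine ext_single fun a => ?_
    have h' : (tmap f g) ∘ₗ (tmulL (single a 1)) = (tmulL (f (single a 1))) ∘ₗ g := by
      refine ext_single fun b => ?_
      simp [tmulL_apply, tmul_single, tmap_single]
    exact LinearMap.congr_fun h' y
  exact LinearMap.congr_fun h x

/-- A linear map out of a tensor product is determined by its values on pure tensors. -/
theorem ext_tmul {M : Type*} [AddCommGroup M] [Module R M] {f g : (α × β →₀ R) →ₗ[R] M}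
    (h : ∀ x y, f (tmul x y) = g (tmul x y)) : f = g := by
  refine ext_single fun p => ?_
  have := h (single p.1 1) (single p.2 1)
  rwa [tmul_single] at this

theorem assoc_single (a : α) (b : β) (c : γ) :
    assoc (single ((a, b), c) (1 : R)) = single (a, b, c) 1 := by simp [assoc]

theorem assoc_tmul (x : α →₀ R) (y : β →₀ R) (z : γ →₀ R) :
    assoc (tmul (tmul x y) z) = tmul x (tmul y z) := by
  induction x using linear_induction with
  | zero => simp [zero_tmul]
  | add x x' h h' => simp [add_tmul, h, h']
  | smul c x h => simp [smul_tmul, h]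
  | single a =>
    induction y using linear_induction with
    | zero => simp [zero_tmul, tmul_zero]
    | add x x' h h' => simp [add_tmul, tmul_add, h, h']
    | smul c x h => simp [smul_tmul, tmul_smul, h]
    | single b =>
      induction z using linear_induction with
      | zero => simp [tmul_zero]
      | add x x' h h' => simp [tmul_add, h, h']
      | smul c x h => simp [tmul_smul, h]
      | single c => simp [tmul_single, assoc]

/-- The submodule of homogeneous elements of degree `k`. -/
def homog (d : α → ℤ) (k : ℤ) : Submodule R (α →₀ R) := Finsupp.supported R R {a | d a = k}

theorem mem_homog {d : α → ℤ} {k : ℤ} {x : α →₀ R} :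
    x ∈ homog d k ↔ ∀ a, x a ≠ 0 → d a = k := by
  simp [homog, Finsupp.mem_supported, Set.subset_def]

theorem single_mem_homog {d : α → ℤ} {k : ℤ} {a : α} (h : d a = k) :
    (single a 1 : α →₀ R) ∈ homog d k := Finsupp.single_mem_supported R 1 h

/-- Homogeneous elements of degree `k` are spanned by the basis elements of degree `k`. The sign in
a Koszul formula is constant on them, so a formula for basis elements extends linearly. -/
theorem homog_induction {d : α → ℤ} {k : ℤ} {p : (α →₀ R) → Prop} {x : α →₀ R}
    (hx : x ∈ homog d k) (zero : p 0)
    (add : ∀ x y, p x → p y → p (x + y)) (smul : ∀ (c : R) x, p x → p (c • x))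
    (single : ∀ a, d a = k → p (Finsupp.single a 1)) : p x := by
  rw [homog, Finsupp.supported_eq_span_single] at hx
  induction hx using Submodule.span_induction with
  | mem x h => obtain ⟨a, ha, rfl⟩ := h; exact single a ha
  | zero => exact zero
  | add x y _ _ hx hy => exact add x y hx hy
  | smul c x _ h => exact smul c x h

theorem hasDegree_iff {da : α → ℤ} {db : β → ℤ} {k : ℤ} {f : (α →₀ R) →ₗ[R] (β →₀ R)} :
    HasDegree da db k f ↔ ∀ a, f (single a 1) ∈ homog db (da a + k) := by
  simp only [HasDegree, mem_homog]

theorem HasDegree.mem {da : α → ℤ} {db : β → ℤ} {k l m : ℤ} {f : (α →₀ R) →ₗ[R] (β →₀ R)}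
    (h : HasDegree da db k f) {x : α →₀ R} (hx : x ∈ homog da l) (hm : l + k = m) :
    f x ∈ homog db m := by
  subst hm
  refine homog_induction (p := fun x => f x ∈ homog db (l + k)) hx ?_ ?_ ?_ ?_
  · simp
  · intro x y hx hy; rw [map_add]; exact add_mem hx hy
  · intro c x hx; rw [map_smul]; exact Submodule.smul_mem _ _ hx
  · rintro a rfl; exact hasDegree_iff.1 h a

theorem tmul_mem_homog {da : α → ℤ} {db : β → ℤ} {k l m : ℤ} {x : α →₀ R} {y : β →₀ R}
    (hx : x ∈ homog da k) (hy : y ∈ homog db l) (hm : k + l = m) :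
    tmul x y ∈ homog (fun p : α × β => da p.1 + db p.2) m := by
  rw [mem_homog] at *
  rintro ⟨a, b⟩ h
  rw [tmul_apply] at h
  rw [hx a (left_ne_zero_of_mul h), hy b (right_ne_zero_of_mul h), hm]

/-- The operator `a ↦ (-1)^{k|a|} a`. -/
def gr (d : α → ℤ) (k : ℤ) : (α →₀ R) →ₗ[R] (α →₀ R) := lin fun a => sgn R (k * d a) • single a 1

theorem gr_single (d : α → ℤ) (k : ℤ) (a : α) :
    gr d k (single a (1 : R)) = sgn R (k * d a) • single a 1 := lin_single _ _

theorem gr_homog {d : α → ℤ} {k l : ℤ} {x : α →₀ R} (hx : x ∈ homog d l) :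
    gr d k x = sgn R (k * l) • x := by
  refine homog_induction (p := fun x => gr d k x = sgn R (k * l) • x) hx ?_ ?_ ?_ ?_
  · simp
  · intro x y hx hy; simp [hx, hy]
  · intro c x hx; rw [map_smul, hx, smul_comm]
  · rintro a rfl; exact gr_single _ _ _

theorem gr_gr (d : α → ℤ) (k l : ℤ) (x : α →₀ R) : gr d k (gr d l x) = gr d (k + l) x := by
  refine eq_of_single (gr d k ∘ₗ gr d l) (gr d (k + l)) (fun a => ?_) x
  simp only [LinearMap.comp_apply, gr_single, map_smul, smul_smul, ← sgn_add]
  congr 2; ring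

/-- On basis elements of even degree both operators are the identity, on those of odd degree they
multiply by `sgn R k` and `sgn R l`. The hypothesis compares signs in `R` instead of parities, so
that it can be discharged by the sign rules. -/
theorem gr_congr (d : α → ℤ) {k l : ℤ} (h : sgn R k = sgn R l) (x : α →₀ R) :
    gr d k x = gr d l x := by
  refine eq_of_single (gr d k) (gr d l) (fun a => ?_) x
  rw [gr_single, gr_single]
  rcases Int.even_or_odd (d a) with ha | ha
  · rw [sgn_even (ha.mul_left k), sgn_even (ha.mul_left l)]
  · obtain ⟨m, hm⟩ := ha
    have : ∀ k : ℤ, sgn R (k * d a) = sgn R k := fun k => by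
      rw [hm, mul_add, mul_one, sgn_add, ← mul_assoc, mul_comm k 2, mul_assoc,
        sgn_even (even_two_mul _), one_mul]
    rw [this, this, h]

theorem gr_zero (d : α → ℤ) (x : α →₀ R) : gr d 0 x = x := by
  refine eq_of_single (gr d 0) LinearMap.id (fun a => ?_) x
  simp [gr_single, sgn_zero]

/-- This is how homogeneity of a map enters sign computations: since `f` shifts all degrees by `k`,
moving a sign operator across it costs a constant sign. -/
theorem HasDegree.gr_map {da : α → ℤ} {db : β → ℤ} {k : ℤ} {f : (α →₀ R) →ₗ[R] (β →₀ R)}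
    (h : HasDegree da db k f) (l : ℤ) (x : α →₀ R) :
    gr db l (f x) = sgn R (l * k) • f (gr da l x) := by
  refine eq_of_single (gr db l ∘ₗ f) (sgn R (l * k) • f ∘ₗ gr da l) (fun a => ?_) x
  simp only [LinearMap.comp_apply, LinearMap.smul_apply, gr_single, map_smul]
  rw [gr_homog (hasDegree_iff.1 h a), smul_smul, ← sgn_add]
  congr 2; ring

end Linear

/-! ### The tensor algebra and its graded derivations -/

section Words

variable {R : Type v} [CommRing R] {α : Type*}

/-- The product of the tensor algebra. -/
def cat (u v : List α →₀ R) : List α →₀ R := concat (tmul u v)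

infixr:74 " ⋄ " => cat

theorem cat_def (u v : List α →₀ R) : u ⋄ v = concat (tmul u v) := rfl

theorem add_cat (u v w : List α →₀ R) : (u + v) ⋄ w = u ⋄ w + v ⋄ w := by
  simp [cat, add_tmul]
theorem cat_add (u v w : List α →₀ R) : u ⋄ (v + w) = u ⋄ v + u ⋄ w := by
  simp [cat, tmul_add]
theorem neg_cat (u w : List α →₀ R) : (-u) ⋄ w = -(u ⋄ w) := by simp [cat, neg_tmul]
theorem cat_neg (u w : List α →₀ R) : u ⋄ (-w) = -(u ⋄ w) := by simp [cat, tmul_neg]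
theorem sub_cat (u v w : List α →₀ R) : (u - v) ⋄ w = u ⋄ w - v ⋄ w := by
  simp [cat, sub_tmul]
theorem cat_sub (u v w : List α →₀ R) : u ⋄ (v - w) = u ⋄ v - u ⋄ w := by
  simp [cat, tmul_sub]
theorem smul_cat (c : R) (u w : List α →₀ R) : (c • u) ⋄ w = c • (u ⋄ w) := by
  simp [cat, smul_tmul]
theorem cat_smul (c : R) (u w : List α →₀ R) : u ⋄ (c • w) = c • (u ⋄ w) := by
  simp [cat, tmul_smul]
theorem zero_cat (w : List α →₀ R) : (0 : List α →₀ R) ⋄ w = 0 := by simp [cat, zero_tmul]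
theorem cat_zero (w : List α →₀ R) : w ⋄ (0 : List α →₀ R) = 0 := by simp [cat, tmul_zero]
/-- Left multiplication as a linear map. -/
def catL (u : List α →₀ R) : (List α →₀ R) →ₗ[R] (List α →₀ R) := concat ∘ₗ tmulL u
/-- Right multiplication as a linear map. -/
def catR (w : List α →₀ R) : (List α →₀ R) →ₗ[R] (List α →₀ R) := concat ∘ₗ tmulL.flip w

theorem catL_apply (u w : List α →₀ R) : catL u w = u ⋄ w := rfl
theorem catR_apply (u w : List α →₀ R) : catR w u = u ⋄ w := rfl

theorem single_cat (p q : List α) :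
    (single p 1 : List α →₀ R) ⋄ single q 1 = single (p ++ q) 1 := by
  simp [cat, tmul_single, concat]

theorem single_cons (a : α) (w : List α) :
    (single (a :: w) 1 : List α →₀ R) = single [a] 1 ⋄ single w 1 := by
  rw [single_cat]; rfl

theorem cat_assoc (u v w : List α →₀ R) : (u ⋄ v) ⋄ w = u ⋄ v ⋄ w := by
  induction u using linear_induction with
  | zero => simp [zero_cat]
  | add x x' h h' => simp [add_cat, h, h']
  | smul c x h => simp [smul_cat, h]
  | single a =>
    induction v using linear_induction with
    | zero => simp [zero_cat, cat_zero]
    | add x x' h h' => simp [add_cat, cat_add, h, h']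
    | smul c x h => simp [smul_cat, cat_smul, h]
    | single b =>
      induction w using linear_induction with
      | zero => simp [cat_zero]
      | add x x' h h' => simp [cat_add, h, h']
      | smul c x h => simp [cat_smul, h]
      | single c => simp [single_cat]

theorem one_cat (u : List α →₀ R) : single [] 1 ⋄ u = u := by
  refine eq_of_single (catL (single [] 1)) LinearMap.id (fun a => ?_) u
  simp [catL_apply, single_cat]

theorem cat_one (u : List α →₀ R) : u ⋄ single [] 1 = u := by
  refine eq_of_single (catR (single [] 1)) LinearMap.id (fun a => ?_) u
  simp [catR_apply, single_cat]

/-- The degree of a word. -/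
def wdeg (d : α → ℤ) (w : List α) : ℤ := (w.map d).sum

theorem wdeg_nil (d : α → ℤ) : wdeg d [] = 0 := rfl
theorem wdeg_cons (d : α → ℤ) (a : α) (w : List α) : wdeg d (a :: w) = d a + wdeg d w := by
  simp [wdeg]
theorem wdeg_append (d : α → ℤ) (v w : List α) : wdeg d (v ++ w) = wdeg d v + wdeg d w := by
  simp [wdeg]

theorem hasDegree_concat (d : α → ℤ) :
    HasDegree (fun p : List α × List α => wdeg d p.1 + wdeg d p.2) (wdeg d) 0
      (concat : _ →ₗ[R] _) := by
  rw [hasDegree_iff]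
  rintro ⟨p, q⟩
  rw [← tmul_single]
  change single p 1 ⋄ single q 1 ∈ _
  rw [single_cat]
  apply single_mem_homog
  simp [wdeg_append]

theorem cat_mem_homog {d : α → ℤ} {k l m : ℤ} {u w : List α →₀ R} (hu : u ∈ homog (wdeg d) k)
    (hw : w ∈ homog (wdeg d) l) (hm : k + l = m) : u ⋄ w ∈ homog (wdeg d) m :=
  (hasDegree_concat d).mem (tmul_mem_homog hu hw hm) (add_zero m)

theorem gr_cat (d : α → ℤ) (k : ℤ) (u w : List α →₀ R) :
    gr (wdeg d) k (u ⋄ w) = gr (wdeg d) k u ⋄ gr (wdeg d) k w := by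
  induction u using linear_induction with
  | zero => simp [zero_cat]
  | add x x' h h' => simp [add_cat, h, h']
  | smul c x h => simp [smul_cat, h]
  | single a =>
    induction w using linear_induction with
    | zero => simp [cat_zero]
    | add x x' h h' => simp [cat_add, h, h']
    | smul c x h => simp [cat_smul, h]
    | single b =>
      simp only [single_cat, gr_single, smul_cat, cat_smul, smul_smul, wdeg_append, mul_add, sgn_add]
      rw [mul_comm]

theorem cat_induction {p : (List α →₀ R) → Prop} (x : List α →₀ R) (zero : p 0)
    (add : ∀ x y, p x → p y → p (x + y)) (smul : ∀ (c : R) x, p x → p (c • x))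
    (one : p (single [] 1)) (letter : ∀ a w, p (single w 1) → p (single [a] 1 ⋄ single w 1)) :
    p x := by
  refine linear_induction x zero add smul fun w => ?_
  induction w with
  | nil => exact one
  | cons a w ih => rw [single_cons]; exact letter a w ih

/-- `D` is a derivation of degree `k` of the tensor algebra. -/
def IsDer (d : α → ℤ) (k : ℤ) (D : (List α →₀ R) →ₗ[R] (List α →₀ R)) : Prop :=
  ∀ u w, D (u ⋄ w) = D u ⋄ w + gr (wdeg d) k u ⋄ D w

theorem IsDer.map_one {d : α → ℤ} {k : ℤ} {D : (List α →₀ R) →ₗ[R] (List α →₀ R)}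
    (h : IsDer d k D) : D (single [] 1) = 0 := by
  have := h (single [] 1) (single [] 1)
  simp only [one_cat, cat_one, gr_single, wdeg_nil, mul_zero, sgn_zero, one_smul] at this
  simpa using this

/-- The Leibniz rule and the vanishing on the unit propagate equality from letters to words. -/
theorem IsDer.ext {d : α → ℤ} {k : ℤ} {D E : (List α →₀ R) →ₗ[R] (List α →₀ R)}
    (hD : IsDer d k D) (hE : IsDer d k E) (h : ∀ a, D (single [a] 1) = E (single [a] 1)) :
    D = E := by
  refine ext_single fun w => ?_
  induction w with
  | nil => rw [hD.map_one, hE.map_one]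
  | cons a w ih => rw [single_cons, hD, hE, ih, h]

theorem IsDer.add {d : α → ℤ} {k : ℤ} {D E : (List α →₀ R) →ₗ[R] (List α →₀ R)}
    (hD : IsDer d k D) (hE : IsDer d k E) : IsDer d k (D + E) := fun u w => by
  simp only [LinearMap.add_apply, hD u w, hE u w, add_cat, cat_add]; abel

theorem IsDer.smul {d : α → ℤ} {k : ℤ} {D : (List α →₀ R) →ₗ[R] (List α →₀ R)}
    (hD : IsDer d k D) (c : R) : IsDer d k (c • D) := fun u w => by
  simp only [LinearMap.smul_apply, hD u w, smul_cat, cat_smul, smul_add]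

theorem isDer_zero (d : α → ℤ) (k : ℤ) : IsDer d k (0 : (List α →₀ R) →ₗ[R] (List α →₀ R)) :=
  fun u w => by simp [zero_cat, cat_zero]

theorem IsDer.congr {d : α → ℤ} {k l : ℤ} {D : (List α →₀ R) →ₗ[R] (List α →₀ R)}
    (hD : IsDer d k D) (h : sgn R k = sgn R l) : IsDer d l D := fun u w => by
  rw [hD u w, gr_congr _ h]

/-- In the expansion on a product, the mixed terms, in which `D` hits one factor and `E` the other,
cancel because of the sign `(-1)^{kl}`. -/
theorem IsDer.comm {d : α → ℤ} {k l : ℤ} {D E : (List α →₀ R) →ₗ[R] (List α →₀ R)}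
    (hD : IsDer d k D) (hE : IsDer d l E) (hD' : HasDegree (wdeg d) (wdeg d) k D)
    (hE' : HasDegree (wdeg d) (wdeg d) l E) :
    IsDer d (k + l) (D ∘ₗ E - sgn R (k * l) • E ∘ₗ D) := fun u w => by
  simp only [LinearMap.sub_apply, LinearMap.comp_apply, LinearMap.smul_apply, hD _ _, hE _ _,
    map_add, hD'.gr_map, hE'.gr_map, gr_gr, sub_cat, cat_sub, smul_cat, cat_smul]
  rw [add_comm l k, mul_comm l k]
  match_scalars <;> simp [sgn_mul_self]

/-- The graded commutator with a homogeneous element is a derivation. -/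
theorem isDer_ad (d : α → ℤ) (k : ℤ) (z : List α →₀ R) :
    IsDer d k (catL z - catR z ∘ₗ gr (wdeg d) k) := fun u w => by
  simp only [LinearMap.sub_apply, LinearMap.comp_apply, catL_apply, catR_apply, gr_cat, sub_cat,
    cat_sub, cat_assoc]
  abel

/-- The values on words of the derivation of degree `k` with values `f` on the letters. -/
def derWord (d : α → ℤ) (k : ℤ) (f : α → (List α →₀ R)) :
    List α → (List α →₀ R) := fun w =>
  match w with
  | [] => 0
  | a :: w => f a ⋄ single w 1 + sgn R (k * d a) • single [a] 1 ⋄ derWord d k f w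

/-- The derivation of degree `k` with values `f` on the letters. -/
def der (d : α → ℤ) (k : ℤ) (f : α → (List α →₀ R)) : (List α →₀ R) →ₗ[R] (List α →₀ R) :=
  lin (derWord d k f)

theorem der_nil (d : α → ℤ) (k : ℤ) (f : α → (List α →₀ R)) : der d k f (single [] 1) = 0 :=
  lin_single _ _

theorem der_letter (d : α → ℤ) (k : ℤ) (f : α → (List α →₀ R)) (a : α) :
    der d k f (single [a] 1) = f a := by
  rw [der, lin_single, derWord, derWord, cat_zero, smul_zero, add_zero, cat_one]

theorem der_cons (d : α → ℤ) (k : ℤ) (f : α → (List α →₀ R)) (a : α) (w : List α) :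
    der d k f (single (a :: w) 1) =
      f a ⋄ single w 1 + sgn R (k * d a) • single [a] 1 ⋄ der d k f (single w 1) := by
  rw [der, lin_single, lin_single]; rfl

theorem isDer_der (d : α → ℤ) (k : ℤ) (f : α → (List α →₀ R)) : IsDer d k (der d k f) := by
  intro u w
  induction u using cat_induction with
  | zero => simp [zero_cat]
  | add x y hx hy => simp only [add_cat, map_add, hx, hy]; abel
  | smul c x h => simp only [smul_cat, map_smul, h, smul_add]
  | one => simp [one_cat, der_nil, zero_cat, gr_single, wdeg_nil, sgn_zero]
  | letter a v ih =>
    have key : ∀ x : List α →₀ R, der d k f (single [a] 1 ⋄ x) =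
        f a ⋄ x + sgn R (k * d a) • single [a] 1 ⋄ der d k f x := fun x =>
      eq_of_single (der d k f ∘ₗ catL (single [a] 1))
        (catL (f a) + sgn R (k * d a) • catL (single [a] 1) ∘ₗ der d k f) (fun w => by
          simp only [LinearMap.comp_apply, LinearMap.add_apply, LinearMap.smul_apply, catL_apply]
          rw [← single_cons, der_cons]) x
    rw [cat_assoc, key, ih, key, gr_cat]
    simp only [gr_single, add_cat, cat_add, smul_cat, cat_smul, cat_assoc, wdeg_cons, wdeg_nil,
      add_zero, smul_add, add_assoc]
    rw [smul_comm]

theorem hasDegree_der {d : α → ℤ} {k : ℤ} {f : α → (List α →₀ R)}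
    (hf : ∀ a, f a ∈ homog (wdeg d) (d a + k)) :
    HasDegree (wdeg d) (wdeg d) k (der d k f) := by
  rw [hasDegree_iff]
  intro w
  induction w with
  | nil => rw [der_nil]; exact zero_mem _
  | cons a w ih =>
    rw [der_cons]
    refine add_mem (cat_mem_homog (hf a) (single_mem_homog (k := wdeg d w) rfl) ?_)
      (Submodule.smul_mem _ _
        (cat_mem_homog (single_mem_homog (k := wdeg d [a]) rfl) ih ?_))
    · rw [wdeg_cons]; ring
    · simp only [wdeg_cons, wdeg_nil]; ring

/-- The square of an odd derivation is a derivation. -/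
theorem IsDer.sq {d : α → ℤ} {D : (List α →₀ R) →ₗ[R] (List α →₀ R)}
    (hD : IsDer d (-1) D) (hD' : HasDegree (wdeg d) (wdeg d) (-1) D) :
    IsDer d (-2) (D ∘ₗ D) := fun u w => by
  simp only [LinearMap.comp_apply, hD _ _, map_add, hD'.gr_map, gr_gr, smul_cat]
  norm_num [sgn_one]

end Words

end

end DoubleCobar

namespace DoubleCobar

open Finsupp (single)

noncomputable section

/-! ### The bialgebra structure of the tensor algebra with the shuffle coproduct -/

section Shuffle

variable {R : Type v} [CommRing R] {α β : Type*} (d : α → ℤ)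

/-- The inclusion of the letters into the tensor algebra. -/
def letter : (α →₀ R) →ₗ[R] (List α →₀ R) := Finsupp.lmapDomain R R fun a => [a]

theorem letter_single (a : α) : letter (single a (1 : R)) = single [a] 1 := by
  simp [letter]

theorem letter_mem_homog {d : α → ℤ} {k : ℤ} {p : α →₀ R} (hp : p ∈ homog d k) :
    letter p ∈ homog (wdeg d) k := by
  refine homog_induction (p := fun p => letter p ∈ homog (wdeg d) k) hp ?_ ?_ ?_ ?_
  · simp
  · intro x y hx hy; rw [map_add]; exact add_mem hx hy
  · intro c x hx; rw [map_smul]; exact Submodule.smul_mem _ _ hx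
  · rintro a rfl; rw [letter_single]; exact single_mem_homog (by simp [wdeg])

/-- The degree of a pair. -/
def pdeg (f : β → ℤ) (p : β × β) : ℤ := f p.1 + f p.2

/-- Left multiplication of the tensor square of the tensor algebra by `v ⊗ 1 + 1 ⊗ v`. -/
def ins (v : α) : (List α × List α →₀ R) →ₗ[R] (List α × List α →₀ R) :=
  lin fun p => single (v :: p.1, p.2) 1 + sgn R (d v * wdeg d p.1) • single (p.1, v :: p.2) 1

theorem ins_single (v : α) (p q : List α) :
    ins d v (single (p, q) (1 : R)) =
      single (v :: p, q) 1 + sgn R (d v * wdeg d p) • single (p, v :: q) 1 := lin_single _ _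

theorem ins_tmul (v : α) (x y : List α →₀ R) :
    ins d v (tmul x y) =
      tmul (single [v] 1 ⋄ x) y + tmul (gr (wdeg d) (d v) x) (single [v] 1 ⋄ y) := by
  induction x using linear_induction with
  | zero => simp [zero_tmul, cat_zero]
  | add x x' h h' => simp only [add_tmul, cat_add, map_add, h, h']; abel
  | smul c x h => simp only [smul_tmul, cat_smul, map_smul, h, smul_add]
  | single a =>
    induction y using linear_induction with
    | zero => simp [tmul_zero, cat_zero]
    | add x x' h h' => simp only [tmul_add, cat_add, map_add, h, h']; abel
    | smul c x h => simp only [tmul_smul, cat_smul, map_smul, h, smul_add]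
    | single b =>
      simp only [tmul_single, ins_single, single_cat, gr_single, smul_tmul, List.singleton_append]

theorem shuffle_nil : shuffleCoproduct d (single [] (1 : R)) = single ([], []) 1 := lin_single _ _

theorem shuffle_cons (v : α) (w : List α) :
    shuffleCoproduct d (single (v :: w) (1 : R)) = ins d v (shuffleCoproduct d (single w 1)) := by
  simp only [shuffleCoproduct, lin_single]; rfl

/-- The letter `v` is primitive and `ins d v` is multiplication by its coproduct. Each bialgebra
axiom is proved by commuting `ins d v` with the structure map in question and inducting on the word.
-/
theorem shuffle_cat_letter (v : α) (w : List α →₀ R) :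
    shuffleCoproduct d (single [v] (1 : R) ⋄ w) = ins d v (shuffleCoproduct d w) := by
  refine eq_of_single (shuffleCoproduct d ∘ₗ catL (single [v] 1))
    (ins d v ∘ₗ shuffleCoproduct d) (fun a => ?_) w
  simp only [LinearMap.comp_apply, catL_apply, ← single_cons, shuffle_cons]

theorem shuffle_letter (v : α) :
    shuffleCoproduct d (single [v] (1 : R)) = single ([v], []) 1 + single ([], [v]) 1 := by
  rw [shuffle_cons, shuffle_nil, ins_single]; simp [wdeg_nil, sgn_zero]

theorem hasDegree_ins (v : α) :
    HasDegree (pdeg (wdeg d)) (pdeg (wdeg d)) (d v) (ins (R := R) d v) := by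
  rw [hasDegree_iff]
  rintro ⟨p, q⟩
  rw [ins_single]
  refine add_mem (single_mem_homog ?_) (Submodule.smul_mem _ _ (single_mem_homog ?_)) <;>
  · simp only [pdeg, wdeg_cons]; ring

theorem hasDegree_shuffle :
    HasDegree (wdeg d) (pdeg (wdeg d)) 0 (shuffleCoproduct (R := R) d) := by
  rw [hasDegree_iff]
  intro w
  induction w with
  | nil => rw [shuffle_nil]; exact single_mem_homog (by simp [pdeg, wdeg_nil])
  | cons v w ih =>
    rw [shuffle_cons]
    exact (hasDegree_ins d v).mem ih (by rw [wdeg_cons]; ring)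

theorem shuffle_counit_left (w : List α →₀ R) :
    lin (fun p : List α × List α => (single p.1 (1 : R)) [] • single p.2 (1 : R))
      (shuffleCoproduct d w) = w := by
  set ε := lin (R := R) (fun p : List α × List α => (single p.1 (1 : R)) [] • single p.2 (1 : R))
    with hε
  induction w using cat_induction with
  | zero => simp
  | add x y hx hy => simp only [map_add, hx, hy]
  | smul c x h => simp only [map_smul, h]
  | one => simp [hε, shuffle_nil]
  | letter v w ih =>
    rw [shuffle_cat_letter]
    conv_rhs => rw [← ih]
    refine eq_of_single (ε ∘ₗ ins d v) (catL (single [v] 1) ∘ₗ ε) (fun p => ?_) _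
    obtain ⟨p, q⟩ := p
    simp only [LinearMap.comp_apply, ins_single, map_add, map_smul, hε, lin_single, catL_apply,
      cat_smul, single_cat]
    rcases p with _ | ⟨a, p⟩ <;> simp [wdeg_nil, sgn_zero]

theorem shuffle_counit_right (w : List α →₀ R) :
    lin (fun p : List α × List α => (single p.2 (1 : R)) [] • single p.1 (1 : R))
      (shuffleCoproduct d w) = w := by
  set ε := lin (R := R) (fun p : List α × List α => (single p.2 (1 : R)) [] • single p.1 (1 : R))
    with hε
  induction w using cat_induction with
  | zero => simp
  | add x y hx hy => simp only [map_add, hx, hy]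
  | smul c x h => simp only [map_smul, h]
  | one => simp [hε, shuffle_nil]
  | letter v w ih =>
    rw [shuffle_cat_letter]
    conv_rhs => rw [← ih]
    refine eq_of_single (ε ∘ₗ ins d v) (catL (single [v] 1) ∘ₗ ε) (fun p => ?_) _
    obtain ⟨p, q⟩ := p
    simp only [LinearMap.comp_apply, ins_single, map_add, map_smul, hε, lin_single, catL_apply,
      cat_smul, single_cat]
    rcases q with _ | ⟨a, q⟩ <;> simp

/-- Both iterated coproducts intertwine left multiplication by `v` with left multiplication by the
twofold coproduct of `v`, the operator `T` below, so they agree by induction on the word. -/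
theorem shuffle_coassoc (w : List α →₀ R) :
    assoc (tmap (shuffleCoproduct d) LinearMap.id (shuffleCoproduct d w)) =
      tmap LinearMap.id (shuffleCoproduct d) (shuffleCoproduct d w) := by
  induction w using cat_induction with
  | zero => simp
  | add x y hx hy => simp only [map_add, hx, hy]
  | smul c x h => simp only [map_smul, h]
  | one => simp [shuffle_nil, tmap_single, tmul_single, assoc]
  | letter v w ih =>
    rw [shuffle_cat_letter]
    -- Left multiplication by `v ⊗ 1 ⊗ 1 + 1 ⊗ v ⊗ 1 + 1 ⊗ 1 ⊗ v`.
    let T : (List α × List α × List α →₀ R) →ₗ[R] (List α × List α × List α →₀ R) :=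
      lin fun p => single (v :: p.1, p.2.1, p.2.2) 1 +
        sgn R (d v * wdeg d p.1) • single (p.1, v :: p.2.1, p.2.2) 1 +
        sgn R (d v * (wdeg d p.1 + wdeg d p.2.1)) • single (p.1, p.2.1, v :: p.2.2) 1
    have T_single : ∀ p q r, T (single (p, q, r) 1) = single (v :: p, q, r) 1 +
        sgn R (d v * wdeg d p) • single (p, v :: q, r) 1 +
        sgn R (d v * (wdeg d p + wdeg d q)) • single (p, q, v :: r) 1 := fun p q r => lin_single _ _
    have h1 : ∀ X, assoc (tmap (shuffleCoproduct d) LinearMap.id (ins d v X)) =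
        T (assoc (tmap (shuffleCoproduct d) LinearMap.id X)) := by
      intro X
      refine eq_of_single (assoc ∘ₗ tmap (shuffleCoproduct d) LinearMap.id ∘ₗ ins d v)
        (T ∘ₗ assoc ∘ₗ tmap (shuffleCoproduct d) LinearMap.id) (fun p => ?_) X
      obtain ⟨p, q⟩ := p
      simp only [LinearMap.comp_apply, ins_single, map_add, map_smul, tmap_single,
        LinearMap.id_apply, shuffle_cons]
      have hp := hasDegree_iff.1 (hasDegree_shuffle (R := R) d) p
      rw [add_zero] at hp
      -- The sign of the third summand of `T` depends on the total degree of the first two factors,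
      -- which is constant on the coproduct of `p`.
      refine homog_induction (p := fun Y => assoc (tmul (ins d v Y) (single q 1)) +
        sgn R (d v * wdeg d p) • assoc (tmul Y (single (v :: q) 1)) =
        T (assoc (tmul Y (single q 1)))) hp ?_ ?_ ?_ ?_
      · simp [zero_tmul]
      · intro x y hx hy
        simp only [map_add, add_tmul, ← hx, ← hy, smul_add]; abel
      · intro c x hx
        simp only [map_smul, smul_tmul, ← hx, smul_add]
        rw [smul_comm]
      · rintro ⟨p1, p2⟩ h
        simp only [pdeg] at h
        simp only [← h, ins_single, add_tmul, smul_tmul, map_add, map_smul, tmul_single,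
          assoc_single, T_single]
    have h2 : ∀ X, tmap LinearMap.id (shuffleCoproduct d) (ins d v X) =
        T (tmap LinearMap.id (shuffleCoproduct d) X) := by
      intro X
      refine eq_of_single (tmap LinearMap.id (shuffleCoproduct d) ∘ₗ ins d v)
        (T ∘ₗ tmap LinearMap.id (shuffleCoproduct d)) (fun p => ?_) X
      obtain ⟨p, q⟩ := p
      simp only [LinearMap.comp_apply, ins_single, map_add, map_smul, tmap_single,
        LinearMap.id_apply, shuffle_cons]
      refine eq_of_single (tmulL (single (v :: p) 1) +
        sgn R (d v * wdeg d p) • tmulL (single p 1) ∘ₗ ins d v)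
        (T ∘ₗ tmulL (single p 1)) (fun q => ?_) _
      obtain ⟨q, r⟩ := q
      simp only [LinearMap.comp_apply, LinearMap.add_apply, LinearMap.smul_apply, tmulL_apply,
        ins_single, tmul_add, tmul_smul, tmul_single, T_single, smul_add, smul_smul, mul_add,
        sgn_add, add_assoc]
    rw [h1, h2, ih]

/-- The product `(a ⊗ b)(a' ⊗ b') = (-1)^{|b||a'|} aa' ⊗ bb'` of a tensor square. -/
def mulT (f : β → ℤ) (mul : (β × β →₀ R) →ₗ[R] (β →₀ R)) :
    ((β × β) × (β × β) →₀ R) →ₗ[R] (β × β →₀ R) :=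
  lin fun q => sgn R (f q.1.2 * f q.2.1) •
    tmul (mul (single (q.1.1, q.2.1) 1)) (mul (single (q.1.2, q.2.2) 1))

theorem mulT_single (f : β → ℤ) (mul : (β × β →₀ R) →ₗ[R] (β →₀ R)) (p q p' q' : β) :
    mulT f mul (single ((p, q), (p', q')) 1) =
      sgn R (f q * f p') • tmul (mul (single (p, p') 1)) (mul (single (q, q') 1)) := lin_single _ _

theorem concat_single (p q : List α) :
    concat (single (p, q) (1 : R)) = single (p ++ q) 1 := by simp [concat]

theorem mulT_ins (v : α) (X Y : List α × List α →₀ R) :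
    mulT (wdeg d) concat (tmul (ins d v X) Y) = ins d v (mulT (wdeg d) concat (tmul X Y)) := by
  induction X using linear_induction with
  | zero => simp [zero_tmul]
  | add x x' h h' => simp only [add_tmul, map_add, h, h']
  | smul c x h => simp only [smul_tmul, map_smul, h]
  | single a =>
    induction Y using linear_induction with
    | zero => simp [tmul_zero]
    | add x x' h h' => simp only [tmul_add, map_add, h, h']
    | smul c x h => simp only [tmul_smul, map_smul, h]
    | single b =>
      obtain ⟨p, q⟩ := a
      obtain ⟨p', q'⟩ := b
      simp only [ins_single, add_tmul, smul_tmul, tmul_single, map_add, map_smul, mulT_single,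
        concat_single, smul_add, smul_smul, wdeg_cons, wdeg_append, List.cons_append, add_mul,
        mul_add, sgn_add]
      congr 2
      rw [← mul_assoc, mul_comm]

theorem mulT_one (Y : List α × List α →₀ R) :
    mulT (wdeg d) concat (tmul (single ([], []) 1) Y) = Y := by
  refine eq_of_single (mulT (wdeg d) concat ∘ₗ tmulL (single ([], []) 1)) LinearMap.id
    (fun q => ?_) Y
  obtain ⟨p, q⟩ := q
  simp only [LinearMap.comp_apply, tmulL_apply, tmul_single, mulT_single, concat_single]
  simp [wdeg_nil, sgn_zero]

theorem shuffle_cat (u w : List α →₀ R) :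
    shuffleCoproduct d (u ⋄ w) =
      mulT (wdeg d) concat (tmul (shuffleCoproduct d u) (shuffleCoproduct d w)) := by
  induction u using cat_induction with
  | zero => simp [zero_cat, zero_tmul]
  | add x y hx hy => simp only [add_cat, map_add, hx, hy, add_tmul]
  | smul c x h => simp only [smul_cat, map_smul, h, smul_tmul]
  | one => rw [one_cat, shuffle_nil, mulT_one]
  | letter v u ih => rw [cat_assoc, shuffle_cat_letter, shuffle_cat_letter, ih, mulT_ins]

/-- The shuffle coproduct is cocommutative. -/
theorem shuffle_twist (w : List α →₀ R) :
    lin (fun p : List α × List α => sgn R (wdeg d p.1 * wdeg d p.2) • single (p.2, p.1) (1 : R))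
      (shuffleCoproduct d w) = shuffleCoproduct d w := by
  set τ := lin (R := R) (fun p : List α × List α =>
    sgn R (wdeg d p.1 * wdeg d p.2) • single (p.2, p.1) (1 : R)) with hτ
  induction w using cat_induction with
  | zero => simp
  | add x y hx hy => simp only [map_add, hx, hy]
  | smul c x h => simp only [map_smul, h]
  | one => rw [shuffle_nil, hτ, lin_single]; simp [wdeg_nil, sgn_zero]
  | letter v w ih =>
    rw [shuffle_cat_letter]
    conv_rhs => rw [← ih]
    refine eq_of_single (τ ∘ₗ ins d v) (ins d v ∘ₗ τ) (fun p => ?_) _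
    obtain ⟨p, q⟩ := p
    simp only [LinearMap.comp_apply, ins_single, map_add, map_smul, hτ, lin_single, wdeg_cons, smul_add,
      smul_smul, add_mul, mul_add, sgn_add]
    rw [add_comm, sgn_arg_comm (wdeg d p) (d v), ← mul_assoc, sgn_mul_self, one_mul,
      mul_comm (sgn R (d v * wdeg d q))]

/-- The differential `D ⊗ 1 + 1 ⊗ D` of a tensor product. -/
def tensorD {γ : Type*} (f : β → ℤ) (D : (β →₀ R) →ₗ[R] (β →₀ R))
    (E : (γ →₀ R) →ₗ[R] (γ →₀ R)) : (β × γ →₀ R) →ₗ[R] (β × γ →₀ R) :=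
  lin fun p => tmul (D (single p.1 1)) (single p.2 1) +
    sgn R (f p.1) • tmul (single p.1 1) (E (single p.2 1))

theorem tensorD_tmul {γ : Type*} (f : β → ℤ) (D : (β →₀ R) →ₗ[R] (β →₀ R))
    (E : (γ →₀ R) →ₗ[R] (γ →₀ R)) (x : β →₀ R) (y : γ →₀ R) :
    tensorD f D E (tmul x y) = tmul (D x) y + tmul (gr f 1 x) (E y) := by
  induction x using linear_induction with
  | zero => simp [zero_tmul]
  | add x x' h h' => simp only [add_tmul, map_add, h, h']; abel
  | smul c x h => simp only [smul_tmul, map_smul, h, smul_add]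
  | single a =>
    induction y using linear_induction with
    | zero => simp [tmul_zero]
    | add x x' h h' => simp only [tmul_add, map_add, h, h']; abel
    | smul c x h => simp only [tmul_smul, map_smul, h, smul_add]
    | single b => simp only [tmul_single, tensorD, lin_single, gr_single, smul_tmul, one_mul]

end Shuffle

end

end DoubleCobar

namespace DoubleCobar

open Finsupp (single)

noncomputable section

/-! ### Linear differentials and the antipode of the tensor algebra -/

section ShuffleHopf

variable {R : Type v} [CommRing R] {α β : Type*} (d : α → ℤ)

theorem mulT_left (u x y : List α →₀ R) :
    mulT (wdeg d) concat (tmul (tmul u (single [] 1)) (tmul x y)) = tmul (u ⋄ x) y := by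
  induction u using linear_induction with
  | zero => simp [zero_tmul, zero_cat]
  | add x x' h h' => simp only [add_tmul, map_add, h, h', add_cat]
  | smul c x h => simp only [smul_tmul, map_smul, h, smul_cat]
  | single a =>
    induction x using linear_induction with
    | zero => simp [zero_tmul, tmul_zero, cat_zero]
    | add x x' h h' => simp only [add_tmul, tmul_add, map_add, h, h', cat_add]
    | smul c x h => simp only [smul_tmul, tmul_smul, map_smul, h, cat_smul]
    | single b =>
      refine eq_of_single (mulT (wdeg d) concat ∘ₗ tmulL (tmul (single a 1) (single [] 1)) ∘ₗ
        tmulL (single b 1)) (tmulL (single a 1 ⋄ single b 1)) (fun q => ?_) y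
      simp only [LinearMap.comp_apply, tmulL_apply, tmul_single, mulT_single, concat_single,
        wdeg_nil, zero_mul, sgn_zero, one_smul, List.nil_append, single_cat]

theorem mulT_right {k : ℤ} {u : List α →₀ R} (hu : u ∈ homog (wdeg d) k) (x y : List α →₀ R) :
    mulT (wdeg d) concat (tmul (tmul (single [] 1) u) (tmul x y)) =
      tmul (gr (wdeg d) k x) (u ⋄ y) := by
  refine homog_induction (p := fun u => mulT (wdeg d) concat
    (tmul (tmul (single [] 1) u) (tmul x y)) = tmul (gr (wdeg d) k x) (u ⋄ y)) hu ?_ ?_ ?_ ?_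
  · simp [zero_tmul, tmul_zero, zero_cat]
  · intro u u' h h'; simp only [tmul_add, add_tmul, map_add, h, h', add_cat]
  · intro c u h; simp only [tmul_smul, smul_tmul, map_smul, h, smul_cat]
  · rintro a rfl
    induction x using linear_induction with
    | zero => simp [zero_tmul, tmul_zero]
    | add x x' h h' => simp only [add_tmul, tmul_add, map_add, h, h']
    | smul c x h => simp only [smul_tmul, tmul_smul, map_smul, h]
    | single b =>
      refine eq_of_single (mulT (wdeg d) concat ∘ₗ tmulL (tmul (single [] 1) (single a 1)) ∘ₗ
        tmulL (single b 1)) (tmulL (gr (wdeg d) (wdeg d a) (single b 1)) ∘ₗ catL (single a 1))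
        (fun q => ?_) y
      simp only [LinearMap.comp_apply, tmulL_apply, tmul_single, mulT_single, concat_single,
        List.nil_append, single_cat, gr_single, smul_tmul, catL_apply]

theorem shuffle_letter' (p : α →₀ R) :
    shuffleCoproduct d (letter p) =
      tmul (letter p) (single [] 1) + tmul (single [] 1) (letter p) := by
  refine eq_of_single (shuffleCoproduct d ∘ₗ letter)
    (tmulL.flip (single [] 1) ∘ₗ letter + tmulL (single [] 1) ∘ₗ letter) (fun a => ?_) p
  simp only [LinearMap.comp_apply, LinearMap.add_apply, LinearMap.flip_apply, tmulL_apply,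
    letter_single, shuffle_letter, tmul_single]

/-- The differential of the tensor algebra that extends a differential of the letters. -/
def letterD (δ : α → (α →₀ R)) : (List α →₀ R) →ₗ[R] (List α →₀ R) :=
  der d (-1) fun a => letter (δ a)

variable {d} {δ : α → (α →₀ R)}

theorem letterD_letter (a : α) : letterD d δ (single [a] 1) = letter (δ a) := der_letter _ _ _ _

theorem letterD_letter_cat (a : α) (w : List α →₀ R) :
    letterD d δ (single [a] 1 ⋄ w) =
      letter (δ a) ⋄ w + sgn R (d a) • single [a] 1 ⋄ letterD d δ w := by
  have hder : IsDer d (-1) (letterD d δ) := isDer_der _ _ _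
  rw [hder, letterD_letter, gr_single, smul_cat, wdeg_cons, wdeg_nil, add_zero, neg_one_mul,
    sgn_neg]

theorem hasDegree_letterD (hδ : ∀ a, δ a ∈ homog d (d a - 1)) :
    HasDegree (wdeg d) (wdeg d) (-1) (letterD d δ) :=
  hasDegree_der fun a => letter_mem_homog (hδ a)

theorem letterD_letterD (hδ : ∀ a, δ a ∈ homog d (d a - 1))
    (hδ' : ∀ a, lin δ (δ a) = 0) (x : List α →₀ R) : letterD d δ (letterD d δ x) = 0 := by
  have h : ∀ p : α →₀ R, letterD d δ (letter p) = letter (lin δ p) := fun p =>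
    eq_of_single (letterD d δ ∘ₗ letter) (letter ∘ₗ lin δ) (fun a => by
      simp only [LinearMap.comp_apply, letter_single, letterD, der_letter, lin_single]) p
  refine LinearMap.congr_fun (f := letterD d δ ∘ₗ letterD d δ) (g := 0)
    (((isDer_der _ _ _).sq (hasDegree_letterD hδ)).ext (isDer_zero _ _) fun a => ?_) x
  change letterD d δ (letterD d δ (single [a] 1)) = 0
  rw [letterD_letter, h, hδ', map_zero]

/-- On a letter the claim holds because `δ v` is again a combination of letters, hence primitive.
The Leibniz rule on both sides carries it to words. -/
theorem shuffle_letterD (hδ : ∀ a, δ a ∈ homog d (d a - 1)) (w : List α →₀ R) :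
    shuffleCoproduct d (letterD d δ w) =
      tensorD (wdeg d) (letterD d δ) (letterD d δ) (shuffleCoproduct d w) := by
  have hder : IsDer d (-1) (letterD d δ) := isDer_der _ _ _
  induction w using cat_induction with
  | zero => simp
  | add x y hx hy => simp only [map_add, hx, hy]
  | smul c x h => simp only [map_smul, h]
  | one =>
    rw [shuffle_nil, ← tmul_single, tensorD_tmul, hder.map_one]
    simp [zero_tmul, tmul_zero]
  | letter v w ih =>
    rw [letterD_letter_cat, map_add, map_smul, shuffle_cat_letter, shuffle_cat_letter, ih, shuffle_cat, shuffle_letter']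
    refine eq_of_single (mulT (wdeg d) concat ∘ₗ tmulL (tmul (letter (δ v)) (single [] 1) +
      tmul (single [] 1) (letter (δ v))) + sgn R (d v) • ins d v ∘ₗ
      tensorD (wdeg d) (letterD d δ) (letterD d δ))
      (tensorD (wdeg d) (letterD d δ) (letterD d δ) ∘ₗ ins d v) (fun p => ?_) _
    obtain ⟨p, q⟩ := p
    rw [← tmul_single]
    generalize (single p 1 : List α →₀ R) = x
    generalize (single q 1 : List α →₀ R) = y
    simp only [LinearMap.add_apply, LinearMap.smul_apply, LinearMap.comp_apply, tmulL_apply,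
      add_tmul, map_add, mulT_left, mulT_right d (letter_mem_homog (hδ v)), tensorD_tmul,
      ins_tmul, letterD_letter_cat, gr_cat, gr_gr, (hasDegree_letterD hδ).gr_map, gr_single, smul_cat,
      smul_tmul, smul_add, tmul_add, tmul_smul, cat_smul, wdeg_cons, wdeg_nil]
    rw [sub_eq_add_neg, add_comm 1 (d v), gr_congr (l := d v + 1) (k := d v + -1)]
    · match_scalars <;> simp [sgn_neg, sgn_mul_self]
    · simp [sgn_add, sgn_neg]

variable (d)

/-- The values of the antipode of the tensor algebra on words. -/
def antipodeWord : List α → (List α →₀ R) := fun w =>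
  match w with
  | [] => single [] 1
  | a :: w => -(sgn R (d a * wdeg d w) • antipodeWord w ⋄ single [a] 1)

/-- The antipode of the tensor algebra with the shuffle coproduct. -/
def antipode : (List α →₀ R) →ₗ[R] (List α →₀ R) := lin (antipodeWord d)

theorem antipode_nil : antipode d (single [] (1 : R)) = single [] 1 := lin_single _ _

theorem antipode_letter_cat (a : α) (w : List α →₀ R) :
    antipode d (single [a] 1 ⋄ w) = -(antipode d (gr (wdeg d) (d a) w) ⋄ single [a] 1) := by
  refine eq_of_single (antipode d ∘ₗ catL (single [a] 1))
    (-(catR (single [a] (1 : R)) ∘ₗ antipode d ∘ₗ gr (wdeg d) (d a))) (fun w => ?_) w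
  simp only [LinearMap.comp_apply, LinearMap.neg_apply, catL_apply, catR_apply, ← single_cons,
    gr_single, map_smul, smul_cat]
  rw [antipode, lin_single, lin_single]; rfl

theorem antipode_letter (a : α) : antipode d (single [a] (1 : R)) = -single [a] 1 := by
  have := antipode_letter_cat d a (single [] (1 : R))
  simpa only [cat_one, gr_single, wdeg_nil, mul_zero, sgn_zero, one_smul, antipode_nil,
    one_cat] using this

theorem hasDegree_antipode : HasDegree (wdeg d) (wdeg d) 0 (antipode (R := R) d) := by
  rw [hasDegree_iff]
  intro w
  induction w with
  | nil => rw [antipode_nil]; exact single_mem_homog (by simp [wdeg_nil])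
  | cons a w ih =>
    rw [single_cons, antipode_letter_cat, gr_single, map_smul, smul_cat]
    refine neg_mem (Submodule.smul_mem _ _ (cat_mem_homog ih (single_mem_homog rfl) ?_))
    simp only [wdeg_cons, wdeg_nil]; ring

theorem gr_antipode (k : ℤ) (x : List α →₀ R) :
    gr (wdeg d) k (antipode d x) = antipode d (gr (wdeg d) k x) := by
  rw [(hasDegree_antipode d).gr_map, mul_zero, sgn_zero, one_smul]

/-- The antipode reverses products. Its definition peels off the first letter; peeling off the last
one as well shows that applying it twice restores a word. -/
theorem antipode_cat_letter (x : List α →₀ R) (a : α) :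
    antipode d (x ⋄ single [a] 1) = -(single [a] 1 ⋄ antipode d (gr (wdeg d) (d a) x)) := by
  induction x using cat_induction with
  | zero => simp [zero_cat, cat_zero]
  | add x y hx hy => simp only [add_cat, map_add, cat_add, hx, hy, neg_add]
  | smul c x h => simp only [smul_cat, map_smul, cat_smul, h, smul_neg]
  | one => simp only [one_cat, antipode_letter, gr_single, wdeg_nil, mul_zero, sgn_zero, one_smul,
      antipode_nil, cat_one]
  | letter b w ih =>
    rw [cat_assoc, antipode_letter_cat, gr_cat, gr_cat]
    simp only [gr_single, smul_cat, cat_smul, map_smul, ih, antipode_letter_cat, neg_cat, cat_neg, smul_neg, neg_neg, smul_smul, cat_assoc, wdeg_cons, wdeg_nil, add_zero]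
    rw [mul_comm (d b) (d a)]
    congr 1
    ring

theorem antipode_antipode (x : List α →₀ R) : antipode d (antipode d x) = x := by
  induction x using cat_induction with
  | zero => simp
  | add x y hx hy => simp only [map_add, hx, hy]
  | smul c x h => simp only [map_smul, h]
  | one => rw [antipode_nil, antipode_nil]
  | letter a w ih =>
    rw [antipode_letter_cat, map_neg, antipode_cat_letter, neg_neg, gr_antipode, gr_gr,
      gr_congr (l := 0) (h := by simp [sgn_add, sgn_zero, sgn_mul_self]), gr_zero, ih]

theorem antipode_letterD {δ : α → (α →₀ R)} (hδ : ∀ a, δ a ∈ homog d (d a - 1))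
    (x : List α →₀ R) : letterD d δ (antipode d x) = antipode d (letterD d δ x) := by
  have hder : IsDer d (-1) (letterD d δ) := isDer_der _ _ _
  -- The recursion for a first letter is extended to homogeneous combinations of letters, as it will
  -- be applied to `δ a`.
  have key : ∀ {k : ℤ} {p : α →₀ R} (_ : p ∈ homog d k) (w : List α →₀ R),
      antipode d (letter p ⋄ w) = -(antipode d (gr (wdeg d) k w) ⋄ letter p) := by
    intro k p hp w
    refine homog_induction (p := fun p => antipode d (letter p ⋄ w) =
      -(antipode d (gr (wdeg d) k w) ⋄ letter p)) hp ?_ ?_ ?_ ?_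
    · simp [zero_cat, cat_zero]
    · intro x y hx hy; simp only [map_add, add_cat, cat_add, hx, hy, neg_add]
    · intro c x hx; simp only [map_smul, smul_cat, cat_smul, hx, smul_neg]
    · rintro a rfl; rw [letter_single, antipode_letter_cat]
  induction x using cat_induction with
  | zero => simp
  | add x y hx hy => simp only [map_add, hx, hy]
  | smul c x h => simp only [map_smul, h]
  | one => rw [antipode_nil, hder.map_one, map_zero]
  | letter a w ih =>
    rw [antipode_letter_cat, map_neg, hder, letterD_letter_cat, letterD_letter, map_add, map_smul,
      antipode_letter_cat, (hasDegree_letterD hδ).gr_map, key (hδ a), gr_antipode, gr_gr]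
    simp only [gr_single, map_smul, ih, smul_cat, smul_neg]
    rw [neg_add_eq_sub]
    match_scalars <;> simp [sgn_neg, sgn_mul_cancel]

/-- For a word with a first letter `a`, the summand with `a` on the left contributes `-S(±x) a y`
and the one with `a` on the right `S(±x) a y`. They cancel without any induction hypothesis. -/
theorem antipode_left (x : List α →₀ R) :
    concat (tmap (antipode d) LinearMap.id (shuffleCoproduct d x)) =
      Finsupp.lapply (R := R) [] x • single [] 1 := by
  induction x using cat_induction with
  | zero => simp
  | add x y hx hy => simp only [map_add, hx, hy, add_smul]
  | smul c x h => simp only [map_smul, h, smul_assoc]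
  | one =>
    rw [shuffle_nil, tmap_single, antipode_nil, LinearMap.id_apply, tmul_single, concat_single]
    simp
  | letter a w ih =>
    rw [shuffle_cat_letter, ← single_cons]
    trans 0
    · refine eq_of_single ((concat (R := R)) ∘ₗ tmap (antipode d) LinearMap.id ∘ₗ ins d a) 0 (fun p => ?_) _
      obtain ⟨p, q⟩ := p
      rw [LinearMap.comp_apply, LinearMap.comp_apply, ← tmul_single, ins_tmul]
      simp only [map_add, tmap_tmul, antipode_letter_cat, ← cat_def, LinearMap.id_apply, neg_cat,
        cat_assoc]
      simp
    · simp

/-- Here the summands do not cancel one by one. Removing the first letter `a` leaves the graded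
commutator of `a` with the value on the remaining word, and that value is a scalar multiple of the
unit by induction. -/
theorem antipode_right (x : List α →₀ R) :
    concat (tmap LinearMap.id (antipode d) (shuffleCoproduct d x)) =
      Finsupp.lapply (R := R) [] x • single [] 1 := by
  induction x using cat_induction with
  | zero => simp
  | add x y hx hy => simp only [map_add, hx, hy, add_smul]
  | smul c x h => simp only [map_smul, h, smul_assoc]
  | one =>
    rw [shuffle_nil, tmap_single, antipode_nil, LinearMap.id_apply, tmul_single, concat_single]
    simp
  | letter a w ih =>
    rw [shuffle_cat_letter, ← single_cons]
    trans single [a] (1 : R) ⋄ (Finsupp.lapply (R := R) [] (single w (1 : R)) • single [] (1 : R)) -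
      gr (wdeg d) (d a) (Finsupp.lapply (R := R) [] (single w (1 : R)) • single [] (1 : R)) ⋄ single [a] 1
    · rw [← ih]
      refine eq_of_single ((concat (R := R)) ∘ₗ tmap LinearMap.id (antipode d) ∘ₗ ins d a)
        (catL (single [a] 1) ∘ₗ (concat ∘ₗ tmap LinearMap.id (antipode d)) -
          catR (single [a] 1) ∘ₗ gr (wdeg d) (d a) ∘ₗ (concat ∘ₗ tmap LinearMap.id (antipode d)))
        (fun p => ?_) _
      obtain ⟨p, q⟩ := p
      simp only [LinearMap.sub_apply, LinearMap.comp_apply, ← tmul_single, ins_tmul]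
      simp only [map_add, tmap_tmul, antipode_letter_cat, ← cat_def, LinearMap.id_apply, cat_neg,
        cat_assoc, catL_apply, catR_apply, gr_cat, gr_antipode]
      abel
    · simp only [map_smul, gr_single, wdeg_nil, mul_zero, sgn_zero, one_smul, cat_smul, smul_cat,
        one_cat, cat_one, sub_self]
      simp

end ShuffleHopf

end

end DoubleCobar

namespace DoubleCobar

open Finsupp (single)

noncomputable section

/-! ### The cobar construction of the tensor algebra and the derivations given by letters -/

section CobarLetters

variable {R : Type v} [CommRing R] {α : Type*}

/-- The nonempty words. -/
abbrev NE (α : Type*) := {w : List α // w ≠ []}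

/-- Prepend a letter to a nonempty word. -/
def ncons (a : α) (w : NE α) : NE α := ⟨a :: w.1, List.cons_ne_nil _ _⟩

/-- A letter as a nonempty word. -/
def nletter (a : α) : NE α := ⟨[a], List.cons_ne_nil _ _⟩

-- The induction principle for letters of the cobar construction: prepending `v` is `leftDer d v` up
-- to sign, so a property stable under these derivations needs to be checked on the letters `s⁻¹v`
-- only.
@[elab_as_elim]
theorem ne_induction {p : NE α → Prop} (b : NE α) (letter : ∀ a, p (nletter a))
    (cons : ∀ a b, p b → p (ncons a b)) : p b := by
  obtain ⟨w, hw⟩ := b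
  induction w with
  | nil => exact absurd rfl hw
  | cons a w ih =>
    rcases eq_or_ne w [] with rfl | h
    · exact letter a
    · exact cons a ⟨w, h⟩ (ih h)

/-- The projection onto the augmentation ideal, with values in the words of length one. -/
def toWord : (List α →₀ R) →ₗ[R] (List (NE α) →₀ R) :=
  (Finsupp.lmapDomain R R fun a => [a]) ∘ₗ Finsupp.lsubtypeDomain {w | w ≠ []}

theorem toWord_nil : toWord (single ([] : List α) (1 : R)) = 0 := by
  have : Finsupp.lsubtypeDomain (R := R) {w | w ≠ []} (single ([] : List α) (1 : R)) = 0 := by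
    ext ⟨w, hw⟩
    exact Finsupp.single_eq_of_ne hw
  simp only [toWord, LinearMap.comp_apply, this, map_zero]

theorem toWord_single (b : NE α) : toWord (single b.1 (1 : R)) = single [b] 1 := by
  have : Finsupp.lsubtypeDomain (R := R) {w | w ≠ []} (single b.1 (1 : R)) = single b 1 := by
    ext c
    classical
    simp only [Finsupp.lsubtypeDomain_apply, Finsupp.subtypeDomain_apply, Finsupp.single_apply]
    exact if_congr Subtype.val_inj rfl rfl
  simp only [toWord, LinearMap.comp_apply, this]
  simp

theorem toWord_nletter (a : α) : toWord (single [a] (1 : R)) = single [nletter a] 1 :=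
  toWord_single (nletter a)

theorem toWord_ncons (a : α) (b : NE α) :
    toWord (single (a :: b.1) (1 : R)) = single [ncons a b] 1 := toWord_single (ncons a b)

/-- The degree of a letter of the cobar construction of the tensor algebra. -/
def sdeg (d : α → ℤ) (b : NE α) : ℤ := wdeg d b.1 - 1

theorem sdeg_ncons (d : α → ℤ) (a : α) (b : NE α) : sdeg d (ncons a b) = d a + sdeg d b := by
  simp only [sdeg, ncons, wdeg_cons]; ring

theorem sdeg_nletter (d : α → ℤ) (a : α) : sdeg d (nletter a) = d a - 1 := by
  simp [sdeg, nletter, wdeg_cons, wdeg_nil]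

theorem hasDegree_toWord (d : α → ℤ) :
    HasDegree (wdeg d) (wdeg (sdeg d)) (-1) (toWord (R := R) (α := α)) := by
  rw [hasDegree_iff]
  intro w
  rcases eq_or_ne w [] with rfl | h
  · rw [toWord_nil]; exact zero_mem _
  · rw [toWord_single ⟨w, h⟩]
    refine single_mem_homog ?_
    simp only [wdeg_cons, wdeg_nil, sdeg]; ring

variable (d : α → ℤ)

/-- The derivation of the cobar construction given by left multiplication of the letters by `v`. -/
def leftDer (v : α) : (List (NE α) →₀ R) →ₗ[R] (List (NE α) →₀ R) :=
  der (sdeg d) (d v) fun b => sgn R (d v) • single [ncons v b] 1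

theorem isDer_leftDer (v : α) : IsDer (sdeg d) (d v) (leftDer (R := R) d v) := isDer_der _ _ _

theorem hasDegree_leftDer (v : α) :
    HasDegree (wdeg (sdeg d)) (wdeg (sdeg d)) (d v) (leftDer (R := R) d v) := by
  refine hasDegree_der fun b => Submodule.smul_mem _ _ (single_mem_homog ?_)
  simp only [wdeg_cons, wdeg_nil, sdeg_ncons]; ring

theorem leftDer_one (v : α) : leftDer (R := R) d v (single [] 1) = 0 := der_nil _ _ _

theorem leftDer_letter (v : α) (b : NE α) :
    leftDer (R := R) d v (single [b] 1) = sgn R (d v) • single [ncons v b] 1 := der_letter _ _ _ _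

theorem leftDer_letter_cat (v : α) (b : NE α) (x : List (NE α) →₀ R) :
    leftDer d v (single [b] 1 ⋄ x) = sgn R (d v) • single [ncons v b] 1 ⋄ x +
      sgn R (d v * sdeg d b) • single [b] 1 ⋄ leftDer d v x := by
  rw [isDer_leftDer, leftDer_letter, gr_single, smul_cat, smul_cat, wdeg_cons, wdeg_nil, add_zero]

/-- The correction concerns the empty word: `toWord` kills it, whereas its product with `v` is the
letter `v`. -/
theorem leftDer_toWord (v : α) (x : List α →₀ R) :
    leftDer d v (toWord x) =
      sgn R (d v) • (toWord (single [v] 1 ⋄ x) - x [] • single [nletter v] 1) := by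
  refine eq_of_single (leftDer d v ∘ₗ toWord)
    (sgn R (d v) • (toWord ∘ₗ catL (single [v] (1 : R)) -
      (Finsupp.lapply []).smulRight (single [nletter v] 1))) (fun w => ?_) x
  simp only [LinearMap.comp_apply, LinearMap.smul_apply, LinearMap.sub_apply, catL_apply,
    LinearMap.smulRight_apply, Finsupp.lapply_apply, single_cat, List.singleton_append]
  rcases eq_or_ne w [] with rfl | h
  · rw [toWord_nil, toWord_nletter]; simp
  · rw [toWord_single ⟨w, h⟩, toWord_ncons v ⟨w, h⟩, leftDer_letter, Finsupp.single_eq_of_ne' h,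
      zero_smul, sub_zero]

/-- `leftDer`, extended linearly to the span of the letters. -/
def leftDerL : (α →₀ R) →ₗ[R] (List (NE α) →₀ R) →ₗ[R] (List (NE α) →₀ R) :=
  lin (M := (List (NE α) →₀ R) →ₗ[R] (List (NE α) →₀ R)) fun v => leftDer d v

theorem leftDerL_single (v : α) : leftDerL d (single v (1 : R)) = leftDer d v :=
  lin_single _ _

theorem isDer_leftDerL {k : ℤ} {p : α →₀ R} (hp : p ∈ homog d k) :
    IsDer (sdeg d) k (leftDerL d p) := by
  refine homog_induction (p := fun p => IsDer (sdeg d) k (leftDerL d p)) hp ?_ ?_ ?_ ?_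
  · rw [map_zero]; exact isDer_zero _ _
  · intro x y hx hy; rw [map_add]; exact hx.add hy
  · intro c x hx; rw [map_smul]; exact hx.smul c
  · rintro v rfl; rw [leftDerL_single]; exact isDer_leftDer d v

theorem leftDerL_toWord {k : ℤ} {p : α →₀ R} (hp : p ∈ homog d k) (x : List α →₀ R)
    (hx : x [] = 0) :
    leftDerL d p (toWord x) = sgn R k • toWord (letter p ⋄ x) := by
  refine homog_induction (p := fun p => leftDerL d p (toWord x) = sgn R k • toWord (letter p ⋄ x))
    hp ?_ ?_ ?_ ?_
  · simp [zero_cat]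
  · intro x y hx hy; simp only [map_add, LinearMap.add_apply, hx, hy, add_cat, smul_add]
  · intro c x hx
    simp only [map_smul, LinearMap.smul_apply, hx, smul_cat]; rw [smul_comm]
  · rintro v rfl
    rw [leftDerL_single, leftDer_toWord, hx, zero_smul, sub_zero, letter_single]

/-- The quadratic part `a ⊗ b ↦ (-1)^{|a|} s⁻¹a ⊗ s⁻¹b` of the cobar differential. -/
def cobarQuad : (List α × List α →₀ R) →ₗ[R] (List (NE α) →₀ R) :=
  lin fun p => sgn R (wdeg d p.1) • toWord (single p.1 1) ⋄ toWord (single p.2 1)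

theorem cobarQuad_single (p q : List α) : cobarQuad d (single (p, q) (1 : R)) =
    sgn R (wdeg d p) • toWord (single p 1) ⋄ toWord (single q 1) := lin_single _ _

/-- Multiplying one factor of a reduced coproduct by `v` is the action of `leftDer d v`, except
where that factor is the unit: then `v` becomes a letter of its own. The two exceptional terms are
the source of the commutator with `s⁻¹v` in `cobarDiff_leftDer`. -/
theorem cobarQuad_ins (v : α) (X : List α × List α →₀ R) :
    cobarQuad d (ins d v X) = leftDer d v (cobarQuad d X) +
      sgn R (d v) • single [nletter v] 1 ⋄ toWord (lin (fun p : List α × List α =>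
        (single p.1 (1 : R)) [] • single p.2 (1 : R)) X) +
      gr (wdeg (sdeg d)) (d v - 1) (toWord (lin (fun p : List α × List α =>
        (single p.2 (1 : R)) [] • single p.1 (1 : R)) X)) ⋄ (sgn R (d v - 1) • single [nletter v] 1) := by
  set ε₁ := lin (R := R) (fun p : List α × List α => (single p.1 (1 : R)) [] • single p.2 (1 : R))
    with h1
  set ε₂ := lin (R := R) (fun p : List α × List α => (single p.2 (1 : R)) [] • single p.1 (1 : R))
    with h2
  refine eq_of_single (cobarQuad d ∘ₗ ins d v) (leftDer d v ∘ₗ cobarQuad d +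
    sgn R (d v) • catL (single [nletter v] (1 : R)) ∘ₗ toWord ∘ₗ ε₁ +
    catR (sgn R (d v - 1) • single [nletter v] (1 : R)) ∘ₗ gr (wdeg (sdeg d)) (d v - 1) ∘ₗ toWord ∘ₗ ε₂)
    (fun p => ?_) X
  obtain ⟨p, q⟩ := p
  simp only [LinearMap.comp_apply, LinearMap.add_apply, LinearMap.smul_apply, catL_apply,
    catR_apply, ins_single, map_add, map_smul, cobarQuad_single, h1, h2, lin_single]
  rcases eq_or_ne p [] with rfl | hp
  · rcases eq_or_ne q [] with rfl | hq
    · simp [toWord_nil, zero_cat, cat_zero, toWord_nletter]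
    · rw [toWord_single ⟨q, hq⟩]
      simp [toWord_nil, zero_cat, toWord_nletter, Finsupp.single_eq_of_ne' hq, toWord_single ⟨q, hq⟩,
        wdeg_cons, wdeg_nil, sgn_zero]
  · rcases eq_or_ne q [] with rfl | hq
    · rw [toWord_single ⟨p, hp⟩]
      simp only [toWord_nil, cat_zero, toWord_nletter, Finsupp.single_eq_of_ne' hp, smul_zero,
        map_zero, zero_add, zero_smul, Finsupp.single_eq_same, one_smul, toWord_single ⟨p, hp⟩,
        gr_single, wdeg_cons, wdeg_nil, sdeg, smul_cat, cat_smul, add_zero, smul_smul, ← sgn_add]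
      congr 1
      simp only [mul_sub, sub_mul, sgn_sub, sgn_add, sgn_one, mul_one, one_mul]
      grind [sgn_mul_self]
    · rw [toWord_single ⟨p, hp⟩, toWord_single ⟨q, hq⟩, toWord_ncons v ⟨p, hp⟩,
        toWord_ncons v ⟨q, hq⟩, Finsupp.single_eq_of_ne' hp, Finsupp.single_eq_of_ne' hq]
      simp only [zero_smul, map_zero, cat_zero, zero_cat, smul_zero, add_zero, leftDer_letter_cat,
        leftDer_letter, wdeg_cons, sdeg, cat_smul, smul_add, smul_smul, zero_cat]
      match_scalars
      · simp [sgn_add, mul_comm]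
      · simp only [mul_sub, sgn_sub, mul_one]
        have := @sgn_mul_self R _
        grind
      · simp

end CobarLetters

end

end DoubleCobar

namespace DoubleCobar

open Finsupp (single)

noncomputable section

/-! ### The cobar differential and its commutators with the derivations given by letters -/

section CobarDiff

variable {R : Type v} [CommRing R] {α : Type*} (d : α → ℤ) (δ : α → (α →₀ R))

/-- The differential of the cobar construction of the tensor algebra on a generator. -/
def cobarLetter (b : NE α) : List (NE α) →₀ R :=
  -toWord (letterD d δ (single b.1 1)) + cobarQuad d (shuffleCoproduct d (single b.1 1))

/-- The differential of the cobar construction of the tensor algebra. -/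
def cobarDiff : (List (NE α) →₀ R) →ₗ[R] (List (NE α) →₀ R) :=
  der (sdeg d) (-1) (cobarLetter d δ)

theorem isDer_cobarDiff : IsDer (sdeg d) (-1) (cobarDiff d δ) := isDer_der _ _ _

theorem cobarDiff_letter (b : NE α) :
    cobarDiff d δ (single [b] 1) = cobarLetter d δ b := der_letter _ _ _ _

theorem cobarDiff_one : cobarDiff d δ (single [] 1) = 0 := der_nil _ _ _

variable {d δ}

theorem letterD_apply_nil (x : List α →₀ R) : letterD d δ x [] = 0 := by
  have hcat : ∀ u w : List α →₀ R, (u ⋄ w) [] = u [] * w [] := by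
    intro u w
    induction u using linear_induction with
    | zero => simp [zero_cat]
    | add x y hx hy => simp [add_cat, hx, hy, add_mul]
    | smul c x hx => simp [smul_cat, hx, mul_assoc]
    | single p =>
      refine eq_of_single (Finsupp.lapply [] ∘ₗ catL (single p (1 : R)))
        (single p (1 : R) [] • Finsupp.lapply []) (fun q => ?_) w
      simp only [LinearMap.comp_apply, catL_apply, single_cat, LinearMap.smul_apply,
        Finsupp.lapply_apply, smul_eq_mul]
      classical
      by_cases hp : p = [] <;> by_cases hq : q = [] <;> simp [Finsupp.single_apply, hp, hq]
  have hl : ∀ p : α →₀ R, letter p [] = 0 := fun p =>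
    eq_of_single (Finsupp.lapply [] ∘ₗ letter) 0 (fun a => by simp [letter_single]) p
  induction x using cat_induction with
  | zero => simp
  | add x y hx hy => simp [hx, hy]
  | smul c x h => simp [h]
  | one => rw [letterD, der_nil]; rfl
  | letter a w ih => rw [letterD_letter_cat]; simp [hcat, hl, ih]

theorem cobarLetter_mem_homog (hδ : ∀ a, δ a ∈ homog d (d a - 1)) (b : NE α) :
    cobarLetter d δ b ∈ homog (wdeg (sdeg d)) (sdeg d b + -1) := by
  have hQ : HasDegree (pdeg (wdeg d)) (wdeg (sdeg d)) (-2) (cobarQuad (R := R) d) := by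
    rw [hasDegree_iff]
    rintro ⟨p, q⟩
    rw [cobarQuad_single]
    refine Submodule.smul_mem _ _ (cat_mem_homog (hasDegree_iff.1 (hasDegree_toWord d) p)
      (hasDegree_iff.1 (hasDegree_toWord d) q) ?_)
    simp only [pdeg]; ring
  have hb : (single b.1 1 : List α →₀ R) ∈ homog (wdeg d) (wdeg d b.1) := single_mem_homog rfl
  refine add_mem (neg_mem ((hasDegree_toWord d).mem ((hasDegree_letterD hδ).mem hb rfl) ?_))
    (hQ.mem ((hasDegree_shuffle d).mem hb rfl) ?_) <;>
  · simp only [sdeg]; ring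

theorem hasDegree_cobarDiff (hδ : ∀ a, δ a ∈ homog d (d a - 1)) :
    HasDegree (wdeg (sdeg d)) (wdeg (sdeg d)) (-1) (cobarDiff d δ) :=
  hasDegree_der (cobarLetter_mem_homog hδ)

theorem cobarLetter_nletter (v : α) :
    cobarLetter d δ (nletter v) = -toWord (letter (δ v)) := by
  have : cobarQuad d (shuffleCoproduct d (single [v] (1 : R))) = 0 := by
    rw [shuffle_letter, map_add, cobarQuad_single, cobarQuad_single, toWord_nil]
    simp [cat_zero, zero_cat]
  rw [cobarLetter, nletter, this, letterD_letter, add_zero]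

/-- A recursion for the differential of the letters: besides the action of `v` on the differential
of the shorter letter there are the internal differential of `v` and the commutator with `s⁻¹v`
supplied by `cobarQuad_ins`. -/
theorem cobarLetter_ncons (hδ : ∀ a, δ a ∈ homog d (d a - 1)) (v : α) (b : NE α) :
    cobarLetter d δ (ncons v b) = leftDer d v (cobarLetter d δ b) +
      sgn R (d v) • (leftDerL d (δ v) (single [b] 1) + single [nletter v] 1 ⋄ single [b] 1 -
        gr (wdeg (sdeg d)) (d v - 1) (single [b] 1) ⋄ single [nletter v] 1) := by
  have hb : (single b.1 (1 : R)) [] = 0 := Finsupp.single_eq_of_ne' b.2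
  rw [cobarLetter, cobarLetter, ncons, single_cons, letterD_letter_cat, shuffle_cat_letter,
    cobarQuad_ins, shuffle_counit_left, shuffle_counit_right, toWord_single]
  simp only [map_add, map_neg, leftDer_toWord, letterD_apply_nil]
  rw [← toWord_single b, leftDerL_toWord d (hδ v) _ hb]
  simp only [map_add, map_smul, zero_smul, sub_zero, smul_add, smul_sub, cat_smul,
    smul_smul, ← sgn_add]
  have h1 : sgn R (d v + (d v - 1)) = -1 := by
    rw [sgn_add, sgn_sub, sgn_mul_cancel, sgn_one]
  have h2 : sgn R (d v - 1) = -sgn R (d v) := by rw [sgn_sub, sgn_one, mul_neg_one]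
  rw [h1, h2]
  module

/-- The commutator of the cobar differential with the derivation `leftDer d v`. -/
theorem cobarDiff_leftDer (hδ : ∀ a, δ a ∈ homog d (d a - 1)) (v : α) (x : List (NE α) →₀ R) :
    cobarDiff d δ (leftDer d v x) =
      sgn R (d v) • leftDer d v (cobarDiff d δ x) + leftDerL d (δ v) x +
        single [nletter v] 1 ⋄ x -
          gr (wdeg (sdeg d)) (d v - 1) x ⋄ single [nletter v] 1 := by
  -- The commutator and its proposed value are derivations of the same degree modulo two, so they
  -- are compared on letters, where the claim is `cobarLetter_ncons`.
  have h1 := (isDer_cobarDiff d δ).comm (isDer_leftDer d v) (hasDegree_cobarDiff hδ)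
    (hasDegree_leftDer d v)
  have h2 := (isDer_leftDerL d (hδ v)).add (isDer_ad (sdeg d) (d v - 1) (single [nletter v] (1 : R)))
  have := LinearMap.congr_fun ((h1.congr (l := d v - 1) (by rw [neg_add_eq_sub])).ext h2
    fun b => ?_) x
  · simp only [LinearMap.sub_apply, LinearMap.comp_apply, LinearMap.smul_apply,
      LinearMap.add_apply, catL_apply, catR_apply, neg_one_mul, sgn_neg, sub_eq_iff_eq_add] at this
    rw [this]; abel
  · simp only [LinearMap.sub_apply, LinearMap.comp_apply, LinearMap.smul_apply,
      LinearMap.add_apply, catL_apply, catR_apply, neg_one_mul, sgn_neg, leftDer_letter, map_smul,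
      cobarDiff_letter, cobarLetter_ncons hδ, smul_add, smul_sub, sgn_smul_smul]
    abel

theorem cobarDiff_leftDerL (hδ : ∀ a, δ a ∈ homog d (d a - 1)) {k : ℤ} {p : α →₀ R}
    (hp : p ∈ homog d k) (x : List (NE α) →₀ R) :
    cobarDiff d δ (leftDerL d p x) =
      sgn R k • leftDerL d p (cobarDiff d δ x) + leftDerL d (lin δ p) x +
        toWord (letter p) ⋄ x - gr (wdeg (sdeg d)) (k - 1) x ⋄ toWord (letter p) := by
  refine homog_induction (p := fun p => cobarDiff d δ (leftDerL d p x) =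
      sgn R k • leftDerL d p (cobarDiff d δ x) + leftDerL d (lin δ p) x +
        toWord (letter p) ⋄ x - gr (wdeg (sdeg d)) (k - 1) x ⋄ toWord (letter p)) hp ?_ ?_ ?_ ?_
  · simp [zero_cat, cat_zero]
  · intro p q hp hq
    simp only [map_add, LinearMap.add_apply, hp, hq, smul_add, add_cat, cat_add]; abel
  · intro c p hp
    simp only [map_smul, LinearMap.smul_apply, hp, smul_add, smul_sub, smul_cat, cat_smul]
    rw [smul_comm c]
  · rintro v rfl
    rw [leftDerL_single, cobarDiff_leftDer hδ, lin_single, letter_single, toWord_nletter]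

theorem cobarDiff_toWord_letter (p : α →₀ R) :
    cobarDiff d δ (toWord (letter p)) = -toWord (letter (lin δ p)) := by
  refine eq_of_single (cobarDiff d δ ∘ₗ toWord ∘ₗ letter) (-(toWord ∘ₗ letter ∘ₗ lin δ))
    (fun v => ?_) p
  simp only [LinearMap.comp_apply, LinearMap.neg_apply, letter_single, toWord_nletter,
    cobarDiff_letter, cobarLetter_nletter, lin_single]

theorem cobarDiff_nletter (v : α) :
    cobarDiff d δ (single [nletter v] 1) = -toWord (letter (δ v)) := by
  rw [cobarDiff_letter, cobarLetter_nletter]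

/-- The square of an odd derivation is a derivation, so letters suffice, and these are reached
through `leftDer`. Moving the differential past `leftDer d v` twice leaves terms that cancel in
pairs, a term with `δ²`, and the action of `v` on the square for the shorter letter. -/
theorem cobarDiff_cobarDiff (hδ : ∀ a, δ a ∈ homog d (d a - 1)) (hδ' : ∀ a, lin δ (δ a) = 0)
    (x : List (NE α) →₀ R) : cobarDiff d δ (cobarDiff d δ x) = 0 := by
  have hD := isDer_cobarDiff d δ
  have hdeg := hasDegree_cobarDiff hδ
  refine LinearMap.congr_fun (f := cobarDiff d δ ∘ₗ cobarDiff d δ) (g := 0)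
    ((hD.sq hdeg).ext (isDer_zero _ _) fun b => ?_) x
  change cobarDiff d δ (cobarDiff d δ (single [b] 1)) = 0
  induction b using ne_induction with
  | letter v =>
    rw [cobarDiff_letter, cobarLetter_nletter, map_neg, cobarDiff_toWord_letter, hδ', map_zero,
      map_zero, neg_zero, neg_zero]
  | cons v b ih =>
    have h := leftDer_letter (R := R) d v b
    have : single [ncons v b] (1 : R) = sgn R (d v) • leftDer d v (single [b] 1) := by
      rw [h, sgn_smul_smul]
    rw [this, map_smul, map_smul, cobarDiff_leftDer hδ]
    simp only [map_add, map_sub, map_smul, cobarDiff_leftDer hδ, cobarDiff_leftDerL hδ (hδ v), hδ',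
      hD _ _, hdeg.gr_map, ih, cobarDiff_nletter, map_zero, smul_zero, LinearMap.zero_apply,
      gr_gr, gr_single, smul_cat, cat_smul, wdeg_cons, wdeg_nil, sdeg_nletter, add_zero, zero_add, smul_add, smul_sub, neg_cat, cat_neg]
    clear hδ hδ'
    -- Comparing coefficients leaves identities between products of signs, which follow from `sgn R
    -- a * sgn R a = 1`. The same pattern closes most sign computations below.
    match_scalars <;> simp only [mul_sub, sub_mul, mul_add, add_mul, sgn_sub, sgn_add, sgn_neg,
      sgn_one, mul_one, one_mul, neg_mul, mul_neg] <;> have := @sgn_mul_self R _ <;> grind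

end CobarDiff

end

end DoubleCobar

namespace DoubleCobar

open Finsupp (single)

noncomputable section

/-! ### The diagonal action of words and of their antipodes -/

section Action

variable {R : Type v} [CommRing R] {α : Type*} (d : α → ℤ)

/-- The action of a word on the cobar construction, by composing the derivations `leftDer`. -/
def act (w : List α) : (List (NE α) →₀ R) →ₗ[R] (List (NE α) →₀ R) :=
  match w with
  | [] => LinearMap.id
  | v :: w => leftDer d v ∘ₗ act w

/-- The action of the antipode of a word on the cobar construction. -/
def actS (w : List α) : (List (NE α) →₀ R) →ₗ[R] (List (NE α) →₀ R) :=
  match w with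
  | [] => LinearMap.id
  | v :: w => -(sgn R (d v * wdeg d w) • actS w ∘ₗ leftDer d v)

theorem act_cons (v : α) (w : List α) (x : List (NE α) →₀ R) :
    act d (v :: w) x = leftDer d v (act d w x) := rfl

theorem actS_cons (v : α) (w : List α) (x : List (NE α) →₀ R) :
    actS d (v :: w) x = -(sgn R (d v * wdeg d w) • actS d w (leftDer d v x)) := rfl

theorem hasDegree_act (w : List α) :
    HasDegree (wdeg (sdeg d)) (wdeg (sdeg d)) (wdeg d w) (act (R := R) d w) := by
  induction w with
  | nil =>
    rw [hasDegree_iff]; intro x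
    exact single_mem_homog (by rw [wdeg_nil, add_zero])
  | cons v w ih =>
    rw [hasDegree_iff] at *
    intro x
    exact (hasDegree_leftDer d v).mem (ih x) (by rw [wdeg_cons]; ring)

theorem hasDegree_actS (w : List α) :
    HasDegree (wdeg (sdeg d)) (wdeg (sdeg d)) (wdeg d w) (actS (R := R) d w) := by
  induction w with
  | nil =>
    rw [hasDegree_iff]; intro x
    exact single_mem_homog (by rw [wdeg_nil, add_zero])
  | cons v w ih =>
    rw [hasDegree_iff]
    intro x
    rw [actS_cons]
    refine neg_mem (Submodule.smul_mem _ _ (ih.mem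
      (hasDegree_iff.1 (hasDegree_leftDer d v) x) ?_))
    rw [wdeg_cons]; ring

theorem act_one (w : List α) :
    act d w (single [] (1 : R)) = (single w (1 : R)) [] • single [] 1 := by
  rcases w with _ | ⟨v, w⟩
  · simp [act]
  · have h : ∀ w : List α, ∃ c : R, act d w (single [] (1 : R)) = c • single [] 1 := by
      intro w
      induction w with
      | nil => exact ⟨1, (one_smul _ _).symm⟩
      | cons v w ih =>
        obtain ⟨c, hc⟩ := ih
        exact ⟨0, by rw [act_cons, hc, map_smul, leftDer_one, smul_zero, zero_smul]⟩
    obtain ⟨c, hc⟩ := h w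
    rw [act_cons, hc, map_smul, leftDer_one, smul_zero, Finsupp.single_eq_of_ne' (by simp), zero_smul]

theorem actS_one (w : List α) :
    actS d w (single [] (1 : R)) = (single w (1 : R)) [] • single [] 1 := by
  rcases w with _ | ⟨v, w⟩
  · simp [actS]
  · rw [actS_cons, leftDer_one, map_zero, smul_zero, neg_zero,
      Finsupp.single_eq_of_ne' (by simp), zero_smul]

/-- The tensor algebra, with a differential `D`. -/
def tensorAlgebra {α : Type u} (d : α → ℤ) (D : (List α →₀ R) →ₗ[R] (List α →₀ R)) :
    DGMod.{u} R where
  B := List α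
  deg := wdeg d
  one := []
  d := D

variable {α : Type u} (d : α → ℤ) (D : (List α →₀ R) →ₗ[R] (List α →₀ R))

/-- The diagonal operation for the shuffle coproduct. -/
def diag (φ : (List α →₀ R) →ₗ[R] (List α →₀ R)) (w : List (NE α)) :
    (List α →₀ R) →ₗ[R] (List (NE α) →₀ R) :=
  match w with
  | [] => lin fun a => (single a (1 : R)) [] • single [] 1
  | b :: w => lin (fun p : List α × List α => sgn R (wdeg d p.1 + wdeg d p.2 * sdeg d b) •
      toWord (φ (single p.1 1) ⋄ single b.1 1) ⋄ diag φ w (single p.2 1)) ∘ₗ shuffleCoproduct d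

theorem diagAct_eq (φ : (List α →₀ R) →ₗ[R] (List α →₀ R)) (w : List (NE α)) :
    (tensorAlgebra d D).diagAct concat (shuffleCoproduct d) φ w = diag d φ w := by
  induction w with
  | nil => rfl
  | cons b w ih =>
    refine Eq.trans ?_ (congrArg (fun G : (List α →₀ R) →ₗ[R] (List (NE α) →₀ R) =>
      lin (fun p : List α × List α => sgn R (wdeg d p.1 + wdeg d p.2 * sdeg d b) •
      toWord (φ (single p.1 1) ⋄ single b.1 1) ⋄ G (single p.2 1)) ∘ₗ shuffleCoproduct d) ih)
    rfl

theorem diag_nil (φ : (List α →₀ R) →ₗ[R] (List α →₀ R)) (a : List α) :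
    diag d φ [] (single a 1) = (single a (1 : R)) [] • single [] 1 := lin_single _ _

theorem diag_cons (φ : (List α →₀ R) →ₗ[R] (List α →₀ R)) (b : NE α) (w : List (NE α))
    (x : List α →₀ R) : diag d φ (b :: w) x =
      lin (fun p : List α × List α => sgn R (wdeg d p.1 + wdeg d p.2 * sdeg d b) •
        toWord (φ (single p.1 1) ⋄ single b.1 1) ⋄ diag d φ w (single p.2 1))
        (shuffleCoproduct d x) := rfl

theorem cat_apply_nil (u w : List α →₀ R) : (u ⋄ w) [] = u [] * w [] := by
  induction u using linear_induction with
  | zero => simp [zero_cat]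
  | add x y hx hy => simp [add_cat, hx, hy, add_mul]
  | smul c x hx => simp [smul_cat, hx, mul_assoc]
  | single p =>
    refine eq_of_single (Finsupp.lapply [] ∘ₗ catL (single p (1 : R)))
      (single p (1 : R) [] • Finsupp.lapply []) (fun q => ?_) w
    simp only [LinearMap.comp_apply, catL_apply, single_cat, LinearMap.smul_apply,
      Finsupp.lapply_apply, smul_eq_mul]
    classical
    by_cases hp : p = [] <;> by_cases hq : q = [] <;> simp [Finsupp.single_apply, hp, hq]

/-- The diagonal operation, on linear combinations of words. -/
def diagL (φ : (List α →₀ R) →ₗ[R] (List α →₀ R)) : (List (NE α) →₀ R) →ₗ[R] (List α →₀ R) →ₗ[R] (List (NE α) →₀ R) :=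
  lin (M := (List α →₀ R) →ₗ[R] (List (NE α) →₀ R)) (diag d φ)

theorem diagL_single (φ : (List α →₀ R) →ₗ[R] (List α →₀ R)) (w : List (NE α)) :
    diagL d φ (single w (1 : R)) = diag d φ w := lin_single _ _

/-- The diagonal operation on words with first letter `b`, as a function of the
coproduct. -/
def diagPair (φ : (List α →₀ R) →ₗ[R] (List α →₀ R)) (b : NE α) (y : List (NE α) →₀ R) :
    (List α × List α →₀ R) →ₗ[R] (List (NE α) →₀ R) :=
  lin (fun p : List α × List α => sgn R (wdeg d p.1 + wdeg d p.2 * sdeg d b) •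
    toWord (φ (single p.1 1) ⋄ single b.1 1) ⋄ diagL d φ y (single p.2 1))

theorem diagPair_single (φ : (List α →₀ R) →ₗ[R] (List α →₀ R)) (b : NE α)
    (y : List (NE α) →₀ R) (p q : List α) :
    diagPair d φ b y (single (p, q) 1) = sgn R (wdeg d p + wdeg d q * sdeg d b) •
      toWord (φ (single p 1) ⋄ single b.1 1) ⋄ diagL d φ y (single q 1) :=
  lin_single _ _

theorem diagL_letter_cat (φ : (List α →₀ R) →ₗ[R] (List α →₀ R)) (b : NE α)
    (y : List (NE α) →₀ R) (x : List α →₀ R) :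
    diagL d φ (single [b] 1 ⋄ y) x = diagPair d φ b y (shuffleCoproduct d x) := by
  induction y using linear_induction with
  | zero =>
    have : diagPair (R := R) d φ b 0 = 0 := ext_single fun p => by
      rw [diagPair_single, map_zero, LinearMap.zero_apply, cat_zero, smul_zero]; rfl
    rw [cat_zero, map_zero, this]; rfl
  | add y z hy hz =>
    have : diagPair d φ b (y + z) = diagPair d φ b y + diagPair d φ b z := ext_single fun p => by
      rw [LinearMap.add_apply, diagPair_single, diagPair_single, diagPair_single, map_add,
        LinearMap.add_apply, cat_add, smul_add]
    rw [cat_add, map_add, LinearMap.add_apply, hy, hz, this]; rfl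
  | smul c y hy =>
    have : diagPair d φ b (c • y) = c • diagPair d φ b y := ext_single fun p => by
      rw [LinearMap.smul_apply, diagPair_single, diagPair_single, map_smul,
        LinearMap.smul_apply, cat_smul, smul_comm]
    rw [cat_smul, map_smul, LinearMap.smul_apply, hy, this]; rfl
  | single w =>
    have : diagPair d φ b (single w (1 : R)) = lin (fun p : List α × List α =>
      sgn R (wdeg d p.1 + wdeg d p.2 * sdeg d b) • toWord (φ (single p.1 1) ⋄
        single b.1 1) ⋄ diag d φ w (single p.2 1)) := ext_single fun p => by
      rw [diagPair_single, diagL_single, lin_single]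
    rw [← single_cons, diagL_single, diag_cons, this]

/-- The diagonal action is multiplicative in the acting element, and a primitive element acts by a
derivation. So a word acts by composing the derivations of its letters, and iterated coproducts need
not be mentioned again. -/
theorem diag_id (w : List (NE α)) (a : List α) :
    diag d LinearMap.id w (single a (1 : R)) = act d a (single w 1) := by
  induction w generalizing a with
  | nil => rw [diag_nil, act_one]
  | cons b w ih =>
    rw [← diagL_single, single_cons, diagL_letter_cat, ← single_cons]
    induction a with
    | nil =>
      rw [shuffle_nil, diagPair_single, diagL_single, ih]
      simp only [act, LinearMap.id_apply, one_cat, wdeg_nil, zero_mul, add_zero, sgn_zero, one_smul,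
        toWord_single, ← single_cons]
    | cons v a iha =>
      rw [act_cons, ← iha, shuffle_cons]
      -- Prepending `v` to the acting word multiplies its coproduct by that of `v`, so the claim
      -- becomes a statement about `ins d v` alone.
      suffices h : diagPair (R := R) d LinearMap.id b (single w (1 : R)) ∘ₗ ins d v =
          leftDer d v ∘ₗ diagPair (R := R) d LinearMap.id b (single w (1 : R)) by
        have := LinearMap.congr_fun h (shuffleCoproduct d (single a (1 : R)))
        simpa only [LinearMap.comp_apply] using this
      refine ext_single fun p => ?_
      obtain ⟨p, q⟩ := p
      simp only [LinearMap.comp_apply, ins_single, map_add, map_smul, diagPair_single,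
        diagL_single, ih, isDer_leftDer d v _ _, leftDer_toWord, (hasDegree_toWord d).gr_map,
        gr_cat, gr_single, cat_apply_nil, Finsupp.single_eq_of_ne' b.2, act_cons, mul_zero,
        zero_smul, sub_zero, LinearMap.id_apply]
      rw [single_cons v p, cat_assoc]
      simp only [smul_cat, cat_smul, map_smul, wdeg_cons, smul_add]
      have := @sgn_mul_self R _
      match_scalars <;> simp only [mul_sub, sub_mul, mul_add, add_mul, sgn_sub, sgn_add, sgn_neg,
        sgn_one, mul_one, one_mul, neg_mul, mul_neg, sdeg] <;> grind

/-- Since the antipode reverses products, the first letter of the acting word acts first, with a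
minus sign from `S(v) = -v`. This is the recursion defining `actS`. -/
theorem diagL_letter_mul (v : α) (y : List (NE α) →₀ R) (x : List α →₀ R) :
    diagL d (antipode d) y (single [v] 1 ⋄ x) = -diagL d (antipode d) (leftDer d v y) (gr (wdeg d) (d v) x) := by
  induction y using cat_induction generalizing x with
  | zero => simp
  | add y z hy hz => simp only [map_add, LinearMap.add_apply, hy, hz, neg_add]
  | smul c y hy => simp only [map_smul, LinearMap.smul_apply, hy, smul_neg]
  | one =>
    rw [leftDer_one, map_zero, LinearMap.zero_apply, neg_zero, diagL_single]
    refine eq_of_single (diag d (antipode d) [] ∘ₗ catL (single [v] (1 : R))) 0 (fun a => ?_) x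
    simp only [LinearMap.comp_apply, catL_apply, single_cat, diag_nil]
    simp
  | letter b w ih =>
    have hgr := (hasDegree_shuffle (R := R) d).gr_map (d v) x
    rw [mul_zero, sgn_zero, one_smul] at hgr
    rw [diagL_letter_cat, shuffle_cat_letter, leftDer_letter_cat, map_add, map_smul, map_smul,
      LinearMap.add_apply, LinearMap.smul_apply, LinearMap.smul_apply, diagL_letter_cat,
      diagL_letter_cat, ← hgr]
    suffices h : diagPair (R := R) d (antipode d) b (single w (1 : R)) ∘ₗ ins d v =
      -(sgn R (d v) • diagPair (R := R) d (antipode d) (ncons v b) (single w (1 : R)) ∘ₗ gr (pdeg (wdeg d)) (d v) +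
        sgn R (d v * sdeg d b) •
          diagPair (R := R) d (antipode d) b (leftDer d v (single w (1 : R))) ∘ₗ gr (pdeg (wdeg d)) (d v)) by
      have := LinearMap.congr_fun h (shuffleCoproduct d x)
      simpa only [LinearMap.comp_apply, LinearMap.neg_apply, LinearMap.add_apply,
        LinearMap.smul_apply] using this
    refine ext_single fun p => ?_
    obtain ⟨p, q⟩ := p
    simp only [LinearMap.comp_apply, LinearMap.neg_apply, LinearMap.add_apply,
      LinearMap.smul_apply, ins_single, map_add, map_smul, gr_single, diagPair_single]
    rw [single_cons v q, ih, single_cons v p, antipode_letter_cat, ncons, single_cons v b.1]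
    simp only [gr_single, map_smul, neg_cat, cat_neg, smul_cat, cat_smul, map_neg, cat_assoc,
      wdeg_cons, pdeg]
    have := @sgn_mul_self R _
    match_scalars <;> simp only [mul_sub, sub_mul, mul_add, add_mul, sgn_sub, sgn_add, sgn_neg,
      sgn_one, mul_one, one_mul, neg_mul, mul_neg, sdeg, wdeg_cons] <;> grind

theorem diagL_eq (a : List α) (y : List (NE α) →₀ R) : diagL d (antipode d) y (single a 1) = actS d a y := by
  induction a generalizing y with
  | nil =>
    refine eq_of_single ((diagL (R := R) d (antipode d)).flip (single [] (1 : R))) LinearMap.id (fun w => ?_) y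
    rw [LinearMap.flip_apply, LinearMap.id_apply]
    induction w with
    | nil => rw [diagL_single, diag_nil]; simp
    | cons b w ih =>
      rw [single_cons, diagL_letter_cat, shuffle_nil, diagPair_single, ih, antipode_nil, one_cat,
        toWord_single]
      simp [wdeg_nil, sgn_zero]
  | cons v a ih =>
    rw [single_cons, diagL_letter_mul, gr_single, map_smul, ih, actS_cons]

theorem diag_antipode (w : List (NE α)) (a : List α) :
    diag d (antipode d) w (single a (1 : R)) = actS d a (single w 1) := by
  rw [← diagL_single, diagL_eq]

end Action

end

end DoubleCobar

namespace DoubleCobar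

open Finsupp (single)

noncomputable section

/-! ### The deconcatenation coproduct -/

section Deconcat

variable {R : Type v} [CommRing R] {γ : Type*}

theorem deconcat_nil : deconcat (single ([] : List γ) (1 : R)) = single ([], []) 1 := by
  simp [deconcat]

/-- Left multiplication on the first factor of a tensor product. -/
def lcat (β : Type*) : (List γ →₀ R) →ₗ[R] (List γ × β →₀ R) →ₗ[R] (List γ × β →₀ R) :=
  lin (M := (List γ × β →₀ R) →ₗ[R] (List γ × β →₀ R)) fun u =>
    tmap (catL (single u 1)) LinearMap.id

theorem lcat_tmul {β : Type*} (x u : List γ →₀ R) (w : β →₀ R) :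
    lcat β x (tmul u w) = tmul (x ⋄ u) w := by
  refine eq_of_single ((lcat β).flip (tmul u w)) (tmulL.flip w ∘ₗ catR u) (fun a => ?_) x
  rw [LinearMap.flip_apply, lcat, lin_single, tmap_tmul]
  rfl

theorem lcat_single {β : Type*} (x : List γ →₀ R) (u : List γ) (w : β) :
    lcat β x (single (u, w) 1) = tmul (x ⋄ single u 1) (single w 1) := by
  rw [← tmul_single, lcat_tmul]

/-- A word is cut either before its first letter or somewhere behind it. The properties of
deconcatenation are proved along this recursion. -/
theorem deconcat_letter_cat (x : γ →₀ R) (Y : List γ →₀ R) :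
    deconcat (letter x ⋄ Y) = tmul (single [] 1) (letter x ⋄ Y) +
      lcat _ (letter x) (deconcat Y) := by
  induction x using linear_induction with
  | zero => simp [zero_cat, tmul_zero]
  | add x y hx hy => simp only [map_add, add_cat, hx, hy, tmul_add, LinearMap.add_apply]; abel
  | smul c x hx => simp only [map_smul, smul_cat, hx, tmul_smul, LinearMap.smul_apply, smul_add]
  | single a =>
    have : deconcat ∘ₗ catL (letter (single a (1 : R))) =
        tmulL (single [] 1) ∘ₗ catL (letter (single a (1 : R))) +
          lcat _ (letter (single a (1 : R))) ∘ₗ deconcat := ext_single fun w => by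
      simp only [LinearMap.comp_apply, LinearMap.add_apply, catL_apply, tmulL_apply, letter_single,
        single_cat, tmul_single, deconcat, lin_single, map_sum, lcat_single, List.singleton_append,
        List.length_cons]
      -- The summand split off is the cut at position zero.
      rw [Finset.sum_range_succ', add_comm]
      rfl
    exact LinearMap.congr_fun this Y

theorem deconcat_single_cat (a : γ) (Y : List γ →₀ R) :
    deconcat (single [a] 1 ⋄ Y) = tmul (single [] 1) (single [a] 1 ⋄ Y) +
      lcat _ (single [a] 1) (deconcat Y) := by
  have := deconcat_letter_cat (single a (1 : R)) Y
  rwa [letter_single] at this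

theorem hasDegree_deconcat (e : γ → ℤ) :
    HasDegree (wdeg e) (pdeg (wdeg e)) 0 (deconcat (R := R)) := by
  rw [hasDegree_iff]
  intro w
  rw [deconcat, lin_single]
  refine sum_mem fun i _ => single_mem_homog ?_
  rw [pdeg, ← wdeg_append, List.take_append_drop, add_zero]

theorem deconcat_counit_left (Y : List γ →₀ R) :
    lin (fun p : List γ × List γ => (single p.1 (1 : R)) [] • single p.2 1) (deconcat Y) = Y := by
  induction Y using cat_induction with
  | zero => simp
  | add x y hx hy => simp only [map_add, hx, hy]
  | smul c x h => simp only [map_smul, h]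
  | one => rw [deconcat_nil, lin_single]; simp
  | letter a w ih =>
    rw [deconcat_single_cat, map_add]
    have h1 : lin (fun p : List γ × List γ => (single p.1 (1 : R)) [] • single p.2 (1 : R)) ∘ₗ
        lcat _ (single [a] (1 : R)) = 0 := ext_single fun p => by
      rw [LinearMap.comp_apply, lcat_single, single_cat,
        tmul_single, lin_single]
      simp
    have h2 := LinearMap.congr_fun h1 (deconcat (single w 1))
    rw [LinearMap.comp_apply, LinearMap.zero_apply] at h2
    rw [h2, single_cat, tmul_single, lin_single]
    simp

theorem deconcat_counit_right (Y : List γ →₀ R) :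
    lin (fun p : List γ × List γ => (single p.2 (1 : R)) [] • single p.1 1) (deconcat Y) = Y := by
  induction Y using cat_induction with
  | zero => simp
  | add x y hx hy => simp only [map_add, hx, hy]
  | smul c x h => simp only [map_smul, h]
  | one => rw [deconcat_nil, lin_single]; simp
  | letter a w ih =>
    rw [deconcat_single_cat, map_add]
    have h1 : lin (fun p : List γ × List γ => (single p.2 (1 : R)) [] • single p.1 (1 : R)) ∘ₗ
        lcat _ (single [a] (1 : R)) = catL (single [a] (1 : R)) ∘ₗ
          lin (fun p : List γ × List γ => (single p.2 (1 : R)) [] • single p.1 (1 : R)) :=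
      ext_single fun p => by
        rw [LinearMap.comp_apply, LinearMap.comp_apply, lcat_single, single_cat,
          tmul_single, lin_single, lin_single, map_smul, catL_apply, single_cat]
    have h2 := LinearMap.congr_fun h1 (deconcat (single w 1))
    rw [LinearMap.comp_apply, LinearMap.comp_apply, ih, catL_apply] at h2
    rw [h2, single_cat, tmul_single, lin_single]
    simp

theorem deconcat_coassoc (Y : List γ →₀ R) :
    assoc (tmap deconcat LinearMap.id (deconcat Y)) =
      tmap LinearMap.id deconcat (deconcat Y) := by
  induction Y using cat_induction with
  | zero => simp
  | add x y hx hy => simp only [map_add, hx, hy]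
  | smul c x h => simp only [map_smul, h]
  | one => rw [deconcat_nil, tmap_single, tmap_single, deconcat_nil, LinearMap.id_apply,
      tmul_single, tmul_single, assoc_single]
  | letter a w ih =>
    have h3 : ∀ y : List γ →₀ R, assoc ∘ₗ tmulL.flip y ∘ₗ lcat (List γ) (single [a] (1 : R)) =
        lcat (List γ × List γ) (single [a] (1 : R)) ∘ₗ assoc ∘ₗ tmulL.flip y :=
      fun y => ext_tmul fun u w => by
        simp only [LinearMap.comp_apply, LinearMap.flip_apply, tmulL_apply, assoc_tmul, lcat_tmul]
    have h1 : assoc ∘ₗ tmap deconcat LinearMap.id ∘ₗ lcat (List γ) (single [a] (1 : R)) =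
        tmulL (single [] 1) ∘ₗ lcat (List γ) (single [a] (1 : R)) +
        lcat (List γ × List γ) (single [a] (1 : R)) ∘ₗ assoc ∘ₗ
          tmap deconcat LinearMap.id := ext_tmul fun x y => by
      have := LinearMap.congr_fun (h3 y) (deconcat x)
      simp only [LinearMap.comp_apply, LinearMap.flip_apply, tmulL_apply] at this
      simp only [LinearMap.comp_apply, LinearMap.add_apply, tmap_tmul, lcat_tmul,
        deconcat_single_cat, add_tmul, map_add, tmulL_apply, LinearMap.id_apply, this, assoc_tmul]
    have h2 : tmap LinearMap.id deconcat ∘ₗ lcat (List γ) (single [a] (1 : R)) =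
        lcat (List γ × List γ) (single [a] (1 : R)) ∘ₗ tmap LinearMap.id deconcat :=
      ext_tmul fun x y => by
        simp only [LinearMap.comp_apply, tmap_tmul, LinearMap.id_apply, lcat_tmul]
    have h1 := LinearMap.congr_fun h1 (deconcat (single w 1))
    have h2 := LinearMap.congr_fun h2 (deconcat (single w 1))
    simp only [LinearMap.comp_apply, LinearMap.add_apply, tmulL_apply] at h1 h2
    rw [deconcat_single_cat, map_add, map_add, map_add, h1, h2, ih, tmap_tmul, tmap_tmul,
      deconcat_nil, ← tmul_single, assoc_tmul, deconcat_single_cat, tmul_add, LinearMap.id_apply,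
      LinearMap.id_apply]
    abel

end Deconcat

/-! ### The bar construction of an algebra with a multiplicatively closed basis; `e` is the
suspended degree -/

section Bar

variable {R : Type v} [CommRing R] {γ : Type*} (m : γ → γ → γ) (e : γ → ℤ) (δ : γ → (γ →₀ R))

/-- The bilinear product of a semigroup algebra. -/
def mulS : (γ →₀ R) →ₗ[R] (γ →₀ R) →ₗ[R] (γ →₀ R) :=
  lin (M := (γ →₀ R) →ₗ[R] (γ →₀ R)) fun a => lin fun b => single (m a b) 1

theorem mulS_single (a b : γ) : mulS m (single a (1 : R)) (single b 1) = single (m a b) 1 := by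
  rw [mulS, lin_single, lin_single]

/-- Multiplication of the first letter of a word. -/
def merge : (γ →₀ R) →ₗ[R] (List γ →₀ R) →ₗ[R] (List γ →₀ R) :=
  lin (M := (List γ →₀ R) →ₗ[R] (List γ →₀ R)) fun a => lin fun w => match w with
    | [] => 0
    | b :: w => single (m a b :: w) 1

theorem merge_nil (x : γ →₀ R) : merge m x (single [] (1 : R)) = 0 := by
  refine eq_of_single ((merge m).flip (single [] (1 : R))) 0 (fun a => ?_) x
  rw [LinearMap.flip_apply, merge, lin_single, lin_single]; rfl

theorem merge_letter_cat (x y : γ →₀ R) (Y : List γ →₀ R) :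
    merge m x (letter y ⋄ Y) = letter (mulS m x y) ⋄ Y := by
  induction x using linear_induction with
  | zero => simp [zero_cat]
  | add x z hx hz => simp only [map_add, LinearMap.add_apply, hx, hz, add_cat]
  | smul c x h => simp only [map_smul, LinearMap.smul_apply, h, smul_cat]
  | single a =>
    induction y using linear_induction with
    | zero => simp [zero_cat]
    | add x z hx hz => simp only [map_add, hx, hz, add_cat]
    | smul c x h => simp only [map_smul, h, smul_cat]
    | single b =>
      refine eq_of_single (merge m (single a (1 : R)) ∘ₗ catL (letter (single b 1)))
        (catL (letter (mulS m (single a (1 : R)) (single b 1)))) (fun w => ?_) Y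
      rw [LinearMap.comp_apply, catL_apply, catL_apply, mulS_single, letter_single, letter_single,
        single_cat, single_cat, merge, lin_single, lin_single]
      rfl

theorem merge_single_cat (x : γ →₀ R) (b : γ) (Y : List γ →₀ R) :
    merge m x (single [b] 1 ⋄ Y) = letter (mulS m x (single b 1)) ⋄ Y := by
  rw [← letter_single, merge_letter_cat]

/-- The bar differential. -/
def barWord : List γ → (List γ →₀ R) := fun w =>
  match w with
  | [] => 0
  | a :: w => -(letter (δ a) ⋄ single w 1) + sgn R (e a) • merge m (single a 1) (single w 1) +
      sgn R (e a) • single [a] 1 ⋄ barWord w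

/-- The bar differential. -/
def barDiff : (List γ →₀ R) →ₗ[R] (List γ →₀ R) := lin (barWord m e δ)

theorem barDiff_nil : barDiff m e δ (single [] 1) = 0 := lin_single _ _

theorem barDiff_letter_cat (x : γ →₀ R) (Y : List γ →₀ R) :
    barDiff m e δ (letter x ⋄ Y) = -(letter (lin δ x) ⋄ Y) + merge m (gr e 1 x) Y +
      letter (gr e 1 x) ⋄ barDiff m e δ Y := by
  induction x using linear_induction with
  | zero => simp [zero_cat]
  | add x z hx hz => simp only [map_add, LinearMap.add_apply, hx, hz, add_cat, neg_add]; abel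
  | smul c x h => simp only [map_smul, LinearMap.smul_apply, h, smul_cat, smul_add, smul_neg]
  | single a =>
    have : barDiff m e δ ∘ₗ catL (letter (single a (1 : R))) =
        -catL (letter (lin δ (single a (1 : R)))) + merge m (gr e 1 (single a (1 : R))) +
          catL (letter (gr e 1 (single a (1 : R)))) ∘ₗ barDiff m e δ := ext_single fun w => by
      simp only [LinearMap.comp_apply, LinearMap.add_apply, LinearMap.neg_apply, catL_apply,
        letter_single, gr_single, map_smul, LinearMap.smul_apply, smul_cat, one_mul, lin_single,
        single_cat, barDiff]
      rfl
    exact LinearMap.congr_fun this Y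

theorem barDiff_single_cat (a : γ) (Y : List γ →₀ R) :
    barDiff m e δ (single [a] 1 ⋄ Y) = -(letter (δ a) ⋄ Y) +
      sgn R (e a) • merge m (single a 1) Y + sgn R (e a) • single [a] 1 ⋄ barDiff m e δ Y := by
  have := barDiff_letter_cat m e δ (single a 1) Y
  rwa [letter_single, lin_single, gr_single, one_mul, map_smul, map_smul, LinearMap.smul_apply,
    letter_single, smul_cat] at this

variable {m e δ}

theorem merge_merge (hassoc : ∀ a b c, m (m a b) c = m a (m b c)) (a b : γ) (Y : List γ →₀ R) :
    merge m (single a 1) (merge m (single b 1) Y) = merge m (single (m a b) 1) Y := by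
  induction Y using cat_induction with
  | zero => simp
  | add x y hx hy => simp only [map_add, hx, hy]
  | smul c x h => simp only [map_smul, h]
  | one => simp only [merge_nil, map_zero]
  | letter c w ih =>
    rw [merge_single_cat, merge_letter_cat, merge_single_cat, mulS_single, mulS_single, mulS_single,
      hassoc]

theorem merge_mem_homog (hm : ∀ a b, e (m a b) = e a + e b - 1) (a : γ) {k : ℤ} {Y : List γ →₀ R}
    (hY : Y ∈ homog (wdeg e) k) {n : ℤ} (hn : n = e a + k - 1) :
    merge m (single a 1) Y ∈ homog (wdeg e) n := by
  have : HasDegree (wdeg e) (wdeg e) (e a - 1) (merge m (single a (1 : R))) := by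
    rw [hasDegree_iff]
    intro w
    rcases w with _ | ⟨b, w⟩
    · rw [merge_nil]; exact zero_mem _
    · rw [single_cons, merge_single_cat, mulS_single, letter_single, ← single_cons]
      exact single_mem_homog (by rw [wdeg_cons, wdeg_cons, hm]; ring)
  exact this.mem hY (by rw [hn]; ring)

theorem hasDegree_barDiff (hm : ∀ a b, e (m a b) = e a + e b - 1)
    (hδ : ∀ a, δ a ∈ homog e (e a - 1)) :
    HasDegree (wdeg e) (wdeg e) (-1) (barDiff m e δ) := by
  rw [hasDegree_iff]
  intro w
  induction w with
  | nil => rw [barDiff_nil]; exact zero_mem _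
  | cons a w ih =>
    have hw : (single w 1 : List γ →₀ R) ∈ homog (wdeg e) (wdeg e w) := single_mem_homog rfl
    rw [single_cons, barDiff_single_cat]
    refine add_mem (add_mem (neg_mem (cat_mem_homog (letter_mem_homog (hδ a)) hw ?_))
      (Submodule.smul_mem _ _ (merge_mem_homog hm a hw ?_)))
      (Submodule.smul_mem _ _ (cat_mem_homog (single_mem_homog (k := e a) ?_) ih ?_)) <;>
    simp only [wdeg_cons, wdeg_nil] <;> ring

/-- Associativity cancels the two ways of merging three letters, and the Leibniz rule disposes of
the internal differential. With this, the vanishing of the square of the bar differential needs one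
induction over words. -/
theorem barDiff_merge (hm : ∀ a b, e (m a b) = e a + e b - 1)
    (hassoc : ∀ a b c, m (m a b) c = m a (m b c))
    (hleib : ∀ a b, δ (m a b) =
      mulS m (δ a) (single b 1) - sgn R (e a) • mulS m (single a 1) (δ b))
    (a : γ) (Y : List γ →₀ R) :
    barDiff m e δ (merge m (single a 1) Y) = -(merge m (δ a) Y) -
      sgn R (e a) • merge m (single a 1) (barDiff m e δ Y) := by
  induction Y using cat_induction with
  | zero => simp
  | add x y hx hy => simp only [map_add, hx, hy, smul_add]; abel
  | smul c x h => simp only [map_smul, h, smul_sub, smul_neg]; rw [smul_comm c]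
  | one => simp only [merge_nil, map_zero, barDiff_nil, smul_zero, neg_zero, sub_zero]
  | letter b w ih =>
    rw [merge_single_cat, mulS_single, letter_single, barDiff_single_cat, barDiff_single_cat,
      merge_single_cat, hleib]
    simp only [map_add, map_neg, map_smul, map_sub, merge_letter_cat, merge_single_cat,
      merge_merge hassoc, mulS_single, letter_single, hm, sub_cat, smul_cat]
    have := @sgn_mul_self R _
    match_scalars <;> (try simp only [sgn_add, sgn_sub, sgn_one]) <;> grind

theorem barDiff_barDiff (hm : ∀ a b, e (m a b) = e a + e b - 1)
    (hδ : ∀ a, δ a ∈ homog e (e a - 1)) (hassoc : ∀ a b c, m (m a b) c = m a (m b c))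
    (hδ' : ∀ a, lin δ (δ a) = 0)
    (hleib : ∀ a b, δ (m a b) =
      mulS m (δ a) (single b 1) - sgn R (e a) • mulS m (single a 1) (δ b))
    (Y : List γ →₀ R) : barDiff m e δ (barDiff m e δ Y) = 0 := by
  induction Y using cat_induction with
  | zero => simp
  | add x y hx hy => simp only [map_add, hx, hy, add_zero]
  | smul c x h => simp only [map_smul, h, smul_zero]
  | one => simp only [barDiff_nil, map_zero]
  | letter a w ih =>
    rw [barDiff_single_cat]
    simp only [map_add, map_neg, map_smul, barDiff_letter_cat, barDiff_single_cat, ih, cat_zero,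
      hδ', barDiff_merge hm hassoc hleib, gr_homog (hδ a), map_zero, zero_cat, smul_zero, smul_cat,
      LinearMap.smul_apply]
    have := @sgn_mul_self R _
    match_scalars <;> (try simp only [one_mul, sgn_sub, sgn_one]) <;> grind

/-- The cuts of the merged word behind its first letter are those of `Y`. The cut in front of it is
listed separately, because `merge` kills an empty first factor. -/
theorem deconcat_merge (a : γ) (Y : List γ →₀ R) :
    deconcat (merge m (single a 1) Y) = tmul (single [] 1) (merge m (single a 1) Y) +
      tmap (merge m (single a 1)) LinearMap.id (deconcat Y) := by
  induction Y using cat_induction with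
  | zero => simp [tmul_zero]
  | add x y hx hy => simp only [map_add, hx, hy, tmul_add]; abel
  | smul c x h => simp only [map_smul, h, tmul_smul, smul_add]
  | one => simp [merge_nil, deconcat_nil, tmap_single, zero_tmul, tmul_zero]
  | letter b w ih =>
    have h : tmap (merge m (single a 1)) LinearMap.id ∘ₗ lcat (List γ) (single [b] (1 : R)) =
        lcat (List γ) (single [m a b] 1) := ext_tmul fun x y => by
      rw [LinearMap.comp_apply, lcat_tmul, lcat_tmul, tmap_tmul, merge_single_cat, mulS_single,
        letter_single, LinearMap.id_apply]
    have h := LinearMap.congr_fun h (deconcat (single w 1))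
    rw [LinearMap.comp_apply] at h
    rw [merge_single_cat, mulS_single, letter_single, deconcat_single_cat, deconcat_single_cat,
      map_add, h, tmap_tmul, merge_nil, zero_tmul, zero_add]

theorem deconcat_barDiff (Y : List γ →₀ R) :
    deconcat (barDiff m e δ Y) =
      tensorD (wdeg e) (barDiff m e δ) (barDiff m e δ) (deconcat Y) := by
  induction Y using cat_induction with
  | zero => simp
  | add x y hx hy => simp only [map_add, hx, hy]
  | smul c x h => simp only [map_smul, h]
  | one =>
    rw [barDiff_nil, map_zero, deconcat_nil, ← tmul_single, tensorD_tmul, barDiff_nil, zero_tmul,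
      tmul_zero, add_zero]
  | letter a w ih =>
    have h : tensorD (wdeg e) (barDiff m e δ) (barDiff m e δ) ∘ₗ
        lcat (List γ) (single [a] (1 : R)) =
        -lcat (List γ) (letter (δ a)) +
          sgn R (e a) • tmap (merge m (single a (1 : R))) LinearMap.id +
          sgn R (e a) • lcat (List γ) (single [a] (1 : R)) ∘ₗ
            tensorD (wdeg e) (barDiff m e δ) (barDiff m e δ) := ext_tmul fun x y => by
      simp only [LinearMap.comp_apply, LinearMap.add_apply, LinearMap.neg_apply,
        LinearMap.smul_apply, lcat_tmul, tensorD_tmul, map_add, barDiff_single_cat, tmap_tmul,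
        add_tmul, neg_tmul, smul_tmul, gr_cat, gr_single, smul_cat, one_mul, smul_add, wdeg_cons,
        wdeg_nil, add_zero, LinearMap.id_apply]
      abel
    have h := LinearMap.congr_fun h (deconcat (single w 1))
    simp only [LinearMap.comp_apply, LinearMap.add_apply, LinearMap.neg_apply,
        LinearMap.smul_apply] at h
    rw [barDiff_single_cat, map_add, map_add, map_neg, map_smul, map_smul, deconcat_letter_cat,
      deconcat_merge, deconcat_single_cat, deconcat_single_cat, map_add, h, ih, tensorD_tmul,
      barDiff_nil, zero_tmul, zero_add, gr_single, wdeg_nil, mul_zero, sgn_zero, one_smul,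
      barDiff_single_cat]
    simp only [tmul_add, tmul_neg, tmul_smul, smul_add]
    abel

end Bar

end

end DoubleCobar

namespace DoubleCobar

open Finsupp (single)

noncomputable section

/-! ### The product on the bar construction defined by operations `E₁ₖ` -/

section BarProduct

variable {R : Type v} [CommRing R] {γ : Type*} (e : γ → ℤ)
  (κ : (List γ →₀ R) →ₗ[R] (γ →₀ R) →ₗ[R] (γ →₀ R))

/-- The product on the bar construction with operations `E₁ₖ = κ`, for words with first letter `x`,
in terms of the operator `f` of multiplication by the remaining word, which has degree `n`. -/
def barMulCons (x : γ) (n : ℤ) (f : (List γ →₀ R) →ₗ[R] (List γ →₀ R)) :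
    List γ → (List γ →₀ R) := fun Y =>
  lin (R := R) (fun p : List γ × List γ => sgn R (wdeg e p.1 * n) •
      letter (κ (single p.1 1) (single x 1)) ⋄ f (single p.2 1)) (deconcat (single Y (1 : R))) +
    match Y with
    | [] => 0
    | y :: Y => sgn R (e y * (e x + n)) • single [y] 1 ⋄ barMulCons x n f Y

/-- The product on the bar construction with operations `E₁ₖ = κ`, for words. -/
def barMulWord : List γ → (List γ →₀ R) →ₗ[R] (List γ →₀ R) := fun X =>
  match X with
  | [] => LinearMap.id
  | x :: X => lin (barMulCons e κ x (wdeg e X) (barMulWord X))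

/-- The product on the bar construction with operations `E₁ₖ = κ`. -/
def barMul : (List γ →₀ R) →ₗ[R] (List γ →₀ R) →ₗ[R] (List γ →₀ R) :=
  lin (M := (List γ →₀ R) →ₗ[R] (List γ →₀ R)) (barMulWord e κ)

/-- The part of the product of `x ⋄ X` with `p ⊗ q` where `p` is inserted into `x`. -/
def barMulInsert : (γ →₀ R) →ₗ[R] (List γ →₀ R) →ₗ[R]
    (List γ × List γ →₀ R) →ₗ[R] (List γ →₀ R) :=
  LinearMap.mk₂ R (fun x X => lin fun p : List γ × List γ =>
      letter (κ (single p.1 1) x) ⋄ barMul e κ (gr (wdeg e) (wdeg e p.1) X) (single p.2 1))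
    (fun x y X => ext_single fun p => by
      rw [LinearMap.add_apply, lin_single, lin_single, lin_single, map_add, map_add, add_cat])
    (fun c x X => ext_single fun p => by
      rw [LinearMap.smul_apply, lin_single, lin_single, map_smul, map_smul, smul_cat])
    (fun x X Y => ext_single fun p => by
      rw [LinearMap.add_apply, lin_single, lin_single, lin_single, map_add, map_add,
        LinearMap.add_apply, cat_add])
    (fun c x X => ext_single fun p => by
      rw [LinearMap.smul_apply, lin_single, lin_single, map_smul, map_smul, LinearMap.smul_apply,
        cat_smul])

theorem barMulInsert_single (x : γ →₀ R) (X : List γ →₀ R) (p q : List γ) :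
    barMulInsert e κ x X (single (p, q) 1) =
      letter (κ (single p 1) x) ⋄ barMul e κ (gr (wdeg e) (wdeg e p) X) (single q 1) :=
  lin_single _ _

/-- The part of the product of `X` with `Y` whose first letter is that of `Y`. -/
def barMulPass : (List γ →₀ R) →ₗ[R] (List γ →₀ R) →ₗ[R] (List γ →₀ R) :=
  LinearMap.mk₂ R (fun X => lin fun Y => match Y with
      | [] => 0
      | y :: Y => single [y] 1 ⋄ barMul e κ (gr (wdeg e) (e y) X) (single Y 1))
    (fun X Y Z => by
      rw [← LinearMap.add_apply]
      refine LinearMap.congr_fun (ext_single fun p => ?_) Z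
      rw [LinearMap.add_apply, lin_single, lin_single, lin_single]
      rcases p with _ | ⟨y, p⟩
      · exact (add_zero _).symm
      · simp only [map_add, LinearMap.add_apply, cat_add])
    (fun c X Z => by
      rw [← LinearMap.smul_apply]
      refine LinearMap.congr_fun (ext_single fun p => ?_) Z
      rw [LinearMap.smul_apply, lin_single, lin_single]
      rcases p with _ | ⟨y, p⟩
      · exact (smul_zero _).symm
      · simp only [map_smul, LinearMap.smul_apply, cat_smul])
    (fun X Y Z => map_add _ _ _)
    (fun c X Y => map_smul _ _ _)

theorem barMulPass_nil (X : List γ →₀ R) : barMulPass e κ X (single [] 1) = 0 := lin_single _ _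

theorem barMulPass_single_cat (X : List γ →₀ R) (y : γ) (Y : List γ →₀ R) :
    barMulPass e κ X (single [y] 1 ⋄ Y) =
      single [y] 1 ⋄ barMul e κ (gr (wdeg e) (e y) X) Y := by
  have : barMulPass e κ X ∘ₗ catL (single [y] (1 : R)) =
      catL (single [y] (1 : R)) ∘ₗ barMul e κ (gr (wdeg e) (e y) X) := ext_single fun w => by
    rw [LinearMap.comp_apply, LinearMap.comp_apply, catL_apply, catL_apply, single_cat]
    exact lin_single _ _
  exact LinearMap.congr_fun this Y

theorem barMulPass_letter_cat (X : List γ →₀ R) {k : ℤ} {y : γ →₀ R} (hy : y ∈ homog e k)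
    (Y : List γ →₀ R) : barMulPass e κ X (letter y ⋄ Y) =
      letter y ⋄ barMul e κ (gr (wdeg e) k X) Y := by
  refine homog_induction (p := fun y => barMulPass e κ X (letter y ⋄ Y) =
      letter y ⋄ barMul e κ (gr (wdeg e) k X) Y) hy ?_ ?_ ?_ ?_
  · simp [zero_cat]
  · intro x y hx hy; simp only [map_add, add_cat, hx, hy]
  · intro c x hx; simp only [map_smul, smul_cat, hx]
  · rintro y rfl
    rw [letter_single, barMulPass_single_cat]

theorem barMul_one_left (Y : List γ →₀ R) : barMul e κ (single [] 1) Y = Y := by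
  rw [barMul, lin_single]; rfl

/-- A product starts either with `x`, into which an initial and possibly empty segment of `Y` has
been inserted, or with the first letter of `Y`, which has passed in front of `x`. All further proofs
about the product follow this recursion. -/
theorem barMul_letter_cat (x : γ →₀ R) (X Y : List γ →₀ R) :
    barMul e κ (letter x ⋄ X) Y = barMulInsert e κ x X (deconcat Y) +
      barMulPass e κ (letter x ⋄ X) Y := by
  induction x using linear_induction with
  | zero => simp [zero_cat]
  | add x y hx hy => simp only [map_add, add_cat, LinearMap.add_apply, hx, hy]; abel
  | smul c x h => simp only [map_smul, smul_cat, LinearMap.smul_apply, h, smul_add]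
  | single x =>
    induction X using linear_induction with
    | zero => simp [cat_zero]
    | add x y hx hy => simp only [map_add, cat_add, LinearMap.add_apply, hx, hy]; abel
    | smul c x h => simp only [map_smul, cat_smul, LinearMap.smul_apply, h, smul_add]
    | single X =>
      induction Y using linear_induction with
      | zero => simp
      | add x y hx hy => simp only [map_add, hx, hy]; abel
      | smul c x h => simp only [map_smul, h, smul_add]
      | single Y =>
        have h : lin (fun p : List γ × List γ => sgn R (wdeg e p.1 * wdeg e X) •
            letter (κ (single p.1 1) (single x 1)) ⋄ barMulWord e κ X (single p.2 1)) =
            barMulInsert e κ (single x (1 : R)) (single X 1) := ext_single fun p => by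
          rw [lin_single, barMulInsert_single, gr_single, map_smul, LinearMap.smul_apply,
            cat_smul, barMul, lin_single]
        have hw : barMul e κ (single (x :: X) 1) = lin (barMulCons e κ x (wdeg e X)
          (barMulWord e κ X)) := lin_single _ _
        rw [letter_single, ← single_cons, hw, lin_single]
        rcases Y with _ | ⟨y, Y⟩
        · rw [barMulCons, h, barMulPass_nil]
        · rw [barMulCons, h, single_cons y Y, barMulPass_single_cat, gr_single, map_smul,
            LinearMap.smul_apply, cat_smul, wdeg_cons, hw, lin_single]

variable {e κ}

theorem barMul_one_right (hκ₀ : ∀ x, κ (single [] 1) x = x) (X : List γ →₀ R) :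
    barMul e κ X (single [] 1) = X := by
  induction X using cat_induction with
  | zero => simp
  | add x y hx hy => simp only [map_add, LinearMap.add_apply, hx, hy]
  | smul c x h => simp only [map_smul, LinearMap.smul_apply, h]
  | one => rw [barMul_one_left]
  | letter a w ih =>
    rw [← letter_single, barMul_letter_cat, deconcat_nil, barMulPass_nil, add_zero,
      barMulInsert_single, wdeg_nil, gr_zero, ih, hκ₀]

theorem barMul_mem_homog
    (hκ : ∀ Y x, κ (single Y 1) (single x 1) ∈ homog e (e x + wdeg e Y)) (X Y : List γ) :
    barMul e κ (single X 1) (single Y 1) ∈ homog (wdeg e) (wdeg e X + wdeg e Y) := by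
  induction X generalizing Y with
  | nil => rw [barMul_one_left, wdeg_nil, zero_add]; exact single_mem_homog rfl
  | cons x X ihX =>
    have hI : ∀ Y : List γ, barMulInsert e κ (single x 1) (single X 1) (deconcat (single Y 1)) ∈
        homog (wdeg e) (wdeg e (x :: X) + wdeg e Y) := by
      intro Y
      have : HasDegree (pdeg (wdeg e)) (wdeg e) (wdeg e (x :: X))
          (barMulInsert e κ (single x 1) (single X 1)) := by
        rw [hasDegree_iff]
        rintro ⟨p, q⟩
        rw [barMulInsert_single, gr_single, map_smul, LinearMap.smul_apply, cat_smul]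
        refine Submodule.smul_mem _ _ (cat_mem_homog (letter_mem_homog (hκ p x)) (ihX q) ?_)
        simp only [pdeg, wdeg_cons]; ring
      exact this.mem (hasDegree_iff.1 (hasDegree_deconcat e) Y) (by ring)
    -- A letter of `Y` that passes leaves the left word unchanged, so a second induction, on `Y`, is
    -- required.
    induction Y with
    | nil =>
      rw [single_cons, ← letter_single, barMul_letter_cat, barMulPass_nil, add_zero]
      exact hI []
    | cons y Y ihY =>
      have := hI (y :: Y)
      rw [single_cons, ← letter_single, barMul_letter_cat]
      refine add_mem this ?_
      rw [letter_single, ← single_cons, single_cons y Y, barMulPass_single_cat, gr_single, map_smul,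
        LinearMap.smul_apply, cat_smul]
      refine Submodule.smul_mem _ _ (cat_mem_homog (single_mem_homog (k := e y) ?_) ihY ?_) <;>
      simp only [wdeg_cons, wdeg_nil] <;> ring

theorem gr_barMul (hκ : ∀ Y x, κ (single Y 1) (single x 1) ∈ homog e (e x + wdeg e Y)) (k : ℤ)
    (X Y : List γ →₀ R) :
    gr (wdeg e) k (barMul e κ X Y) = barMul e κ (gr (wdeg e) k X) (gr (wdeg e) k Y) := by
  induction X using linear_induction with
  | zero => simp
  | add x y hx hy => simp only [map_add, LinearMap.add_apply, hx, hy]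
  | smul c x h => simp only [map_smul, LinearMap.smul_apply, h]
  | single X =>
    induction Y using linear_induction with
    | zero => simp
    | add x y hx hy => simp only [map_add, hx, hy]
    | smul c x h => simp only [map_smul, h]
    | single Y =>
      rw [gr_homog (barMul_mem_homog hκ X Y), gr_single, gr_single, map_smul, map_smul,
        LinearMap.smul_apply, smul_smul, ← sgn_add]
      congr 2; ring

end BarProduct

end

end DoubleCobar

namespace DoubleCobar

open Finsupp (single)

noncomputable section

/-! ### Compatibility of the product with deconcatenation -/

section BarComul

variable {R : Type v} [CommRing R] {γ : Type*} (e : γ → ℤ)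
  (κ : (List γ →₀ R) →ₗ[R] (γ →₀ R) →ₗ[R] (γ →₀ R))

/-- The product on the bar construction, on the tensor square. -/
def barMulT : (List γ × List γ →₀ R) →ₗ[R] (List γ →₀ R) :=
  lin fun p => barMul e κ (single p.1 1) (single p.2 1)

theorem barMulT_single (p q : List γ) : barMulT e κ (single (p, q) 1) =
    barMul e κ (single p 1) (single q 1) := lin_single _ _

theorem barMulT_tmul (X Y : List γ →₀ R) : barMulT e κ (tmul X Y) = barMul e κ X Y := by
  induction X using linear_induction with
  | zero => simp [zero_tmul]
  | add x y hx hy => simp only [add_tmul, map_add, LinearMap.add_apply, hx, hy]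
  | smul c x h => simp only [smul_tmul, map_smul, LinearMap.smul_apply, h]
  | single X =>
    induction Y using linear_induction with
    | zero => simp [tmul_zero]
    | add x y hx hy => simp only [tmul_add, map_add, hx, hy]
    | smul c x h => simp only [tmul_smul, map_smul, h]
    | single Y => rw [tmul_single, barMulT_single]

/-- The product of the tensor square of the bar construction. -/
def barMul₂ : (List γ × List γ →₀ R) →ₗ[R] (List γ × List γ →₀ R) →ₗ[R]
    (List γ × List γ →₀ R) := tmulL.compr₂ (mulT (wdeg e) (barMulT e κ))

theorem barMul₂_apply (Z W : List γ × List γ →₀ R) :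
    barMul₂ e κ Z W = mulT (wdeg e) (barMulT e κ) (tmul Z W) := rfl

theorem barMul₂_single (u v p q : List γ) :
    barMul₂ e κ (single (u, v) 1) (single (p, q) 1) = sgn R (wdeg e v * wdeg e p) •
      tmul (barMul e κ (single u 1) (single p 1)) (barMul e κ (single v 1) (single q 1)) := by
  rw [barMul₂_apply, tmul_single, mulT_single, barMulT_single, barMulT_single]

theorem barMul₂_tmul (v : List γ) (u p q : List γ →₀ R) :
    barMul₂ e κ (tmul u (single v 1)) (tmul p q) =
      tmul (barMul e κ u (gr (wdeg e) (wdeg e v) p)) (barMul e κ (single v 1) q) := by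
  induction u using linear_induction with
  | zero => simp [zero_tmul]
  | add x y hx hy => simp only [add_tmul, map_add, LinearMap.add_apply, hx, hy]
  | smul c x h => simp only [smul_tmul, map_smul, LinearMap.smul_apply, h]
  | single u =>
    induction p using linear_induction with
    | zero => simp [zero_tmul]
    | add x y hx hy => simp only [add_tmul, map_add, hx, hy]
    | smul c x h => simp only [smul_tmul, map_smul, h]
    | single p =>
      induction q using linear_induction with
      | zero => simp [tmul_zero]
      | add x y hx hy => simp only [tmul_add, map_add, hx, hy]
      | smul c x h => simp only [tmul_smul, map_smul, h]
      | single q =>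
        rw [tmul_single, tmul_single, barMul₂_single, gr_single, map_smul, smul_tmul]

variable {e κ}

theorem deconcat_barMulInsert (x : γ →₀ R) (X : List γ →₀ R) (Z : List γ × List γ →₀ R) :
    deconcat (barMulInsert e κ x X Z) = tmul (single [] 1) (barMulInsert e κ x X Z) +
      lin (fun p : List γ × List γ => lcat _ (letter (κ (single p.1 1) x))
        (deconcat (barMul e κ (gr (wdeg e) (wdeg e p.1) X) (single p.2 1)))) Z := by
  have : deconcat ∘ₗ barMulInsert e κ x X = tmulL (single [] 1) ∘ₗ barMulInsert e κ x X +
      lin (fun p : List γ × List γ => lcat _ (letter (κ (single p.1 1) x))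
        (deconcat (barMul e κ (gr (wdeg e) (wdeg e p.1) X) (single p.2 1)))) :=
    ext_single fun p => by
      rw [LinearMap.add_apply, lin_single, LinearMap.comp_apply, LinearMap.comp_apply,
        barMulInsert_single, deconcat_letter_cat, tmulL_apply]
  exact LinearMap.congr_fun this Z

/-- The action of triples of words used to compare the two sides of the multiplicativity of the
deconcatenation. -/
def barMulInsert₃ (e : γ → ℤ) (κ : (List γ →₀ R) →ₗ[R] (γ →₀ R) →ₗ[R] (γ →₀ R)) (x : γ →₀ R)
    (u v : List γ) : (List γ × List γ × List γ →₀ R) →ₗ[R] (List γ × List γ →₀ R) :=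
  lin fun p => (sgn R (wdeg e v * (wdeg e p.1 + wdeg e p.2.1))) •
    tmul (letter (κ (single p.1 1) x) ⋄
      barMul e κ (gr (wdeg e) (wdeg e p.1) (single u 1)) (single p.2.1 1))
      (barMul e κ (single v 1) (single p.2.2 1))

/-- The right-hand word is cut into three: the first part is inserted into `x`, the second is
multiplied with `u` and the third with `v`. This lemma and `barMulInsert₃_right` read the result off
the two iterated deconcatenations, which agree by coassociativity. -/
theorem barMulInsert₃_left (x : γ →₀ R) (u v : List γ) (Z : List γ × List γ →₀ R) :
    barMulInsert₃ e κ x u v (assoc (tmap deconcat LinearMap.id Z)) =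
      lin (fun p : List γ × List γ => sgn R (wdeg e v * wdeg e p.1) •
        tmul (barMulInsert e κ x (single u 1) (deconcat (single p.1 1)))
          (barMul e κ (single v 1) (single p.2 1))) Z := by
  have : barMulInsert₃ e κ x u v ∘ₗ assoc ∘ₗ tmap deconcat LinearMap.id =
      lin (fun p : List γ × List γ => sgn R (wdeg e v * wdeg e p.1) •
        tmul (barMulInsert e κ x (single u 1) (deconcat (single p.1 1)))
          (barMul e κ (single v 1) (single p.2 1))) := ext_single fun p => by
    obtain ⟨p, q⟩ := p
    rw [LinearMap.comp_apply, LinearMap.comp_apply, tmap_single, lin_single, LinearMap.id_apply]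
    have h := hasDegree_iff.1 (hasDegree_deconcat (R := R) e) p
    rw [add_zero] at h
    refine homog_induction (p := fun Z => barMulInsert₃ e κ x u v (assoc (tmul Z (single q 1))) =
      sgn R (wdeg e v * wdeg e p) • tmul (barMulInsert e κ x (single u 1) Z)
        (barMul e κ (single v 1) (single q 1))) h ?_ ?_ ?_ ?_
    · simp [zero_tmul]
    · intro Z W hZ hW; simp only [add_tmul, map_add, hZ, hW, smul_add]
    · intro c Z hZ; simp only [smul_tmul, map_smul, hZ]; rw [smul_comm]
    · rintro ⟨r, s⟩ hr
      rw [tmul_single, assoc_single, barMulInsert₃, lin_single, ← hr, barMulInsert_single]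
      rfl
  exact LinearMap.congr_fun this Z

/-- The part of the product of `x ⋄ Z` with `p ⊗ q` in the tensor square where the first factor of
`p` is inserted into `x`. -/
def barMulInsert₂ (e : γ → ℤ) (κ : (List γ →₀ R) →ₗ[R] (γ →₀ R) →ₗ[R] (γ →₀ R)) (x : γ →₀ R) :
    (List γ × List γ →₀ R) →ₗ[R] (List γ × List γ →₀ R) →ₗ[R] (List γ × List γ →₀ R) :=
  LinearMap.mk₂ R (fun Z => lin fun p : List γ × List γ => lcat _ (letter (κ (single p.1 1) x))
      (barMul₂ e κ (gr (pdeg (wdeg e)) (wdeg e p.1) Z) (deconcat (single p.2 1))))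
    (fun Z W D => by
      rw [← LinearMap.add_apply]
      refine LinearMap.congr_fun (ext_single fun p => ?_) D
      simp only [LinearMap.add_apply, lin_single, map_add])
    (fun c Z D => by
      rw [← LinearMap.smul_apply]
      refine LinearMap.congr_fun (ext_single fun p => ?_) D
      simp only [LinearMap.smul_apply, lin_single, map_smul])
    (fun X Y Z => map_add _ _ _)
    (fun c X Y => map_smul _ _ _)

theorem barMulInsert₂_single (x : γ →₀ R) (Z : List γ × List γ →₀ R) (p q : List γ) :
    barMulInsert₂ e κ x Z (single (p, q) 1) = lcat _ (letter (κ (single p 1) x))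
      (barMul₂ e κ (gr (pdeg (wdeg e)) (wdeg e p) Z) (deconcat (single q 1))) := lin_single _ _

theorem barMulInsert₃_right (x : γ →₀ R) (u v : List γ) (Z : List γ × List γ →₀ R) :
    barMulInsert₃ e κ x u v (tmap LinearMap.id deconcat Z) =
      barMulInsert₂ e κ x (single (u, v) 1) Z := by
  have : barMulInsert₃ e κ x u v ∘ₗ tmap LinearMap.id deconcat =
      barMulInsert₂ e κ x (single (u, v) 1) := ext_single fun p => by
    obtain ⟨r, q⟩ := p
    rw [LinearMap.comp_apply, tmap_single, barMulInsert₂_single, LinearMap.id_apply]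
    have : barMulInsert₃ e κ x u v ∘ₗ tmulL (single r 1) = lcat _ (letter (κ (single r 1) x)) ∘ₗ
        barMul₂ e κ (gr (pdeg (wdeg e)) (wdeg e r) (single (u, v) 1)) := ext_single fun p => by
      obtain ⟨s, t⟩ := p
      rw [LinearMap.comp_apply, LinearMap.comp_apply, tmulL_apply, tmul_single, gr_single, map_smul,
        LinearMap.smul_apply, barMul₂_single, map_smul, map_smul, lcat_tmul, barMulInsert₃,
        lin_single, gr_single, map_smul, LinearMap.smul_apply, cat_smul, smul_tmul, smul_smul,
        smul_smul, ← sgn_add, ← sgn_add, pdeg]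
      congr 2; ring
    exact LinearMap.congr_fun this (deconcat (single q 1))
  exact LinearMap.congr_fun this Z

/-- The alternative of `barMul_letter_cat`, insertion into `x` or passing of `y`, carried over to
the tensor square when the left factor starts with `x`. -/
theorem barMul₂_lcat (hκ₀ : ∀ x, κ (single [] 1) x = x) (x y : γ) (u v : List γ) (Y : List γ →₀ R) :
    barMul₂ e κ (lcat _ (letter (single x 1)) (single (u, v) 1)) (deconcat (single [y] 1 ⋄ Y)) =
      barMulInsert₂ e κ (single x 1) (single (u, v) 1) (deconcat (single [y] 1 ⋄ Y)) +
      lcat _ (single [y] 1) (barMul₂ e κ (gr (pdeg (wdeg e)) (e y)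
        (lcat _ (letter (single x 1)) (single (u, v) 1))) (deconcat Y)) := by
  rw [← barMulInsert₃_right, ← deconcat_coassoc, barMulInsert₃_left, deconcat_single_cat]
  set W := deconcat Y
  rw [map_add, map_add, lcat_single]
  have h1 : barMul₂ e κ (tmul (letter (single x 1) ⋄ single u 1) (single v 1)) ∘ₗ
      lcat _ (single [y] (1 : R)) =
      lin (fun p : List γ × List γ => sgn R (wdeg e v * wdeg e p.1) •
        tmul (barMulInsert e κ (single x 1) (single u 1) (deconcat (single p.1 1)))
          (barMul e κ (single v 1) (single p.2 1))) ∘ₗ lcat _ (single [y] (1 : R)) +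
      lcat _ (single [y] 1) ∘ₗ barMul₂ e κ (gr (pdeg (wdeg e)) (e y)
        (tmul (letter (single x 1) ⋄ single u 1) (single v 1))) := ext_single fun p => by
    obtain ⟨p, q⟩ := p
    have hs : lcat (List γ) (single [y] (1 : R)) (single (p, q) 1) = single (y :: p, q) 1 := by
      rw [lcat_single, single_cat, tmul_single]; rfl
    rw [LinearMap.comp_apply, LinearMap.add_apply, LinearMap.comp_apply, LinearMap.comp_apply, hs,
      lin_single, ← tmul_single (y :: p) q, barMul₂_tmul, gr_single, map_smul, smul_tmul,
      barMul_letter_cat, add_tmul, smul_add, single_cons y p, barMulPass_single_cat, letter_single,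
      single_cat [x], tmul_single _ v, gr_single, gr_single, map_smul, map_smul, LinearMap.smul_apply,
      LinearMap.smul_apply, barMul₂_single, map_smul, map_smul, lcat_tmul, cat_smul, smul_tmul,
      smul_smul, smul_smul, ← sgn_add, ← sgn_add, pdeg, wdeg_cons]
    congr 3; ring
  have h1 := LinearMap.congr_fun h1 W
  rw [LinearMap.comp_apply, LinearMap.add_apply, LinearMap.comp_apply, LinearMap.comp_apply] at h1
  rw [h1, ← add_assoc]
  refine congrArg (· + _) (congrArg (· + _) ?_)
  -- It remains to treat the cut before `y`. There is nothing to insert or to pass on the first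
  -- factor, and inserting nothing is the identity by `hκ₀`.
  have h2 : barMul₂ e κ (tmul (letter (single x 1) ⋄ single u 1) (single v 1)) ∘ₗ
      tmulL (single [] 1) = lin (fun p : List γ × List γ => sgn R (wdeg e v * wdeg e p.1) •
        tmul (barMulInsert e κ (single x 1) (single u 1) (deconcat (single p.1 1)))
          (barMul e κ (single v 1) (single p.2 1))) ∘ₗ tmulL (single [] 1) := ext_single fun q => by
    rw [LinearMap.comp_apply, LinearMap.comp_apply, tmulL_apply, tmul_single, lin_single,
      ← tmul_single, barMul₂_tmul, gr_single, deconcat_nil, barMulInsert_single, hκ₀, wdeg_nil,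
      mul_zero, sgn_zero, one_smul, one_smul, gr_zero, barMul_one_right hκ₀,
      barMul_one_right hκ₀]
  exact LinearMap.congr_fun h2 (single [y] 1 ⋄ Y)

/-- The product on the bar construction is compatible with the deconcatenation coproduct. -/
theorem deconcat_barMul (hκ₀ : ∀ x, κ (single [] 1) x = x)
    (hκ : ∀ Y x, κ (single Y 1) (single x 1) ∈ homog e (e x + wdeg e Y)) (X Y : List γ →₀ R) :
    deconcat (barMul e κ X Y) = barMul₂ e κ (deconcat X) (deconcat Y) := by
  induction X using cat_induction generalizing Y with
  | zero => simp
  | add x y hx hy => simp only [map_add, LinearMap.add_apply, hx, hy]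
  | smul c x h => simp only [map_smul, LinearMap.smul_apply, h]
  | one =>
    rw [barMul_one_left, deconcat_nil]
    have : barMul₂ e κ (single ([], []) 1) = LinearMap.id := ext_single fun p => by
      obtain ⟨p, q⟩ := p
      rw [barMul₂_single, wdeg_nil, zero_mul, sgn_zero, one_smul, barMul_one_left, barMul_one_left,
        tmul_single]; rfl
    rw [this]; rfl
  | letter x w ihX =>
    induction Y using cat_induction with
    | zero => simp
    | add x y hx hy => simp only [map_add, hx, hy]
    | smul c x h => simp only [map_smul, h]
    | one =>
      rw [barMul_one_right hκ₀, deconcat_nil]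
      have : (barMul₂ e κ).flip (single ([], []) 1) = LinearMap.id := ext_single fun p => by
        obtain ⟨p, q⟩ := p
        rw [LinearMap.flip_apply, barMul₂_single, wdeg_nil, mul_zero, sgn_zero, one_smul,
          barMul_one_right hκ₀, barMul_one_right hκ₀, tmul_single]; rfl
      exact (LinearMap.congr_fun this _).symm
    | letter y Y ihY =>
      have hX := deconcat_single_cat x (single w (1 : R))
      -- This is `barMul₂_lcat`, extended linearly to the whole coproduct of `w`.
      have hXY : barMul₂ e κ (lcat _ (single [x] 1) (deconcat (single w 1)))
          (deconcat (single [y] 1 ⋄ single Y 1)) =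
        barMulInsert₂ e κ (single x 1) (deconcat (single w 1)) (deconcat (single [y] 1 ⋄ single Y 1)) +
        lcat _ (single [y] 1) (barMul₂ e κ (gr (pdeg (wdeg e)) (e y)
          (lcat _ (single [x] 1) (deconcat (single w 1)))) (deconcat (single Y 1))) := by
        induction deconcat (single w (1 : R)) using linear_induction with
        | zero => simp
        | add Z W hZ hW => simp only [map_add, LinearMap.add_apply, hZ, hW]; abel
        | smul c Z hZ => simp only [map_smul, LinearMap.smul_apply, hZ, smul_add]
        | single p =>
          rw [← letter_single]
          exact barMul₂_lcat hκ₀ x y p.1 p.2 (single Y 1)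
      have hgr := (hasDegree_deconcat (R := R) e).gr_map (e y) (single [x] 1 ⋄ single w 1)
      rw [mul_zero, sgn_zero, one_smul] at hgr
      -- After an insertion into `x` the shorter word `w` is multiplied, so the induction hypothesis
      -- on the left argument applies.
      have hins : barMulInsert₂ e κ (single x 1) (deconcat (single w 1)) =
          lin (fun p : List γ × List γ => lcat _ (letter (κ (single p.1 1) (single x 1)))
            (deconcat (barMul e κ (gr (wdeg e) (wdeg e p.1) (single w 1)) (single p.2 1)))) :=
          ext_single fun p => by
        have hgr := (hasDegree_deconcat (R := R) e).gr_map (wdeg e p.1) (single w 1)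
        rw [mul_zero, sgn_zero, one_smul] at hgr
        rw [barMulInsert₂_single, lin_single, hgr, gr_single, map_smul, map_smul, map_smul,
          LinearMap.smul_apply, LinearMap.smul_apply, map_smul, map_smul, ihX, map_smul]
      -- After `y` has passed, the induction hypothesis on the right argument applies.
      have hp : deconcat (barMul e κ (gr (wdeg e) (e y) (single [x] 1 ⋄ single w 1)) (single Y 1)) =
          barMul₂ e κ (gr (pdeg (wdeg e)) (e y) (deconcat (single [x] 1 ⋄ single w 1)))
            (deconcat (single Y 1)) := by
        rw [hgr, ← single_cons, gr_single, map_smul, map_smul, map_smul, LinearMap.smul_apply,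
          LinearMap.smul_apply, map_smul, single_cons, ihY]
      have h0 : ∀ (v : List γ) (W : List γ →₀ R), barMul₂ e κ (tmul (single [] 1) (single v 1))
          (tmul (single [] 1) W) = tmul (single [] 1) (barMul e κ (single v 1) W) := fun v W => by
        rw [barMul₂_tmul, gr_single, wdeg_nil, mul_zero, sgn_zero, one_smul, barMul_one_left]
      have h1 : barMul₂ e κ (tmul (single [] 1) (single [x] 1 ⋄ single w 1)) ∘ₗ
          lcat _ (single [y] (1 : R)) = lcat _ (single [y] (1 : R)) ∘ₗ barMul₂ e κ
            (gr (pdeg (wdeg e)) (e y) (tmul (single [] 1) (single [x] 1 ⋄ single w 1))) :=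
          ext_single fun p => by
        obtain ⟨p, q⟩ := p
        rw [LinearMap.comp_apply, LinearMap.comp_apply, lcat_single, single_cat, single_cat,
          barMul₂_tmul, tmul_single, gr_single, gr_single, map_smul, map_smul,
          LinearMap.smul_apply, map_smul, barMul₂_single, map_smul, lcat_tmul, smul_tmul,
          barMul_one_left, barMul_one_left, single_cat, smul_smul, ← sgn_add]
        congr 2
        simp only [pdeg, wdeg_nil, wdeg_append, wdeg_cons]; ring
      have h1 := LinearMap.congr_fun h1 (deconcat (single Y 1))
      rw [LinearMap.comp_apply, LinearMap.comp_apply] at h1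
      have hb := barMul_letter_cat e κ (single x 1) (single w 1) (single [y] 1 ⋄ single Y 1)
      rw [letter_single] at hb
      have hA : barMul₂ e κ (tmul (single [] 1) (single [x] 1 ⋄ single w 1))
          (deconcat (single [y] 1 ⋄ single Y 1)) =
          tmul (single [] 1) (barMul e κ (single [x] 1 ⋄ single w 1) (single [y] 1 ⋄ single Y 1)) +
          lcat _ (single [y] (1 : R)) (barMul₂ e κ (gr (pdeg (wdeg e)) (e y)
            (tmul (single [] 1) (single [x] 1 ⋄ single w 1))) (deconcat (single Y 1))) := by
        rw [deconcat_single_cat, map_add, h1, ← single_cons x w, h0]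
      have hB : deconcat (single [y] 1 ⋄
          barMul e κ (gr (wdeg e) (e y) (single [x] 1 ⋄ single w 1)) (single Y 1)) =
          tmul (single [] 1) (single [y] 1 ⋄
            barMul e κ (gr (wdeg e) (e y) (single [x] 1 ⋄ single w 1)) (single Y 1)) +
          lcat _ (single [y] (1 : R)) (barMul₂ e κ (gr (pdeg (wdeg e)) (e y)
            (deconcat (single [x] 1 ⋄ single w 1))) (deconcat (single Y 1))) := by
        rw [deconcat_single_cat, hp]
      conv_rhs => rw [hX, map_add, LinearMap.add_apply, hA, hXY]
      rw [hb, barMulPass_single_cat, map_add, hB, deconcat_barMulInsert, ← hins, hX]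
      simp only [map_add, LinearMap.add_apply, tmul_add]
      abel

end BarComul

end

end DoubleCobar

namespace DoubleCobar

open Finsupp (single)

noncomputable section

/-! ### Associativity of the product -/

section BarAssoc

variable {R : Type v} [CommRing R] {γ : Type*} {e : γ → ℤ}
  {κ : (List γ →₀ R) →ₗ[R] (γ →₀ R) →ₗ[R] (γ →₀ R)}

theorem barMulInsert_tmul (x : γ →₀ R) (X : List γ →₀ R) {k : ℤ} {U : List γ →₀ R}
    (hU : U ∈ homog (wdeg e) k) (V : List γ →₀ R) :
    barMulInsert e κ x X (tmul U V) = letter (κ U x) ⋄ barMul e κ (gr (wdeg e) k X) V := by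
  refine homog_induction (p := fun U => barMulInsert e κ x X (tmul U V) =
    letter (κ U x) ⋄ barMul e κ (gr (wdeg e) k X) V) hU ?_ ?_ ?_ ?_
  · simp [zero_tmul, zero_cat]
  · intro U W hU hW; simp only [add_tmul, map_add, LinearMap.add_apply, hU, hW, add_cat]
  · intro c U hU; simp only [smul_tmul, map_smul, LinearMap.smul_apply, hU, smul_cat]
  · rintro p rfl
    have : barMulInsert e κ x X ∘ₗ tmulL (single p (1 : R)) =
        catL (letter (κ (single p 1) x)) ∘ₗ barMul e κ (gr (wdeg e) (wdeg e p) X) :=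
      ext_single fun q => by
        rw [LinearMap.comp_apply, LinearMap.comp_apply, tmulL_apply, tmul_single,
          barMulInsert_single, catL_apply]
    exact LinearMap.congr_fun this V

theorem barMul_barMulInsert (x : γ →₀ R) (X : List γ →₀ R) (D : List γ × List γ →₀ R)
    (Z : List γ →₀ R) :
    barMul e κ (barMulInsert e κ x X D) Z =
      lin (fun p : List γ × List γ => barMulInsert e κ (κ (single p.1 1) x)
        (barMul e κ (gr (wdeg e) (wdeg e p.1) X) (single p.2 1)) (deconcat Z)) D +
      barMulPass e κ (barMulInsert e κ x X D) Z := by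
  have : (barMul e κ).flip Z ∘ₗ barMulInsert e κ x X =
      lin (fun p : List γ × List γ => barMulInsert e κ (κ (single p.1 1) x)
        (barMul e κ (gr (wdeg e) (wdeg e p.1) X) (single p.2 1)) (deconcat Z)) +
      (barMulPass e κ).flip Z ∘ₗ barMulInsert e κ x X := ext_single fun p => by
    obtain ⟨p, q⟩ := p
    rw [LinearMap.add_apply, LinearMap.comp_apply, LinearMap.comp_apply, barMulInsert_single,
      LinearMap.flip_apply, LinearMap.flip_apply, barMul_letter_cat, lin_single]
  exact LinearMap.congr_fun this D

theorem barMulPass_barMulInsert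
    (hκ : ∀ Y x, κ (single Y 1) (single x 1) ∈ homog e (e x + wdeg e Y)) (y : γ)
    (X Y : List γ →₀ R) (D : List γ × List γ →₀ R) :
    barMulPass e κ X (barMulInsert e κ (single y 1) Y D) =
      lin (fun p : List γ × List γ => letter (κ (single p.1 1) (single y 1)) ⋄
        barMul e κ (gr (wdeg e) (e y + wdeg e p.1) X)
          (barMul e κ (gr (wdeg e) (wdeg e p.1) Y) (single p.2 1))) D := by
  have : barMulPass e κ X ∘ₗ barMulInsert e κ (single y 1) Y =
      lin (fun p : List γ × List γ => letter (κ (single p.1 1) (single y 1)) ⋄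
        barMul e κ (gr (wdeg e) (e y + wdeg e p.1) X)
          (barMul e κ (gr (wdeg e) (wdeg e p.1) Y) (single p.2 1))) := ext_single fun p => by
    obtain ⟨p, q⟩ := p
    rw [LinearMap.comp_apply, barMulInsert_single, barMulPass_letter_cat e κ X (hκ p y), lin_single]
  exact LinearMap.congr_fun this D

/-- By the brace relation `hbr`, inserting a product of two words into `x` amounts to inserting one
after the other; what remains is associativity for `X`. The sign operators also act on `X`, and
`hX'` allows pulling them out as scalars. -/
theorem barMulInsert_barMul₂
    (hκ : ∀ Y x, κ (single Y 1) (single x 1) ∈ homog e (e x + wdeg e Y))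
    (hbr : ∀ Y Z x, κ (single Z 1) (κ (single Y 1) x) = κ (barMul e κ (single Y 1) (single Z 1)) x)
    (x : γ →₀ R) (X : List γ →₀ R)
    (hX : ∀ Y Z, barMul e κ (barMul e κ X Y) Z = barMul e κ X (barMul e κ Y Z))
    (hX' : ∀ k, ∃ c : R, gr (wdeg e) k X = c • X) (D E : List γ × List γ →₀ R) :
    barMulInsert e κ x X (barMul₂ e κ D E) =
      lin (fun p : List γ × List γ => barMulInsert e κ (κ (single p.1 1) x)
        (barMul e κ (gr (wdeg e) (wdeg e p.1) X) (single p.2 1)) E) D := by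
  refine LinearMap.congr_fun (f := barMulInsert e κ x X ∘ₗ (barMul₂ e κ).flip E)
    (g := lin (fun p : List γ × List γ => barMulInsert e κ (κ (single p.1 1) x)
        (barMul e κ (gr (wdeg e) (wdeg e p.1) X) (single p.2 1)) E)) (ext_single fun p => ?_) D
  rw [lin_single]
  refine LinearMap.congr_fun (f := barMulInsert e κ x X ∘ₗ barMul₂ e κ (single p 1))
    (g := barMulInsert e κ (κ (single p.1 1) x)
        (barMul e κ (gr (wdeg e) (wdeg e p.1) X) (single p.2 1))) (ext_single fun r => ?_) E
  obtain ⟨p, q⟩ := p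
  obtain ⟨r, s⟩ := r
  obtain ⟨c, hc⟩ := hX' (wdeg e r + wdeg e p)
  rw [LinearMap.comp_apply, barMul₂_single, map_smul, barMulInsert_tmul x X (barMul_mem_homog hκ p r),
    barMulInsert_single, hbr, gr_barMul hκ, gr_gr, gr_single, map_smul, map_smul,
    LinearMap.smul_apply, cat_smul, add_comm (wdeg e p), hc, mul_comm (wdeg e q)]
  simp only [map_smul, LinearMap.smul_apply, hX]

/-- The product on the bar construction is associative. -/
theorem barMul_assoc (hκ₀ : ∀ x, κ (single [] 1) x = x)
    (hκ : ∀ Y x, κ (single Y 1) (single x 1) ∈ homog e (e x + wdeg e Y))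
    (hbr : ∀ Y Z x, κ (single Z 1) (κ (single Y 1) x) = κ (barMul e κ (single Y 1) (single Z 1)) x)
    (X Y Z : List γ →₀ R) :
    barMul e κ (barMul e κ X Y) Z = barMul e κ X (barMul e κ Y Z) := by
  induction X using cat_induction generalizing Y Z with
  | zero => simp
  | add x y hx hy => simp only [map_add, LinearMap.add_apply, hx, hy]
  | smul c x h => simp only [map_smul, LinearMap.smul_apply, h]
  | one => rw [barMul_one_left, barMul_one_left]
  | letter x X ihX =>
    induction Y using cat_induction generalizing Z with
    | zero => simp
    | add x y hx hy => simp only [map_add, LinearMap.add_apply, hx, hy]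
    | smul c x h => simp only [map_smul, LinearMap.smul_apply, h]
    | one => rw [barMul_one_left, barMul_one_right hκ₀]
    | letter y Y ihY =>
      induction Z using cat_induction with
      | zero => simp
      | add x y hx hy => simp only [map_add, hx, hy]
      | smul c x h => simp only [map_smul, h]
      | one => rw [barMul_one_right hκ₀, barMul_one_right hκ₀]
      | letter z Z ihZ =>
        have e1 := barMul_letter_cat e κ (single x 1) (single X 1) (single [y] 1 ⋄ single Y 1)
        have e2 := barMul_letter_cat e κ (single y 1) (single Y 1) (single [z] 1 ⋄ single Z 1)
        have e3 := barMul_letter_cat e κ (single x 1) (single X 1)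
          (barMul e κ (single [y] 1 ⋄ single Y 1) (single [z] 1 ⋄ single Z 1))
        have e4 := barMul_letter_cat e κ (single y 1)
          (barMul e κ (gr (wdeg e) (e y) (single [x] 1 ⋄ single X 1)) (single Y 1))
          (single [z] 1 ⋄ single Z 1)
        rw [letter_single] at e1 e2 e3 e4
        -- Both bracketings are sorted by the letter that comes first. If it is `z`, the rest is
        -- covered by the induction on `Z`.
        have e5 : barMulPass e κ (barMul e κ (single [x] 1 ⋄ single X 1) (single [y] 1 ⋄ single Y 1))
            (single [z] 1 ⋄ single Z 1) = barMulPass e κ (single [x] 1 ⋄ single X 1)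
              (barMulPass e κ (single [y] 1 ⋄ single Y 1) (single [z] 1 ⋄ single Z 1)) := by
          rw [barMulPass_single_cat, barMulPass_single_cat, barMulPass_single_cat, gr_barMul hκ,
            ← single_cons x, ← single_cons y, gr_single, gr_single]
          simp only [map_smul, LinearMap.smul_apply, cat_smul]
          rw [single_cons x, single_cons y, ihZ]
        -- If the product starts with `y`, with a segment of the third word inserted, the induction
        -- on `Y` applies.
        have e6 : ∀ D : List γ × List γ →₀ R, barMulInsert e κ (single y 1)
            (barMul e κ (gr (wdeg e) (e y) (single [x] 1 ⋄ single X 1)) (single Y 1)) D =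
            barMulPass e κ (single [x] 1 ⋄ single X 1)
              (barMulInsert e κ (single y 1) (single Y 1) D) := fun D => by
          rw [barMulPass_barMulInsert hκ]
          refine LinearMap.congr_fun (ext_single fun p => ?_) D
          obtain ⟨p, q⟩ := p
          rw [barMulInsert_single, lin_single, gr_barMul hκ, gr_gr, ← single_cons x, gr_single,
            gr_single, add_comm (e y)]
          simp only [map_smul, LinearMap.smul_apply, cat_smul]
          rw [single_cons x, ihY, ← single_cons x, gr_single]
          simp only [map_smul, LinearMap.smul_apply, cat_smul]
        have hX' : ∀ k, ∃ c : R, gr (wdeg e) k (single X (1 : R)) = c • single X 1 :=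
          fun k => ⟨_, gr_single _ _ _⟩
        -- If it starts with `x`, the brace relation is needed, and the multiplicativity of
        -- deconcatenation rewrites the cuts of the product of the last two words.
        have e7 := barMulInsert_barMul₂ hκ hbr (single x 1) (single X 1) ihX hX'
          (deconcat (single [y] 1 ⋄ single Y 1)) (deconcat (single [z] 1 ⋄ single Z 1))
        rw [← deconcat_barMul hκ₀ hκ] at e7
        have e8 := congrArg (fun W => barMulPass e κ W (single [z] 1 ⋄ single Z 1)) e1
        simp only [map_add, LinearMap.add_apply] at e8
        rw [barMulPass_single_cat e κ (single [x] 1 ⋄ single X 1) y] at e8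
        rw [e3, e7]
        conv_rhs => rw [e2, map_add, ← e5, ← e6, e8]
        conv_lhs => rw [e1, barMulPass_single_cat, map_add, LinearMap.add_apply, barMul_barMulInsert,
          e4]
        abel

end BarAssoc

end

end DoubleCobar

namespace DoubleCobar

open Finsupp (single)

noncomputable section

/-! ### Boundary terms in the differential of a product -/

section BarDifferential

variable {R : Type v} [CommRing R] {γ : Type*} {m : γ → γ → γ} {e : γ → ℤ} {δ : γ → (γ →₀ R)}
  {κ : (List γ →₀ R) →ₗ[R] (γ →₀ R) →ₗ[R] (γ →₀ R)}

theorem letters_nil : letters (single ([] : List γ) (1 : R)) = 0 := by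
  ext a
  simp [letters, Finsupp.lcomapDomain]

theorem letters_letter (x : γ →₀ R) : letters (letter x) = x := by
  refine eq_of_single (letters ∘ₗ letter) LinearMap.id (fun a => ?_) x
  rw [LinearMap.comp_apply, letter_single]
  ext b
  classical
  simp [letters, Finsupp.lcomapDomain, Finsupp.single_apply]

theorem letters_cons_cons (a b : γ) (w : List γ) :
    letters (single (a :: b :: w) (1 : R)) = 0 := by
  ext c
  simp [letters, Finsupp.lcomapDomain]

variable (m e κ)

/-- The term of the differential of `κ Y x` in which the first letter of `Y` is multiplied to `κ`
from the left. -/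
def leftEnd (x : γ →₀ R) : (List γ →₀ R) →ₗ[R] (γ →₀ R) :=
  lin fun Y => match Y with
    | [] => 0
    | y :: Y => sgn R (e y) • mulS m (single y 1) (κ (single Y 1) (gr e (e y) x))

theorem leftEnd_nil (x : γ →₀ R) : leftEnd m e κ x (single [] 1) = 0 := lin_single _ _

theorem leftEnd_cons (x : γ →₀ R) (y : γ) (Y : List γ) : leftEnd m e κ x (single (y :: Y) 1) =
    sgn R (e y) • mulS m (single y 1) (κ (single Y 1) (gr e (e y) x)) := lin_single _ _

/-- The terms of the differential of `κ Y x` in which the last letter of `Y` is multiplied to `κ`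
from the right, as a function of the deconcatenation of `Y`. -/
def rightEnd (x : γ →₀ R) : (List γ × List γ →₀ R) →ₗ[R] (γ →₀ R) :=
  lin fun p => mulS m (gr e 1 (κ (single p.1 1) x)) (letters (single p.2 1))

variable {m e κ}

/-- The passing letter is the first one of `q`, and `letters` selects the cut right behind it.
Written as a sum over all cuts, the term can be regrouped by coassociativity. -/
theorem merge_barMulPass (a : γ →₀ R) (X q : List γ →₀ R) :
    merge m a (barMulPass e κ X q) =
      lin (fun p : List γ × List γ => letter (mulS m a (letters (single p.1 1))) ⋄
        barMul e κ (gr (wdeg e) (wdeg e p.1) X) (single p.2 1)) (deconcat q) := by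
  induction q using cat_induction with
  | zero => simp
  | add x y hx hy => simp only [map_add, hx, hy]
  | smul c x h => simp only [map_smul, h]
  | one => rw [barMulPass_nil, deconcat_nil, lin_single, letters_nil, map_zero, map_zero,
      map_zero, zero_cat]
  | letter y w ih =>
    rw [barMulPass_single_cat, merge_single_cat, deconcat_single_cat, map_add, single_cat,
      tmul_single, lin_single, letters_nil, map_zero, map_zero, zero_cat, zero_add]
    have h : lin (fun p : List γ × List γ => letter (mulS m a (letters (single p.1 1))) ⋄
        barMul e κ (gr (wdeg e) (wdeg e p.1) X) (single p.2 1)) ∘ₗ lcat _ (single [y] (1 : R)) =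
        catL (letter (mulS m a (single y 1))) ∘ₗ barMul e κ (gr (wdeg e) (e y) X) ∘ₗ
          lin (fun p : List γ × List γ => (single p.1 (1 : R)) [] • single p.2 1) :=
        ext_single fun p => by
      obtain ⟨p, q⟩ := p
      rw [LinearMap.comp_apply, LinearMap.comp_apply, LinearMap.comp_apply, lcat_single, single_cat,
        tmul_single, lin_single, lin_single]
      rcases p with _ | ⟨b, p⟩
      · have := letters_letter (single y (1 : R))
        rw [letter_single] at this
        simp [this, catL_apply, wdeg_cons, wdeg_nil]
      · simp [letters_cons_cons, zero_cat]
    have h := LinearMap.congr_fun h (deconcat (single w 1))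
    rw [LinearMap.comp_apply, LinearMap.comp_apply, LinearMap.comp_apply, deconcat_counit_left] at h
    rw [h, catL_apply]

/-- Coassociativity of the deconcatenation, for functions on triples of words. -/
theorem deconcat_coassoc_lin {M : Type*} [AddCommGroup M] [Module R M]
    (F : (List γ × List γ × List γ →₀ R) →ₗ[R] M) (G H : (List γ × List γ →₀ R) →ₗ[R] M)
    (hG : ∀ p q, G (single (p, q) 1) = F (assoc (tmul (deconcat (single p 1)) (single q 1))))
    (hH : ∀ p q, H (single (p, q) 1) = F (tmul (single p 1) (deconcat (single q 1))))
    (Y : List γ →₀ R) : G (deconcat Y) = H (deconcat Y) := by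
  have h1 : G = F ∘ₗ assoc ∘ₗ tmap deconcat LinearMap.id := ext_single fun p => by
    rw [LinearMap.comp_apply, LinearMap.comp_apply, tmap_single, hG]; rfl
  have h2 : H = F ∘ₗ tmap LinearMap.id deconcat := ext_single fun p => by
    rw [LinearMap.comp_apply, tmap_single, hH]; rfl
  rw [h1, h2, LinearMap.comp_apply, LinearMap.comp_apply, LinearMap.comp_apply, deconcat_coassoc]

/-- The first two factors of the deconcatenation of a word of degree `k`. -/
theorem deconcat_mem_homog (p : List γ) :
    deconcat (single p (1 : R)) ∈ homog (pdeg (wdeg e)) (wdeg e p) := by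
  have := hasDegree_iff.1 (hasDegree_deconcat (R := R) e) p
  rwa [add_zero] at this

/-- Both sides run over the cuts of `Y` into a word inserted into `x`, one letter multiplied from
the right, and a rest. They differ in the order of the two cuts. -/
theorem rightEnd_barMul (hκ : ∀ Y x, κ (single Y 1) (single x 1) ∈ homog e (e x + wdeg e Y))
    (x : γ →₀ R) (X Y : List γ →₀ R) :
    lin (fun p : List γ × List γ => letter (rightEnd m e κ x (deconcat (single p.1 1))) ⋄
      barMul e κ (gr (wdeg e) (wdeg e p.1) X) (single p.2 1)) (deconcat Y) =
    lin (fun p : List γ × List γ => merge m (gr e 1 (κ (single p.1 1) x))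
      (barMulPass e κ (gr (wdeg e) (wdeg e p.1) X) (single p.2 1))) (deconcat Y) := by
  refine deconcat_coassoc_lin (lin fun t : List γ × List γ × List γ =>
    letter (mulS m (gr e 1 (κ (single t.1 1) x)) (letters (single t.2.1 1))) ⋄
      barMul e κ (gr (wdeg e) (wdeg e t.1 + wdeg e t.2.1) X) (single t.2.2 1)) _ _ ?_ ?_ Y
  · intro p q
    rw [lin_single]
    refine homog_induction (p := fun Z => letter (rightEnd m e κ x Z) ⋄
      barMul e κ (gr (wdeg e) (wdeg e p) X) (single q 1) = lin (fun t : List γ × List γ × List γ =>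
    letter (mulS m (gr e 1 (κ (single t.1 1) x)) (letters (single t.2.1 1))) ⋄
      barMul e κ (gr (wdeg e) (wdeg e t.1 + wdeg e t.2.1) X) (single t.2.2 1))
        (assoc (tmul Z (single q 1)))) (deconcat_mem_homog (e := e) p) ?_ ?_ ?_ ?_
    · simp [zero_cat, zero_tmul]
    · intro Z W hZ hW; simp only [add_tmul, map_add, add_cat, hZ, hW]
    · intro c Z hZ; simp only [smul_tmul, map_smul, smul_cat, hZ]
    · rintro ⟨r, s⟩ hr
      rw [tmul_single, assoc_single, lin_single, rightEnd, lin_single, ← hr]; rfl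
  · intro p q
    rw [lin_single, merge_barMulPass]
    refine LinearMap.congr_fun (g := lin (fun t : List γ × List γ × List γ =>
      letter (mulS m (gr e 1 (κ (single t.1 1) x)) (letters (single t.2.1 1))) ⋄
      barMul e κ (gr (wdeg e) (wdeg e t.1 + wdeg e t.2.1) X) (single t.2.2 1)) ∘ₗ
        tmulL (single p 1)) (ext_single fun t => ?_) _
    rw [LinearMap.comp_apply, tmulL_apply, tmul_single, lin_single, lin_single, gr_gr,
      add_comm (wdeg e t.1)]

/-- The letter multiplied from the left has to be `y`, the first of the word: the cut before `y`
contributes nothing, and in all other terms `y` factors out. -/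
theorem leftEnd_barMul (x : γ) (X : List γ) (y : γ) (Y : List γ →₀ R) :
    lin (fun p : List γ × List γ => letter (leftEnd m e κ (single x (1 : R)) (single p.1 1)) ⋄
      barMul e κ (gr (wdeg e) (wdeg e p.1) (single X (1 : R))) (single p.2 1))
        (deconcat (single [y] 1 ⋄ Y)) =
    sgn R (e y) • merge m (single y 1) (barMulInsert e κ (gr e (e y) (single x (1 : R)))
      (gr (wdeg e) (e y) (single X (1 : R))) (deconcat Y)) := by
  rw [deconcat_single_cat, map_add]
  have h1 : lin (fun p : List γ × List γ => letter (leftEnd m e κ (single x (1 : R)) (single p.1 1)) ⋄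
      barMul e κ (gr (wdeg e) (wdeg e p.1) (single X (1 : R))) (single p.2 1)) ∘ₗ
        tmulL (single [] (1 : R)) = 0 := ext_single fun q => by
    rw [LinearMap.comp_apply, tmulL_apply, tmul_single, lin_single, leftEnd_nil, map_zero, zero_cat]
    rfl
  have h2 : lin (fun p : List γ × List γ => letter (leftEnd m e κ (single x (1 : R)) (single p.1 1)) ⋄
      barMul e κ (gr (wdeg e) (wdeg e p.1) (single X (1 : R))) (single p.2 1)) ∘ₗ
        lcat _ (single [y] (1 : R)) = sgn R (e y) • merge m (single y 1) ∘ₗ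
          barMulInsert e κ (gr e (e y) (single x (1 : R))) (gr (wdeg e) (e y) (single X (1 : R))) :=
      ext_single fun p => by
    obtain ⟨p, q⟩ := p
    rw [LinearMap.comp_apply, LinearMap.smul_apply, LinearMap.comp_apply, lcat_single, single_cat,
      tmul_single, lin_single, barMulInsert_single, merge_letter_cat, gr_gr, List.singleton_append,
      leftEnd_cons, map_smul, smul_cat, wdeg_cons, add_comm (e y)]
  have h1 := LinearMap.congr_fun h1 (single [y] 1 ⋄ Y)
  have h2 := LinearMap.congr_fun h2 (deconcat Y)
  rw [LinearMap.comp_apply, tmulL_apply, LinearMap.zero_apply] at h1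
  rw [LinearMap.comp_apply, LinearMap.smul_apply, LinearMap.comp_apply] at h2
  rw [h1, h2, zero_add]

/-- The function on triples of words used to compare `merge_barMulInsert`. -/
def mergeInsert₃ (m : γ → γ → γ) (e : γ → ℤ) (κ : (List γ →₀ R) →ₗ[R] (γ →₀ R) →ₗ[R] (γ →₀ R))
    (x x' : γ) (X : List γ) : (List γ × List γ × List γ →₀ R) →ₗ[R] (List γ →₀ R) :=
  lin fun t => (sgn R (e x) * sgn R (wdeg e t.1 * (e x' - 1))) •
    letter (mulS m (κ (single t.1 1) (single x 1)) (κ (single t.2.1 1) (single x' 1))) ⋄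
      barMul e κ (gr (wdeg e) (wdeg e t.1 + wdeg e t.2.1) (single X 1)) (single t.2.2 1)

theorem mergeInsert₃_single (x x' : γ) (X r s t : List γ) :
    mergeInsert₃ m e κ x x' X (single (r, s, t) 1) =
      (sgn R (e x) * sgn R (wdeg e r * (e x' - 1))) •
      letter (mulS m (κ (single r 1) (single x 1)) (κ (single s 1) (single x' 1))) ⋄
        barMul e κ (gr (wdeg e) (wdeg e r + wdeg e s) (single X 1)) (single t 1) :=
  lin_single _ _

/-- The hypothesis `hmul` distributes a word inserted into a product over the two factors;
coassociativity turns this into two successive cuts. -/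
theorem merge_barMulInsert (hκ : ∀ Y x, κ (single Y 1) (single x 1) ∈ homog e (e x + wdeg e Y))
    (hmul : ∀ Y x x', κ (single Y 1) (single (m x x') 1) =
      lin (fun p : List γ × List γ => sgn R (wdeg e p.1 * (e x' - 1)) •
        mulS m (κ (single p.1 1) (single x 1)) (κ (single p.2 1) (single x' 1)))
        (deconcat (single Y (1 : R))))
    (x x' : γ) (X : List γ) (Y : List γ →₀ R) :
    sgn R (e x) • barMulInsert e κ (single (m x x') 1) (single X 1) (deconcat Y) =
    lin (fun p : List γ × List γ => merge m (gr e 1 (κ (single p.1 1) (single x (1 : R))))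
      (barMulInsert e κ (gr e (wdeg e p.1) (single x' (1 : R)))
        (gr (wdeg e) (wdeg e p.1) (single X (1 : R))) (deconcat (single p.2 1)))) (deconcat Y) := by
  rw [← LinearMap.smul_apply]
  refine deconcat_coassoc_lin (mergeInsert₃ m e κ x x' X) _ _ ?_ ?_ Y
  · intro p q
    rw [LinearMap.smul_apply, barMulInsert_single, hmul]
    set G := lin (R := R) (fun p : List γ × List γ => sgn R (wdeg e p.1 * (e x' - 1)) •
      mulS m (κ (single p.1 1) (single x (1 : R))) (κ (single p.2 1) (single x' (1 : R)))) with hG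
    have h : ∀ Z ∈ homog (R := R) (pdeg (wdeg e)) (wdeg e p), sgn R (e x) • letter (G Z) ⋄
        barMul e κ (gr (wdeg e) (wdeg e p) (single X 1)) (single q 1) =
        mergeInsert₃ m e κ x x' X (assoc (tmul Z (single q 1))) := fun Z hZ => by
      refine homog_induction (p := fun Z => sgn R (e x) • letter (G Z) ⋄
        barMul e κ (gr (wdeg e) (wdeg e p) (single X 1)) (single q 1) =
        mergeInsert₃ m e κ x x' X (assoc (tmul Z (single q 1)))) hZ ?_ ?_ ?_ ?_
      · simp [zero_cat, zero_tmul]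
      · intro Z W hZ hW; simp only [add_tmul, map_add, add_cat, smul_add, hZ, hW]
      · intro c Z hZ; simp only [smul_tmul, map_smul, smul_cat, ← hZ]; rw [smul_comm]
      · rintro ⟨r, s⟩ hr
        rw [tmul_single, assoc_single, mergeInsert₃_single, hG, lin_single, ← hr, map_smul, smul_cat,
          smul_smul]
        rfl
    exact h _ (deconcat_mem_homog p)
  · intro p q
    rw [lin_single]
    have h : merge m (gr e 1 (κ (single p 1) (single x (1 : R)))) ∘ₗ
        barMulInsert e κ (gr e (wdeg e p) (single x' (1 : R)))
          (gr (wdeg e) (wdeg e p) (single X (1 : R))) =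
        mergeInsert₃ m e κ x x' X ∘ₗ tmulL (single p 1) := ext_single fun t => by
      rw [LinearMap.comp_apply, LinearMap.comp_apply, tmulL_apply, tmul_single, mergeInsert₃_single,
        barMulInsert_single, merge_letter_cat, gr_gr, gr_homog (hκ p x), gr_single,
        add_comm (wdeg e p)]
      simp only [map_smul, LinearMap.smul_apply, smul_cat, smul_smul, ← sgn_add]
      congr 1
      rw [one_mul, mul_sub, mul_one]
      simp only [sgn_add, sgn_sub]
      ring
    exact LinearMap.congr_fun h (deconcat (single q 1))

end BarDifferential

end

end DoubleCobar

namespace DoubleCobar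

open Finsupp (single)

noncomputable section

/-! ### The Leibniz rule for the product on the bar construction -/

section BarDGAlgebra

variable {R : Type v} [CommRing R] {γ : Type*} {m : γ → γ → γ} {e : γ → ℤ} {δ : γ → (γ →₀ R)}
  {κ : (List γ →₀ R) →ₗ[R] (γ →₀ R) →ₗ[R] (γ →₀ R)}

/-- The bar differential acts on the leading letter through `hdiff`, merges it with what follows, or
acts on the rest through `hX`. The mergers and the two end terms are kept for cancellation. -/
theorem barDiff_barMulInsert
    (hκ : ∀ Y x, κ (single Y 1) (single x 1) ∈ homog e (e x + wdeg e Y)) (x : γ) (X : List γ)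
    (hX : ∀ Y, barDiff m e δ (barMul e κ (single X 1) Y) =
      barMul e κ (barDiff m e δ (single X 1)) Y +
        barMul e κ (gr (wdeg e) 1 (single X 1)) (barDiff m e δ Y))
    (hd : HasDegree (wdeg e) (wdeg e) (-1) (barDiff m e δ))
    (hdiff : ∀ Y x, lin δ (κ (single Y 1) (single x 1)) = κ (single Y 1) (δ x) -
      sgn R (e x) • κ (barDiff m e δ (single Y 1)) (single x 1) +
      rightEnd m e κ (single x 1) (deconcat (single Y 1)) +
      leftEnd m e κ (single x 1) (single Y 1)) (D : List γ × List γ →₀ R) :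
    barDiff m e δ (barMulInsert e κ (single x 1) (single X 1) D) =
      -barMulInsert e κ (δ x) (single X 1) D +
      sgn R (e x) • barMulInsert e κ (single x 1) (barDiff m e δ (single X 1)) D +
      barMulInsert e κ (gr e 1 (single x 1)) (gr (wdeg e) 1 (single X 1))
        (tensorD (wdeg e) (barDiff m e δ) (barDiff m e δ) D) +
      lin (fun p : List γ × List γ => merge m (gr e 1 (κ (single p.1 1) (single x 1)))
        (barMul e κ (gr (wdeg e) (wdeg e p.1) (single X 1)) (single p.2 1))) D -
      lin (fun p : List γ × List γ =>
        letter (rightEnd m e κ (single x 1) (deconcat (single p.1 1))) ⋄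
        barMul e κ (gr (wdeg e) (wdeg e p.1) (single X 1)) (single p.2 1)) D -
      lin (fun p : List γ × List γ => letter (leftEnd m e κ (single x 1) (single p.1 1)) ⋄
        barMul e κ (gr (wdeg e) (wdeg e p.1) (single X 1)) (single p.2 1)) D := by
  have h : barDiff m e δ ∘ₗ barMulInsert e κ (single x 1) (single X 1) =
      -barMulInsert e κ (δ x) (single X 1) +
      sgn R (e x) • barMulInsert e κ (single x 1) (barDiff m e δ (single X 1)) +
      barMulInsert e κ (gr e 1 (single x 1)) (gr (wdeg e) 1 (single X 1)) ∘ₗ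
        tensorD (wdeg e) (barDiff m e δ) (barDiff m e δ) +
      lin (fun p : List γ × List γ => merge m (gr e 1 (κ (single p.1 1) (single x 1)))
        (barMul e κ (gr (wdeg e) (wdeg e p.1) (single X 1)) (single p.2 1))) -
      lin (fun p : List γ × List γ =>
        letter (rightEnd m e κ (single x 1) (deconcat (single p.1 1))) ⋄
        barMul e κ (gr (wdeg e) (wdeg e p.1) (single X 1)) (single p.2 1)) -
      lin (fun p : List γ × List γ => letter (leftEnd m e κ (single x 1) (single p.1 1)) ⋄
        barMul e κ (gr (wdeg e) (wdeg e p.1) (single X 1)) (single p.2 1)) := by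
    refine ext_single fun p => ?_
    obtain ⟨p, q⟩ := p
    have hp : (single p 1 : List γ →₀ R) ∈ homog (wdeg e) (wdeg e p) := single_mem_homog rfl
    have hX' : (single X 1 : List γ →₀ R) ∈ homog (wdeg e) (wdeg e X) := single_mem_homog rfl
    simp only [LinearMap.sub_apply, LinearMap.add_apply, LinearMap.neg_apply, LinearMap.smul_apply,
      LinearMap.comp_apply, lin_single]
    rw [← tmul_single, tensorD_tmul, map_add (barMulInsert e κ (gr e 1 (single x 1)) _),
      barMulInsert_tmul _ _ hp, barMulInsert_tmul _ _ hp, barMulInsert_tmul _ _ hp,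
      barMulInsert_tmul _ _ (hd.mem hp rfl), gr_homog hp, smul_tmul, map_smul,
      barMulInsert_tmul _ _ hp, barDiff_letter_cat, hdiff, gr_homog (hκ p x), gr_gr,
      gr_homog hX', gr_homog hX', gr_homog hX', gr_homog (hd.mem hX' rfl), gr_single]
    simp only [map_smul, LinearMap.smul_apply, hX, map_add, map_sub, add_cat, sub_cat, smul_cat,
      cat_smul, cat_add, smul_add, gr_homog hX']
    have := @sgn_mul_self R _
    generalize barMul e κ (barDiff m e δ (single X 1)) (single q 1) = A1
    generalize barMul e κ (single X 1) (barDiff m e δ (single q 1)) = A2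
    generalize barMul e κ (single X 1) (single q 1) = A3
    clear hdiff hX hd hκ
    match_scalars <;> simp only [mul_sub, sub_mul, mul_add, add_mul, sgn_sub, sgn_add, sgn_neg,
      sgn_one, mul_one, one_mul, neg_mul, mul_neg] <;> grind
  have h := LinearMap.congr_fun h D
  simpa only [LinearMap.sub_apply, LinearMap.add_apply, LinearMap.neg_apply, LinearMap.smul_apply,
      LinearMap.comp_apply] using h

/-- Behind the leading letter comes either a passing letter of `Y`, and merging yields the
`rightEnd` terms, or the next letter of `X` with an insertion, and merging yields an insertion into
the product of the first two letters. -/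
theorem merge_barMul (hκ : ∀ Y x, κ (single Y 1) (single x 1) ∈ homog e (e x + wdeg e Y))
    (hmul : ∀ Y x x', κ (single Y 1) (single (m x x') 1) =
      lin (fun p : List γ × List γ => sgn R (wdeg e p.1 * (e x' - 1)) •
        mulS m (κ (single p.1 1) (single x 1)) (κ (single p.2 1) (single x' 1)))
        (deconcat (single Y (1 : R))))
    (x : γ) (X : List γ) (Y : List γ →₀ R) :
    lin (fun p : List γ × List γ => merge m (gr e 1 (κ (single p.1 1) (single x 1)))
      (barMul e κ (gr (wdeg e) (wdeg e p.1) (single X 1)) (single p.2 1))) (deconcat Y) =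
      lin (fun p : List γ × List γ =>
        letter (rightEnd m e κ (single x 1) (deconcat (single p.1 1))) ⋄
        barMul e κ (gr (wdeg e) (wdeg e p.1) (single X 1)) (single p.2 1)) (deconcat Y) +
      sgn R (e x) • (barMul e κ (merge m (single x 1) (single X 1)) Y -
        barMulPass e κ (merge m (single x 1) (single X 1)) Y) := by
  rw [rightEnd_barMul hκ]
  rcases X with _ | ⟨x', X⟩
  · rw [merge_nil]
    simp only [map_zero, LinearMap.zero_apply, sub_zero, smul_zero, add_zero]
    refine LinearMap.congr_fun (ext_single fun p => ?_) _
    obtain ⟨p, q⟩ := p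
    rw [lin_single, lin_single, gr_single, wdeg_nil, mul_zero, sgn_zero, one_smul, barMul_one_left]
    rcases q with _ | ⟨b, q⟩
    · rw [merge_nil, barMulPass_nil, map_zero]
    · rw [single_cons, barMulPass_single_cat, gr_single, wdeg_nil, mul_zero, sgn_zero, one_smul,
        barMul_one_left]
  · rw [single_cons, merge_single_cat, barMul_letter_cat, add_sub_cancel_right, mulS_single,
      merge_barMulInsert hκ hmul, ← LinearMap.add_apply]
    refine LinearMap.congr_fun (ext_single fun p => ?_) _
    obtain ⟨p, q⟩ := p
    have hb := barMul_letter_cat e κ (gr e (wdeg e p) (single x' 1))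
      (gr (wdeg e) (wdeg e p) (single X 1)) (single q 1)
    rw [gr_single, map_smul, letter_single] at hb
    rw [LinearMap.add_apply, lin_single, lin_single, lin_single, ← map_add, gr_cat, add_comm,
      gr_single (wdeg e) _ [x'], wdeg_cons, wdeg_nil, add_zero, hb, gr_single e _ x']

theorem merge_barMulPass_gr (hm : ∀ a b, e (m a b) = e a + e b - 1) (X : List γ →₀ R) (y : γ)
    (Y : List γ →₀ R) : merge m (single y 1) (barMulPass e κ (gr (wdeg e) (e y) X) Y) =
      barMulPass e κ (gr (wdeg e) 1 X) (merge m (single y 1) Y) := by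
  induction Y using cat_induction with
  | zero => simp
  | add x y hx hy => simp only [map_add, hx, hy]
  | smul c x h => simp only [map_smul, h]
  | one => rw [barMulPass_nil, merge_nil, map_zero, map_zero]
  | letter z w ih =>
    rw [barMulPass_single_cat, merge_single_cat, merge_single_cat, mulS_single,
      letter_single, barMulPass_single_cat, gr_gr, gr_gr, hm]
    rw [show e z + e y = e y + e z - 1 + 1 by ring]

/-- The mergers with passing letters cancel the `rightEnd` terms. The remaining insertions are full
products minus their passing parts, by `barMul_letter_cat`, and only the `leftEnd` terms stay
uncancelled. -/
theorem barDiff_barMul_letter (hm : ∀ a b, e (m a b) = e a + e b - 1)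
    (hδ : ∀ a, δ a ∈ homog e (e a - 1))
    (hκ : ∀ Y x, κ (single Y 1) (single x 1) ∈ homog e (e x + wdeg e Y))
    (hmul : ∀ Y x x', κ (single Y 1) (single (m x x') 1) =
      lin (fun p : List γ × List γ => sgn R (wdeg e p.1 * (e x' - 1)) •
        mulS m (κ (single p.1 1) (single x 1)) (κ (single p.2 1) (single x' 1)))
        (deconcat (single Y (1 : R))))
    (hdiff : ∀ Y x, lin δ (κ (single Y 1) (single x 1)) = κ (single Y 1) (δ x) -
      sgn R (e x) • κ (barDiff m e δ (single Y 1)) (single x 1) +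
      rightEnd m e κ (single x 1) (deconcat (single Y 1)) +
      leftEnd m e κ (single x 1) (single Y 1)) (x : γ) (X : List γ)
    (hX : ∀ Y, barDiff m e δ (barMul e κ (single X 1) Y) =
      barMul e κ (barDiff m e δ (single X 1)) Y +
        barMul e κ (gr (wdeg e) 1 (single X 1)) (barDiff m e δ Y)) (W : List γ →₀ R) :
    barDiff m e δ (barMulInsert e κ (single x 1) (single X 1) (deconcat W)) =
      barMul e κ (barDiff m e δ (single [x] 1 ⋄ single X 1)) W -
      barMulPass e κ (barDiff m e δ (single [x] 1 ⋄ single X 1)) W +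
      barMul e κ (gr (wdeg e) 1 (single [x] 1 ⋄ single X 1)) (barDiff m e δ W) -
      barMulPass e κ (gr (wdeg e) 1 (single [x] 1 ⋄ single X 1)) (barDiff m e δ W) -
      lin (fun p : List γ × List γ => letter (leftEnd m e κ (single x 1) (single p.1 1)) ⋄
        barMul e κ (gr (wdeg e) (wdeg e p.1) (single X 1)) (single p.2 1)) (deconcat W) := by
  have hd := hasDegree_barDiff (R := R) hm hδ
  have h1 := barMul_letter_cat e κ (δ x) (single X 1) W
  have h2 := barMul_letter_cat e κ (single x 1) (barDiff m e δ (single X 1)) W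
  have h3 := barMul_letter_cat e κ (gr e 1 (single x (1 : R))) (gr (wdeg e) 1 (single X 1))
    (barDiff m e δ W)
  have h4 : gr (wdeg e) 1 (single [x] (1 : R)) = letter (gr e 1 (single x 1)) := by
    rw [gr_single, gr_single, map_smul, letter_single, wdeg_cons, wdeg_nil, add_zero]
  rw [letter_single] at h2
  rw [barDiff_barMulInsert hκ x X hX hd hdiff, merge_barMul hκ hmul, ← deconcat_barDiff,
    barDiff_single_cat, gr_cat, h4]
  simp only [map_add, map_neg, map_smul, LinearMap.add_apply, LinearMap.neg_apply,
    LinearMap.smul_apply, smul_cat, h1, h2, h3, smul_add, smul_sub]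
  abel

/-- Double induction following `barMul_letter_cat`. The `leftEnd` terms left over by the insertions
cancel against those in which a passing letter `y` is merged with an insertion right behind it. -/
theorem barDiff_barMul (hm : ∀ a b, e (m a b) = e a + e b - 1)
    (hδ : ∀ a, δ a ∈ homog e (e a - 1))
    (hκ₀ : ∀ x, κ (single [] 1) x = x)
    (hκ : ∀ Y x, κ (single Y 1) (single x 1) ∈ homog e (e x + wdeg e Y))
    (hmul : ∀ Y x x', κ (single Y 1) (single (m x x') 1) =
      lin (fun p : List γ × List γ => sgn R (wdeg e p.1 * (e x' - 1)) •
        mulS m (κ (single p.1 1) (single x 1)) (κ (single p.2 1) (single x' 1)))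
        (deconcat (single Y (1 : R))))
    (hdiff : ∀ Y x, lin δ (κ (single Y 1) (single x 1)) = κ (single Y 1) (δ x) -
      sgn R (e x) • κ (barDiff m e δ (single Y 1)) (single x 1) +
      rightEnd m e κ (single x 1) (deconcat (single Y 1)) +
      leftEnd m e κ (single x 1) (single Y 1)) (X Y : List γ →₀ R) :
    barDiff m e δ (barMul e κ X Y) = barMul e κ (barDiff m e δ X) Y +
      barMul e κ (gr (wdeg e) 1 X) (barDiff m e δ Y) := by
  have hd := hasDegree_barDiff (R := R) hm hδ
  induction X using cat_induction generalizing Y with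
  | zero => simp
  | add x y hx hy => simp only [map_add, LinearMap.add_apply, hx, hy]; abel
  | smul c x h => simp only [map_smul, LinearMap.smul_apply, h, smul_add]
  | one => rw [barDiff_nil, gr_single, wdeg_nil, mul_zero, sgn_zero, one_smul, barMul_one_left,
      barMul_one_left, map_zero, LinearMap.zero_apply, zero_add]
  | letter x X ih =>
    have hE := barDiff_barMul_letter hm hδ hκ hmul hdiff x X ih
    induction Y using cat_induction with
    | zero => simp
    | add x y hx hy => simp only [map_add, hx, hy]; abel
    | smul c x h => simp only [map_smul, h, smul_add]
    | one => rw [barDiff_nil, map_zero, add_zero, barMul_one_right hκ₀, barMul_one_right hκ₀]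
    | letter y Y ihY =>
      have h0 := barMul_letter_cat e κ (single x 1) (single X 1) (single [y] 1 ⋄ single Y 1)
      have h1 := barMul_letter_cat e κ (gr e (e y) (single x (1 : R)))
        (gr (wdeg e) (e y) (single X 1)) (single Y 1)
      have h4 : letter (gr e (e y) (single x (1 : R))) = gr (wdeg e) (e y) (single [x] 1) := by
        rw [gr_single, gr_single, map_smul, letter_single, wdeg_cons, wdeg_nil, add_zero]
      have h5 : (single [x] 1 ⋄ single X 1 : List γ →₀ R) ∈ homog (wdeg e) (wdeg e (x :: X)) := by
        rw [← single_cons]; exact single_mem_homog rfl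
      have h6 := hd.mem h5 rfl
      have hF := leftEnd_barMul (m := m) (κ := κ) (e := e) x X y (single Y (1 : R))
      have hG := merge_barMulPass_gr (κ := κ) hm (single [x] 1 ⋄ single X 1) y (single Y 1)
      rw [letter_single] at h0
      rw [h4, ← gr_cat] at h1
      -- The insertion part in `hF` is replaced by the full product minus its passing part, so that
      -- the `leftEnd` terms match those from the differential of the passing part.
      rw [eq_sub_of_add_eq h1.symm, map_sub, hG] at hF
      rw [h0, map_add, hE, hF]
      clear h0 hE hF hG h1 h4
      generalize (single [x] (1 : R) ⋄ single X (1 : R)) = Z at *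
      simp only [barMulPass_single_cat, barDiff_single_cat _ _ _ y, map_add, map_neg, map_smul,
        barMulPass_letter_cat e κ _ (hδ y), gr_gr, sub_add_cancel, gr_homog h6]
      simp only [gr_homog h5, map_smul, LinearMap.smul_apply, ihY, cat_smul, smul_smul, smul_add,
        cat_add]
      have := @sgn_mul_self R _
      generalize barMul e κ (barDiff m e δ Z) (single Y 1) = A1
      generalize barMul e κ Z (barDiff m e δ (single Y 1)) = A2
      generalize barMul e κ Z (single Y 1) = A3
      clear hdiff ihY ih hd hκ hκ₀ hmul
      match_scalars <;> (try simp only [mul_sub, sub_mul, mul_add, add_mul, sgn_sub, sgn_add,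
        sgn_neg, sgn_one, mul_one, one_mul, neg_mul, mul_neg]) <;> grind

end BarDGAlgebra

end

end DoubleCobar

namespace DoubleCobar

open Finsupp (single)

noncomputable section

/-! ### Convolution of maps from the tensor coalgebra to a tensor algebra -/

section Convolution

variable {R : Type v} [CommRing R] {β γ : Type*}

/-- The convolution product of linear maps from the tensor coalgebra to a tensor algebra. -/
def conv : ((List γ →₀ R) →ₗ[R] (List β →₀ R)) →ₗ[R] ((List γ →₀ R) →ₗ[R] (List β →₀ R)) →ₗ[R]
    ((List γ →₀ R) →ₗ[R] (List β →₀ R)) :=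
  LinearMap.mk₂ R (fun F G => lin (fun p : List γ × List γ =>
      F (single p.1 1) ⋄ G (single p.2 1)) ∘ₗ deconcat)
    (fun F F' G => by
      rw [← LinearMap.add_comp]; congr 1; refine ext_single fun p => ?_
      simp only [LinearMap.add_apply, lin_single, add_cat])
    (fun c F G => by
      rw [← LinearMap.smul_comp]; congr 1; refine ext_single fun p => ?_
      simp only [LinearMap.smul_apply, lin_single, smul_cat])
    (fun F G G' => by
      rw [← LinearMap.add_comp]; congr 1; refine ext_single fun p => ?_
      simp only [LinearMap.add_apply, lin_single, cat_add])
    (fun c F G => by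
      rw [← LinearMap.smul_comp]; congr 1; refine ext_single fun p => ?_
      simp only [LinearMap.smul_apply, lin_single, cat_smul])

/-- The convolution product, as a function of the coproduct. -/
def convMap (F G : (List γ →₀ R) →ₗ[R] (List β →₀ R)) :
    (List γ × List γ →₀ R) →ₗ[R] (List β →₀ R) :=
  lin fun p : List γ × List γ => F (single p.1 1) ⋄ G (single p.2 1)

theorem convMap_tmul (F G : (List γ →₀ R) →ₗ[R] (List β →₀ R)) (X Y : List γ →₀ R) :
    convMap F G (tmul X Y) = F X ⋄ G Y := by
  have h : convMap F G = concat ∘ₗ tmap F G := ext_single fun p => by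
    rw [convMap, lin_single, LinearMap.comp_apply, tmap_single]; rfl
  rw [h, LinearMap.comp_apply, tmap_tmul]; rfl

theorem convMap_single (F G : (List γ →₀ R) →ₗ[R] (List β →₀ R)) (p q : List γ) :
    convMap F G (single (p, q) 1) = F (single p 1) ⋄ G (single q 1) := lin_single _ _

theorem conv_apply (F G : (List γ →₀ R) →ₗ[R] (List β →₀ R)) (Y : List γ →₀ R) :
    conv F G Y = convMap F G (deconcat Y) := rfl

theorem conv_nil (F G : (List γ →₀ R) →ₗ[R] (List β →₀ R)) :
    conv F G (single [] 1) = F (single [] 1) ⋄ G (single [] 1) := by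
  rw [conv_apply, deconcat_nil, convMap_single]

theorem conv_cons (F G : (List γ →₀ R) →ₗ[R] (List β →₀ R)) (y : γ) (Y : List γ →₀ R) :
    conv F G (single [y] 1 ⋄ Y) = F (single [] 1) ⋄ G (single [y] 1 ⋄ Y) +
      conv (F ∘ₗ catL (single [y] 1)) G Y := by
  have h : convMap F G ∘ₗ lcat _ (single [y] (1 : R)) = convMap (F ∘ₗ catL (single [y] 1)) G :=
    ext_tmul fun u w => by
      rw [LinearMap.comp_apply, lcat_tmul, convMap_tmul, convMap_tmul]; rfl
  have h := LinearMap.congr_fun h (deconcat Y)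
  rw [LinearMap.comp_apply] at h
  rw [conv_apply, deconcat_single_cat, map_add, convMap_tmul, h, conv_apply]

theorem conv_assoc (F G H : (List γ →₀ R) →ₗ[R] (List β →₀ R)) :
    conv (conv F G) H = conv F (conv G H) := by
  refine LinearMap.ext fun Y => ?_
  set M : (List γ × List γ × List γ →₀ R) →ₗ[R] (List β →₀ R) := lin fun t =>
    F (single t.1 1) ⋄ G (single t.2.1 1) ⋄ H (single t.2.2 1) with hM
  rw [conv_apply, conv_apply]
  refine deconcat_coassoc_lin M _ _ (fun p q => ?_) (fun p q => ?_) Y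
  · have : M ∘ₗ assoc ∘ₗ tmulL.flip (single q 1) = catR (H (single q 1)) ∘ₗ convMap F G :=
      ext_single fun t => by
        obtain ⟨t, u⟩ := t
        rw [LinearMap.comp_apply, LinearMap.comp_apply, LinearMap.comp_apply, LinearMap.flip_apply,
          tmulL_apply, tmul_single, assoc_single, hM, lin_single, convMap_single, catR_apply,
          cat_assoc]
    exact (convMap_single _ _ _ _).trans (LinearMap.congr_fun this (deconcat (single p 1))).symm
  · have : M ∘ₗ tmulL (single p 1) = catL (F (single p 1)) ∘ₗ convMap G H :=
      ext_single fun t => by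
        obtain ⟨t, u⟩ := t
        rw [LinearMap.comp_apply, LinearMap.comp_apply,
          tmulL_apply, tmul_single, hM, lin_single, convMap_single, catL_apply]
    exact (convMap_single _ _ _ _).trans (LinearMap.congr_fun this (deconcat (single q 1))).symm

/-- The map with value `x` on the empty word which vanishes on the other words. -/
def atNil (x : List β →₀ R) : (List γ →₀ R) →ₗ[R] (List β →₀ R) :=
  (Finsupp.lapply []).smulRight x

theorem atNil_apply (x : List β →₀ R) (Y : List γ →₀ R) : atNil x Y = Y [] • x := rfl

theorem single_cat_apply_nil (y : γ) (Y : List γ →₀ R) : (single [y] (1 : R) ⋄ Y) [] = 0 := by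
  refine eq_of_single (Finsupp.lapply [] ∘ₗ catL (single [y] (1 : R))) 0 (fun w => ?_) Y
  rw [LinearMap.comp_apply, catL_apply, single_cat]
  exact Finsupp.single_eq_of_ne (by simp)

/-- Only the cut before the whole word meets the support of `atNil x`. In particular `atNil` of the
unit is neutral for convolution. -/
theorem conv_atNil_left (x : List β →₀ R) (F : (List γ →₀ R) →ₗ[R] (List β →₀ R)) :
    conv (atNil x) F = catL x ∘ₗ F := by
  refine ext_single fun w => ?_
  rw [LinearMap.comp_apply, catL_apply]
  rcases w with _ | ⟨y, w⟩
  · rw [conv_nil, atNil_apply, Finsupp.single_eq_same, one_smul]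
  · have : atNil x ∘ₗ catL (single [y] (1 : R)) = 0 := LinearMap.ext fun Y => by
      rw [LinearMap.comp_apply, atNil_apply, catL_apply, single_cat_apply_nil, zero_smul]; rfl
    rw [single_cons, conv_cons, this, map_zero, atNil_apply, Finsupp.single_eq_same, one_smul]
    exact add_zero _

theorem conv_atNil_right (x : List β →₀ R) (F : (List γ →₀ R) →ₗ[R] (List β →₀ R)) :
    conv F (atNil x) = catR x ∘ₗ F := by
  refine LinearMap.ext fun Y => ?_
  induction Y using cat_induction generalizing F with
  | zero => simp
  | add x y hx hy => simp only [map_add, hx, hy]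
  | smul c x h => simp only [map_smul, h]
  | one => rw [conv_nil, atNil_apply, Finsupp.single_eq_same, one_smul]; rfl
  | letter a w ih =>
    rw [conv_cons, ih, atNil_apply, single_cat_apply_nil, zero_smul, cat_zero, zero_add]; rfl

variable {s : β → ℤ} {e : γ → ℤ}

theorem IsDer.comp_conv {k : ℤ} {D : (List β →₀ R) →ₗ[R] (List β →₀ R)} (hD : IsDer s k D)
    (F G : (List γ →₀ R) →ₗ[R] (List β →₀ R)) :
    D ∘ₗ conv F G = conv (D ∘ₗ F) G + conv (gr (wdeg s) k ∘ₗ F) (D ∘ₗ G) := by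
  have : D ∘ₗ convMap F G = convMap (D ∘ₗ F) G + convMap (gr (wdeg s) k ∘ₗ F) (D ∘ₗ G) :=
    ext_tmul fun u w => by
      simp only [LinearMap.comp_apply, LinearMap.add_apply, convMap_tmul, hD _ _]
  exact LinearMap.ext fun Y => LinearMap.congr_fun this (deconcat Y)

theorem gr_comp_conv (k : ℤ) (F G : (List γ →₀ R) →ₗ[R] (List β →₀ R)) :
    gr (wdeg s) k ∘ₗ conv F G = conv (gr (wdeg s) k ∘ₗ F) (gr (wdeg s) k ∘ₗ G) := by
  have : gr (wdeg s) k ∘ₗ convMap F G = convMap (gr (wdeg s) k ∘ₗ F) (gr (wdeg s) k ∘ₗ G) :=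
    ext_tmul fun u w => by
      simp only [LinearMap.comp_apply, convMap_tmul, gr_cat]
  exact LinearMap.ext fun Y => LinearMap.congr_fun this (deconcat Y)

theorem conv_comp_gr (k : ℤ) (F G : (List γ →₀ R) →ₗ[R] (List β →₀ R)) :
    conv F G ∘ₗ gr (wdeg e) k = conv (F ∘ₗ gr (wdeg e) k) (G ∘ₗ gr (wdeg e) k) := by
  have : convMap F G ∘ₗ gr (pdeg (wdeg e)) k =
      convMap (F ∘ₗ gr (wdeg e) k) (G ∘ₗ gr (wdeg e) k) :=
    ext_single fun p => by
      obtain ⟨p, q⟩ := p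
      simp only [LinearMap.comp_apply, gr_single, map_smul, convMap_single, pdeg, smul_cat,
        cat_smul, smul_smul, ← sgn_add, mul_add, add_comm]
  refine LinearMap.ext fun Y => ?_
  have hgr := (hasDegree_deconcat (R := R) e).gr_map k Y
  rw [mul_zero, sgn_zero, one_smul] at hgr
  rw [LinearMap.comp_apply, conv_apply, ← hgr]
  exact LinearMap.congr_fun this (deconcat Y)

/-- The bar differential is a coderivation, so composing with it is a derivation of the convolution
product. -/
theorem conv_comp_barDiff (m : γ → γ → γ) (δ : γ → (γ →₀ R))
    (F G : (List γ →₀ R) →ₗ[R] (List β →₀ R)) :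
    conv F G ∘ₗ barDiff m e δ = conv (F ∘ₗ barDiff m e δ) G +
      conv (F ∘ₗ gr (wdeg e) 1) (G ∘ₗ barDiff m e δ) := by
  have : convMap F G ∘ₗ tensorD (wdeg e) (barDiff m e δ) (barDiff m e δ) =
      convMap (F ∘ₗ barDiff m e δ) G + convMap (F ∘ₗ gr (wdeg e) 1) (G ∘ₗ barDiff m e δ) :=
    ext_tmul fun u w => by
      simp only [LinearMap.comp_apply, LinearMap.add_apply, tensorD_tmul, map_add, convMap_tmul]
  refine LinearMap.ext fun Y => ?_
  rw [LinearMap.comp_apply, conv_apply, deconcat_barDiff]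
  exact LinearMap.congr_fun this (deconcat Y)

end Convolution

end

end DoubleCobar

namespace DoubleCobar

open Finsupp (single)

noncomputable section

/-! ### The augmentation ideal of a tensor algebra, with nonempty words as basis -/

section NonemptyWords

variable {R : Type v} [CommRing R] {β : Type*} (s : β → ℤ)

/-- Concatenation of nonempty words. -/
def nmul (x y : NE β) : NE β := ⟨x.1 ++ y.1, by simp [x.2]⟩

/-- The degree of a letter of the bar construction of the tensor algebra. -/
def bdeg (x : NE β) : ℤ := wdeg s x.1 + 1

/-- The inclusion of the augmentation ideal of the tensor algebra. -/
def nincl : (NE β →₀ R) →ₗ[R] (List β →₀ R) := lin fun x => single x.1 1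

/-- The projection onto the augmentation ideal of the tensor algebra. -/
def nred : (List β →₀ R) →ₗ[R] (NE β →₀ R) := Finsupp.lsubtypeDomain {w | w ≠ []}

theorem nincl_single (x : NE β) : nincl (single x (1 : R)) = single x.1 1 := lin_single _ _

theorem nred_single (x : NE β) : nred (single x.1 (1 : R)) = single x 1 := by
  ext c
  classical
  change single x.1 (1 : R) c.1 = _
  rw [Finsupp.single_apply, Finsupp.single_apply]
  exact if_congr Subtype.val_inj rfl rfl

theorem nred_nil : nred (single ([] : List β) (1 : R)) = 0 := by
  ext ⟨w, hw⟩
  exact Finsupp.single_eq_of_ne hw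

theorem nred_nincl (x : NE β →₀ R) : nred (nincl x) = x :=
  eq_of_single (nred ∘ₗ nincl) LinearMap.id (fun a => by
    rw [LinearMap.comp_apply, nincl_single, nred_single]; rfl) x

theorem nincl_nred (x : List β →₀ R) : nincl (nred x) = x - x [] • single [] 1 := by
  refine eq_of_single (nincl ∘ₗ nred)
    (LinearMap.id - (Finsupp.lapply []).smulRight (single [] 1)) (fun w => ?_) x
  rw [LinearMap.comp_apply, LinearMap.sub_apply]
  simp only [LinearMap.smulRight_apply, Finsupp.lapply_apply, LinearMap.id_apply]
  rcases eq_or_ne w [] with rfl | h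
  · simp [nred_nil]
  · rw [nred_single ⟨w, h⟩, nincl_single, Finsupp.single_eq_of_ne' h, zero_smul, sub_zero]

/-- It allows identities in the augmentation ideal to be checked in the tensor algebra, where
products are concatenations. -/
theorem nincl_injective : Function.Injective (nincl : (NE β →₀ R) → (List β →₀ R)) :=
  fun x y h => by rw [← nred_nincl x, h, nred_nincl]

theorem nincl_apply_nil (x : NE β →₀ R) : nincl x [] = 0 :=
  eq_of_single (Finsupp.lapply [] ∘ₗ nincl) 0 (fun a => by
    rw [LinearMap.comp_apply, nincl_single]; exact Finsupp.single_eq_of_ne' a.2) x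

theorem nincl_nred_of_apply_nil {x : List β →₀ R} (hx : x [] = 0) : nincl (nred x) = x := by
  rw [nincl_nred, hx, zero_smul, sub_zero]

theorem nincl_mulS (x y : NE β →₀ R) : nincl (mulS nmul x y) = nincl x ⋄ nincl y := by
  induction x using linear_induction with
  | zero => simp [zero_cat]
  | add x z hx hz => simp only [map_add, LinearMap.add_apply, hx, hz, add_cat]
  | smul c x h => simp only [map_smul, LinearMap.smul_apply, h, smul_cat]
  | single a =>
    induction y using linear_induction with
    | zero => simp [cat_zero]
    | add x z hx hz => simp only [map_add, hx, hz, cat_add]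
    | smul c x h => simp only [map_smul, h, cat_smul]
    | single b => rw [mulS_single, nincl_single, nincl_single, nincl_single, single_cat]; rfl

theorem bdeg_nmul (x y : NE β) : bdeg s (nmul x y) = bdeg s x + bdeg s y - 1 := by
  simp only [bdeg, nmul, wdeg_append]; ring

theorem nmul_assoc (x y z : NE β) : nmul (nmul x y) z = nmul x (nmul y z) :=
  Subtype.ext (List.append_assoc _ _ _)

/-- The shift by one appears because `bdeg` is the degree after suspension. -/
theorem nincl_mem_homog_iff {k : ℤ} {x : NE β →₀ R} :
    nincl x ∈ homog (wdeg s) (k - 1) ↔ x ∈ homog (bdeg s) k := by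
  have hx : ∀ b, nincl x b.1 = x b := fun b => by
    conv_rhs => rw [← nred_nincl x]
    rfl
  rw [mem_homog, mem_homog]
  constructor
  · intro h b hb
    have := h b.1 (by rwa [hx])
    rw [bdeg, this]; ring
  · intro h w hw
    rcases eq_or_ne w [] with rfl | hne
    · exact absurd (nincl_apply_nil x) hw
    · have := h ⟨w, hne⟩ (by rwa [hx ⟨w, hne⟩] at hw)
      rw [← this, bdeg]; ring

theorem nincl_gr (k : ℤ) (x : NE β →₀ R) :
    nincl (gr (bdeg s) k x) = sgn R k • gr (wdeg s) k (nincl x) := by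
  refine eq_of_single (nincl ∘ₗ gr (bdeg s) k) (sgn R k • gr (wdeg s) k ∘ₗ nincl) (fun a => ?_) x
  simp only [LinearMap.comp_apply, LinearMap.smul_apply, gr_single, map_smul, nincl_single,
    smul_smul, bdeg, mul_add, sgn_add, mul_one]
  rw [mul_comm]

/-- The projection of the bar construction of the tensor algebra to the tensor algebra. -/
def nletters : (List (NE β) →₀ R) →ₗ[R] (List β →₀ R) := nincl ∘ₗ letters

theorem nletters_nil : nletters (single ([] : List (NE β)) (1 : R)) = 0 := by
  rw [nletters, LinearMap.comp_apply, letters_nil, map_zero]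

theorem nletters_single_cat (y : NE β) (Y : List (NE β) →₀ R) :
    nletters (single [y] 1 ⋄ Y) = Y [] • single y.1 1 := by
  refine eq_of_single (nletters ∘ₗ catL (single [y] (1 : R)))
    ((Finsupp.lapply []).smulRight (single y.1 1)) (fun w => ?_) Y
  rw [LinearMap.comp_apply, catL_apply, single_cat, nletters, LinearMap.comp_apply]
  simp only [LinearMap.smulRight_apply, Finsupp.lapply_apply]
  rcases w with _ | ⟨z, w⟩
  · rw [List.append_nil, ← letter_single, letters_letter, nincl_single]; simp
  · rw [List.singleton_append, letters_cons_cons, map_zero, Finsupp.single_eq_of_ne (by simp),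
      zero_smul]

theorem nletters_single (y : NE β) : nletters (single [y] (1 : R)) = single y.1 1 := by
  have := nletters_single_cat y (single [] (1 : R))
  rwa [cat_one, Finsupp.single_eq_same, one_smul] at this

theorem hasDegree_nletters :
    HasDegree (wdeg (bdeg s)) (wdeg s) (-1) (nletters (R := R) (β := β)) := by
  rw [hasDegree_iff]
  rintro (_ | ⟨y, Y⟩)
  · rw [nletters_nil]; exact zero_mem _
  · rw [single_cons, nletters_single_cat]
    rcases Y with _ | ⟨z, Y⟩
    · refine Submodule.smul_mem _ _ (single_mem_homog ?_)
      rw [wdeg_cons, wdeg_nil, bdeg]; ring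
    · rw [Finsupp.single_eq_of_ne (by simp), zero_smul]; exact zero_mem _

theorem nletters_comp_gr (k : ℤ) : nletters (R := R) ∘ₗ gr (wdeg (bdeg s)) k =
    sgn R k • gr (wdeg s) k ∘ₗ nletters := LinearMap.ext fun Y => by
  have := (hasDegree_nletters (R := R) s).gr_map k Y
  rw [LinearMap.comp_apply, LinearMap.smul_apply, LinearMap.comp_apply, this, smul_smul,
    mul_neg, mul_one, sgn_neg, sgn_mul_self, one_smul]

theorem letter_cat_apply_nil {γ : Type*} (x : γ →₀ R) (Y : List γ →₀ R) :
    (letter x ⋄ Y) [] = 0 :=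
  eq_of_single (Finsupp.lapply [] ∘ₗ catR Y ∘ₗ letter) 0 (fun a => by
    rw [LinearMap.comp_apply, LinearMap.comp_apply, letter_single, catR_apply]
    exact single_cat_apply_nil a Y) x

theorem nletters_letter_cat (x : NE β →₀ R) (Y : List (NE β) →₀ R) :
    nletters (letter x ⋄ Y) = Y [] • nincl x := by
  have h : nletters ∘ₗ catR Y ∘ₗ letter = Y [] • nincl := ext_single fun a => by
    rw [LinearMap.comp_apply, LinearMap.comp_apply, letter_single, catR_apply, nletters_single_cat,
      LinearMap.smul_apply, nincl_single]
  exact LinearMap.congr_fun h x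

theorem nletters_merge (y : NE β) (Y : List (NE β) →₀ R) :
    nletters (merge nmul (single y 1) Y) = single y.1 1 ⋄ nletters Y := by
  induction Y using cat_induction with
  | zero => simp [cat_zero]
  | add x y hx hy => simp only [map_add, hx, hy, cat_add]
  | smul c x h => simp only [map_smul, h, cat_smul]
  | one => rw [merge_nil, map_zero, nletters_nil, cat_zero]
  | letter z w ih =>
    rw [merge_single_cat, nletters_letter_cat, nletters_single_cat, nincl_mulS, nincl_single,
      nincl_single, cat_smul]

theorem barDiff_apply_nil {γ : Type*} (m : γ → γ → γ) (e : γ → ℤ) (δ : γ → (γ →₀ R))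
    (Y : List γ →₀ R) : barDiff m e δ Y [] = 0 := by
  induction Y using cat_induction with
  | zero => simp
  | add x y hx hy => simp [hx, hy]
  | smul c x h => simp [h]
  | one => rw [barDiff_nil]; rfl
  | letter y w ih =>
    have hm : ∀ Y : List γ →₀ R, merge m (single y 1) Y [] = 0 := fun Y => by
      refine eq_of_single (Finsupp.lapply [] ∘ₗ merge m (single y (1 : R))) 0 (fun w => ?_) Y
      rw [LinearMap.comp_apply]
      rcases w with _ | ⟨z, w⟩
      · rw [merge_nil, map_zero]; rfl
      · rw [single_cons, merge_single_cat]; exact letter_cat_apply_nil _ _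
    rw [barDiff_single_cat, Finsupp.add_apply, Finsupp.add_apply, Finsupp.neg_apply,
      letter_cat_apply_nil, Finsupp.smul_apply, hm, Finsupp.smul_apply, single_cat_apply_nil]
    simp

end NonemptyWords

/-! ### Differentials on the augmentation ideal -/

section NonemptyWordsDiff

variable {R : Type v} [CommRing R] {β : Type*} {s : β → ℤ}
  (D : (List β →₀ R) →ₗ[R] (List β →₀ R))

/-- The restriction of a differential of the tensor algebra to the augmentation ideal. -/
def ndiff (x : NE β) : NE β →₀ R := nred (D (single x.1 1))

variable {D}

theorem nincl_ndiff (hD₀ : ∀ x, D x [] = 0) (x : NE β →₀ R) :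
    nincl (lin (ndiff D) x) = D (nincl x) :=
  eq_of_single (nincl ∘ₗ lin (ndiff D)) (D ∘ₗ nincl) (fun a => by
    rw [LinearMap.comp_apply, LinearMap.comp_apply, lin_single, ndiff,
      nincl_nred_of_apply_nil (hD₀ _), nincl_single]) x

theorem nincl_ndiff_single (hD₀ : ∀ x, D x [] = 0) (x : NE β) :
    nincl (ndiff D x) = D (single x.1 1) := nincl_nred_of_apply_nil (hD₀ _)

theorem ndiff_mem_homog (hD₀ : ∀ x, D x [] = 0) (hD : HasDegree (wdeg s) (wdeg s) (-1) D)
    (x : NE β) : ndiff D x ∈ homog (bdeg s) (bdeg s x - 1) := by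
  rw [← nincl_mem_homog_iff, nincl_ndiff_single hD₀]
  have := hasDegree_iff.1 hD x.1
  rwa [bdeg, add_sub_cancel_right, sub_eq_add_neg]

theorem ndiff_ndiff (hD₀ : ∀ x, D x [] = 0) (hDD : ∀ x, D (D x) = 0) (x : NE β) :
    lin (ndiff D) (ndiff D x) = 0 :=
  nincl_injective (by rw [nincl_ndiff hD₀, nincl_ndiff_single hD₀, hDD, map_zero])

theorem ndiff_nmul (hD₀ : ∀ x, D x [] = 0) (hD : IsDer s (-1) D) (x y : NE β) :
    ndiff D (nmul x y) = mulS nmul (ndiff D x) (single y 1) -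
      sgn R (bdeg s x) • mulS nmul (single x 1) (ndiff D y) :=
  nincl_injective (by
    rw [map_sub, map_smul, nincl_mulS, nincl_mulS, nincl_ndiff_single hD₀, nincl_ndiff_single hD₀,
      nincl_ndiff_single hD₀, nincl_single, nincl_single]
    change D (single (x.1 ++ y.1) 1) = _
    rw [← single_cat, hD, gr_single, smul_cat, bdeg, sgn_add, sgn_one, mul_neg_one, neg_smul,
      neg_one_mul, sgn_neg, sub_neg_eq_add])

theorem nletters_barDiff_single_cat (hD₀ : ∀ x, D x [] = 0) (y : NE β) (Y : List (NE β) →₀ R) :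
    nletters (barDiff nmul (bdeg s) (ndiff D) (single [y] 1 ⋄ Y)) =
      -(Y [] • D (single y.1 1)) + sgn R (bdeg s y) • single y.1 1 ⋄ nletters Y := by
  rw [barDiff_single_cat, map_add, map_add, map_neg, map_smul, nletters_letter_cat,
    nletters_merge, map_smul, nletters_single_cat, barDiff_apply_nil,
    nincl_ndiff_single hD₀, zero_smul, smul_zero, add_zero]

end NonemptyWordsDiff

end

end DoubleCobar

namespace DoubleCobar

open Finsupp (single)

noncomputable section

/-! ### Kadeishvili's operations as convolution products -/

section Kadeishvili

variable {R : Type v} [CommRing R] {α : Type*} (d : α → ℤ)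

/-- The operations `E₁ₖ` on a letter of the cobar construction. -/
def kadLetter (a : NE α) : (List (NE (NE α)) →₀ R) →ₗ[R] (List (NE α) →₀ R) :=
  atNil (single [a] 1) + sgn R (wdeg d a.1) • act d a.1 ∘ₗ nletters

/-- The operations `E₁ₖ` on a word of the cobar construction. -/
def kadWord : List (NE α) → ((List (NE (NE α)) →₀ R) →ₗ[R] (List (NE α) →₀ R)) := fun x =>
  match x with
  | [] => atNil (single [] 1)
  | a :: x => conv (kadLetter d a ∘ₗ gr (wdeg (bdeg (sdeg d))) (wdeg (sdeg d) x)) (kadWord x)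

/-- The operations `E₁ₖ` on the cobar construction. -/
def kad : (List (NE α) →₀ R) →ₗ[R] ((List (NE (NE α)) →₀ R) →ₗ[R] (List (NE α) →₀ R)) :=
  lin (M := (List (NE (NE α)) →₀ R) →ₗ[R] (List (NE α) →₀ R)) (kadWord d)

theorem kad_one : kad d (single [] (1 : R)) = atNil (single [] 1) := lin_single _ _

theorem kad_single (x : List (NE α)) : kad d (single x (1 : R)) = kadWord d x := lin_single _ _

theorem kadLetter_apply (a : NE α) (Y : List (NE (NE α)) →₀ R) : kadLetter d a Y =
    Y [] • single [a] 1 + sgn R (wdeg d a.1) • act d a.1 (nletters Y) := rfl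

theorem act_comp_nletters_hasDegree (a : NE α) :
    HasDegree (wdeg (bdeg (sdeg d))) (wdeg (sdeg d)) (sdeg d a) (act (R := R) d a.1 ∘ₗ nletters) := by
  rw [hasDegree_iff]
  intro Y
  exact (hasDegree_act d a.1).mem (hasDegree_iff.1 (hasDegree_nletters _) Y)
    (by rw [sdeg]; ring)

theorem hasDegree_atNil {β γ : Type*} {s : β → ℤ} {e : γ → ℤ} {k : ℤ} {x : List β →₀ R}
    (hx : x ∈ homog (wdeg s) k) : HasDegree (wdeg e) (wdeg s) k (atNil (γ := γ) x) := by
  rw [hasDegree_iff]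
  rintro (_ | ⟨y, Y⟩)
  · rw [atNil_apply, wdeg_nil, zero_add]; exact Submodule.smul_mem _ _ hx
  · rw [atNil_apply, Finsupp.single_eq_of_ne (by simp), zero_smul]; exact zero_mem _

theorem hasDegree_kadLetter (a : NE α) :
    HasDegree (wdeg (bdeg (sdeg d))) (wdeg (sdeg d)) (sdeg d a) (kadLetter (R := R) d a) := by
  have h1 := act_comp_nletters_hasDegree (R := R) d a
  have h2 : HasDegree (wdeg (bdeg (sdeg d))) (wdeg (sdeg d)) (sdeg d a)
    (atNil (γ := NE (NE α)) (single [a] (1 : R))) :=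
    hasDegree_atNil (single_mem_homog (by rw [wdeg_cons, wdeg_nil, add_zero]))
  rw [hasDegree_iff] at *
  intro Y
  exact add_mem (h2 Y) (Submodule.smul_mem _ _ (h1 Y))

theorem hasDegree_conv {β γ : Type*} {s : β → ℤ} {e : γ → ℤ} {k l n : ℤ}
    {F G : (List γ →₀ R) →ₗ[R] (List β →₀ R)} (hF : HasDegree (wdeg e) (wdeg s) k F)
    (hG : HasDegree (wdeg e) (wdeg s) l G) (hn : k + l = n) :
    HasDegree (wdeg e) (wdeg s) n (conv F G) := by
  have : HasDegree (pdeg (wdeg e)) (wdeg s) n (convMap F G) := by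
    rw [hasDegree_iff] at *
    rintro ⟨p, q⟩
    rw [convMap_single]
    exact cat_mem_homog (hF p) (hG q) (by simp only [pdeg]; linarith)
  rw [hasDegree_iff]
  intro Y
  rw [conv_apply]
  exact this.mem (hasDegree_iff.1 (hasDegree_deconcat e) Y) (by ring)

theorem HasDegree.comp_gr {β γ : Type*} {s : β → ℤ} {e : γ → ℤ} {k : ℤ}
    {F : (γ →₀ R) →ₗ[R] (β →₀ R)} (hF : HasDegree e s k F) (l : ℤ) :
    HasDegree e s k (F ∘ₗ gr e l) := by
  rw [hasDegree_iff] at *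
  intro Y
  rw [LinearMap.comp_apply, gr_single, map_smul]
  exact Submodule.smul_mem _ _ (hF Y)

theorem hasDegree_kadWord (x : List (NE α)) :
    HasDegree (wdeg (bdeg (sdeg d))) (wdeg (sdeg d)) (wdeg (sdeg d) x) (kadWord (R := R) d x) := by
  induction x with
  | nil => exact hasDegree_atNil (single_mem_homog rfl)
  | cons a x ih => exact hasDegree_conv ((hasDegree_kadLetter d a).comp_gr _) ih rfl

theorem hasDegree_kad {k : ℤ} {x : List (NE α) →₀ R} (hx : x ∈ homog (wdeg (sdeg d)) k) :
    HasDegree (wdeg (bdeg (sdeg d))) (wdeg (sdeg d)) k (kad d x) := by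
  rw [hasDegree_iff]
  intro Y
  refine homog_induction (p := fun x => kad d x (single Y 1) ∈
    homog (wdeg (sdeg d)) (wdeg (bdeg (sdeg d)) Y + k)) hx ?_ ?_ ?_ ?_
  · rw [map_zero]; exact zero_mem _
  · intro x y hx hy; rw [map_add]; exact add_mem hx hy
  · intro c x hx; rw [map_smul]; exact Submodule.smul_mem _ _ hx
  · rintro x rfl; rw [kad_single]; exact hasDegree_iff.1 (hasDegree_kadWord d x) Y

theorem kad_single_cat {k : ℤ} (a : NE α) {x : List (NE α) →₀ R}
    (hx : x ∈ homog (wdeg (sdeg d)) k) : kad d (single [a] 1 ⋄ x) =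
      conv (kadLetter d a ∘ₗ gr (wdeg (bdeg (sdeg d))) k) (kad d x) := by
  refine homog_induction (p := fun x => kad d (single [a] 1 ⋄ x) =
      conv (kadLetter d a ∘ₗ gr (wdeg (bdeg (sdeg d))) k) (kad d x)) hx ?_ ?_ ?_ ?_
  · simp [cat_zero]
  · intro x y hx hy; simp only [cat_add, map_add, hx, hy]
  · intro c x hx; simp only [cat_smul, map_smul, hx]
  · rintro x rfl; rw [← single_cons, kad_single, kad_single]; rfl

theorem kad_letter (a : NE α) : kad d (single [a] (1 : R)) = kadLetter d a := by
  have := kad_single_cat (R := R) d (k := 0) a (x := single [] 1) (single_mem_homog rfl)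
  rw [cat_one] at this
  rw [this, kad_one, conv_atNil_right]
  refine LinearMap.ext fun Y => ?_
  rw [LinearMap.comp_apply, LinearMap.comp_apply, gr_zero, catR_apply, cat_one]

/-- Distributing a list of arguments over the letters of `u ⋄ x` means cutting the list and
inserting the first part into `u`, the second into `x`. The sign operator moves the first part past
`x`. -/
theorem kad_cat (u : List (NE α) →₀ R) {k : ℤ} {x : List (NE α) →₀ R}
    (hx : x ∈ homog (wdeg (sdeg d)) k) : kad d (u ⋄ x) =
      conv (kad d u ∘ₗ gr (wdeg (bdeg (sdeg d))) k) (kad d x) := by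
  induction u using cat_induction with
  | zero => simp [zero_cat]
  | add u w hu hw => simp only [add_cat, map_add, hu, hw, LinearMap.add_comp, LinearMap.add_apply]
  | smul c u h => simp only [smul_cat, map_smul, h, LinearMap.smul_comp, LinearMap.smul_apply]
  | one =>
    have : atNil (single [] 1) ∘ₗ gr (wdeg (bdeg (sdeg d))) k =
        atNil (γ := NE (NE α)) (single ([] : List (NE α)) (1 : R)) := ext_single fun Y => by
      rw [LinearMap.comp_apply, gr_single, map_smul, atNil_apply]
      rcases Y with _ | ⟨y, Y⟩
      · rw [wdeg_nil, mul_zero, sgn_zero, one_smul]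
      · rw [Finsupp.single_eq_of_ne (by simp), zero_smul, smul_zero]
    rw [one_cat, kad_one, this, conv_atNil_left]
    refine LinearMap.ext fun Y => ?_
    rw [LinearMap.comp_apply, catL_apply, one_cat]
  | letter a u ih =>
    have hu : (single u 1 : List (NE α) →₀ R) ∈ homog (wdeg (sdeg d)) (wdeg (sdeg d) u) :=
      single_mem_homog rfl
    rw [cat_assoc, kad_single_cat d a (cat_mem_homog hu hx rfl), ih, kad_single_cat d a hu,
      conv_comp_gr, conv_assoc, LinearMap.comp_assoc]
    congr 3
    refine LinearMap.ext fun Y => ?_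
    rw [LinearMap.comp_apply, gr_gr]

theorem kad_nil (x : List (NE α) →₀ R) : kad d x (single [] 1) = x := by
  induction x using cat_induction with
  | zero => simp
  | add u w hu hw => simp only [map_add, hu, hw, LinearMap.add_apply]
  | smul c u h => simp only [map_smul, h, LinearMap.smul_apply]
  | one => rw [kad_one, atNil_apply, Finsupp.single_eq_same, one_smul]
  | letter a u ih =>
    rw [kad_single_cat d a (k := wdeg (sdeg d) u) (single_mem_homog rfl), conv_nil, ih,
      LinearMap.comp_apply, gr_single, wdeg_nil, mul_zero, sgn_zero, one_smul, kadLetter_apply,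
      nletters_nil, map_zero, smul_zero, add_zero, Finsupp.single_eq_same, one_smul]

theorem leftDer_apply_nil (v : α) (x : List (NE α) →₀ R) : leftDer d v x [] = 0 := by
  induction x using cat_induction with
  | zero => simp
  | add u w hu hw => simp [hu, hw]
  | smul c u h => simp [h]
  | one => rw [leftDer_one]; rfl
  | letter a u ih =>
    rw [leftDer_letter_cat, Finsupp.add_apply, Finsupp.smul_apply, Finsupp.smul_apply,
      single_cat_apply_nil, single_cat_apply_nil, smul_zero, smul_zero, add_zero]

theorem act_apply_nil (a : NE α) (x : List (NE α) →₀ R) : act d a.1 x [] = 0 := by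
  obtain ⟨_ | ⟨v, w⟩, ha⟩ := a
  · exact absurd rfl ha
  · exact leftDer_apply_nil d v _

theorem kadLetter_apply_nil (a : NE α) (Y : List (NE (NE α)) →₀ R) : kadLetter d a Y [] = 0 := by
  rw [kadLetter_apply, Finsupp.add_apply, Finsupp.smul_apply, Finsupp.smul_apply, act_apply_nil,
    Finsupp.single_eq_of_ne (by simp), smul_zero, smul_zero, add_zero]

theorem kad_apply_nil (x : List (NE α) →₀ R) (Y : List (NE (NE α)) →₀ R) :
    kad d x Y [] = x [] * Y [] := by
  induction x using cat_induction with
  | zero => simp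
  | add u w hu hw => simp [hu, hw, add_mul]
  | smul c u h => simp [h, mul_assoc]
  | one => rw [kad_one, atNil_apply]; simp
  | letter a u ih =>
    have h : Finsupp.lapply [] ∘ₗ convMap (kadLetter d a ∘ₗ
        gr (wdeg (bdeg (sdeg d))) (wdeg (sdeg d) u)) (kad d (single u (1 : R))) = 0 :=
      ext_single fun p => by
        obtain ⟨p, q⟩ := p
        rw [LinearMap.comp_apply, convMap_single, Finsupp.lapply_apply, cat_apply_nil,
          LinearMap.comp_apply, gr_single, map_smul, Finsupp.smul_apply, kadLetter_apply_nil,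
          smul_zero, zero_mul]; rfl
    rw [kad_single_cat d a (k := wdeg (sdeg d) u) (single_mem_homog rfl), single_cat_apply_nil,
      zero_mul, conv_apply]
    exact LinearMap.congr_fun h _

/-- The derivation acts on one letter at a time. On a letter `a` acting on `y` it gives the action
of `v a` on `y`, so acting before or after the insertion makes no difference. -/
theorem kad_leftDer (v : α) (x : List (NE α) →₀ R) :
    kad d (leftDer d v x) = leftDer d v ∘ₗ kad d x := by
  induction x using cat_induction with
  | zero => simp
  | add u w hu hw => simp only [map_add, hu, hw, LinearMap.comp_add]
  | smul c u h => simp only [map_smul, h, LinearMap.comp_smul]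
  | one =>
    rw [leftDer_one, map_zero, kad_one]
    refine LinearMap.ext fun Y => ?_
    rw [LinearMap.comp_apply, atNil_apply, map_smul, leftDer_one, smul_zero]; rfl
  | letter a u ih =>
    have hu : (single u 1 : List (NE α) →₀ R) ∈ homog (wdeg (sdeg d)) (wdeg (sdeg d) u) :=
      single_mem_homog rfl
    have hu' := (hasDegree_leftDer (R := R) d v).mem hu rfl
    -- The case of one letter: the action of `ncons v a` is by definition that of `a` followed by
    -- that of `v`.
    have h1 : leftDer d v ∘ₗ kadLetter (R := R) d a = sgn R (d v) • kadLetter d (ncons v a) :=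
      LinearMap.ext fun Y => by
        simp only [LinearMap.comp_apply, LinearMap.smul_apply, kadLetter_apply, map_add, map_smul,
          leftDer_letter, smul_add, ncons, wdeg_cons, sgn_add, act_cons, mul_smul, sgn_smul_smul]
        rw [smul_comm]
    have h2 : gr (wdeg (sdeg d)) (d v) ∘ₗ kadLetter (R := R) d a =
        sgn R (d v * sdeg d a) • kadLetter d a ∘ₗ gr (wdeg (bdeg (sdeg d))) (d v) :=
      LinearMap.ext fun Y => (hasDegree_kadLetter d a).gr_map _ _
    rw [leftDer_letter_cat, map_add, map_smul, map_smul, kad_single_cat d _ hu,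
      kad_single_cat d _ hu', kad_single_cat d _ hu, ih, (isDer_leftDer d v).comp_conv,
      ← LinearMap.comp_assoc, h1, ← LinearMap.comp_assoc, h2]
    simp only [LinearMap.smul_comp, map_smul, LinearMap.smul_apply, LinearMap.comp_assoc]
    congr 4
    refine LinearMap.ext fun Y => ?_
    rw [LinearMap.comp_apply, LinearMap.comp_apply, LinearMap.comp_apply, gr_gr, add_comm]

theorem kad_act (w : List α) (x : List (NE α) →₀ R) :
    kad d (act d w x) = act d w ∘ₗ kad d x := by
  induction w with
  | nil => rfl
  | cons v w ih => rw [act_cons, kad_leftDer, ih]; rfl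

end Kadeishvili

end

end DoubleCobar

namespace DoubleCobar

open Finsupp (single)

noncomputable section

/-! ### The length-one component of a product in the bar construction -/

section BarProductLetters

variable {R : Type v} [CommRing R] {γ : Type*} {e : γ → ℤ}
  {κ : (List γ →₀ R) →ₗ[R] (γ →₀ R) →ₗ[R] (γ →₀ R)}

theorem barMulPass_apply_nil (X Y : List γ →₀ R) : barMulPass e κ X Y [] = 0 := by
  refine eq_of_single (Finsupp.lapply [] ∘ₗ barMulPass e κ X) 0 (fun w => ?_) Y
  rw [LinearMap.comp_apply]
  rcases w with _ | ⟨y, w⟩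
  · rw [barMulPass_nil, map_zero]; rfl
  · rw [single_cons, barMulPass_single_cat]; exact single_cat_apply_nil _ _

theorem barMul_apply_nil (X Y : List γ →₀ R) : barMul e κ X Y [] = X [] * Y [] := by
  induction X using cat_induction with
  | zero => simp
  | add x y hx hy => simp [hx, hy, add_mul]
  | smul c x h => simp [h, mul_assoc]
  | one => rw [barMul_one_left]; simp
  | letter x X ih =>
    have h : Finsupp.lapply [] ∘ₗ barMulInsert e κ (single x (1 : R)) (single X 1) = 0 :=
      ext_single fun p => by
        obtain ⟨p, q⟩ := p
        rw [LinearMap.comp_apply, barMulInsert_single]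
        exact letter_cat_apply_nil _ _
    have h := LinearMap.congr_fun h (deconcat Y)
    rw [LinearMap.comp_apply, Finsupp.lapply_apply] at h
    rw [single_cat_apply_nil, zero_mul, ← letter_single, barMul_letter_cat, Finsupp.add_apply, h,
      barMulPass_apply_nil]
    exact add_zero _

theorem letters_letter_cat (x : γ →₀ R) (Y : List γ →₀ R) :
    letters (letter x ⋄ Y) = Y [] • x := by
  refine eq_of_single (letters ∘ₗ catL (letter x)) ((Finsupp.lapply []).smulRight x)
    (fun w => ?_) Y
  rw [LinearMap.comp_apply, catL_apply, LinearMap.smulRight_apply, Finsupp.lapply_apply]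
  rcases w with _ | ⟨z, w⟩
  · rw [cat_one, letters_letter]; simp
  · rw [Finsupp.single_eq_of_ne (by simp), zero_smul]
    refine eq_of_single (letters ∘ₗ catR (single (z :: w) 1) ∘ₗ letter) 0 (fun a => ?_) x
    rw [LinearMap.comp_apply, LinearMap.comp_apply, letter_single, catR_apply, single_cat]
    exact letters_cons_cons _ _ _

/-- A product has length one only if nothing follows the leading letter: nothing has passed, all of
`Y` sits in `x`, and `X` is empty. Hence the product has `κ` as its operations `E₁ₖ`, and those with
two or more left arguments vanish. -/
theorem letters_barMul_letter_cat (x : γ →₀ R) (X Y : List γ →₀ R) :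
    letters (barMul e κ (letter x ⋄ X) Y) = X [] • κ Y x := by
  have h1 : letters ∘ₗ barMulPass e κ (letter x ⋄ X) = 0 := ext_single fun w => by
    rw [LinearMap.comp_apply]
    rcases w with _ | ⟨y, w⟩
    · rw [barMulPass_nil, map_zero]; rfl
    · rw [single_cons, barMulPass_single_cat, ← letter_single, letters_letter_cat, barMul_apply_nil,
        gr_cat]
      refine (congrArg (· • _) ?_).trans (zero_smul _ _)
      have : gr (wdeg e) (e y) (letter x) = letter (gr e (e y) x) := by
        refine eq_of_single (gr (wdeg e) (e y) ∘ₗ letter) (letter ∘ₗ gr e (e y)) (fun a => ?_) x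
        rw [LinearMap.comp_apply, LinearMap.comp_apply, letter_single, gr_single, gr_single,
          map_smul, letter_single, wdeg_cons, wdeg_nil, add_zero]
      rw [this, letter_cat_apply_nil, zero_mul]
  have h1 := LinearMap.congr_fun h1 Y
  rw [LinearMap.comp_apply] at h1
  have h2 : letters ∘ₗ barMulInsert e κ x X = X [] • κ.flip x ∘ₗ
      lin (fun p : List γ × List γ => (single p.2 (1 : R)) [] • single p.1 (1 : R)) :=
    ext_single fun p => by
      obtain ⟨p, q⟩ := p
      have hX : ∀ k, gr (wdeg e) k X [] = X [] := fun k => by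
        refine eq_of_single (Finsupp.lapply [] ∘ₗ gr (wdeg e) k) (Finsupp.lapply []) (fun w => ?_) X
        rw [LinearMap.comp_apply, gr_single, map_smul, Finsupp.lapply_apply]
        rcases w with _ | ⟨z, w⟩
        · rw [wdeg_nil, mul_zero, sgn_zero, one_smul]
        · rw [Finsupp.single_eq_of_ne (by simp), smul_zero]
      simp only [LinearMap.comp_apply, LinearMap.smul_apply, barMulInsert_single, lin_single,
        letters_letter_cat, barMul_apply_nil, hX, map_smul, LinearMap.flip_apply, mul_smul]
  have h2 := LinearMap.congr_fun h2 (deconcat Y)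
  rw [LinearMap.comp_apply, LinearMap.smul_apply, LinearMap.comp_apply,
    deconcat_counit_right] at h2
  rw [barMul_letter_cat, map_add, h1, h2]
  exact add_zero _

end BarProductLetters

/-! ### The brace relation for Kadeishvili's operations -/

section Brace

variable {R : Type v} [CommRing R] {α : Type*} (d : α → ℤ)

/-- The operations `E₁ₖ` on the augmentation ideal of the cobar construction. -/
def kadOp : (List (NE (NE α)) →₀ R) →ₗ[R] (NE (NE α) →₀ R) →ₗ[R] (NE (NE α) →₀ R) :=
  ((kad d).flip.compl₂ nincl).compr₂ nred

theorem nincl_kadOp (Y : List (NE (NE α)) →₀ R) (x : NE (NE α) →₀ R) :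
    nincl (kadOp d Y x) = kad d (nincl x) Y :=
  nincl_nred_of_apply_nil (by
    rw [LinearMap.compl₂_apply, LinearMap.flip_apply, kad_apply_nil, nincl_apply_nil, zero_mul])

theorem kadOp_nil (x : NE (NE α) →₀ R) : kadOp d (single [] 1) x = x :=
  nincl_injective (by rw [nincl_kadOp, kad_nil])

theorem kadOp_mem_homog (Y : List (NE (NE α))) (x : NE (NE α)) :
    kadOp d (single Y (1 : R)) (single x 1) ∈
      homog (bdeg (sdeg d)) (bdeg (sdeg d) x + wdeg (bdeg (sdeg d)) Y) := by
  rw [← nincl_mem_homog_iff, nincl_kadOp, nincl_single]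
  have := hasDegree_iff.1 (hasDegree_kad (R := R) d (x := single x.1 1) (single_mem_homog rfl)) Y
  convert this using 2
  rw [bdeg]; ring

/-- This is `kad_cat` on the augmentation ideal, in the form of the hypothesis `hmul` of the general
bar product. -/
theorem kadOp_nmul (Y : List (NE (NE α))) (x x' : NE (NE α)) :
    kadOp d (single Y (1 : R)) (single (nmul x x') 1) =
      lin (fun p : List (NE (NE α)) × List (NE (NE α)) =>
        sgn R (wdeg (bdeg (sdeg d)) p.1 * (bdeg (sdeg d) x' - 1)) •
        mulS nmul (kadOp d (single p.1 1) (single x 1)) (kadOp d (single p.2 1) (single x' 1)))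
        (deconcat (single Y (1 : R))) := by
  refine nincl_injective ?_
  have h : nincl ∘ₗ lin (fun p : List (NE (NE α)) × List (NE (NE α)) =>
        sgn R (wdeg (bdeg (sdeg d)) p.1 * (bdeg (sdeg d) x' - 1)) •
        mulS nmul (kadOp d (single p.1 (1 : R)) (single x 1))
          (kadOp d (single p.2 1) (single x' 1))) =
      convMap (kad d (single x.1 1) ∘ₗ gr (wdeg (bdeg (sdeg d))) (wdeg (sdeg d) x'.1))
        (kad d (single x'.1 1)) := ext_single fun p => by
    obtain ⟨p, q⟩ := p
    rw [LinearMap.comp_apply, lin_single, convMap_single, map_smul, nincl_mulS, nincl_kadOp,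
      nincl_kadOp, nincl_single, nincl_single, LinearMap.comp_apply, gr_single, map_smul, smul_cat,
      bdeg, add_sub_cancel_right, mul_comm]
  have h := LinearMap.congr_fun h (deconcat (single Y 1))
  rw [LinearMap.comp_apply] at h
  rw [h, nincl_kadOp, nincl_single, ← conv_apply, ← kad_cat _ _ (single_mem_homog rfl), single_cat]
  rfl

/-- Length one can come from an empty left word, when the component is that of `Z`, or from a single
left letter that absorbs all of `Z`. -/
theorem nletters_barMul (Y Z : List (NE (NE α)) →₀ R) :
    nletters (barMul (bdeg (sdeg d)) (kadOp d) Y Z) =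
      Y [] • nletters Z + kad d (nletters Y) Z := by
  induction Y using cat_induction with
  | zero => simp
  | add x y hx hy => simp only [map_add, LinearMap.add_apply, hx, hy, Finsupp.add_apply, add_smul]; abel
  | smul c x h => simp only [map_smul, LinearMap.smul_apply, h, Finsupp.smul_apply, smul_add,
      smul_smul, smul_eq_mul]
  | one => rw [barMul_one_left, nletters_nil]; simp
  | letter x X ih =>
    rw [single_cat_apply_nil, zero_smul, zero_add, nletters_single_cat, ← letter_single, nletters,
      LinearMap.comp_apply, letters_barMul_letter_cat, map_smul, nincl_kadOp, nincl_single,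
      map_smul, LinearMap.smul_apply]

/-- Inserting `Z` into the result of `a` acting on `y` is the action of `a` on `y` with `Z`
inserted, by `kad_act`. By `nletters_barMul` this is what `a` does to the length-one part of the
product of `Y` and `Z`. -/
theorem kad_kad_letter (a : NE α) (Y Z : List (NE (NE α)) →₀ R) :
    kad d (kad d (single [a] 1) Y) Z =
      kad d (single [a] 1) (barMul (bdeg (sdeg d)) (kadOp d) Y Z) := by
  rw [kad_letter, kadLetter_apply, kadLetter_apply, barMul_apply_nil, nletters_barMul, map_add,
    map_smul, map_smul, kad_act, LinearMap.add_apply, LinearMap.smul_apply, LinearMap.smul_apply,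
    LinearMap.comp_apply, kad_letter, kadLetter_apply]
  simp only [smul_add, map_add, map_smul, mul_smul]
  rw [smul_comm (Y []) (sgn R _)]
  abel

/-- From letters to words: by `kad_cat` both sides are convolutions, and cutting a product in the
bar construction means cutting both of its factors (`deconcat_barMul`). -/
theorem kad_kad (x : List (NE α) →₀ R) (Y Z : List (NE (NE α))) :
    kad d (kad d x (single Y 1)) (single Z 1) =
      kad d x (barMul (bdeg (sdeg d)) (kadOp d) (single Y 1) (single Z 1)) := by
  induction x using cat_induction generalizing Y Z with
  | zero => simp
  | add u w hu hw => simp only [map_add, hu, hw, LinearMap.add_apply]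
  | smul c u h => simp only [map_smul, h, LinearMap.smul_apply]
  | one =>
    rw [kad_one, atNil_apply, atNil_apply, barMul_apply_nil, map_smul, kad_one,
      LinearMap.smul_apply, atNil_apply, smul_smul]
  | letter a u ih =>
    set k := wdeg (sdeg d) u with hk
    have hu : (single u 1 : List (NE α) →₀ R) ∈ homog (wdeg (sdeg d)) k := single_mem_homog rfl
    set e := bdeg (sdeg d) with he
    set F := kad d (single [a] (1 : R)) ∘ₗ gr (wdeg e) k with hF
    have hFa : ∀ W, F W = kad d (single [a] (1 : R)) (gr (wdeg e) k W) := fun W => rfl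
    set G := kad d (single u (1 : R)) with hG
    have key : (kad d).flip (single Z 1) ∘ₗ convMap F G =
        convMap F G ∘ₗ (barMul₂ e (kadOp d)).flip (deconcat (single Z 1)) :=
      ext_single fun p => by
        obtain ⟨p, q⟩ := p
        have hq := hasDegree_iff.1 (hasDegree_kad (R := R) d hu) q
        -- The second insertion goes into the concatenation of `F p` and `G q`. The degree of `G q`
        -- gives the exponent of the sign operator on the part that enters `F p`.
        have h2 : convMap (kad d (F (single p 1)) ∘ₗ gr (wdeg e) (wdeg e q + k))
            (kad d (G (single q 1))) = convMap F G ∘ₗ barMul₂ e (kadOp d) (single (p, q) 1) :=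
          ext_single fun r => by
            obtain ⟨r, t⟩ := r
            have hr : (kad d (F (single p 1)) ∘ₗ gr (wdeg e) (wdeg e q + k)) (single r 1) =
                kad d (F (single p 1)) (gr (wdeg e) (wdeg e q + k) (single r 1)) := rfl
            have hR : (convMap F G ∘ₗ barMul₂ e (kadOp d) (single (p, q) 1)) (single (r, t) 1) =
              convMap F G (barMul₂ e (kadOp d) (single (p, q) 1) (single (r, t) 1)) := rfl
            rw [hR, convMap_single, hr, barMul₂_single, map_smul, convMap_tmul, hFa, hFa, gr_single,
              gr_single, map_smul, map_smul, map_smul, LinearMap.smul_apply, ih,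
              gr_homog (barMul_mem_homog (kadOp_mem_homog d) p r), map_smul, kad_kad_letter]
            simp only [smul_cat, smul_smul, ← sgn_add]
            congr 2
            ring
        have h2 := LinearMap.congr_fun h2 (deconcat (single Z 1))
        rw [LinearMap.comp_apply, convMap_single]
        exact (LinearMap.congr_fun (kad_cat d (F (single p 1)) hq) (single Z 1)).trans h2
    have key := LinearMap.congr_fun key (deconcat (single Y 1))
    rw [LinearMap.comp_apply, LinearMap.flip_apply, LinearMap.comp_apply,
      LinearMap.flip_apply] at key
    rw [kad_cat _ _ hu, conv_apply, conv_apply, key,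
      deconcat_barMul (kadOp_nil d) (kadOp_mem_homog d)]

theorem kadOp_kadOp (Y Z : List (NE (NE α))) (x : NE (NE α) →₀ R) :
    kadOp d (single Z 1) (kadOp d (single Y 1) x) =
      kadOp d (barMul (bdeg (sdeg d)) (kadOp d) (single Y 1) (single Z 1)) x :=
  nincl_injective (by rw [nincl_kadOp, nincl_kadOp, nincl_kadOp, kad_kad])

end Brace

end

end DoubleCobar

namespace DoubleCobar

open Finsupp (single)

noncomputable section

/-! ### The differential of Kadeishvili's operations -/

section KadeishviliDiff

variable {R : Type v} [CommRing R] {α : Type*} {d : α → ℤ} {δ : α → (α →₀ R)}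

theorem cobarDiff_apply_nil (x : List (NE α) →₀ R) : cobarDiff d δ x [] = 0 := by
  have h0 : ∀ x : List α →₀ R, toWord x [] = 0 := fun x => by
    refine eq_of_single (Finsupp.lapply [] ∘ₗ toWord) 0 (fun w => ?_) x
    rw [LinearMap.comp_apply]
    rcases eq_or_ne w [] with rfl | h
    · rw [toWord_nil]; rfl
    · rw [toWord_single ⟨w, h⟩]; exact Finsupp.single_eq_of_ne (by simp)
  have h1 : ∀ x : List α × List α →₀ R, cobarQuad d x [] = 0 := fun x => by
    refine eq_of_single (Finsupp.lapply [] ∘ₗ cobarQuad d) 0 (fun p => ?_) x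
    obtain ⟨p, q⟩ := p
    rw [LinearMap.comp_apply, cobarQuad_single, Finsupp.lapply_apply, Finsupp.smul_apply,
      cat_apply_nil, h0, zero_mul, smul_zero]; rfl
  induction x using cat_induction with
  | zero => simp
  | add u w hu hw => simp [hu, hw]
  | smul c u h => simp [h]
  | one => rw [cobarDiff_one]; rfl
  | letter a u ih =>
    rw [isDer_cobarDiff, Finsupp.add_apply, cat_apply_nil, cat_apply_nil, ih, mul_zero, add_zero,
      cobarDiff_letter, cobarLetter, Finsupp.add_apply, Finsupp.neg_apply, h0, h1]
    simp

theorem conv_sub_left {β γ : Type*} (F F' G : (List γ →₀ R) →ₗ[R] (List β →₀ R)) :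
    conv (F - F') G = conv F G - conv F' G := by
  have h : convMap (F - F') G = convMap F G - convMap F' G := ext_single fun p => by
    obtain ⟨p, q⟩ := p
    simp only [LinearMap.sub_apply, convMap_single, sub_cat]
  exact LinearMap.ext fun Y => LinearMap.congr_fun h (deconcat Y)

theorem conv_sub_right {β γ : Type*} (F G G' : (List γ →₀ R) →ₗ[R] (List β →₀ R)) :
    conv F (G - G') = conv F G - conv F G' := by
  have h : convMap F (G - G') = convMap F G - convMap F G' := ext_single fun p => by
    obtain ⟨p, q⟩ := p
    simp only [LinearMap.sub_apply, convMap_single, cat_sub]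
  exact LinearMap.ext fun Y => LinearMap.congr_fun h (deconcat Y)

theorem conv_add_left {β γ : Type*} (F F' G : (List γ →₀ R) →ₗ[R] (List β →₀ R)) :
    conv (F + F') G = conv F G + conv F' G := by rw [map_add, LinearMap.add_apply]

theorem conv_add_right {β γ : Type*} (F G G' : (List γ →₀ R) →ₗ[R] (List β →₀ R)) :
    conv F (G + G') = conv F G + conv F G' := by rw [map_add]

theorem conv_smul_left {β γ : Type*} (c : R) (F G : (List γ →₀ R) →ₗ[R] (List β →₀ R)) :
    conv (c • F) G = c • conv F G := by rw [map_smul, LinearMap.smul_apply]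

theorem conv_smul_right {β γ : Type*} (c : R) (F G : (List γ →₀ R) →ₗ[R] (List β →₀ R)) :
    conv F (c • G) = c • conv F G := by rw [map_smul]

theorem conv_neg_left {β γ : Type*} (F G : (List γ →₀ R) →ₗ[R] (List β →₀ R)) :
    conv (-F) G = -conv F G := by
  have h : convMap (-F) G = -convMap F G := ext_single fun p => by
    obtain ⟨p, q⟩ := p
    simp only [LinearMap.neg_apply, convMap_single, neg_cat]
  exact LinearMap.ext fun Y => LinearMap.congr_fun h (deconcat Y)

variable (d δ) in
/-- The differential of `kad d x Y`, for `x` of degree `k`. -/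
def KadDiff (k : ℤ) (x : List (NE α) →₀ R) : Prop :=
  cobarDiff d δ ∘ₗ kad d x = kad d (cobarDiff d δ x) +
    sgn R k • kad d x ∘ₗ barDiff nmul (bdeg (sdeg d)) (ndiff (cobarDiff d δ)) -
    conv (gr (wdeg (sdeg d)) 1 ∘ₗ kad d x) nletters +
    conv (nletters ∘ₗ gr (wdeg (bdeg (sdeg d))) k) (kad d x)

theorem atNil_comp_barDiff {β γ : Type*} (m : γ → γ → γ) (e : γ → ℤ) (δ : γ → (γ →₀ R))
    (x : List β →₀ R) : atNil x ∘ₗ barDiff m e δ = 0 := LinearMap.ext fun Y => by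
  rw [LinearMap.comp_apply, atNil_apply, barDiff_apply_nil, zero_smul]; rfl

theorem kadDiff_one : KadDiff d δ 0 (single [] (1 : R)) := by
  have h1 : cobarDiff d δ ∘ₗ atNil (γ := NE (NE α)) (single [] 1) = 0 := LinearMap.ext fun Y => by
    rw [LinearMap.comp_apply, atNil_apply, map_smul, cobarDiff_one, smul_zero]; rfl
  have h2 : gr (wdeg (sdeg d)) 1 ∘ₗ atNil (γ := NE (NE α)) (single ([] : List (NE α)) (1 : R)) =
      atNil (single [] 1) := LinearMap.ext fun Y => by
    rw [LinearMap.comp_apply, atNil_apply, map_smul, gr_single, wdeg_nil, mul_zero, sgn_zero,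
      one_smul]
  have h3 : nletters (R := R) ∘ₗ gr (wdeg (bdeg (sdeg d))) 0 = nletters := LinearMap.ext fun Y => by
    rw [LinearMap.comp_apply, gr_zero]
  rw [KadDiff, cobarDiff_one, kad_one, map_zero, h1, h2, h3, atNil_comp_barDiff, conv_atNil_left,
    conv_atNil_right]
  refine LinearMap.ext fun Y => ?_
  simp [catL_apply, catR_apply, one_cat, cat_one]

/-- The operations commute with `leftDer`, so the commutator formula for the differential can be
used on both sides. The commutator with `s⁻¹v` creates terms in which an outer argument is inserted
into `s⁻¹v`, that is, acted on by `v`; these are the extra terms of the Leibniz rule for `leftDer d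
v` on the two boundary convolutions. -/
theorem kadDiff_leftDer (hδ : ∀ a, δ a ∈ homog d (d a - 1)) (v : α) {k : ℤ}
    {x : List (NE α) →₀ R} (hx : x ∈ homog (wdeg (sdeg d)) k) (h : KadDiff d δ k x) :
    KadDiff d δ (k + d v) (leftDer d v x) := by
  rw [KadDiff] at *
  set F := kad d x with hF
  have hFd : ∀ l, F ∘ₗ gr (wdeg (bdeg (sdeg d))) l = sgn R (l * k) • gr (wdeg (sdeg d)) l ∘ₗ F := fun l =>
    LinearMap.ext fun Y => by
      have := (hasDegree_kad (R := R) d hx).gr_map l Y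
      rw [LinearMap.comp_apply, LinearMap.smul_apply, LinearMap.comp_apply, this, smul_smul,
        sgn_mul_self, one_smul]
  have hK : ∀ u : List (NE α) →₀ R, kad d (leftDer d v u) = leftDer d v ∘ₗ kad d u := kad_leftDer d v
  have hKL : ∀ (p : α →₀ R) (u : List (NE α) →₀ R), kad d (leftDerL d p u) = leftDerL d p ∘ₗ kad d u := fun p u => by
    refine LinearMap.ext fun Y => ?_
    refine eq_of_single ((kad d).flip Y ∘ₗ (leftDerL d).flip u) ((leftDerL d).flip (kad d u Y))
      (fun a => ?_) p
    rw [LinearMap.comp_apply, LinearMap.flip_apply, LinearMap.flip_apply, LinearMap.flip_apply,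
      leftDerL_single, kad_leftDer]; rfl
  have hv : kad d (single [nletter v] (1 : R)) = atNil (single [nletter v] 1) +
      sgn R (d v) • leftDer d v ∘ₗ nletters := by
    rw [kad_letter]
    refine LinearMap.ext fun Y => ?_
    rw [kadLetter_apply]
    simp only [nletter, wdeg_cons, wdeg_nil, add_zero, act_cons, act, LinearMap.id_apply]
    rfl
  have h1 : kad d (single [nletter v] 1 ⋄ x) = catL (single [nletter v] 1) ∘ₗ F +
      sgn R (d v) • conv (leftDer d v ∘ₗ nletters ∘ₗ gr (wdeg (bdeg (sdeg d))) k) F := by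
    have h0 : atNil (single [nletter v] (1 : R)) ∘ₗ gr (wdeg (bdeg (sdeg d))) k =
        atNil (γ := NE (NE α)) (single [nletter v] (1 : R)) := ext_single fun Y => by
      rw [LinearMap.comp_apply, gr_single, map_smul, atNil_apply]
      rcases Y with _ | ⟨y, Y⟩
      · rw [wdeg_nil, mul_zero, sgn_zero, one_smul]
      · rw [Finsupp.single_eq_of_ne (by simp), zero_smul, smul_zero]
    rw [kad_cat _ _ hx, hv, LinearMap.add_comp, LinearMap.smul_comp, h0, map_add,
      LinearMap.add_apply, conv_atNil_left, map_smul, LinearMap.smul_apply, LinearMap.comp_assoc]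
  have h2 : kad d (gr (wdeg (sdeg d)) (d v - 1) x ⋄ single [nletter v] 1) =
      catR (single [nletter v] 1) ∘ₗ gr (wdeg (sdeg d)) (d v - 1) ∘ₗ F +
      sgn R (d v) • conv (gr (wdeg (sdeg d)) (d v - 1) ∘ₗ F) (leftDer d v ∘ₗ nletters) := by
    rw [gr_homog hx, smul_cat, map_smul, kad_cat (k := d v - 1) _ _ (single_mem_homog (by
      rw [wdeg_cons, wdeg_nil, sdeg_nletter, add_zero])), hFd, map_smul, LinearMap.smul_apply,
      smul_smul, sgn_mul_self, one_smul, hv, map_add, conv_atNil_right, map_smul]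
  have h3 : ∀ G : (List (NE (NE α)) →₀ R) →ₗ[R] (List (NE α) →₀ R), cobarDiff d δ ∘ₗ leftDer d v ∘ₗ G =
      sgn R (d v) • leftDer d v ∘ₗ cobarDiff d δ ∘ₗ G + leftDerL d (δ v) ∘ₗ G +
        catL (single [nletter v] 1) ∘ₗ G -
        catR (single [nletter v] 1) ∘ₗ gr (wdeg (sdeg d)) (d v - 1) ∘ₗ G := fun G =>
    LinearMap.ext fun Y => cobarDiff_leftDer hδ v (G Y)
  have h4 : ∀ G : (List (NE (NE α)) →₀ R) →ₗ[R] (List (NE α) →₀ R), gr (wdeg (sdeg d)) 1 ∘ₗ leftDer d v ∘ₗ G =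
      sgn R (d v) • leftDer d v ∘ₗ gr (wdeg (sdeg d)) 1 ∘ₗ G := fun G =>
    LinearMap.ext fun Y => by
      have := (hasDegree_leftDer (R := R) d v).gr_map 1 (G Y)
      rwa [one_mul] at this
  have h5 : gr (wdeg (sdeg d)) (d v) ∘ₗ gr (wdeg (sdeg d)) 1 ∘ₗ F = gr (wdeg (sdeg d)) (d v - 1) ∘ₗ F :=
    LinearMap.ext fun Y => (gr_gr _ _ _ _).trans
      (gr_congr _ (by rw [sgn_add, sgn_sub]) _)
  have h6 : gr (wdeg (sdeg d)) (d v) ∘ₗ nletters ∘ₗ gr (wdeg (bdeg (sdeg d))) k =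
      sgn R (d v) • nletters (R := R) ∘ₗ gr (wdeg (bdeg (sdeg d))) (k + d v) := by
    have h7 := nletters_comp_gr (R := R) (sdeg d) (d v)
    have h8 : gr (wdeg (sdeg d)) (d v) ∘ₗ nletters = sgn R (d v) • nletters (R := R) ∘ₗ gr (wdeg (bdeg (sdeg d))) (d v) := by
      rw [h7, smul_smul, sgn_mul_self, one_smul]
    rw [← LinearMap.comp_assoc, h8, LinearMap.smul_comp, LinearMap.comp_assoc]
    congr 2
    exact LinearMap.ext fun Y => (gr_gr _ _ _ _).trans (by rw [add_comm])
  rw [cobarDiff_leftDer hδ]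
  simp only [map_add, map_sub, map_smul, hK, hKL, h1, h2, ← hF, h3, h, LinearMap.comp_add,
    LinearMap.comp_sub, LinearMap.comp_smul, (isDer_leftDer d v).comp_conv, h4, h5, h6,
    LinearMap.smul_apply, LinearMap.comp_assoc, smul_add, smul_sub, sgn_smul_smul, sgn_add]
  refine LinearMap.ext fun Y => ?_
  simp only [LinearMap.add_apply, LinearMap.sub_apply, LinearMap.smul_apply, LinearMap.neg_apply,
    LinearMap.comp_apply, map_add, map_sub, map_smul]
  have := @sgn_mul_self R _
  clear hδ hx h hFd hK hKL hv h1 h2 h3 h4 h5 h6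
  match_scalars <;> grind

/-- The projection to letters is a twisting cochain. On words of length one the bar differential is
the internal one up to sign; on words of length two its product term is cancelled by the convolution
square. -/
theorem comp_nletters {β : Type*} {s : β → ℤ} {D : (List β →₀ R) →ₗ[R] (List β →₀ R)}
    (hD₀ : ∀ x, D x [] = 0) : D ∘ₗ nletters =
      -(nletters ∘ₗ barDiff nmul (bdeg s) (ndiff D)) - conv (gr (wdeg s) 1 ∘ₗ nletters) nletters := by
  refine ext_single fun w => ?_
  simp only [LinearMap.comp_apply, LinearMap.sub_apply, LinearMap.neg_apply]
  rcases w with _ | ⟨y, w⟩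
  · rw [nletters_nil, barDiff_nil, conv_nil, nletters_nil, cat_zero, map_zero, map_zero]; simp
  · have h : (gr (wdeg s) 1 ∘ₗ nletters) ∘ₗ catL (single [y] (1 : R)) =
        atNil (sgn R (wdeg s y.1) • single y.1 1) := LinearMap.ext fun Y => by
      rw [LinearMap.comp_apply, LinearMap.comp_apply, catL_apply, nletters_single_cat, map_smul,
        gr_single, one_mul, atNil_apply]
    rw [single_cons, nletters_barDiff_single_cat hD₀, nletters_single_cat, map_smul, conv_cons, h,
      conv_atNil_left, LinearMap.comp_apply, LinearMap.comp_apply, nletters_nil, map_zero, zero_cat,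
      catL_apply, smul_cat, bdeg, sgn_add, sgn_one]
    module

theorem kad_toWord_letter {k : ℤ} {p : α →₀ R} (hp : p ∈ homog d k) :
    kad d (toWord (letter p)) = atNil (toWord (letter p)) +
      sgn R k • leftDerL d p ∘ₗ nletters := by
  refine homog_induction (p := fun p => kad d (toWord (letter p)) = atNil (toWord (letter p)) +
      sgn R k • leftDerL d p ∘ₗ nletters) hp ?_ ?_ ?_ ?_
  · refine LinearMap.ext fun Y => ?_
    simp [atNil_apply]
  · intro x y hx hy
    refine LinearMap.ext fun Y => ?_
    simp only [map_add, hx, hy, LinearMap.add_apply, LinearMap.smul_apply, LinearMap.comp_apply,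
      atNil_apply, smul_add]
    abel
  · intro c x hx
    refine LinearMap.ext fun Y => ?_
    simp only [map_smul, hx, LinearMap.add_apply, LinearMap.smul_apply, LinearMap.comp_apply,
      atNil_apply, smul_add]
    rw [smul_comm c, smul_comm c]
  · rintro v rfl
    rw [letter_single, toWord_nletter, kad_letter, leftDerL_single]
    refine LinearMap.ext fun Y => ?_
    rw [kadLetter_apply]
    simp only [nletter, wdeg_cons, wdeg_nil, add_zero, act_cons, act, LinearMap.id_apply]
    rfl

/-- On `s⁻¹v` at most one argument is inserted, and the insertion is `leftDer d v`. The claim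
combines the commutator of this derivation with the differential and `comp_nletters`. -/
theorem kadDiff_nletter (hδ : ∀ a, δ a ∈ homog d (d a - 1)) (v : α) :
    KadDiff d δ (d v - 1) (single [nletter v] (1 : R)) := by
  have hv : kad d (single [nletter v] (1 : R)) = atNil (single [nletter v] 1) +
      sgn R (d v) • leftDer d v ∘ₗ nletters := by
    have := kad_toWord_letter (R := R) (d := d) (p := single v 1) (single_mem_homog rfl)
    rwa [letter_single, toWord_nletter, leftDerL_single] at this
  have h0 : ∀ (f : (List (NE α) →₀ R) →ₗ[R] (List (NE α) →₀ R)) (x : List (NE α) →₀ R),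
      f ∘ₗ atNil x = atNil (γ := NE (NE α)) (f x) := fun f x => LinearMap.ext fun Y => by
    rw [LinearMap.comp_apply, atNil_apply, map_smul, atNil_apply]
  have h1 : cobarDiff d δ ∘ₗ leftDer d v ∘ₗ nletters =
      sgn R (d v) • leftDer d v ∘ₗ cobarDiff d δ ∘ₗ nletters + leftDerL d (δ v) ∘ₗ nletters +
        catL (single [nletter v] 1) ∘ₗ nletters -
        catR (single [nletter v] 1) ∘ₗ gr (wdeg (sdeg d)) (d v - 1) ∘ₗ nletters :=
    LinearMap.ext fun Y => cobarDiff_leftDer hδ v (nletters Y)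
  have h2 : gr (wdeg (sdeg d)) 1 ∘ₗ leftDer d v ∘ₗ nletters =
      sgn R (d v) • leftDer d v ∘ₗ gr (wdeg (sdeg d)) 1 ∘ₗ nletters (R := R) :=
    LinearMap.ext fun Y => by
      have := (hasDegree_leftDer (R := R) d v).gr_map 1 (nletters Y)
      rwa [one_mul] at this
  have h3 : gr (wdeg (sdeg d)) (d v) ∘ₗ gr (wdeg (sdeg d)) 1 ∘ₗ nletters =
      gr (wdeg (sdeg d)) (d v - 1) ∘ₗ nletters (R := R) :=
    LinearMap.ext fun Y => (gr_gr _ _ _ _).trans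
      (gr_congr _ (by rw [sgn_add, sgn_sub]) _)
  have h4 : gr (wdeg (sdeg d)) 1 (single [nletter v] (1 : R)) = -(sgn R (d v) • single [nletter v] 1) := by
    rw [gr_single, one_mul, wdeg_cons, wdeg_nil, add_zero, sdeg_nletter, sgn_sub, sgn_one,
      mul_neg_one, neg_smul]
  have h5 : atNil (-(toWord (letter (δ v)))) = -atNil (γ := NE (NE α)) (toWord (letter (δ v))) :=
    LinearMap.ext fun Y => by rw [atNil_apply, smul_neg]; rfl
  have h6 : atNil (-(sgn R (d v) • single [nletter v] (1 : R))) =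
      -(sgn R (d v) • atNil (γ := NE (NE α)) (single [nletter v] 1)) :=
    LinearMap.ext fun Y => by rw [atNil_apply, smul_neg, smul_comm]; rfl
  have h7 : sgn R (d v - 1) = -sgn R (d v) := by rw [sgn_sub, sgn_one, mul_neg_one]
  rw [KadDiff, hv, cobarDiff_nletter, map_neg, kad_toWord_letter (hδ v)]
  simp only [LinearMap.comp_add, LinearMap.comp_smul, h0, h1, h2, h4, h5, h6, cobarDiff_nletter,
    LinearMap.add_comp, LinearMap.smul_comp, atNil_comp_barDiff, map_add, LinearMap.add_apply,
    LinearMap.comp_assoc, comp_nletters (s := sdeg d) cobarDiff_apply_nil, LinearMap.comp_sub,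
    LinearMap.comp_neg, LinearMap.zero_apply, (isDer_leftDer d v).comp_conv, h3, conv_atNil_left, conv_atNil_right,
    nletters_comp_gr, map_smul, conv_neg_left, LinearMap.smul_apply, LinearMap.neg_apply, smul_add,
    smul_sub, smul_neg, sgn_smul_smul, h7, neg_smul]
  refine LinearMap.ext fun Y => ?_
  simp only [LinearMap.add_apply, LinearMap.sub_apply, LinearMap.smul_apply, LinearMap.neg_apply,
    LinearMap.zero_apply]
  have := @sgn_mul_self R _
  clear hδ hv h0 h1 h2 h3 h4 h5 h6
  match_scalars <;> grind

/-- The algebra behind `kadDiff_cat`, for opaque maps. The terms with `n'` coming from the two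
factors are `-(E * n') * G` and `E * (n' * G)` and cancel by associativity of convolution. -/
theorem conv_leibniz {β γ : Type*} {a b : R} (ha : a * a = 1) (hb : b * b = 1)
    {F G K K' n E F' n' n'' : (List γ →₀ R) →ₗ[R] (List β →₀ R)}
    {D g : (List β →₀ R) →ₗ[R] (List β →₀ R)} {B f f' : (List γ →₀ R) →ₗ[R] (List γ →₀ R)}
    (hD : D ∘ₗ conv F' G = conv (D ∘ₗ F') G + conv E (D ∘ₗ G))
    (hF : D ∘ₗ F' = K' + a • (b • F' ∘ₗ B) - conv E n' + conv n'' F')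
    (hG : D ∘ₗ G = K + b • G ∘ₗ B - conv (g ∘ₗ G) n + conv n' G)
    (hB : conv F' G ∘ₗ B = conv (F' ∘ₗ B) G + conv (F' ∘ₗ f') (G ∘ₗ B))
    (hf' : F' ∘ₗ f' = a • E) (hg : g ∘ₗ conv F' G = conv E (g ∘ₗ G)) (hf : F ∘ₗ f = a • E) :
    D ∘ₗ conv F' G = conv K' G + a • conv (F ∘ₗ f) K + (a * b) • conv F' G ∘ₗ B -
      conv (g ∘ₗ conv F' G) n + conv n'' (conv F' G) := by
  rw [hD, hF, hG, hB, hf', hg, hf]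
  simp only [conv_add_left, conv_add_right, conv_sub_left, conv_sub_right, conv_smul_left,
    conv_smul_right, conv_assoc]
  refine LinearMap.ext fun Y => ?_
  simp only [LinearMap.add_apply, LinearMap.sub_apply, LinearMap.smul_apply]
  clear hD hF hG hB hf' hg hf
  match_scalars <;> grind

/-- An argument placed between `u` and `x` occurs as the right boundary term of `u` and as the left
boundary term of `x`, with opposite signs. The outer boundary terms become those of the
concatenation. -/
theorem kadDiff_cat (hδ : ∀ a, δ a ∈ homog d (d a - 1)) {k l : ℤ} {u x : List (NE α) →₀ R}
    (hu : u ∈ homog (wdeg (sdeg d)) k) (hx : x ∈ homog (wdeg (sdeg d)) l)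
    (hu' : KadDiff d δ k u) (hx' : KadDiff d δ l x) : KadDiff d δ (k + l) (u ⋄ x) := by
  rw [KadDiff] at *
  have hD := hasDegree_cobarDiff hδ
  have hB : HasDegree (wdeg (bdeg (sdeg d))) (wdeg (bdeg (sdeg d))) (-1)
      (barDiff nmul (bdeg (sdeg d)) (ndiff (cobarDiff d δ))) :=
    hasDegree_barDiff (bdeg_nmul _) (ndiff_mem_homog cobarDiff_apply_nil hD)
  have hDx := hD.mem hx rfl
  have hF : ∀ n Y, kad d u (gr (wdeg (bdeg (sdeg d))) n Y) =
      sgn R (n * k) • gr (wdeg (sdeg d)) n (kad d u Y) := fun n Y => by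
    rw [(hasDegree_kad (R := R) d hu).gr_map n Y, smul_smul, sgn_mul_self, one_smul]
  have hFcat := kad_cat d u hx
  have hFcat' := kad_cat d u hDx
  have hGcat := kad_cat d (cobarDiff d δ u) hx
  generalize kad d u = F at *
  generalize kad d x = G at *
  obtain ⟨E, hE⟩ : ∃ E, E = gr (wdeg (sdeg d)) 1 ∘ₗ F ∘ₗ gr (wdeg (bdeg (sdeg d))) l := ⟨_, rfl⟩
  have f1 : gr (wdeg (sdeg d)) (-1) ∘ₗ F ∘ₗ gr (wdeg (bdeg (sdeg d))) l = E :=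
    LinearMap.ext fun Y => by
      rw [hE, LinearMap.comp_apply, gr_congr (k := -1) (l := 1) _ (by rw [sgn_neg])]
      rfl
  have f2 : F ∘ₗ gr (wdeg (bdeg (sdeg d))) (l + -1) = sgn R k • E := LinearMap.ext fun Y => by
    simp only [hE, LinearMap.comp_apply, LinearMap.smul_apply, hF, map_smul, gr_gr, smul_smul]
    rw [gr_congr (k := l + -1) (l := 1 + l) _ (by simp only [sgn_add, sgn_neg, mul_comm])]
    simp only [add_mul, sgn_add, neg_mul, sgn_neg, one_mul]
    rw [mul_comm]
  have f3 : barDiff nmul (bdeg (sdeg d)) (ndiff (cobarDiff d δ)) ∘ₗ gr (wdeg (bdeg (sdeg d))) l = sgn R l • gr (wdeg (bdeg (sdeg d))) l ∘ₗ barDiff nmul (bdeg (sdeg d)) (ndiff (cobarDiff d δ)) :=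
    LinearMap.ext fun Y => by
      rw [LinearMap.comp_apply, LinearMap.smul_apply, LinearMap.comp_apply, hB.gr_map, smul_smul,
        mul_neg_one, sgn_neg, sgn_mul_self, one_smul]
  have f4 : F ∘ₗ gr (wdeg (bdeg (sdeg d))) l ∘ₗ gr (wdeg (bdeg (sdeg d))) 1 = sgn R k • E := by
    rw [← f2]
    refine LinearMap.ext fun Y => ?_
    rw [LinearMap.comp_apply, LinearMap.comp_apply, LinearMap.comp_apply, gr_gr,
      gr_congr (k := l + 1) (l := l + -1) _ (by rw [sgn_add, sgn_add, sgn_neg])]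
  have f5 : nletters (R := R) ∘ₗ gr (wdeg (bdeg (sdeg d))) k ∘ₗ gr (wdeg (bdeg (sdeg d))) l =
      nletters ∘ₗ gr (wdeg (bdeg (sdeg d))) (k + l) :=
    LinearMap.ext fun Y => by
      rw [LinearMap.comp_apply, LinearMap.comp_apply, LinearMap.comp_apply, gr_gr]
  have f6 : cobarDiff d δ (u ⋄ x) = cobarDiff d δ u ⋄ x + sgn R k • u ⋄ cobarDiff d δ x := by
    rw [isDer_cobarDiff d δ, gr_homog hu, smul_cat, neg_one_mul, sgn_neg]
  have f7 : (cobarDiff d δ ∘ₗ F) ∘ₗ gr (wdeg (bdeg (sdeg d))) l = cobarDiff d δ ∘ₗ F ∘ₗ gr (wdeg (bdeg (sdeg d))) l :=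
    LinearMap.comp_assoc _ _ _
  have f8 : cobarDiff d δ ∘ₗ F ∘ₗ gr (wdeg (bdeg (sdeg d))) l =
      kad d (cobarDiff d δ u) ∘ₗ gr (wdeg (bdeg (sdeg d))) l + sgn R k • (sgn R l •
        (F ∘ₗ gr (wdeg (bdeg (sdeg d))) l) ∘ₗ
          barDiff nmul (bdeg (sdeg d)) (ndiff (cobarDiff d δ))) -
      conv E (nletters ∘ₗ gr (wdeg (bdeg (sdeg d))) l) +
      conv (nletters ∘ₗ gr (wdeg (bdeg (sdeg d))) (k + l)) (F ∘ₗ gr (wdeg (bdeg (sdeg d))) l) := by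
    rw [← f7, hu', LinearMap.add_comp, LinearMap.sub_comp, LinearMap.add_comp, conv_comp_gr,
      conv_comp_gr, LinearMap.smul_comp, LinearMap.comp_assoc, f3, LinearMap.comp_assoc,
      LinearMap.comp_assoc, f5, ← hE, LinearMap.comp_smul, LinearMap.comp_assoc]
  have f9 := (isDer_cobarDiff d δ).comp_conv (F ∘ₗ gr (wdeg (bdeg (sdeg d))) l) G
  rw [f1] at f9
  have f10 := gr_comp_conv (s := sdeg d) 1 (F ∘ₗ gr (wdeg (bdeg (sdeg d))) l) G
  rw [← hE] at f10
  rw [f6, map_add, map_smul, hGcat, hFcat', hFcat, sgn_add]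
  exact conv_leibniz (sgn_mul_self k) (sgn_mul_self l) f9 f8 hx' (conv_comp_barDiff _ _ _ _)
    (by rw [LinearMap.comp_assoc, f4]) f10 f2

/-- The formula passes to words by `kadDiff_cat` and to longer letters by `kadDiff_leftDer`,
starting from the letters `s⁻¹v`. -/
theorem kadDiff (hδ : ∀ a, δ a ∈ homog d (d a - 1)) (x : List (NE α)) :
    KadDiff d δ (wdeg (sdeg d) x) (single x (1 : R)) := by
  induction x with
  | nil => exact kadDiff_one
  | cons a x ih =>
    rw [single_cons, wdeg_cons]
    refine kadDiff_cat hδ (single_mem_homog (by rw [wdeg_cons, wdeg_nil, add_zero]))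
      (single_mem_homog rfl) ?_ ih
    clear ih
    induction a using ne_induction with
    | letter v => rw [sdeg_nletter]; exact kadDiff_nletter hδ v
    | cons v b ih =>
      have := kadDiff_leftDer hδ v (single_mem_homog (by rw [wdeg_cons, wdeg_nil, add_zero])) ih
      rw [leftDer_letter] at this
      -- Prepending `v` agrees with `leftDer d v` up to the sign of `v`; multiplying by that sign a
      -- second time removes it.
      have h : KadDiff d δ (sdeg d b + d v)
          (sgn R (d v) • sgn R (d v) • single [ncons v b] (1 : R)) := by
        generalize sgn R (d v) • single [ncons v b] (1 : R) = z at *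
        rw [KadDiff] at *
        simp only [map_smul, LinearMap.comp_smul, LinearMap.smul_comp, LinearMap.smul_apply, this]
        refine LinearMap.ext fun Y => ?_
        simp only [LinearMap.add_apply, LinearMap.sub_apply, LinearMap.smul_apply, LinearMap.neg_apply, smul_add, smul_sub]
        rw [smul_comm (sgn R (d v)) (sgn R (sdeg d b + d v))]
      rw [sgn_smul_smul] at h
      rwa [sdeg_ncons, add_comm]

end KadeishviliDiff

end

end DoubleCobar

namespace DoubleCobar

open Finsupp (single)

noncomputable section

/-! ### The boundary formula on the augmentation ideal -/

section BraceDifferential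

variable {R : Type v} [CommRing R] {α : Type*} {d : α → ℤ} {δ : α → (α →₀ R)}

theorem nincl_rightEnd (x : NE (NE α)) (Z : List (NE (NE α)) × List (NE (NE α)) →₀ R) :
    nincl (rightEnd nmul (bdeg (sdeg d)) (kadOp d) (single x (1 : R)) Z) =
      -convMap (gr (wdeg (sdeg d)) 1 ∘ₗ kad d (single x.1 (1 : R))) nletters Z := by
  have h : nincl ∘ₗ rightEnd nmul (bdeg (sdeg d)) (kadOp d) (single x (1 : R)) =
      -convMap (gr (wdeg (sdeg d)) 1 ∘ₗ kad d (single x.1 (1 : R))) nletters := ext_single fun p => by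
    obtain ⟨p, q⟩ := p
    rw [LinearMap.neg_apply, LinearMap.comp_apply, rightEnd, lin_single, nincl_mulS, nincl_gr,
      nincl_kadOp, nincl_single, convMap_single, LinearMap.comp_apply, sgn_one, neg_one_smul,
      neg_cat]
    rfl
  exact LinearMap.congr_fun h Z

/-- Convolving with `nletters` on the left singles out the first letter of `Y` and multiplies the
operation by it from the left. -/
theorem nincl_leftEnd (x : NE (NE α)) (Y : List (NE (NE α))) :
    nincl (leftEnd nmul (bdeg (sdeg d)) (kadOp d) (single x (1 : R)) (single Y 1)) =
      conv (nletters ∘ₗ gr (wdeg (bdeg (sdeg d))) (wdeg (sdeg d) x.1)) (kad d (single x.1 1))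
        (single Y 1) := by
  rcases Y with _ | ⟨y, Y⟩
  · rw [leftEnd_nil, map_zero, conv_nil, LinearMap.comp_apply, gr_single, map_smul, nletters_nil,
      smul_zero, zero_cat]
  · have h : (nletters ∘ₗ gr (wdeg (bdeg (sdeg d))) (wdeg (sdeg d) x.1)) ∘ₗ
        catL (single [y] (1 : R)) = sgn R (wdeg (sdeg d) x.1 * bdeg (sdeg d) y) •
          atNil (single y.1 1) := ext_single fun w => by
      rw [LinearMap.comp_apply, LinearMap.comp_apply, catL_apply, single_cat, gr_single, map_smul,
        LinearMap.smul_apply, atNil_apply, List.singleton_append, single_cons, nletters_single_cat,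
        wdeg_cons]
      rcases w with _ | ⟨z, w⟩
      · rw [wdeg_nil, add_zero]
      · rw [Finsupp.single_eq_of_ne (by simp), zero_smul, smul_zero, smul_zero]
    have h0 : (nletters ∘ₗ gr (wdeg (bdeg (sdeg d))) (wdeg (sdeg d) x.1))
        (single ([] : List (NE (NE α))) (1 : R)) = 0 := by
      rw [LinearMap.comp_apply, gr_single, map_smul, nletters_nil, smul_zero]
    rw [leftEnd_cons, single_cons, conv_cons, h, h0, zero_cat, zero_add, conv_smul_left,
      LinearMap.smul_apply, conv_atNil_left, LinearMap.comp_apply, catL_apply, map_smul, nincl_mulS,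
      nincl_single, nincl_kadOp, gr_single, map_smul, map_smul, LinearMap.smul_apply, cat_smul,
      smul_smul, nincl_single]
    -- The two sign exponents differ by twice the suspended degree of `y`.
    congr 1
    rw [← sgn_add, show bdeg (sdeg d) y + bdeg (sdeg d) y * bdeg (sdeg d) x =
      (bdeg (sdeg d) y + bdeg (sdeg d) y) + wdeg (sdeg d) x.1 * bdeg (sdeg d) y by
        rw [bdeg, bdeg]; ring, sgn_add, sgn_even (Even.add_self _), one_mul]

/-- This is `kadDiff` in the form of the hypothesis `hdiff` of the general bar product; the boundary
convolutions become the two end terms. -/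
theorem kadOp_diff (hδ : ∀ a, δ a ∈ homog d (d a - 1)) (Y : List (NE (NE α))) (x : NE (NE α)) :
    lin (ndiff (cobarDiff d δ)) (kadOp d (single Y (1 : R)) (single x 1)) =
      kadOp d (single Y 1) (ndiff (cobarDiff d δ) x) - sgn R (bdeg (sdeg d) x) •
        kadOp d (barDiff nmul (bdeg (sdeg d)) (ndiff (cobarDiff d δ)) (single Y 1)) (single x 1) +
      rightEnd nmul (bdeg (sdeg d)) (kadOp d) (single x 1) (deconcat (single Y 1)) +
      leftEnd nmul (bdeg (sdeg d)) (kadOp d) (single x 1) (single Y 1) := by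
  refine nincl_injective ?_
  have h := LinearMap.congr_fun (kadDiff hδ x.1) (single Y (1 : R))
  simp only [LinearMap.comp_apply, LinearMap.add_apply, LinearMap.sub_apply,
    LinearMap.smul_apply] at h
  rw [nincl_ndiff cobarDiff_apply_nil, map_add, map_add, map_sub, map_smul, nincl_kadOp, nincl_kadOp, nincl_kadOp,
    nincl_single, nincl_rightEnd, nincl_leftEnd, nincl_ndiff_single cobarDiff_apply_nil, h,
    ← conv_apply, bdeg, sgn_add, sgn_one, mul_neg, mul_one, neg_smul, sub_neg_eq_add, sub_eq_add_neg]

end BraceDifferential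

/-! ### The explicit models as differential graded algebras and Hopf algebras -/

section TensorAlgebra

variable {R : Type v} [CommRing R] {α : Type u}

theorem tensorAlgebra_incl (d : α → ℤ) (D : (List α →₀ R) →ₗ[R] (List α →₀ R)) :
    (tensorAlgebra d D).incl = nincl := ext_single fun x =>
  Finsupp.mapDomain_single.trans (nincl_single x).symm

theorem tensorAlgebra_isDGAlgebra {d : α → ℤ} {D : (List α →₀ R) →ₗ[R] (List α →₀ R)}
    (hdeg : HasDegree (wdeg d) (wdeg d) (-1) D) (hD : IsDer d (-1) D) (hD₀ : ∀ x, D x [] = 0)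
    (hDD : ∀ x, D (D x) = 0) : (tensorAlgebra d D).IsDGAlgebra concat where
  complex :=
    { deg_one := rfl
      degree := hdeg
      d_d := hDD
      d_one := hD.map_one
      counit_d := hD₀ }
  dgMap :=
    { degree := hasDegree_concat d
      comm := fun x => by
        have h : D ∘ₗ concat = concat ∘ₗ tensorD (wdeg d) D D := ext_tmul fun u w => by
          rw [LinearMap.comp_apply, LinearMap.comp_apply, tensorD_tmul, map_add]
          have := hD u w
          rwa [gr_congr (l := 1) _ (sgn_neg 1)] at this
        rw [sgn_zero, one_smul]
        exact LinearMap.congr_fun h x }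
  one_mul := one_cat
  mul_one := cat_one
  mul_assoc := cat_assoc
  counit_mul := cat_apply_nil

theorem tensorAlgebra_isInvolutiveDGHopf {d : α → ℤ} {δ : α → (α →₀ R)}
    (hδ : ∀ a, δ a ∈ homog d (d a - 1)) (hδ' : ∀ a, lin δ (δ a) = 0) :
    (tensorAlgebra d (letterD d δ)).IsInvolutiveDGHopf concat (shuffleCoproduct d)
      (antipode d) where
  bialgebra :=
    { algebra := tensorAlgebra_isDGAlgebra (hasDegree_letterD hδ) (isDer_der _ _ _)
        letterD_apply_nil (letterD_letterD hδ hδ')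
      coalgebra :=
        { complex := (tensorAlgebra_isDGAlgebra (hasDegree_letterD hδ) (isDer_der _ _ _)
            letterD_apply_nil (letterD_letterD hδ hδ')).complex
          dgMap :=
            { degree := hasDegree_shuffle d
              comm := fun x => by
                rw [sgn_zero, one_smul]; exact (shuffle_letterD hδ x).symm }
          counit_left := shuffle_counit_left d
          counit_right := shuffle_counit_right d
          coassoc := shuffle_coassoc d
          map_one := (shuffle_nil d).trans (tmul_single _ _).symm }
      comul_mul := shuffle_cat d }
  antipode :=
    { dgMap :=
        { degree := hasDegree_antipode d
          comm := fun x => by rw [sgn_zero, one_smul]; exact antipode_letterD d hδ x }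
      left_inv := antipode_left d
      right_inv := antipode_right d }
  involutive := antipode_antipode d

/-- In the degrees of the cobar and bar constructions the list of reduced letters is first coerced
to a list of basis elements, which elaborates to a `flatMap`. So these degrees equal `wdeg` by a
proof and not by definition. -/
theorem sum_map_flatMap_val {β : Type*} {p : β → Prop} (f : β → ℤ) (w : List (Subtype p)) :
    ((w.flatMap fun a => [a.1]).map f).sum = wdeg (fun c : Subtype p => f c.1) w := by
  induction w with
  | nil => rfl
  | cons a w ih => rw [wdeg_cons, ← ih]; simp

theorem cobar_deg (M : DGMod.{u} R) (Δ : M.V →ₗ[R] (M.B × M.B →₀ R)) :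
    (M.cobar Δ).deg = wdeg fun c : M.Red => M.deg c.1 - 1 :=
  funext fun w => sum_map_flatMap_val (fun b => M.deg b - 1) w

theorem bar_deg (M : DGMod.{u} R) (mul : (M.B × M.B →₀ R) →ₗ[R] M.V) :
    (M.bar mul).deg = wdeg fun c : M.Red => M.deg c.1 + 1 :=
  funext fun w => sum_map_flatMap_val (fun b => M.deg b + 1) w

theorem merge_nmul_cons (a b : NE α) (w : List (NE α)) :
    merge nmul (single a (1 : R)) (single (b :: w) 1) =
      toWord (concat (single (a.1, b.1) 1)) ⋄ single w 1 := by
  rw [single_cons, merge_single_cat, mulS_single, concat_single, letter_single]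
  exact congrArg (fun z : List (NE α) →₀ R => z ⋄ single w 1) (toWord_single (nmul a b)).symm

theorem bar_d {s : α → ℤ} (D : (List α →₀ R) →ₗ[R] (List α →₀ R)) :
    ((tensorAlgebra s D).bar concat).d = barDiff nmul (bdeg s) (ndiff D) := by
  refine ext_single fun w => ?_
  refine (lin_single _ _).trans (Eq.trans ?_ (lin_single _ _).symm)
  induction w with
  | nil => rfl
  | cons a w ih =>
    refine congrArg₂ _ (congrArg₂ _ rfl ?_)
      (congrArg (fun z : List (NE α) →₀ R => sgn R (bdeg s a) • single [a] 1 ⋄ z) ih)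
    rcases w with _ | ⟨b, w⟩
    · exact ((congrArg (fun z : List (NE α) →₀ R => sgn R (bdeg s a) • z)
        (merge_nil nmul (single a 1))).trans (smul_zero _)).symm
    · exact congrArg (fun z : List (NE α) →₀ R => sgn R (bdeg s a) • z)
        (merge_nmul_cons a b w).symm

end TensorAlgebra

/-! ### The double cobar construction as a homotopy G-algebra -/

section BarBialgebra

variable {R : Type v} [CommRing R] {α : Type u} {d : α → ℤ} {δ : α → (α →₀ R)}

theorem cobar_isDGAlgebra (hδ : ∀ a, δ a ∈ homog d (d a - 1)) (hδ' : ∀ a, lin δ (δ a) = 0) :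
    (tensorAlgebra (sdeg d) (cobarDiff d δ)).IsDGAlgebra concat :=
  tensorAlgebra_isDGAlgebra (hasDegree_cobarDiff hδ) (isDer_cobarDiff _ _) cobarDiff_apply_nil
    (cobarDiff_cobarDiff hδ hδ')

/-- The product on the bar construction of the double cobar construction. -/
abbrev braceMul (d : α → ℤ) : (List (NE (NE α)) × List (NE (NE α)) →₀ R) →ₗ[R]
    (List (NE (NE α)) →₀ R) := barMulT (bdeg (sdeg d)) (kadOp d)

theorem tensorCoalgebra_isComplex (hδ : ∀ a, δ a ∈ homog d (d a - 1))
    (hδ' : ∀ a, lin δ (δ a) = 0) : (tensorAlgebra (bdeg (sdeg d))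
      (barDiff nmul (bdeg (sdeg d)) (ndiff (cobarDiff d δ)))).IsComplex where
  deg_one := rfl
  degree := hasDegree_barDiff (bdeg_nmul _)
      (ndiff_mem_homog cobarDiff_apply_nil (hasDegree_cobarDiff hδ))
  d_d := barDiff_barDiff (bdeg_nmul _)
      (ndiff_mem_homog cobarDiff_apply_nil (hasDegree_cobarDiff hδ)) nmul_assoc
      (ndiff_ndiff cobarDiff_apply_nil (cobarDiff_cobarDiff hδ hδ'))
      (ndiff_nmul cobarDiff_apply_nil (isDer_cobarDiff _ _))
  d_one := barDiff_nil _ _ _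
  counit_d := barDiff_apply_nil _ _ _

theorem hasDegree_braceMul : HasDegree (pdeg (wdeg (bdeg (sdeg d)))) (wdeg (bdeg (sdeg d))) 0
    (braceMul (R := R) d) := hasDegree_iff.2 fun p => by
  rw [add_zero, barMulT_single]
  exact barMul_mem_homog (kadOp_mem_homog d) p.1 p.2

theorem barDiff_braceMul (hδ : ∀ a, δ a ∈ homog d (d a - 1))
    (x : List (NE (NE α)) × List (NE (NE α)) →₀ R) :
    barDiff nmul (bdeg (sdeg d)) (ndiff (cobarDiff d δ)) (braceMul d x) =
      braceMul d (tensorD (wdeg (bdeg (sdeg d)))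
        (barDiff nmul (bdeg (sdeg d)) (ndiff (cobarDiff d δ)))
        (barDiff nmul (bdeg (sdeg d)) (ndiff (cobarDiff d δ))) x) := by
  have h : barDiff nmul (bdeg (sdeg d)) (ndiff (cobarDiff d δ)) ∘ₗ braceMul d =
      braceMul d ∘ₗ tensorD (wdeg (bdeg (sdeg d)))
        (barDiff nmul (bdeg (sdeg d)) (ndiff (cobarDiff d δ)))
        (barDiff nmul (bdeg (sdeg d)) (ndiff (cobarDiff d δ))) :=
    ext_tmul fun u w => by
      rw [LinearMap.comp_apply, LinearMap.comp_apply, tensorD_tmul, map_add,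
        barMulT_tmul, barMulT_tmul, barMulT_tmul]
      exact barDiff_barMul (bdeg_nmul _)
        (ndiff_mem_homog cobarDiff_apply_nil (hasDegree_cobarDiff hδ)) (kadOp_nil d)
        (kadOp_mem_homog d) (kadOp_nmul d) (kadOp_diff hδ) u w
  exact LinearMap.congr_fun h x

theorem braceMul_one_left (x : List (NE (NE α)) →₀ R) :
    braceMul d (tmul (single [] 1) x) = x := by
  rw [barMulT_tmul, barMul_one_left]

theorem braceMul_one_right (x : List (NE (NE α)) →₀ R) :
    braceMul d (tmul x (single [] 1)) = x := by
  rw [barMulT_tmul, barMul_one_right (kadOp_nil d)]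

theorem braceMul_assoc (x y z : List (NE (NE α)) →₀ R) :
    braceMul d (tmul (braceMul d (tmul x y)) z) = braceMul d (tmul x (braceMul d (tmul y z))) := by
  rw [barMulT_tmul, barMulT_tmul, barMulT_tmul, barMulT_tmul]
  exact barMul_assoc (kadOp_nil d) (kadOp_mem_homog d) (kadOp_kadOp d) x y z

theorem braceMul_apply_nil (x y : List (NE (NE α)) →₀ R) :
    braceMul d (tmul x y) [] = x [] * y [] := by
  rw [barMulT_tmul, barMul_apply_nil]

theorem deconcat_braceMul (x y : List (NE (NE α)) →₀ R) : deconcat (braceMul d (tmul x y)) =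
    mulT (wdeg (bdeg (sdeg d))) (braceMul d) (tmul (deconcat x) (deconcat y)) := by
  rw [barMulT_tmul]
  exact deconcat_barMul (kadOp_nil d) (kadOp_mem_homog d) x y

theorem tensorCoalgebra_isDGBialgebra (hδ : ∀ a, δ a ∈ homog d (d a - 1))
    (hδ' : ∀ a, lin δ (δ a) = 0) : (tensorAlgebra (bdeg (sdeg d))
      (barDiff nmul (bdeg (sdeg d)) (ndiff (cobarDiff d δ)))).IsDGBialgebra
        (braceMul d) deconcat where
  algebra :=
    { complex := tensorCoalgebra_isComplex hδ hδ'
      dgMap :=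
        { degree := hasDegree_braceMul
          comm := fun x => by rw [sgn_zero, one_smul]; exact barDiff_braceMul hδ x }
      one_mul := braceMul_one_left
      mul_one := braceMul_one_right
      mul_assoc := braceMul_assoc
      counit_mul := braceMul_apply_nil }
  coalgebra :=
    { complex := tensorCoalgebra_isComplex hδ hδ'
      dgMap :=
        { degree := hasDegree_deconcat (bdeg (sdeg d))
          comm := fun x => by
            rw [sgn_zero, one_smul]
            exact (deconcat_barDiff x).symm }
      counit_left := deconcat_counit_left
      counit_right := deconcat_counit_right
      coassoc := deconcat_coassoc
      map_one := deconcat_nil.trans (tmul_single _ _).symm }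
  comul_mul := deconcat_braceMul

theorem bar_isDGBialgebra (hδ : ∀ a, δ a ∈ homog d (d a - 1)) (hδ' : ∀ a, lin δ (δ a) = 0) :
    ((tensorAlgebra (sdeg d) (cobarDiff d δ)).bar concat).IsDGBialgebra (braceMul d) deconcat := by
  -- Degree and differential of the bar construction agree with those of the model propositionally
  -- only; both are replaced by variables so that the equations can be substituted.
  have h : ∀ (f : List (NE (NE α)) → ℤ) (D : (List (NE (NE α)) →₀ R) →ₗ[R] (List (NE (NE α)) →₀ R)),
      f = wdeg (bdeg (sdeg d)) → D = barDiff nmul (bdeg (sdeg d)) (ndiff (cobarDiff d δ)) →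
      (DGMod.mk (List (NE (NE α))) f [] D).IsDGBialgebra (braceMul d) deconcat := by
    rintro _ _ rfl rfl
    exact tensorCoalgebra_isDGBialgebra hδ hδ'
  exact h _ _ (bar_deg (tensorAlgebra (sdeg d) (cobarDiff d δ)) concat) (bar_d _)

theorem wdeg_nonneg {β : Type*} {s : β → ℤ} (hs : ∀ b, 0 < s b) (w : List β) : 0 ≤ wdeg s w := by
  induction w with
  | nil => exact le_rfl
  | cons b w ih => rw [wdeg_cons]; have := hs b; omega

theorem wdeg_pos {β : Type*} {s : β → ℤ} (hs : ∀ b, 0 < s b) {w : List β} (hw : w ≠ []) :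
    0 < wdeg s w := by
  rcases w with _ | ⟨b, w⟩
  · exact absurd rfl hw
  · rw [wdeg_cons]; have := hs b; have := wdeg_nonneg hs w; omega

/-- Letters of degree at least two are what keeps desuspended nonempty words in positive degree, so
that the double cobar construction is connected. -/
theorem sdeg_pos (hd : ∀ a, 2 ≤ d a) (b : NE α) : 0 < sdeg d b := by
  obtain ⟨_ | ⟨a, w⟩, hb⟩ := b
  · exact absurd rfl hb
  · have h1 := hd a
    have h2 := wdeg_nonneg (s := d) (fun a => by have := hd a; omega) w
    rw [sdeg, wdeg_cons]; omega

theorem braceMul_op (D : (List (NE α) →₀ R) →ₗ[R] (List (NE α) →₀ R)) (x : NE (NE α))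
    (ys : List (NE (NE α))) : (tensorAlgebra (sdeg d) D).op (braceMul d) [x] ys =
      kad d (single x.1 1) (single ys 1) := by
  have h := letters_barMul_letter_cat (R := R) (e := bdeg (sdeg d)) (κ := kadOp d) (single x 1)
    (single [] 1) (single ys 1)
  rw [cat_one, Finsupp.single_eq_same, one_smul, letter_single] at h
  refine (congrArg (tensorAlgebra (sdeg d) D).incl
    ((congrArg letters (barMulT_single (bdeg (sdeg d)) (kadOp d) [x] ys)).trans h)).trans ?_
  rw [tensorAlgebra_incl]
  exact (nincl_kadOp d _ _).trans (by rw [nincl_single])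

theorem letters_braceMul (x x' : NE (NE α)) (X ys : List (NE (NE α))) :
    letters (braceMul d (single (x :: x' :: X, ys) (1 : R))) = 0 := by
  rw [barMulT_single, single_cons, ← letter_single, letters_barMul_letter_cat,
    Finsupp.single_eq_of_ne (by simp), zero_smul]

theorem cobar_isHomotopyGAlgebra (hδ : ∀ a, δ a ∈ homog d (d a - 1))
    (hδ' : ∀ a, lin δ (δ a) = 0) (hd : ∀ a, 2 ≤ d a) :
    (tensorAlgebra (sdeg d) (cobarDiff d δ)).IsHomotopyGAlgebra concat (braceMul d) where
  algebra := cobar_isDGAlgebra hδ hδ'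
  connected := fun _ hb => wdeg_pos (sdeg_pos hd) hb
  bialgebra := bar_isDGBialgebra hδ hδ'
  op_eq_zero := fun xs ys hx _ => by
    obtain _ | ⟨x, _ | ⟨x', X⟩⟩ := xs
    · simp at hx
    · simp at hx
    · exact (congrArg _ (letters_braceMul x x' X ys)).trans (map_zero _)

/-- The operations `E₁ₖ` on words, for the shuffle coproduct. -/
def kadRec (d : α → ℤ) : List (NE α) → List (List (NE α)) → (List (NE α) →₀ R) := fun x ys =>
  match x, ys with
  | [], [] => single [] 1
  | [], _ :: _ => 0
  | a :: x, ys => single [a] 1 ⋄ kadRec d x ys +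
      (match ys with
        | [] => 0
        | y :: ys' => sgn R ((wdeg (sdeg d) y + 1) * wdeg (sdeg d) x + wdeg d a.1) •
            diag d LinearMap.id y (single a.1 1) ⋄ kadRec d x ys')

theorem kadeishvili_eq_kadRec (D : (List α →₀ R) →ₗ[R] (List α →₀ R)) (x : List (NE α))
    (ys : List (List (NE α))) :
    (tensorAlgebra d D).kadeishvili concat (shuffleCoproduct d) x ys = kadRec d x ys := by
  induction x generalizing ys with
  | nil => rcases ys with _ | ⟨y, ys⟩ <;> rfl
  | cons a x ih =>
    refine congrArg₂ _ (congrArg (fun z : List (NE α) →₀ R => single [a] 1 ⋄ z) (ih ys)) ?_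
    rcases ys with _ | ⟨y, ys⟩
    · rfl
    · have h := congrArg₂ (fun z w : List (NE α) →₀ R =>
        sgn R ((wdeg (sdeg d) y + 1) * wdeg (sdeg d) x + wdeg d a.1) • z ⋄ w)
        (LinearMap.congr_fun (diagAct_eq d D LinearMap.id y) (single a.1 1)) (ih ys)
      have hdeg : ((tensorAlgebra d D).cobar (shuffleCoproduct d)).deg = wdeg (sdeg d) :=
        cobar_deg _ _
      refine Eq.trans (congrArg (fun n : ℤ => sgn R n • _) ?_) h
      exact congrArg (fun f : List (NE α) → ℤ => (f y + 1) * f x + wdeg d a.1) hdeg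

/-- A letter takes at most one argument. Thus of all cuts of the list of arguments only two matter
for the first letter: it takes nothing, or exactly the first argument. -/
theorem kadRec_eq (x : List (NE α)) (ys : List (NE (NE α))) :
    kadRec d x (ys.map Subtype.val) = kad d (single x (1 : R)) (single ys 1) := by
  induction x generalizing ys with
  | nil =>
    rw [kad_one, atNil_apply]
    rcases ys with _ | ⟨y, ys⟩
    · rw [Finsupp.single_eq_same, one_smul]; rfl
    · rw [Finsupp.single_eq_of_ne (by simp), zero_smul]; rfl
  | cons a x ih =>
    rw [single_cons, kad_single_cat d a (single_mem_homog rfl)]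
    have h0 : (kadLetter (R := R) d a ∘ₗ gr (wdeg (bdeg (sdeg d))) (wdeg (sdeg d) x))
        (single [] 1) = single [a] 1 := by
      rw [LinearMap.comp_apply, gr_single, wdeg_nil, mul_zero, sgn_zero, one_smul, kadLetter_apply,
        nletters_nil, map_zero, smul_zero, add_zero, Finsupp.single_eq_same, one_smul]
    rcases ys with _ | ⟨y, ys⟩
    · rw [conv_nil, h0, ← ih []]
      exact (add_zero _)
    · have h1 : (kadLetter (R := R) d a ∘ₗ gr (wdeg (bdeg (sdeg d))) (wdeg (sdeg d) x)) ∘ₗ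
          catL (single [y] 1) = (sgn R (wdeg (sdeg d) x * bdeg (sdeg d) y) * sgn R (wdeg d a.1)) •
            atNil (act d a.1 (single y.1 1)) := ext_single fun w => by
        rw [LinearMap.comp_apply, LinearMap.comp_apply, catL_apply, single_cat, gr_single, map_smul,
          kadLetter_apply, List.singleton_append, Finsupp.single_eq_of_ne (by simp), zero_smul,
          zero_add, single_cons, nletters_single_cat, map_smul, LinearMap.smul_apply, atNil_apply,
          wdeg_cons, smul_smul]
        rcases w with _ | ⟨z, w⟩
        · rw [wdeg_nil, add_zero]
        · rw [Finsupp.single_eq_of_ne (by simp), zero_smul, smul_zero, smul_zero]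
      rw [single_cons, conv_cons, h0, h1, conv_smul_left, LinearMap.smul_apply, conv_atNil_left,
        LinearMap.comp_apply, catL_apply, ← single_cons, ← ih, ← ih, ← diag_id]
      rw [← sgn_add, mul_comm (wdeg (sdeg d) x)]
      rfl

end BarBialgebra

end

end DoubleCobar

namespace DoubleCobar

open Finsupp (single)

noncomputable section

/-! ### The cyclic pairing, and the square of the Connes–Moscovici operator -/

section CyclicPairing

variable {R : Type v} [CommRing R] {α : Type*} (d : α → ℤ)

/-- The sum `∑ ± S(a) ⋄ (q w p)` over all factorizations `p a q` of a word `u`. -/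
def cmPairWord : List (NE α) → ((List (NE α) →₀ R) →ₗ[R] (List (NE α) →₀ R)) := fun u =>
  match u with
  | [] => 0
  | a :: u => actS d a.1 ∘ₗ catL (single u 1) + sgn R (sdeg d a * wdeg (sdeg d) u) •
      cmPairWord u ∘ₗ catR (single [a] 1) ∘ₗ gr (wdeg (sdeg d)) (sdeg d a)

/-- The bilinear extension of `cmPairWord`. -/
def cmPair : (List (NE α) →₀ R) →ₗ[R] (List (NE α) →₀ R) →ₗ[R] (List (NE α) →₀ R) :=
  lin (M := (List (NE α) →₀ R) →ₗ[R] (List (NE α) →₀ R)) (cmPairWord d)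

theorem cmPair_one (w : List (NE α) →₀ R) : cmPair d (single [] 1) w = 0 := by
  rw [cmPair, lin_single]; rfl

theorem cmPair_single_cat (a : NE α) {k : ℤ} {u : List (NE α) →₀ R}
    (hu : u ∈ homog (wdeg (sdeg d)) k) (w : List (NE α) →₀ R) :
    cmPair d (single [a] 1 ⋄ u) w = actS d a.1 (u ⋄ w) + sgn R (sdeg d a * k) •
      cmPair d u (gr (wdeg (sdeg d)) (sdeg d a) w ⋄ single [a] 1) := by
  refine homog_induction (p := fun u => cmPair d (single [a] 1 ⋄ u) w = actS d a.1 (u ⋄ w) +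
    sgn R (sdeg d a * k) • cmPair d u (gr (wdeg (sdeg d)) (sdeg d a) w ⋄ single [a] 1))
    hu ?_ ?_ ?_ ?_
  · simp [cat_zero, zero_cat]
  · intro x y hx hy
    simp only [cat_add, add_cat, map_add, LinearMap.add_apply, hx, hy, smul_add]; abel
  · intro c x hx
    simp only [cat_smul, smul_cat, map_smul, LinearMap.smul_apply, hx, smul_add, smul_comm c]
  · rintro u rfl
    rw [← single_cons, cmPair, lin_single, lin_single]; rfl

theorem cmPair_letter (a : NE α) (w : List (NE α) →₀ R) :
    cmPair d (single [a] 1) w = actS d a.1 w := by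
  have := cmPair_single_cat d (k := 0) a (u := single [] (1 : R)) (single_mem_homog rfl) w
  rwa [cat_one, one_cat, cmPair_one, smul_zero, add_zero] at this

/-- The distinguished letter of a factorization of `u ⋄ u'` lies in `u`, and then `u'` stands
between the remaining end of `u` and `w`; or it lies in `u'`, and then `u` follows `w`. -/
theorem cmPair_cat {k l : ℤ} {u u' : List (NE α) →₀ R} (hu : u ∈ homog (wdeg (sdeg d)) k)
    (hu' : u' ∈ homog (wdeg (sdeg d)) l) (w : List (NE α) →₀ R) :
    cmPair d (u ⋄ u') w = cmPair d u (u' ⋄ w) +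
      sgn R (k * l) • cmPair d u' (gr (wdeg (sdeg d)) k w ⋄ u) := by
  refine homog_induction (p := fun u => cmPair d (u ⋄ u') w = cmPair d u (u' ⋄ w) +
      sgn R (k * l) • cmPair d u' (gr (wdeg (sdeg d)) k w ⋄ u)) hu ?_ ?_ ?_ ?_
  · simp [cat_zero, zero_cat]
  · intro x y hx hy
    simp only [cat_add, add_cat, map_add, LinearMap.add_apply, hx, hy, smul_add]; abel
  · intro c x hx
    simp only [cat_smul, smul_cat, map_smul, LinearMap.smul_apply, hx, smul_add, smul_comm c]
  · rintro u rfl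
    clear hu
    induction u generalizing w with
    | nil => rw [one_cat, cmPair_one, wdeg_nil, zero_mul, sgn_zero, one_smul, gr_zero, cat_one,
        zero_add]
    | cons a u ih =>
      have hu : (single u 1 : List (NE α) →₀ R) ∈ homog (wdeg (sdeg d)) (wdeg (sdeg d) u) :=
        single_mem_homog rfl
      rw [single_cons, cat_assoc, cmPair_single_cat d a (cat_mem_homog hu hu' rfl), ih,
        cmPair_single_cat d a hu, gr_cat, gr_cat, gr_gr, gr_homog hu', gr_single, wdeg_cons,
        wdeg_cons, wdeg_nil, add_zero, add_comm (wdeg (sdeg d) u) (sdeg d a)]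
      simp only [cat_assoc, smul_cat, cat_smul, map_smul, smul_add]
      have := @sgn_mul_self R _
      match_scalars <;> (try simp only [mul_sub, sub_mul, mul_add, add_mul, sgn_sub, sgn_add,
        sgn_neg, sgn_one, mul_one, one_mul, neg_mul, mul_neg, sgn_zero, mul_zero]) <;> grind

/-- Integration by parts. Where `v` multiplies the distinguished letter `a`, the antipode turns this
into minus the action of `v` on the cyclic remainder `q w p`, followed by `S(a)`. By the Leibniz
rule the terms on `p` and `q` cancel those in which `v` hits the other letters, and the term on `w`
is left. -/
theorem cmPair_leftDer (v : α) {k : ℤ} {u : List (NE α) →₀ R}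
    (hu : u ∈ homog (wdeg (sdeg d)) k) (w : List (NE α) →₀ R) :
    cmPair d (leftDer d v u) w = -(sgn R (d v * k) • cmPair d u (leftDer d v w)) := by
  refine homog_induction (p := fun u => cmPair d (leftDer d v u) w =
    -(sgn R (d v * k) • cmPair d u (leftDer d v w))) hu ?_ ?_ ?_ ?_
  · simp
  · intro x y hx hy
    simp only [map_add, LinearMap.add_apply, hx, hy, smul_add]; abel
  · intro c x hx
    simp only [map_smul, LinearMap.smul_apply, hx, smul_comm c, smul_neg]
  · rintro u rfl
    clear hu
    induction u generalizing w with
    | nil => rw [leftDer_one, map_zero, cmPair_one, smul_zero, neg_zero]; rfl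
    | cons a u ih =>
      have hu : (single u 1 : List (NE α) →₀ R) ∈ homog (wdeg (sdeg d)) (wdeg (sdeg d) u) :=
        single_mem_homog rfl
      have hLu := (hasDegree_leftDer d v).mem hu rfl
      have hg := (hasDegree_leftDer (R := R) d v).gr_map (sdeg d a) w
      rw [single_cons, leftDer_letter_cat, map_add, map_smul, map_smul, LinearMap.add_apply,
        LinearMap.smul_apply, LinearMap.smul_apply, cmPair_single_cat d _ hu,
        cmPair_single_cat d _ hLu, cmPair_single_cat d _ hu, ih, ncons, actS_cons,
        isDer_leftDer d v (single u 1) w, isDer_leftDer d v _ (single [a] 1), leftDer_letter,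
        gr_single, gr_gr, hg, ← ncons, sdeg_ncons, wdeg_cons]
      simp only [cat_smul, smul_cat, map_smul, map_add, smul_add, smul_neg]
      generalize actS d a.1 (leftDer d v (single u 1) ⋄ w) = x₁
      generalize actS d a.1 (single u 1 ⋄ leftDer d v w) = x₂
      generalize cmPair d (single u 1)
        (gr (wdeg (sdeg d)) (d v + sdeg d a) w ⋄ single [ncons v a] 1) = x₃
      generalize cmPair d (single u 1)
        (leftDer d v (gr (wdeg (sdeg d)) (sdeg d a) w) ⋄ single [a] 1) = x₄
      -- All degrees are expressed by desuspended ones, so that the signs depend on `m`, `n` and `j`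
      -- alone.
      rw [show wdeg d a.1 = sdeg d a + 1 by rw [sdeg]; ring]
      generalize sdeg d a = m
      generalize wdeg (sdeg d) u = n
      generalize d v = j
      clear ih hu hLu hg
      have := @sgn_mul_self R _
      have := @sgn_arg_self R _
      match_scalars <;> (try simp only [mul_sub, sub_mul, mul_add, add_mul, sgn_sub, sgn_add,
        sgn_neg, sgn_one, mul_one, one_mul, neg_mul, mul_neg, sgn_zero, mul_zero]) <;> grind

theorem cmPair_leftDerL {j : ℤ} {p : α →₀ R} (hp : p ∈ homog d j) {k : ℤ}
    {u : List (NE α) →₀ R} (hu : u ∈ homog (wdeg (sdeg d)) k) (w : List (NE α) →₀ R) :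
    cmPair d (leftDerL d p u) w = -(sgn R (j * k) • cmPair d u (leftDerL d p w)) := by
  refine homog_induction (p := fun p => cmPair d (leftDerL d p u) w =
    -(sgn R (j * k) • cmPair d u (leftDerL d p w))) hp ?_ ?_ ?_ ?_
  · simp
  · intro x y hx hy
    simp only [map_add, LinearMap.add_apply, hx, hy, smul_add]; abel
  · intro c x hx
    simp only [map_smul, LinearMap.smul_apply, hx, smul_comm c, smul_neg]
  · rintro v rfl
    rw [leftDerL_single, cmPair_leftDer d v hu]

theorem hasDegree_cmPair {k : ℤ} {u : List (NE α) →₀ R} (hu : u ∈ homog (wdeg (sdeg d)) k) :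
    HasDegree (wdeg (sdeg d)) (wdeg (sdeg d)) (k + 1) (cmPair d u) := by
  rw [hasDegree_iff]
  intro w
  refine homog_induction (p := fun u => cmPair d u (single w 1) ∈
    homog (wdeg (sdeg d)) (wdeg (sdeg d) w + (k + 1))) hu ?_ ?_ ?_ ?_
  · rw [map_zero]; exact zero_mem _
  · intro x y hx hy; rw [map_add]; exact add_mem hx hy
  · intro c x hx; rw [map_smul]; exact Submodule.smul_mem _ _ hx
  · rintro u rfl
    clear hu
    induction u generalizing w with
    | nil => rw [cmPair_one]; exact zero_mem _
    | cons a u ih =>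
      rw [single_cons, cmPair_single_cat d a (single_mem_homog rfl), gr_single, smul_cat, map_smul,
        single_cat, single_cat]
      refine add_mem ((hasDegree_actS d a.1).mem (single_mem_homog rfl) ?_)
        (Submodule.smul_mem _ _ (Submodule.smul_mem _ _ ?_))
      · rw [wdeg_append, wdeg_cons, sdeg]; ring
      · convert ih (w ++ [a]) using 1
        rw [wdeg_append, wdeg_cons, wdeg_cons, wdeg_nil]; ring_nf

/-- The Connes–Moscovici operator. -/
def cmOp : (List (NE α) →₀ R) →ₗ[R] (List (NE α) →₀ R) := (cmPair d).flip (single [] 1)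

theorem cmOp_apply (x : List (NE α) →₀ R) : cmOp d x = cmPair d x (single [] 1) := rfl

theorem hasDegree_cmOp : HasDegree (wdeg (sdeg d)) (wdeg (sdeg d)) 1 (cmOp (R := R) d) := by
  rw [hasDegree_iff]
  intro x
  have h : (single x 1 : List (NE α) →₀ R) ∈ homog (wdeg (sdeg d)) (wdeg (sdeg d) x) :=
    single_mem_homog rfl
  have := hasDegree_iff.1 (hasDegree_cmPair d h) []
  rwa [wdeg_nil, zero_add, ← cmOp_apply] at this

/-- Integrate by parts with `w = 1`: a derivation kills the unit. -/
theorem cmOp_leftDer (v : α) (x : List (NE α) →₀ R) : cmOp d (leftDer d v x) = 0 := by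
  have h : cmOp (R := R) d ∘ₗ leftDer d v = 0 := ext_single fun x => ?_
  · exact LinearMap.congr_fun h x
  rw [LinearMap.comp_apply, cmOp_apply, cmPair_leftDer d v (single_mem_homog rfl), leftDer_one,
    map_zero, smul_zero, neg_zero]; rfl

theorem cmOp_actS (a : NE α) (x : List (NE α) →₀ R) : cmOp d (actS d a.1 x) = 0 := by
  induction a using ne_induction generalizing x with
  | letter v =>
    rw [nletter, actS_cons, map_neg, map_smul]
    exact (congrArg (fun z => -(sgn R (d v * wdeg d []) • z)) (cmOp_leftDer d v x)).trans (by simp)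
  | cons v a ih => rw [ncons, actS_cons, map_neg, map_smul, ih, smul_zero, neg_zero]

/-- Every summand of a value of `cmPair` has the form `S(a)` applied to something with `a` a
nonempty word. It therefore lies in the image of some `leftDer`, which the operator annihilates. -/
theorem cmOp_cmOp (x : List (NE α) →₀ R) : cmOp d (cmOp d x) = 0 := by
  have h : ∀ (u : List (NE α)) (w : List (NE α) →₀ R), cmOp d (cmPair d (single u 1) w) = 0 := by
    intro u
    induction u with
    | nil => intro w; rw [cmPair_one, map_zero]
    | cons a u ih =>
      intro w
      rw [single_cons, cmPair_single_cat d a (single_mem_homog rfl), map_add, map_smul, ih,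
        cmOp_actS, smul_zero, add_zero]
  have h' : cmOp (R := R) d ∘ₗ cmOp d = 0 := ext_single fun u => by
    rw [LinearMap.comp_apply, cmOp_apply d (single u 1), h]; rfl
  exact LinearMap.congr_fun h' x

end CyclicPairing

/-! ### The differential of the cyclic pairing -/

section CyclicDifferential

variable {R : Type v} [CommRing R] {α : Type*} {d : α → ℤ} {δ : α → (α →₀ R)}

variable (d δ) in
/-- The differential of `cmPair d x`, for `x` of degree `k`. -/
def CmDiff (k : ℤ) (x : List (NE α) →₀ R) : Prop :=
  ∀ w, cobarDiff d δ (cmPair d x w) = -cmPair d (cobarDiff d δ x) w -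
    sgn R k • cmPair d x (cobarDiff d δ w) - x ⋄ w + gr (wdeg (sdeg d)) k w ⋄ x

theorem CmDiff.smul {k : ℤ} {x : List (NE α) →₀ R} (h : CmDiff d δ k x) (c : R) :
    CmDiff d δ k (c • x) := fun w => by
  simp only [map_smul, LinearMap.smul_apply, smul_cat, cat_smul, h w, smul_add, smul_sub, smul_neg,
    smul_comm c]

/-- Each of the two terms of `cmPair_cat` contributes a commutator. The inner products `x ⋄ w ⋄ u`
cancel, and the outer ones form the commutator of `u ⋄ x` with `w`. -/
theorem cmDiff_cat (hδ : ∀ a, δ a ∈ homog d (d a - 1)) {k l : ℤ} {u x : List (NE α) →₀ R}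
    (hu : u ∈ homog (wdeg (sdeg d)) k) (hx : x ∈ homog (wdeg (sdeg d)) l)
    (hu' : CmDiff d δ k u) (hx' : CmDiff d δ l x) : CmDiff d δ (k + l) (u ⋄ x) := fun w => by
  have hD := hasDegree_cobarDiff hδ
  rw [cmPair_cat d hu hx, map_add, map_smul, hu', hx', isDer_cobarDiff d δ u x,
    isDer_cobarDiff d δ x w, isDer_cobarDiff d δ _ u, map_add (cmPair d) (_ ⋄ x), LinearMap.add_apply, gr_homog hu,
    smul_cat, map_smul (cmPair d), LinearMap.smul_apply, cmPair_cat d hu (hD.mem hx rfl),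
    cmPair_cat d (hD.mem hu rfl) hx, cmPair_cat d hu hx, gr_cat, gr_cat, gr_homog hu,
    gr_homog hx, gr_gr, gr_gr, hD.gr_map, gr_homog hx, add_comm l k,
    add_comm (-1) k]
  simp only [cat_assoc, smul_cat, cat_smul, map_smul, map_add, smul_add, smul_sub, smul_neg]
  have := @sgn_mul_self R _
  match_scalars <;> (try simp only [mul_sub, sub_mul, mul_add, add_mul, sgn_sub, sgn_add,
        sgn_neg, sgn_one, mul_one, one_mul, neg_mul, mul_neg, sgn_zero, mul_zero]) <;> grind

theorem cmPair_nletter (v : α) (w : List (NE α) →₀ R) :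
    cmPair d (single [nletter v] 1) w = -leftDer d v w := by
  rw [cmPair_letter, nletter, actS_cons, wdeg_nil, mul_zero, sgn_zero, one_smul]; rfl

/-- After integration by parts `leftDer d v` acts on `w`, where its commutator with the differential
is known; `cmPair_cat` evaluates the pairing on the commutators of `s⁻¹v` with `u`. -/
theorem cmDiff_leftDer (hδ : ∀ a, δ a ∈ homog d (d a - 1)) (v : α) {k : ℤ}
    {u : List (NE α) →₀ R} (hu : u ∈ homog (wdeg (sdeg d)) k) (h : CmDiff d δ k u) :
    CmDiff d δ (k + d v) (leftDer d v u) := fun w => by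
  have hD := (hasDegree_cobarDiff hδ).mem hu rfl
  have hv : (single [nletter v] (1 : R)) ∈ homog (wdeg (sdeg d)) (d v - 1) :=
    single_mem_homog (by rw [wdeg_cons, wdeg_nil, add_zero, sdeg_nletter])
  have hg := (hasDegree_leftDer (R := R) d v).gr_map k w
  rw [cmPair_leftDer d v hu, map_neg, map_smul, h, cobarDiff_leftDer hδ v w,
    cobarDiff_leftDer hδ v u, map_sub, map_add, map_add, map_sub, map_add, map_add, map_smul,
    map_smul, LinearMap.sub_apply, LinearMap.add_apply, LinearMap.add_apply, LinearMap.smul_apply,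
    cmPair_leftDer d v hD, cmPair_leftDerL d (hδ v) hu, cmPair_cat d hv hu, gr_homog hu, smul_cat,
    map_smul, LinearMap.smul_apply, cmPair_cat d hu hv, cmPair_leftDer d v hu, cmPair_nletter,
    cmPair_nletter, isDer_leftDer d v u, isDer_leftDer d v _ u, gr_homog hu, gr_gr, hg,
    add_comm k (d v)]
  simp only [cat_smul, smul_cat, map_smul, map_add, smul_add, smul_sub, smul_neg]
  generalize cmPair d (cobarDiff d δ u) (leftDer d v w) = x₁
  generalize cmPair d u (leftDer d v (cobarDiff d δ w)) = x₂
  generalize cmPair d u (leftDerL d (δ v) w) = x₃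
  generalize cmPair d u (single [nletter v] 1 ⋄ w) = x₄
  generalize cmPair d u (gr (wdeg (sdeg d)) (d v - 1) w ⋄ single [nletter v] 1) = x₅
  generalize leftDer d v u ⋄ w = x₆
  generalize u ⋄ leftDer d v w = x₇
  generalize leftDer d v (gr (wdeg (sdeg d)) k w) ⋄ u = x₈
  generalize gr (wdeg (sdeg d)) (d v + k) w ⋄ leftDer d v u = x₉
  generalize d v = j
  have := @sgn_mul_self R _
  have := @sgn_arg_self R _
  clear hD hv hg h hu
  match_scalars <;> (try simp only [mul_sub, sub_mul, mul_add, add_mul, sgn_sub, sgn_add,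
        sgn_neg, sgn_one, mul_one, one_mul, neg_mul, mul_neg, sgn_zero, mul_zero]) <;> grind

/-- Since `S(v) = -v`, pairing with `s⁻¹v` is minus `leftDer d v`, so this is again the commutator
formula for the differential. -/
theorem cmDiff_nletter (hδ : ∀ a, δ a ∈ homog d (d a - 1)) (v : α) :
    CmDiff d δ (d v - 1) (single [nletter v] (1 : R)) := fun w => by
  have hL : cmPair d (toWord (letter (δ v))) w = -leftDerL d (δ v) w := by
    have h : (cmPair d).flip w ∘ₗ toWord ∘ₗ letter = -(leftDerL d).flip w :=
      ext_single fun a => by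
        rw [LinearMap.comp_apply, LinearMap.comp_apply, letter_single, toWord_nletter,
          LinearMap.flip_apply, cmPair_nletter, LinearMap.neg_apply, LinearMap.flip_apply,
          leftDerL_single]
    exact LinearMap.congr_fun h (δ v)
  rw [cmPair_nletter, map_neg, cobarDiff_leftDer hδ v w, cobarDiff_nletter, map_neg,
    LinearMap.neg_apply, hL, cmPair_nletter, sgn_sub, sgn_one]
  module

theorem cmDiff (hδ : ∀ a, δ a ∈ homog d (d a - 1)) (x : List (NE α)) :
    CmDiff d δ (wdeg (sdeg d) x) (single x (1 : R)) := by
  induction x with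
  | nil => exact fun w => by simp [cmPair_one, cobarDiff_one, one_cat, cat_one, wdeg_nil, gr_zero]
  | cons a x ih =>
    rw [single_cons, wdeg_cons]
    refine cmDiff_cat hδ (single_mem_homog (by rw [wdeg_cons, wdeg_nil, add_zero]))
      (single_mem_homog rfl) ?_ ih
    induction a using ne_induction with
    | letter v => rw [sdeg_nletter]; exact cmDiff_nletter hδ v
    | cons v a iha =>
      have h := cmDiff_leftDer hδ v (single_mem_homog (by rw [wdeg_cons, wdeg_nil, add_zero])) iha
      rw [leftDer_letter] at h
      have h := h.smul (sgn R (d v))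
      rwa [sgn_smul_smul, add_comm, ← sdeg_ncons] at h

/-- For `w = 1` the commutator term in `cmDiff` vanishes. -/
theorem cobarDiff_cmOp (hδ : ∀ a, δ a ∈ homog d (d a - 1)) (x : List (NE α) →₀ R) :
    cobarDiff d δ (cmOp d x) = -cmOp d (cobarDiff d δ x) := by
  have h : cobarDiff d δ ∘ₗ cmOp d = -(cmOp d ∘ₗ cobarDiff d δ) := ext_single fun x => by
    rw [LinearMap.neg_apply, LinearMap.comp_apply, LinearMap.comp_apply, cmOp_apply, cmDiff hδ x,
      cobarDiff_one, map_zero, gr_single, wdeg_nil, mul_zero, sgn_zero, one_smul, cat_one, one_cat,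
      cmOp_apply]
    simp
  exact LinearMap.congr_fun h x

end CyclicDifferential

end

end DoubleCobar

namespace DoubleCobar

open Finsupp (single)

noncomputable section

/-! ### The operation `E₁₁` -/

section BraceOne

variable {R : Type v} [CommRing R] {α : Type*} (d : α → ℤ)

/-- The operation `E₁₁` on the cobar construction, extended by zero to the unit. -/
def kadOne : (List (NE α) →₀ R) →ₗ[R] (List (NE α) →₀ R) →ₗ[R] (List (NE α) →₀ R) :=
  (kad d).compl₂ (letter ∘ₗ nred)

theorem kadOne_apply (u y : List (NE α) →₀ R) : kadOne d u y = kad d u (letter (nred y)) := rfl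

theorem kadOne_nil (u : List (NE α) →₀ R) : kadOne d u (single [] 1) = 0 := by
  rw [kadOne_apply, nred_nil, map_zero, map_zero]

theorem kadOne_single (u : List (NE α) →₀ R) (y : NE (NE α)) :
    kadOne d u (single y.1 1) = kad d u (single [y] 1) := by
  rw [kadOne_apply, nred_single, letter_single]

theorem kadOne_one (y : List (NE α) →₀ R) : kadOne d (single [] 1) y = 0 := by
  have := letter_cat_apply_nil (nred y) (single ([] : List (NE (NE α))) (1 : R))
  rw [cat_one] at this
  rw [kadOne_apply, kad_one, atNil_apply, this, zero_smul]

theorem kadOne_leftDer (v : α) (u y : List (NE α) →₀ R) :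
    kadOne d (leftDer d v u) y = leftDer d v (kadOne d u y) := by
  rw [kadOne_apply, kad_leftDer]; rfl

/-- Induction on homogeneous elements of the tensor algebra: the unit, and nonempty words. -/
theorem word_homog_induction {β : Type*} {s : β → ℤ} {l : ℤ} {p : (List β →₀ R) → Prop}
    {y : List β →₀ R} (hy : y ∈ homog (wdeg s) l) (zero : p 0) (add : ∀ x y, p x → p y → p (x + y))
    (smul : ∀ (c : R) x, p x → p (c • x)) (one : l = 0 → p (single [] 1))
    (word : ∀ y : NE β, wdeg s y.1 = l → p (single y.1 1)) : p y :=
  homog_induction hy zero add smul fun y hl => by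
    rcases eq_or_ne y [] with rfl | h
    · exact one hl.symm
    · exact word ⟨y, h⟩ hl

/-- A single argument enters either `x` or `u`; in the second case it has to be moved past `x`. -/
theorem kadOne_cat (u : List (NE α) →₀ R) {k l : ℤ} {x y : List (NE α) →₀ R}
    (hx : x ∈ homog (wdeg (sdeg d)) k) (hy : y ∈ homog (wdeg (sdeg d)) l) :
    kadOne d (u ⋄ x) y = u ⋄ kadOne d x y + sgn R (k * (l + 1)) • kadOne d u y ⋄ x := by
  refine word_homog_induction (p := fun y => kadOne d (u ⋄ x) y = u ⋄ kadOne d x y +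
    sgn R (k * (l + 1)) • kadOne d u y ⋄ x) hy ?_ ?_ ?_ ?_ ?_
  · simp [cat_zero, zero_cat]
  · intro y z hy hz; simp only [map_add, hy, hz, cat_add, add_cat, smul_add]; abel
  · intro c y hy; simp only [map_smul, hy, cat_smul, smul_cat, smul_add, smul_comm c]
  · intro _; simp only [kadOne_nil, cat_zero, zero_cat, smul_zero, add_zero]
  · rintro y rfl
    have h := conv_cons (kad d u ∘ₗ gr (wdeg (bdeg (sdeg d))) k) (kad d x) y (single [] 1)
    rw [conv_nil, cat_one, LinearMap.comp_apply, gr_single, wdeg_nil, mul_zero, sgn_zero,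
      one_smul, kad_nil, LinearMap.comp_apply, LinearMap.comp_apply, catL_apply, cat_one, gr_single,
      map_smul, kad_nil, smul_cat, wdeg_cons, wdeg_nil, add_zero] at h
    rw [kadOne_single, kadOne_single, kadOne_single, kad_cat d u hx, h, bdeg]

/-- This holds for every `y`, units included: the operation ignores the unit part of `y`, and a
nonempty word annihilates the unit. -/
theorem kadOne_letter (a : NE α) (y : List (NE α) →₀ R) :
    kadOne d (single [a] 1) y = sgn R (wdeg d a.1) • act d a.1 y := by
  have h1 := letter_cat_apply_nil (nred y) (single ([] : List (NE (NE α))) (1 : R))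
  have h2 := nletters_letter_cat (nred y) (single ([] : List (NE (NE α))) (1 : R))
  rw [cat_one] at h1 h2
  rw [kadOne_apply, kad_letter, kadLetter_apply, h1, h2, zero_smul, zero_add,
    Finsupp.single_eq_same, one_smul, nincl_nred, map_sub, map_smul, act_one,
    Finsupp.single_eq_of_ne' a.2, zero_smul, smul_zero, sub_zero]

theorem kadOne_nletter (v : α) (y : List (NE α) →₀ R) :
    kadOne d (single [nletter v] 1) y = sgn R (d v) • leftDer d v y := by
  rw [kadOne_letter, nletter, wdeg_cons, wdeg_nil, add_zero]; rfl

theorem kadOne_mem_homog {k l m : ℤ} {u y : List (NE α) →₀ R} (hu : u ∈ homog (wdeg (sdeg d)) k)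
    (hy : y ∈ homog (wdeg (sdeg d)) l) (hm : k + l + 1 = m) :
    kadOne d u y ∈ homog (wdeg (sdeg d)) m := by
  refine word_homog_induction (p := fun y => kadOne d u y ∈ homog (wdeg (sdeg d)) m) hy
    ?_ ?_ ?_ ?_ ?_
  · rw [map_zero]; exact zero_mem _
  · intro x y hx hy; rw [map_add]; exact add_mem hx hy
  · intro c x hx; rw [map_smul]; exact Submodule.smul_mem _ _ hx
  · intro _; rw [kadOne_nil]; exact zero_mem _
  · rintro y rfl
    rw [kadOne_single]
    have := hasDegree_iff.1 (hasDegree_kad d hu) [y]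
    rwa [wdeg_cons, wdeg_nil, add_zero, bdeg,
      show wdeg (sdeg d) y.1 + 1 + k = m by rw [← hm]; ring] at this

/-- For one argument the boundary convolutions in `kadDiff` are the products of `u` and `y` in the
two orders. So the operation is a homotopy for graded commutativity. -/
theorem kadOne_diff {δ : α → (α →₀ R)} (hδ : ∀ a, δ a ∈ homog d (d a - 1)) {k l : ℤ}
    {u y : List (NE α) →₀ R} (hu : u ∈ homog (wdeg (sdeg d)) k)
    (hy : y ∈ homog (wdeg (sdeg d)) l) :
    cobarDiff d δ (kadOne d u y) = kadOne d (cobarDiff d δ u) y -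
      sgn R k • kadOne d u (cobarDiff d δ y) - sgn R k • u ⋄ y +
      sgn R (k * (l + 1)) • y ⋄ u := by
  refine homog_induction (p := fun u => cobarDiff d δ (kadOne d u y) =
    kadOne d (cobarDiff d δ u) y - sgn R k • kadOne d u (cobarDiff d δ y) - sgn R k • u ⋄ y +
      sgn R (k * (l + 1)) • y ⋄ u) hu ?_ ?_ ?_ ?_
  · simp [cat_zero, zero_cat]
  · intro x z hx hz
    simp only [map_add, LinearMap.add_apply, hx, hz, cat_add, add_cat, smul_add]; abel
  · intro c x hx
    simp only [map_smul, LinearMap.smul_apply, hx, cat_smul, smul_cat, smul_add, smul_sub,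
      smul_comm c]
  rintro u rfl
  clear hu
  refine word_homog_induction (p := fun y => cobarDiff d δ (kadOne d (single u 1) y) =
    kadOne d (cobarDiff d δ (single u 1)) y -
      sgn R (wdeg (sdeg d) u) • kadOne d (single u 1) (cobarDiff d δ y) -
      sgn R (wdeg (sdeg d) u) • single u 1 ⋄ y +
      sgn R (wdeg (sdeg d) u * (l + 1)) • y ⋄ single u 1) hy ?_ ?_ ?_ ?_ ?_
  · simp [cat_zero, zero_cat]
  · intro x z hx hz; simp only [map_add, hx, hz, cat_add, add_cat, smul_add]; abel
  · intro c x hx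
    simp only [map_smul, hx, cat_smul, smul_cat, smul_add, smul_sub, smul_comm c]
  · rintro rfl
    rw [kadOne_nil, kadOne_nil, cobarDiff_one, map_zero, map_zero, one_cat, cat_one, zero_add,
      mul_one]
    simp
  · rintro y rfl
    have h := LinearMap.congr_fun (kadDiff hδ u) (single [y] (1 : R))
    have hb : barDiff nmul (bdeg (sdeg d)) (ndiff (cobarDiff d δ)) (single [y] 1) =
        -letter (ndiff (cobarDiff d δ) y) := by
      have := barDiff_single_cat nmul (bdeg (sdeg d)) (ndiff (cobarDiff d δ)) y (single [] 1)
      rw [cat_one, cat_one, merge_nil, barDiff_nil, cat_zero] at this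
      simpa using this
    have h1 := conv_cons (gr (wdeg (sdeg d)) 1 ∘ₗ kad d (single u (1 : R))) nletters y (single [] 1)
    rw [conv_nil, cat_one, nletters_nil, cat_zero, add_zero, LinearMap.comp_apply, kad_nil,
      nletters_single, gr_single, one_mul, smul_cat] at h1
    have h2 := conv_cons (nletters ∘ₗ gr (wdeg (bdeg (sdeg d))) (wdeg (sdeg d) u))
      (kad d (single u (1 : R))) y (single [] 1)
    rw [conv_nil, cat_one, LinearMap.comp_apply, gr_single, map_smul, nletters_nil, smul_zero,
      zero_cat, zero_add, kad_nil, LinearMap.comp_apply, catL_apply, cat_one, LinearMap.comp_apply,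
      gr_single, map_smul, nletters_single, smul_cat, wdeg_cons, wdeg_nil, add_zero] at h2
    simp only [LinearMap.comp_apply, LinearMap.add_apply, LinearMap.sub_apply,
      LinearMap.smul_apply] at h
    rw [h1, h2, hb, map_neg] at h
    rw [kadOne_single, kadOne_single, h, kadOne_apply, bdeg, smul_neg, ← sub_eq_add_neg]
    rfl

end BraceOne

/-! ### The cyclic pairing with an additional insertion -/

section BraceHomotopy

variable {R : Type v} [CommRing R] {α : Type*} (d : α → ℤ)

/-- The sum `∑ ± S(a) ⋄ (E₁₁(q; y) w p)` over all factorizations `p a q` of a word `u`. -/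
def cmBraceWord : List (NE α) →
    ((List (NE α) →₀ R) →ₗ[R] (List (NE α) →₀ R) →ₗ[R] (List (NE α) →₀ R)) := fun u =>
  match u with
  | [] => 0
  | a :: u => ((tmulL.compr₂ concat) ∘ₗ kadOne d (single u 1)).compr₂ (actS d a.1) +
      sgn R (sdeg d a * (wdeg (sdeg d) u + 1)) • (cmBraceWord u).compl₁₂
        (gr (wdeg (sdeg d)) (sdeg d a)) (catR (single [a] 1) ∘ₗ gr (wdeg (sdeg d)) (sdeg d a))

/-- The trilinear extension of `cmBraceWord`. -/
def cmBrace : (List (NE α) →₀ R) →ₗ[R] (List (NE α) →₀ R) →ₗ[R] (List (NE α) →₀ R) →ₗ[R]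
    (List (NE α) →₀ R) :=
  Finsupp.linearCombination R (cmBraceWord d)

theorem cmBrace_single (u : List (NE α)) : cmBrace d (single u (1 : R)) = cmBraceWord d u := by
  rw [cmBrace, Finsupp.linearCombination_single, one_smul]

theorem cmBrace_one (y w : List (NE α) →₀ R) : cmBrace d (single [] 1) y w = 0 := by
  rw [cmBrace_single]; rfl

theorem cmBrace_single_cat (a : NE α) {k l : ℤ} {u y : List (NE α) →₀ R}
    (hu : u ∈ homog (wdeg (sdeg d)) k) (hy : y ∈ homog (wdeg (sdeg d)) l)
    (w : List (NE α) →₀ R) :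
    cmBrace d (single [a] 1 ⋄ u) y w = actS d a.1 (kadOne d u y ⋄ w) +
      sgn R (sdeg d a * (k + l + 1)) •
        cmBrace d u y (gr (wdeg (sdeg d)) (sdeg d a) w ⋄ single [a] 1) := by
  refine homog_induction (p := fun u => cmBrace d (single [a] 1 ⋄ u) y w =
    actS d a.1 (kadOne d u y ⋄ w) + sgn R (sdeg d a * (k + l + 1)) •
        cmBrace d u y (gr (wdeg (sdeg d)) (sdeg d a) w ⋄ single [a] 1)) hu ?_ ?_ ?_ ?_
  · simp [cat_zero, zero_cat]
  · intro x y hx hy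
    simp only [cat_add, add_cat, map_add, LinearMap.add_apply, hx, hy, smul_add]; abel
  · intro c x hx
    simp only [cat_smul, smul_cat, map_smul, LinearMap.smul_apply, hx, smul_add, smul_comm c]
  · rintro u rfl
    have h : cmBraceWord d (a :: u) y w = actS d a.1 (kadOne d (single u (1 : R)) y ⋄ w) +
        sgn R (sdeg d a * (wdeg (sdeg d) u + 1)) • cmBraceWord d u
          (gr (wdeg (sdeg d)) (sdeg d a) y) (gr (wdeg (sdeg d)) (sdeg d a) w ⋄ single [a] 1) := rfl
    rw [← single_cons, cmBrace_single, cmBrace_single, h, gr_homog hy, map_smul,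
      LinearMap.smul_apply, smul_smul, ← sgn_add]
    congr 3; ring

theorem cmBrace_letter (a : NE α) {l : ℤ} {y : List (NE α) →₀ R}
    (hy : y ∈ homog (wdeg (sdeg d)) l) (w : List (NE α) →₀ R) :
    cmBrace d (single [a] 1) y w = 0 := by
  have := cmBrace_single_cat d (k := 0) a (u := single [] (1 : R)) (single_mem_homog rfl) hy w
  rwa [cat_one, kadOne_one, zero_cat, map_zero, cmBrace_one, smul_zero, add_zero] at this

/-- In a factorization of `u ⋄ x` the distinguished letter and the insertion both lie in `u`; or the
letter lies in `u` and the insertion in `x`, which gives the `cmPair` term; or the letter lies in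
`x`, and so does the insertion, since it comes after the letter. -/
theorem cmBrace_cat {k j l : ℤ} {u x y : List (NE α) →₀ R} (hu : u ∈ homog (wdeg (sdeg d)) k)
    (hx : x ∈ homog (wdeg (sdeg d)) j) (hy : y ∈ homog (wdeg (sdeg d)) l)
    (w : List (NE α) →₀ R) :
    cmBrace d (u ⋄ x) y w = sgn R (j * (l + 1)) • cmBrace d u y (x ⋄ w) +
      cmPair d u (kadOne d x y ⋄ w) +
      sgn R (k * (j + l + 1)) • cmBrace d x y (gr (wdeg (sdeg d)) k w ⋄ u) := by
  refine homog_induction (p := fun u => cmBrace d (u ⋄ x) y w =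
    sgn R (j * (l + 1)) • cmBrace d u y (x ⋄ w) + cmPair d u (kadOne d x y ⋄ w) +
      sgn R (k * (j + l + 1)) • cmBrace d x y (gr (wdeg (sdeg d)) k w ⋄ u)) hu ?_ ?_ ?_ ?_
  · simp [cat_zero, zero_cat]
  · intro x y hx hy
    simp only [cat_add, add_cat, map_add, LinearMap.add_apply, hx, hy, smul_add]; abel
  · intro c x hx
    simp only [cat_smul, smul_cat, map_smul, LinearMap.smul_apply, hx, smul_add, smul_comm c]
  · rintro u rfl
    clear hu
    induction u generalizing w with
    | nil =>
      rw [one_cat, cmBrace_one, cmPair_one, wdeg_nil, zero_mul, sgn_zero, one_smul, gr_zero, cat_one,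
        smul_zero, zero_add, zero_add]
    | cons a u ih =>
      have hu : (single u 1 : List (NE α) →₀ R) ∈ homog (wdeg (sdeg d)) (wdeg (sdeg d) u) :=
        single_mem_homog rfl
      rw [single_cons, cat_assoc, cmBrace_single_cat d a (cat_mem_homog hu hx rfl) hy, ih,
        cmBrace_single_cat d a hu hy, cmPair_single_cat d a hu, kadOne_cat d _ hx hy, gr_cat,
        gr_cat, gr_gr, gr_cat, gr_homog hx, gr_homog (kadOne_mem_homog d hx hy rfl), gr_single,
        wdeg_cons, wdeg_cons, wdeg_nil, add_zero, add_comm (wdeg (sdeg d) u) (sdeg d a)]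
      simp only [cat_assoc, smul_cat, cat_smul, add_cat, map_add, map_smul, smul_add]
      generalize actS d a.1 (single u 1 ⋄ kadOne d x y ⋄ w) = x₁
      generalize actS d a.1 (kadOne d (single u 1) y ⋄ x ⋄ w) = x₂
      generalize cmBrace d (single u 1) y _ = x₃
      generalize cmPair d (single u (1 : R)) _ = x₄
      generalize cmBrace d x y _ = x₅
      generalize sdeg d a = m
      generalize wdeg (sdeg d) u = n
      clear ih hu hx hy
      simp only [mul_sub, sub_mul, mul_add, add_mul, sgn_sub, sgn_add, mul_one, mul_comm n m,
        mul_comm j m]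
      -- Each product of degrees contributes an independent sign with square one. Once these are
      -- variables, the comparison consists of polynomial identities.
      have h₁ := sgn_mul_self (R := R) (m * n)
      have h₂ := sgn_mul_self (R := R) (m * j)
      have h₃ := sgn_mul_self (R := R) (m * l)
      have h₄ := sgn_mul_self (R := R) m
      generalize sgn R (m * n) = c₁ at *
      generalize sgn R (m * j) = c₂ at *
      generalize sgn R (m * l) = c₃ at *
      generalize sgn R m = c₄ at *
      match_scalars <;> grind

/-- Integration by parts as in `cmPair_leftDer`; the insertion does not disturb it, because `E₁₁`
commutes with `leftDer` in its first argument. -/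
theorem cmBrace_leftDer (v : α) {k l : ℤ} {u y : List (NE α) →₀ R}
    (hu : u ∈ homog (wdeg (sdeg d)) k) (hy : y ∈ homog (wdeg (sdeg d)) l)
    (w : List (NE α) →₀ R) :
    cmBrace d (leftDer d v u) y w =
      -(sgn R (d v * (k + l + 1)) • cmBrace d u y (leftDer d v w)) := by
  refine homog_induction (p := fun u => cmBrace d (leftDer d v u) y w =
    -(sgn R (d v * (k + l + 1)) • cmBrace d u y (leftDer d v w))) hu ?_ ?_ ?_ ?_
  · simp
  · intro x y hx hy
    simp only [map_add, LinearMap.add_apply, hx, hy, smul_add]; abel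
  · intro c x hx
    simp only [map_smul, LinearMap.smul_apply, hx, smul_comm c, smul_neg]
  · rintro u rfl
    clear hu
    induction u generalizing w with
    | nil => rw [leftDer_one, map_zero, cmBrace_one, smul_zero, neg_zero]; rfl
    | cons a u ih =>
      have hu : (single u 1 : List (NE α) →₀ R) ∈ homog (wdeg (sdeg d)) (wdeg (sdeg d) u) :=
        single_mem_homog rfl
      have hLu := (hasDegree_leftDer d v).mem hu rfl
      have hg := (hasDegree_leftDer (R := R) d v).gr_map (sdeg d a) w
      rw [single_cons, leftDer_letter_cat, map_add, map_smul, map_smul, LinearMap.add_apply,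
        LinearMap.smul_apply, LinearMap.smul_apply, LinearMap.add_apply,
        LinearMap.smul_apply, LinearMap.smul_apply, cmBrace_single_cat d _ hu hy,
        cmBrace_single_cat d _ hLu hy, cmBrace_single_cat d _ hu hy, ih, ncons, actS_cons,
        kadOne_leftDer, isDer_leftDer d v (kadOne d _ _) w, isDer_leftDer d v _ (single [a] 1),
        leftDer_letter, gr_homog (kadOne_mem_homog d hu hy rfl), gr_gr, hg, ← ncons, sdeg_ncons,
        wdeg_cons]
      simp only [cat_smul, smul_cat, map_smul, map_add, smul_add, smul_neg]
      generalize actS d a.1 (leftDer d v (kadOne d (single u 1) y) ⋄ w) = x₁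
      generalize actS d a.1 (kadOne d (single u 1) y ⋄ leftDer d v w) = x₂
      generalize cmBrace d (single u 1) y
        (gr (wdeg (sdeg d)) (d v + sdeg d a) w ⋄ single [ncons v a] 1) = x₃
      generalize cmBrace d (single u 1) y
        (leftDer d v (gr (wdeg (sdeg d)) (sdeg d a) w) ⋄ single [a] 1) = x₄
      rw [show wdeg d a.1 = sdeg d a + 1 by rw [sdeg]; ring]
      generalize sdeg d a = m
      generalize wdeg (sdeg d) u = n
      generalize d v = j
      clear ih hu hLu hg hy
      simp only [mul_sub, sub_mul, mul_add, add_mul, sgn_sub, sgn_add, mul_one, mul_comm m j]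
      have h₁ := sgn_mul_self (R := R) j
      have h₂ := sgn_mul_self (R := R) m
      have h₃ := sgn_mul_self (R := R) (j * m)
      have h₄ := sgn_mul_self (R := R) (j * n)
      have h₅ := sgn_mul_self (R := R) (j * l)
      have h₆ := sgn_mul_self (R := R) (m * n)
      have h₇ := sgn_mul_self (R := R) (m * l)
      generalize sgn R (j * m) = c₃ at *
      generalize sgn R (j * n) = c₄ at *
      generalize sgn R (j * l) = c₅ at *
      generalize sgn R (m * n) = c₆ at *
      generalize sgn R (m * l) = c₇ at *
      generalize sgn R j = c₁ at *
      generalize sgn R m = c₂ at *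
      match_scalars <;> grind

theorem cmBrace_leftDerL {j : ℤ} {p : α →₀ R} (hp : p ∈ homog d j) {k l : ℤ}
    {u y : List (NE α) →₀ R} (hu : u ∈ homog (wdeg (sdeg d)) k)
    (hy : y ∈ homog (wdeg (sdeg d)) l) (w : List (NE α) →₀ R) :
    cmBrace d (leftDerL d p u) y w =
      -(sgn R (j * (k + l + 1)) • cmBrace d u y (leftDerL d p w)) := by
  refine homog_induction (p := fun p => cmBrace d (leftDerL d p u) y w =
    -(sgn R (j * (k + l + 1)) • cmBrace d u y (leftDerL d p w))) hp ?_ ?_ ?_ ?_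
  · simp
  · intro x y hx hy
    simp only [map_add, LinearMap.add_apply, hx, hy, smul_add]; abel
  · intro c x hx
    simp only [map_smul, LinearMap.smul_apply, hx, smul_comm c, smul_neg]
  · rintro v rfl
    rw [leftDerL_single, cmBrace_leftDer d v hu hy]

end BraceHomotopy

end

end DoubleCobar

namespace DoubleCobar

open Finsupp (single)

noncomputable section

/-! ### The differential of the cyclic pairing with an insertion -/

section BraceDifferential

variable {R : Type v} [CommRing R] {α : Type*} {d : α → ℤ} {δ : α → (α →₀ R)}

theorem cmDiff_homog (hδ : ∀ a, δ a ∈ homog d (d a - 1)) {k : ℤ} {x : List (NE α) →₀ R}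
    (hx : x ∈ homog (wdeg (sdeg d)) k) : CmDiff d δ k x := by
  refine homog_induction (p := CmDiff d δ k) hx ?_ ?_ ?_ ?_
  · intro w; simp [cat_zero, zero_cat]
  · intro x y hx hy w
    simp only [map_add, LinearMap.add_apply, hx w, hy w, cat_add, add_cat, smul_add]; abel
  · intro c x hx; exact hx.smul c
  · rintro x rfl; exact cmDiff hδ x

theorem cmBrace_neg (u y w : List (NE α) →₀ R) : cmBrace d (-u) y w = -cmBrace d u y w :=
  map_neg (((cmBrace d).flip y).flip w) u

theorem cmBrace_sub (u v y w : List (NE α) →₀ R) :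
    cmBrace d (u - v) y w = cmBrace d u y w - cmBrace d v y w :=
  map_sub (((cmBrace d).flip y).flip w) u v

variable (d δ) in
/-- The differential of `cmBrace d u y`, for `u` of degree `k` and `y` of degree `l`. -/
def BrDiff (k l : ℤ) (u y : List (NE α) →₀ R) : Prop :=
  ∀ w, cobarDiff d δ (cmBrace d u y w) = -cmBrace d (cobarDiff d δ u) y w +
    sgn R k • cmBrace d u (cobarDiff d δ y) w -
    sgn R (k + l + 1) • cmBrace d u y (cobarDiff d δ w) - kadOne d u y ⋄ w -
    sgn R (k + (k + 1) * l) • y ⋄ cmPair d u w + sgn R k • cmPair d u (y ⋄ w)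

theorem BrDiff.smul {k l : ℤ} {u y : List (NE α) →₀ R} (h : BrDiff d δ k l u y) (c : R) :
    BrDiff d δ k l (c • u) y := fun w => by
  simp only [map_smul, LinearMap.smul_apply, smul_cat, cat_smul, h w, smul_add, smul_sub, smul_neg,
    smul_comm c]

/-- The mixed `cmPair` term of `cmBrace_cat` supplies what is missing. The commutator of `x` and `y`
from `kadOne_diff` trades `y ⋄ x ⋄ w` for `x ⋄ y ⋄ w` inside the pairing with `u`. The commutator
from `cmDiff` cancels `kadOne d x y ⋄ w ⋄ u` and supplies `u ⋄ kadOne d x y ⋄ w`. -/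
theorem BrDiff.cat (hδ : ∀ a, δ a ∈ homog d (d a - 1)) {k j l : ℤ}
    {u x y : List (NE α) →₀ R} (hu : u ∈ homog (wdeg (sdeg d)) k)
    (hx : x ∈ homog (wdeg (sdeg d)) j) (hy : y ∈ homog (wdeg (sdeg d)) l)
    (hu' : BrDiff d δ k l u y) (hx' : BrDiff d δ j l x y) : BrDiff d δ (k + j) l (u ⋄ x) y :=
  fun w => by
  have hD := hasDegree_cobarDiff hδ
  have hE := kadOne_mem_homog d hx hy rfl
  have h1 : cmBrace d (cobarDiff d δ (u ⋄ x)) y w =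
      sgn R (j * (l + 1)) • cmBrace d (cobarDiff d δ u) y (x ⋄ w) +
      cmPair d (cobarDiff d δ u) (kadOne d x y ⋄ w) +
      sgn R ((k + -1) * (j + l + 1)) •
        cmBrace d x y (gr (wdeg (sdeg d)) (k + -1) w ⋄ cobarDiff d δ u) +
      sgn R k • (sgn R ((j + -1) * (l + 1)) • cmBrace d u y (cobarDiff d δ x ⋄ w) +
        cmPair d u (kadOne d (cobarDiff d δ x) y ⋄ w) +
        sgn R (k * (j + -1 + l + 1)) •
          cmBrace d (cobarDiff d δ x) y (gr (wdeg (sdeg d)) k w ⋄ u)) := by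
    rw [isDer_cobarDiff d δ u x, gr_homog hu, map_add, LinearMap.add_apply, LinearMap.add_apply,
      cmBrace_cat d (hD.mem hu rfl) hx hy, smul_cat, map_smul, LinearMap.smul_apply,
      LinearMap.smul_apply, cmBrace_cat d hu (hD.mem hx rfl) hy, neg_one_mul, sgn_neg]
  rw [h1, cmBrace_cat d hu hx hy, map_add, map_add, map_smul, map_smul, hu', hx',
    cmDiff_homog hδ hu, cmBrace_cat d hu hx (hD.mem hy rfl), cmBrace_cat d hu hx hy,
    cmPair_cat d hu hx, cmPair_cat d hu hx, kadOne_cat d _ hx hy, isDer_cobarDiff d δ x w,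
    isDer_cobarDiff d δ _ w, isDer_cobarDiff d δ _ u, kadOne_diff d hδ hx hy, gr_homog hx,
    gr_homog hE, gr_cat, gr_homog hE, gr_gr, hD.gr_map, gr_cat, gr_homog hy]
  simp only [cat_assoc, smul_cat, cat_smul, sub_cat, add_cat, map_smul, map_add, map_sub,
    cat_add, smul_add, smul_sub, smul_neg, add_comm (-1) k]
  generalize cmBrace d (cobarDiff d δ u) y (x ⋄ w) = t0
  generalize cmBrace d u (cobarDiff d δ y) (x ⋄ w) = t1
  generalize cmBrace d u y (cobarDiff d δ x ⋄ w) = t2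
  generalize cmBrace d u y (x ⋄ cobarDiff d δ w) = t3
  generalize kadOne d u y ⋄ x ⋄ w = t4
  generalize y ⋄ cmPair d u (x ⋄ w) = t5
  generalize cmPair d u (y ⋄ x ⋄ w) = t6
  generalize cmPair d (cobarDiff d δ u) (kadOne d x y ⋄ w) = t7
  generalize cmPair d u (kadOne d (cobarDiff d δ x) y ⋄ w) = t8
  generalize cmPair d u (kadOne d x (cobarDiff d δ y) ⋄ w) = t9
  generalize cmPair d u (x ⋄ y ⋄ w) = t10
  generalize cmPair d u (kadOne d x y ⋄ cobarDiff d δ w) = t11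
  generalize u ⋄ kadOne d x y ⋄ w = t12
  generalize kadOne d x y ⋄ gr (wdeg (sdeg d)) k w ⋄ u = t13
  generalize cmBrace d (cobarDiff d δ x) y (gr (wdeg (sdeg d)) k w ⋄ u) = t14
  generalize cmBrace d x (cobarDiff d δ y) (gr (wdeg (sdeg d)) k w ⋄ u) = t15
  generalize cmBrace d x y (cobarDiff d δ (gr (wdeg (sdeg d)) k w) ⋄ u) = t16
  generalize cmBrace d x y (gr (wdeg (sdeg d)) (k + -1) w ⋄ cobarDiff d δ u) = t17
  generalize y ⋄ cmPair d x (gr (wdeg (sdeg d)) k w ⋄ u) = t18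
  generalize cmPair d x (y ⋄ gr (wdeg (sdeg d)) k w ⋄ u) = t19
  clear h1 hu hx hy hu' hx' hD hE
  simp only [mul_sub, sub_mul, mul_add, add_mul, sgn_sub, sgn_add, mul_one, one_mul, neg_mul,
    mul_neg, sgn_neg, sgn_one]
  have h0 := sgn_mul_self (R := R) (j * l)
  have h1 := sgn_mul_self (R := R) (k * j)
  have h2 := sgn_mul_self (R := R) (k * l)
  have h3 := sgn_mul_self (R := R) k
  have h4 := sgn_mul_self (R := R) j
  have h5 := sgn_mul_self (R := R) l
  generalize sgn R (j * l) = c0 at *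
  generalize sgn R (k * j) = c1 at *
  generalize sgn R (k * l) = c2 at *
  generalize sgn R k = c3 at *
  generalize sgn R j = c4 at *
  generalize sgn R l = c5 at *
  match_scalars <;> grind

/-- A single letter leaves no room for an insertion behind it, so `cmBrace` vanishes, and what is
left is the Leibniz rule for `leftDer d v` on `y ⋄ w`. -/
theorem brDiff_nletter (hδ : ∀ a, δ a ∈ homog d (d a - 1)) (v : α) {l : ℤ}
    {y : List (NE α) →₀ R} (hy : y ∈ homog (wdeg (sdeg d)) l) :
    BrDiff d δ (d v - 1) l (single [nletter v] (1 : R)) y := fun w => by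
  have hL : cmBrace d (toWord (letter (δ v))) y w = 0 := by
    have h : ((cmBrace d).flip y).flip w ∘ₗ toWord ∘ₗ letter = 0 :=
      ext_single fun a => by
        rw [LinearMap.comp_apply, LinearMap.comp_apply, letter_single, toWord_nletter,
          LinearMap.flip_apply, LinearMap.flip_apply, cmBrace_letter d _ hy]; rfl
    exact LinearMap.congr_fun h (δ v)
  rw [cmBrace_letter d _ hy, cobarDiff_nletter, cmBrace_neg, hL, map_zero, cmBrace_letter d _ ((hasDegree_cobarDiff hδ).mem hy rfl), cmBrace_letter d _ hy,
    kadOne_nletter, cmPair_nletter, cmPair_nletter, isDer_leftDer d v y, gr_homog hy]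
  simp only [smul_cat, cat_neg, smul_neg, smul_add, sub_add_cancel]
  have h₁ := sgn_mul_self (R := R) (d v * l)
  simp only [mul_sub, sub_mul, mul_add, add_mul, sgn_sub, sgn_add, sgn_one]
  match_scalars <;> grind

/-- As in `cmDiff_leftDer`. On the commutator of `s⁻¹v` with `u`, `cmBrace_cat` also produces
`cmPair` terms with `v` acting on `y`, which account for the derivation acting on `y` in `y ⋄ w`. -/
theorem brDiff_leftDer (hδ : ∀ a, δ a ∈ homog d (d a - 1)) (v : α) {k l : ℤ}
    {u y : List (NE α) →₀ R} (hu : u ∈ homog (wdeg (sdeg d)) k)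
    (hy : y ∈ homog (wdeg (sdeg d)) l) (h : BrDiff d δ k l u y) :
    BrDiff d δ (k + d v) l (leftDer d v u) y := fun w => by
  have hD := (hasDegree_cobarDiff hδ).mem hu rfl
  have hDy := (hasDegree_cobarDiff hδ).mem hy rfl
  have hv : (single [nletter v] (1 : R)) ∈ homog (wdeg (sdeg d)) (d v - 1) :=
    single_mem_homog (by rw [wdeg_cons, wdeg_nil, add_zero, sdeg_nletter])
  rw [cmBrace_leftDer d v hu hy, map_neg, map_smul, h, cobarDiff_leftDer hδ v w,
    cobarDiff_leftDer hδ v u, map_sub, map_add, map_add, cmBrace_sub, map_add, map_add, map_smul,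
    map_smul, LinearMap.add_apply, LinearMap.add_apply,
    LinearMap.add_apply, LinearMap.add_apply, LinearMap.smul_apply, LinearMap.smul_apply,
    cmBrace_leftDer d v hD hy, cmBrace_leftDerL d (hδ v) hu hy, cmBrace_cat d hv hu hy,
    cmBrace_letter d _ hy, gr_homog hu, smul_cat, map_smul, LinearMap.smul_apply,
    LinearMap.smul_apply, cmBrace_cat d hu hv hy, cmBrace_letter d _ hy,
    cmBrace_leftDer d v hu hDy, cmBrace_leftDer d v hu hy, kadOne_leftDer, kadOne_nletter,
    cmPair_nletter, cmPair_leftDer d v hu, cmPair_leftDer d v hu,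
    isDer_leftDer d v (kadOne d u y), isDer_leftDer d v y,
    gr_homog (kadOne_mem_homog d hu hy rfl), gr_homog hy]
  simp only [cat_smul, smul_cat, map_smul, map_add, smul_add, smul_sub, smul_neg, neg_add,
    cat_neg, smul_zero, zero_add, add_zero]
  generalize cmBrace d (cobarDiff d δ u) y (leftDer d v w) = t0
  generalize cmBrace d u (cobarDiff d δ y) (leftDer d v w) = t1
  generalize cmBrace d u y (leftDer d v (cobarDiff d δ w)) = t2
  generalize cmBrace d u y (leftDerL d (δ v) w) = t3
  generalize cmBrace d u y (single [nletter v] 1 ⋄ w) = t4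
  generalize cmBrace d u y (gr (wdeg (sdeg d)) (d v - 1) w ⋄ single [nletter v] 1) = t5
  generalize leftDer d v (kadOne d u y) ⋄ w = t6
  generalize kadOne d u y ⋄ leftDer d v w = t7
  generalize y ⋄ cmPair d u (leftDer d v w) = t8
  generalize cmPair d u (leftDer d v y ⋄ w) = t9
  generalize cmPair d u (y ⋄ leftDer d v w) = t10
  generalize d v = j
  clear hD hDy hv h hu hy
  simp only [mul_sub, sub_mul, mul_add, add_mul, sgn_sub, sgn_add, mul_one, one_mul, neg_mul,
    mul_neg, sgn_neg, sgn_one, mul_comm j k, mul_comm j l]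
  have h0 := sgn_mul_self (R := R) (k * j)
  have h1 := sgn_mul_self (R := R) (k * l)
  have h2 := sgn_mul_self (R := R) (l * j)
  have h3 := sgn_mul_self (R := R) k
  have h4 := sgn_mul_self (R := R) j
  have h5 := sgn_mul_self (R := R) l
  generalize sgn R (k * j) = c0 at *
  generalize sgn R (k * l) = c1 at *
  generalize sgn R (l * j) = c2 at *
  generalize sgn R k = c3 at *
  generalize sgn R j = c4 at *
  generalize sgn R l = c5 at *
  match_scalars <;> grind

theorem brDiff (hδ : ∀ a, δ a ∈ homog d (d a - 1)) (u : List (NE α)) {l : ℤ}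
    {y : List (NE α) →₀ R} (hy : y ∈ homog (wdeg (sdeg d)) l) :
    BrDiff d δ (wdeg (sdeg d) u) l (single u (1 : R)) y := by
  induction u with
  | nil =>
    intro w
    simp [cmBrace_one, kadOne_one, cmPair_one, cobarDiff_one, zero_cat, cat_zero]
  | cons a u ih =>
    rw [single_cons, wdeg_cons]
    refine BrDiff.cat hδ (single_mem_homog (by rw [wdeg_cons, wdeg_nil, add_zero]))
      (single_mem_homog rfl) hy ?_ ih
    induction a using ne_induction with
    | letter v => rw [sdeg_nletter]; exact brDiff_nletter hδ v hy
    | cons v a iha =>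
      have h := brDiff_leftDer hδ v (single_mem_homog (by rw [wdeg_cons, wdeg_nil, add_zero])) hy iha
      rw [leftDer_letter] at h
      have h := h.smul (sgn R (d v))
      rwa [sgn_smul_smul, add_comm, ← sdeg_ncons] at h

theorem brDiff_homog (hδ : ∀ a, δ a ∈ homog d (d a - 1)) {k l : ℤ} {u y : List (NE α) →₀ R}
    (hu : u ∈ homog (wdeg (sdeg d)) k) (hy : y ∈ homog (wdeg (sdeg d)) l) :
    BrDiff d δ k l u y := by
  refine homog_induction (p := fun u => BrDiff d δ k l u y) hu ?_ ?_ ?_ ?_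
  · intro w; simp [cat_zero, zero_cat]
  · intro x z hx hz w
    simp only [map_add, LinearMap.add_apply, hx w, hz w, cat_add, add_cat, smul_add]; abel
  · intro c x hx; exact hx.smul c
  · rintro x rfl; exact brDiff hδ x hy

end BraceDifferential

end

end DoubleCobar

namespace DoubleCobar

open Finsupp (single)

noncomputable section

/-! ### The homotopy for the bracket -/

section BVOperator

variable {R : Type v} [CommRing R] {α : Type*} (d : α → ℤ)

theorem cmBrace_mem_homog {k l m n : ℤ} {u y w : List (NE α) →₀ R}
    (hu : u ∈ homog (wdeg (sdeg d)) k) (hy : y ∈ homog (wdeg (sdeg d)) l)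
    (hw : w ∈ homog (wdeg (sdeg d)) m) (hn : k + l + m + 2 = n) :
    cmBrace d u y w ∈ homog (wdeg (sdeg d)) n := by
  refine homog_induction (p := fun u => cmBrace d u y w ∈ homog (wdeg (sdeg d)) n) hu ?_ ?_ ?_ ?_
  · rw [map_zero]; exact zero_mem _
  · intro x z hx hz; rw [map_add]; exact add_mem hx hz
  · intro c x hx; rw [map_smul]; exact Submodule.smul_mem _ _ hx
  · rintro u rfl
    clear hu
    induction u generalizing w m with
    | nil => rw [cmBrace_one]; exact zero_mem _
    | cons a u ih =>
      have ha : (single [a] 1 : List (NE α) →₀ R) ∈ homog (wdeg (sdeg d)) (sdeg d a) :=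
        single_mem_homog (by rw [wdeg_cons, wdeg_nil, add_zero])
      rw [wdeg_cons] at hn
      rw [single_cons, cmBrace_single_cat d a (single_mem_homog rfl) hy, gr_homog hw, smul_cat,
        map_smul]
      refine add_mem ((hasDegree_actS d a.1).mem
        (cat_mem_homog (kadOne_mem_homog d (single_mem_homog rfl) hy rfl) hw rfl) ?_)
        (Submodule.smul_mem _ _ (Submodule.smul_mem _ _
          (ih (cat_mem_homog hw ha rfl) (by linarith))))
      rw [← hn, sdeg]; ring

/-- The homotopy that relates the bracket of `E₁₁` to the deviation of the Connes–Moscovici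
operator from being a derivation. -/
def cmHomotopy : (List (NE α) × List (NE α) →₀ R) →ₗ[R] (List (NE α) →₀ R) :=
  lin fun p => -cmBrace d (single p.1 1) (single p.2 1) (single [] 1) +
    sgn R ((wdeg (sdeg d) p.1 + 1) * (wdeg (sdeg d) p.2 + 1)) •
      cmBrace d (single p.2 1) (single p.1 1) (single [] 1) +
    kadOne d (cmOp d (single p.1 1)) (single p.2 1)

theorem cmHomotopy_tmul {k l : ℤ} {x y : List (NE α) →₀ R}
    (hx : x ∈ homog (wdeg (sdeg d)) k) (hy : y ∈ homog (wdeg (sdeg d)) l) :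
    cmHomotopy d (tmul x y) = -cmBrace d x y (single [] 1) +
      sgn R ((k + 1) * (l + 1)) • cmBrace d y x (single [] 1) + kadOne d (cmOp d x) y := by
  refine homog_induction (p := fun x => cmHomotopy d (tmul x y) = -cmBrace d x y (single [] 1) +
      sgn R ((k + 1) * (l + 1)) • cmBrace d y x (single [] 1) + kadOne d (cmOp d x) y) hx ?_ ?_ ?_ ?_
  · simp [zero_tmul]
  · intro x z hx hz
    simp only [add_tmul, map_add, LinearMap.add_apply, hx, hz, smul_add]; abel
  · intro c x hx
    simp only [smul_tmul, map_smul, LinearMap.smul_apply, hx, smul_add, smul_neg, smul_comm c]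
  rintro x rfl
  refine homog_induction (p := fun y => cmHomotopy d (tmul (single x 1) y) =
    -cmBrace d (single x 1) y (single [] 1) + sgn R ((wdeg (sdeg d) x + 1) * (l + 1)) •
      cmBrace d y (single x 1) (single [] 1) + kadOne d (cmOp d (single x 1)) y) hy ?_ ?_ ?_ ?_
  · simp [tmul_zero]
  · intro y z hy hz
    simp only [tmul_add, map_add, LinearMap.add_apply, hy, hz, smul_add]; abel
  · intro c y hy
    simp only [tmul_smul, map_smul, LinearMap.smul_apply, hy, smul_add, smul_neg, smul_comm c]
  rintro y rfl
  rw [tmul_single, cmHomotopy, lin_single]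

theorem hasDegree_cmHomotopy :
    HasDegree (fun p : List (NE α) × List (NE α) => wdeg (sdeg d) p.1 + wdeg (sdeg d) p.2)
      (wdeg (sdeg d)) 2 (cmHomotopy (R := R) d) := by
  rw [hasDegree_iff]
  rintro ⟨x, y⟩
  have hx : (single x 1 : List (NE α) →₀ R) ∈ homog (wdeg (sdeg d)) (wdeg (sdeg d) x) :=
    single_mem_homog rfl
  have hy : (single y 1 : List (NE α) →₀ R) ∈ homog (wdeg (sdeg d)) (wdeg (sdeg d) y) :=
    single_mem_homog rfl
  have h1 : (single [] 1 : List (NE α) →₀ R) ∈ homog (wdeg (sdeg d)) 0 := single_mem_homog rfl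
  rw [← tmul_single, cmHomotopy_tmul d hx hy]
  exact add_mem (add_mem (neg_mem (cmBrace_mem_homog d hx hy h1 (by ring)))
    (Submodule.smul_mem _ _ (cmBrace_mem_homog d hy hx h1 (by ring))))
    (kadOne_mem_homog d ((hasDegree_cmOp d).mem hx rfl) hy (by ring))

variable {d} {δ : α → (α →₀ R)}

/-- The boundaries of the two `cmBrace` terms contain the operations `E₁₁` of the bracket, the
pairings `cmPair d x y` and `cmPair d y x`, and products with `cmOp`. By `cmPair_cat` at `w = 1` the
pairings add up to the operator on `x ⋄ y`. One product comes in the wrong order, `y ⋄ cmOp d x`;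
the boundary of `kadOne d (cmOp d x) y` replaces it by `cmOp d x ⋄ y`. -/
theorem kadOne_bracket (hδ : ∀ a, δ a ∈ homog d (d a - 1)) {k l : ℤ} {x y : List (NE α) →₀ R}
    (hx : x ∈ homog (wdeg (sdeg d)) k) (hy : y ∈ homog (wdeg (sdeg d)) l) :
    kadOne d x y - sgn R ((k + 1) * (l + 1)) • kadOne d y x =
      sgn R k • (cmOp d (x ⋄ y) - cmOp d x ⋄ y - sgn R k • x ⋄ cmOp d y) +
      (cobarDiff d δ (cmHomotopy d (tmul x y)) + cmHomotopy d (tmul (cobarDiff d δ x) y) -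
        sgn R k • cmHomotopy d (tmul x (cobarDiff d δ y))) := by
  have hD := hasDegree_cobarDiff hδ
  rw [cmHomotopy_tmul d hx hy, cmHomotopy_tmul d (hD.mem hx rfl) hy,
    cmHomotopy_tmul d hx (hD.mem hy rfl), map_add, map_add, map_neg, map_smul,
    brDiff_homog hδ hx hy, brDiff_homog hδ hy hx, cobarDiff_one, map_zero, map_zero,
    kadOne_diff d hδ ((hasDegree_cmOp d).mem hx rfl) hy, cobarDiff_cmOp hδ, cmOp_apply d (x ⋄ y),
    cmPair_cat d hx hy, gr_single, wdeg_nil, mul_zero, sgn_zero, one_smul, one_cat,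
    ← cmOp_apply, ← cmOp_apply]
  simp only [cat_one, smul_zero, sub_zero, map_neg, LinearMap.neg_apply]
  generalize cmBrace d (cobarDiff d δ x) y (single [] 1) = t0
  generalize cmBrace d x (cobarDiff d δ y) (single [] 1) = t1
  generalize cmBrace d y (cobarDiff d δ x) (single [] 1) = t2
  generalize cmBrace d (cobarDiff d δ y) x (single [] 1) = t3
  generalize kadOne d x y = t4
  generalize kadOne d y x = t5
  generalize y ⋄ cmOp d x = t6
  generalize x ⋄ cmOp d y = t7
  generalize cmPair d x y = t8
  generalize cmPair d y x = t9
  generalize cmOp d x ⋄ y = t10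
  generalize kadOne d (cmOp d x) (cobarDiff d δ y) = t11
  generalize kadOne d (cmOp d (cobarDiff d δ x)) y = t12
  clear hD hx hy
  simp only [mul_sub, sub_mul, mul_add, add_mul, sgn_sub, sgn_add, mul_one, one_mul, neg_mul,
    mul_neg, sgn_neg, sgn_one, mul_comm l k]
  have h0 := sgn_mul_self (R := R) (k * l)
  have h1 := sgn_mul_self (R := R) k
  have h2 := sgn_mul_self (R := R) l
  generalize sgn R (k * l) = c0 at *
  generalize sgn R k = c1 at *
  generalize sgn R l = c2 at *
  match_scalars <;> grind

end BVOperator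

/-! ### Identification with the Connes–Moscovici operator -/

section ConnesMoscovici

variable {R : Type v} [CommRing R] {α : Type*} (d : α → ℤ)

/-- The cyclic permutation of words, with the Koszul sign. -/
def rotate : (List (NE α) →₀ R) →ₗ[R] (List (NE α) →₀ R) :=
  lin fun w => match w with
    | [] => single [] 1
    | a :: w => sgn R (sdeg d a * wdeg (sdeg d) w) • single (w ++ [a]) 1

/-- The action of the antipode of the first letter of a word on its remainder. -/
def actHead : (List (NE α) →₀ R) →ₗ[R] (List (NE α) →₀ R) :=
  lin fun w => match w with
    | [] => 0
    | a :: w => actS d a.1 (single w 1)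

/-- Rotating `i` times brings the letter at position `i` to the front, with the part before it moved
to the end. Stopping at the length of `u` lists the factorizations of `u`, with `w` carried along.
-/
theorem cmPair_eq_sum (u w : List (NE α)) : cmPair d (single u (1 : R)) (single w 1) =
    ∑ i ∈ Finset.range u.length, actHead d ((rotate d ^ i) (single (u ++ w) 1)) := by
  induction u generalizing w with
  | nil => rw [cmPair_one, List.length_nil, Finset.range_zero, Finset.sum_empty]
  | cons a u ih =>
    have h : ∀ i, actHead (R := R) d ((rotate d ^ (i + 1)) (single (a :: (u ++ w)) 1)) =
        sgn R (sdeg d a * wdeg (sdeg d) (u ++ w)) •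
          actHead d ((rotate d ^ i) (single (u ++ (w ++ [a])) 1)) := fun i => by
      rw [pow_succ, Module.End.mul_apply, rotate, lin_single]
      exact (by rw [map_smul, map_smul, List.append_assoc])
    rw [single_cons, cmPair_single_cat d a (single_mem_homog rfl), single_cat, gr_single, smul_cat,
      map_smul, single_cat, ih, List.length_cons, Finset.sum_range_succ', List.cons_append,
      pow_zero, Module.End.one_apply, Finset.sum_congr rfl fun i _ => h i, ← Finset.smul_sum,
      smul_smul, ← sgn_add, wdeg_append, mul_add, add_comm, actHead, lin_single]

/-- On a word of length one, the antipode of a nonempty word acts on the unit and gives zero, so the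
prescribed value on short words is automatic. -/
theorem cmOp_single (w : List (NE α)) : cmOp d (single w (1 : R)) = if w.length < 2 then 0 else
    ∑ i ∈ Finset.range w.length, actHead d ((rotate d ^ i) (single w 1)) := by
  split_ifs with h
  · rcases w with _ | ⟨a, _ | ⟨b, w⟩⟩
    · rw [cmOp_apply, cmPair_one]
    · rw [cmOp_apply, cmPair_letter, actS_one, Finsupp.single_eq_of_ne' a.2, zero_smul]
    · simp at h
  · rw [cmOp_apply, cmPair_eq_sum, List.append_nil]

theorem connesMoscovici_eq (D : (List α →₀ R) →ₗ[R] (List α →₀ R)) :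
    (tensorAlgebra d D).connesMoscovici concat (shuffleCoproduct d) (antipode d) = cmOp d := by
  have hdeg : ((tensorAlgebra d D).cobar (shuffleCoproduct d)).deg = wdeg (sdeg d) :=
    cobar_deg _ _
  -- Cocommutativity of the shuffle coproduct: the reversed order of the coproduct factors in the
  -- Connes–Moscovici operator is immaterial.
  have htw : (tensorAlgebra d D).twist (shuffleCoproduct d) = shuffleCoproduct d :=
    LinearMap.ext fun w => shuffle_twist d w
  have hcyc : (tensorAlgebra d D).cyc (shuffleCoproduct d) = rotate d := by
    refine ext_single fun w => ?_
    refine (lin_single _ _).trans (Eq.trans ?_ (lin_single _ _).symm)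
    rcases w with _ | ⟨a, w⟩
    · rfl
    · exact congrArg (fun f : List (NE α) → ℤ => sgn R (sdeg d a * f w) •
        single (w ++ [a]) (1 : R)) hdeg
  have hpi : (tensorAlgebra d D).cmPi concat (shuffleCoproduct d) (antipode d) = actHead d := by
    refine ext_single fun w => ?_
    refine (lin_single _ _).trans (Eq.trans ?_ (lin_single _ _).symm)
    rcases w with _ | ⟨a, w⟩
    · rfl
    · exact (congrArg (fun T => (tensorAlgebra d D).diagAct concat T (antipode d) w
        (single a.1 1)) htw).trans ((LinearMap.congr_fun (diagAct_eq d D (antipode d) w) _).trans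
          (diag_antipode d w a.1))
  refine ext_single fun w => ?_
  refine (lin_single _ _).trans (Eq.trans ?_ (cmOp_single d w).symm)
  exact congrArg₂ (fun P C : (List (NE α) →₀ R) →ₗ[R] (List (NE α) →₀ R) =>
    if w.length < 2 then 0 else ∑ i ∈ Finset.range w.length, P ((C ^ i) (single w 1))) hpi hcyc

end ConnesMoscovici

/-! ### The double cobar construction as a homotopy BV-algebra -/

section BVAlgebra

variable {R : Type v} [CommRing R] {α : Type u} {d : α → ℤ} {δ : α → (α →₀ R)}

theorem nincl_letters_braceMul (x y : List (NE α)) :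
    nincl (letters (braceMul d (tmul (letter (nred (single x (1 : R))))
      (letter (nred (single y 1)))))) = kadOne d (single x (1 : R)) (single y 1) := by
  rcases eq_or_ne x [] with rfl | hx
  · rw [nred_nil, map_zero, zero_tmul, map_zero, map_zero, map_zero, kadOne_one]
  rcases eq_or_ne y [] with rfl | hy
  · rw [nred_nil, map_zero, tmul_zero, map_zero, map_zero, map_zero, kadOne_nil]
  rw [nred_single ⟨x, hx⟩, nred_single ⟨y, hy⟩, letter_single, letter_single, tmul_single,
    kadOne_single d _ ⟨y, hy⟩]
  -- The operations of the product do not involve the differential, so `0` may stand in for it.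
  have := braceMul_op (R := R) (d := d) 0 ⟨x, hx⟩ [⟨y, hy⟩]
  exact (congrArg (fun f => f (letters (braceMul d (single ([⟨x, hx⟩], [⟨y, hy⟩]) (1 : R)))))
    (tensorAlgebra_incl (R := R) (sdeg d) 0)).symm.trans this

theorem op11_eq (D : (List (NE α) →₀ R) →ₗ[R] (List (NE α) →₀ R)) (x y : List (NE α)) :
    (tensorAlgebra (sdeg d) D).op11 (braceMul d) (single (x, y) 1) =
      kadOne d (single x (1 : R)) (single y 1) := by
  refine Eq.trans ?_ (nincl_letters_braceMul x y)
  rw [← tensorAlgebra_incl (sdeg d) D]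
  exact congrArg (fun z => (tensorAlgebra (sdeg d) D).incl (letters (braceMul d z)))
    (lin_single _ (x, y))

theorem cobar_isHomotopyBVAlgebra (hδ : ∀ a, δ a ∈ homog d (d a - 1))
    (hδ' : ∀ a, lin δ (δ a) = 0) (hd : ∀ a, 2 ≤ d a) :
    (tensorAlgebra (sdeg d) (cobarDiff d δ)).IsHomotopyBVAlgebra concat (braceMul d) (cmOp d) where
  homotopyG := cobar_isHomotopyGAlgebra hδ hδ' hd
  dgMap :=
    { degree := hasDegree_cmOp d
      comm := fun x => by
        rw [sgn_one, neg_smul, one_smul]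
        exact cobarDiff_cmOp hδ x }
  square_zero := cmOp_cmOp d
  bracket_eq := ⟨cmHomotopy d, hasDegree_cmHomotopy d, fun x y => by
    refine Eq.trans ?_ (kadOne_bracket hδ (single_mem_homog rfl) (single_mem_homog rfl))
    exact congrArg₂ (fun a b => a - sgn R ((wdeg (sdeg d) x + 1) * (wdeg (sdeg d) y + 1)) • b)
      (op11_eq _ x y) (op11_eq _ y x)⟩

end BVAlgebra

end

end DoubleCobar

namespace DoubleCobar

open Finsupp (single)

noncomputable section

/-! ### The normalized chain complex -/

section NormalizedChains

variable (R : Type v) [CommRing R] {Y : SSet.{u}}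

theorem nd_of_nonDegenerate {n : ℕ} (σ : Y.nonDegenerate n) :
    nd R Y ⟨n, σ.1⟩ = single ⟨n, σ⟩ 1 := by
  rw [nd, dif_pos σ.2]

theorem nd_of_degenerate {τ : Σ n : ℕ, Y _⦋n⦌} (h : τ.2 ∈ Y.degenerate τ.1) : nd R Y τ = 0 := by
  rw [nd, dif_neg]
  rwa [← SSet.mem_degenerate_iff_notMem_nonDegenerate]

/-- The alternating sum of the faces of a simplex, in the normalized chains. -/
def boundary {n : ℕ} (τ : Y _⦋n + 1⦌) : (Σ n : ℕ, Y.nonDegenerate n) →₀ R :=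
  ∑ i : Fin (n + 2), sgn R (i : ℕ) • nd R Y ⟨n, Y.δ i τ⟩

theorem δ_σ_mem_degenerate {n : ℕ} (y : Y _⦋n⦌) {j : Fin (n + 1)} {i : Fin (n + 2)}
    (h1 : i ≠ j.castSucc) (h2 : i ≠ j.succ) : Y.δ i (Y.σ j y) ∈ Y.degenerate n := by
  rcases n with _ | n
  · obtain rfl : j = 0 := Fin.fin_one_eq_zero j
    fin_cases i
    · exact absurd rfl h1
    · exact absurd rfl h2
  rcases lt_or_gt_of_ne h1 with h | h
  · obtain ⟨j, rfl⟩ := Fin.exists_succ_eq.2 (show j ≠ 0 by rintro rfl; simp at h)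
    obtain ⟨i, rfl⟩ := Fin.exists_castSucc_eq.2 (ne_of_lt (lt_of_lt_of_le h (Fin.le_last _)))
    rw [SSet.δ_comp_σ_of_le_apply (by simpa using h)]
    exact Y.σ_mem_degenerate _ _
  · have h : j.succ < i := lt_of_le_of_ne (Fin.castSucc_lt_iff_succ_le.1 h) (Ne.symm h2)
    rw [SSet.δ_comp_σ_of_gt'_apply h]
    exact Y.σ_mem_degenerate _ _

/-- The faces `j` and `j + 1` of the `j`-th degeneracy of `y` are both `y`, with opposite signs; all
other faces are degenerate. -/
theorem boundary_σ {n : ℕ} (j : Fin (n + 1)) (y : Y _⦋n⦌) : boundary R (Y.σ j y) = 0 := by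
  rw [boundary, Finset.sum_eq_add j.castSucc j.succ (by simp [Fin.ext_iff])]
  · rw [SSet.δ_comp_σ_self_apply, SSet.δ_comp_σ_succ_apply, Fin.val_castSucc, Fin.val_succ,
      Nat.cast_add, sgn_add, Nat.cast_one, sgn_one]
    module
  · rintro i - ⟨h1, h2⟩
    rw [nd_of_degenerate R (δ_σ_mem_degenerate y h1 h2), smul_zero]
  · simp
  · simp

variable (Y) in
/-- The differential of the normalized chains. -/
def chainsD : ((Σ n : ℕ, Y.nonDegenerate n) →₀ R) →ₗ[R] ((Σ n : ℕ, Y.nonDegenerate n) →₀ R) :=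
  lin fun b => match b with
    | ⟨0, _⟩ => 0
    | ⟨_ + 1, σ⟩ => boundary R σ.1

theorem chainsD_zero (σ : Y.nonDegenerate 0) : chainsD R Y (single ⟨0, σ⟩ 1) = 0 :=
  lin_single _ _

theorem chainsD_succ {n : ℕ} (σ : Y.nonDegenerate (n + 1)) :
    chainsD R Y (single ⟨n + 1, σ⟩ 1) = boundary R σ.1 :=
  lin_single _ _

theorem chainsD_nd_zero (τ : Y _⦋0⦌) : chainsD R Y (nd R Y ⟨0, τ⟩) = 0 := by
  rw [nd_of_nonDegenerate R (⟨τ, by simp⟩ : Y.nonDegenerate 0)]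
  exact chainsD_zero R _

/-- The alternating sum of faces may be used for any simplex, degenerate or not, because it vanishes
on degenerate ones. -/
theorem chainsD_nd_succ {n : ℕ} (τ : Y _⦋n + 1⦌) :
    chainsD R Y (nd R Y ⟨n + 1, τ⟩) = boundary R τ := by
  by_cases h : τ ∈ Y.nonDegenerate (n + 1)
  · rw [nd_of_nonDegenerate R (⟨τ, h⟩ : Y.nonDegenerate (n + 1))]
    exact chainsD_succ R _
  · rw [← SSet.mem_degenerate_iff_notMem_nonDegenerate] at h
    rw [nd_of_degenerate R h, map_zero]
    rw [SSet.degenerate_eq_iUnion_range_σ, Set.mem_iUnion] at h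
    obtain ⟨j, y, rfl⟩ := h
    exact (boundary_σ R j y).symm

/-- The iterated faces cancel in pairs by the simplicial identities, the indices `(i, j)` with `i ≤
j` being matched with `(j + 1, i)`. -/
theorem sum_boundary {n : ℕ} (τ : Y _⦋n + 2⦌) :
    ∑ i : Fin (n + 3), sgn R (i : ℕ) • boundary R (Y.δ i τ) = 0 := by
  simp only [boundary, Finset.smul_sum, smul_smul, ← sgn_add]
  rw [← Finset.sum_product', Finset.univ_product_univ]
  let S : Finset (Fin (n + 3) × Fin (n + 2)) := {ij | (ij.1 : ℕ) ≤ ij.2}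
  rw [← Finset.sum_add_sum_compl S, ← eq_neg_iff_add_eq_zero, ← Finset.sum_neg_distrib]
  refine Finset.sum_bij (fun ij hij => (ij.2.succ, ij.1.castLT
    (lt_of_le_of_lt (Finset.mem_filter.mp hij).right (Fin.is_lt ij.2)))) ?_ ?_ ?_ ?_
  · rintro ⟨i, j⟩ hij
    simp only [S, Finset.compl_filter, Finset.mem_filter, Finset.mem_univ, true_and] at hij ⊢
    simp only [Fin.val_succ, Fin.val_castLT]; omega
  · rintro ⟨i, j⟩ hij ⟨i', j'⟩ hij' h
    simp only [Prod.mk.injEq, Fin.ext_iff, Fin.val_succ, Fin.val_castLT] at h ⊢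
    omega
  · rintro ⟨i, j⟩ hij
    simp only [S, Finset.compl_filter, Finset.mem_filter, Finset.mem_univ, true_and, not_le] at hij
    refine ⟨(j.castSucc, i.pred (by rintro rfl; simp at hij)), ?_, ?_⟩
    · simp only [S, Finset.mem_filter, Finset.mem_univ, true_and, Fin.val_castSucc, Fin.val_pred]
      omega
    · simp
  · rintro ⟨i, j⟩ hij
    have hij : (i : ℕ) ≤ j := by simpa [S] using hij
    rw [SSet.δ_comp_δ''_apply (show i ≤ Fin.castSucc j from hij), ← neg_smul]
    congr 1
    simp only [Fin.val_succ, Fin.val_castLT, Nat.cast_add, Nat.cast_one, sgn_add, sgn_one]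
    ring

theorem chainsD_chainsD (x : (Σ n : ℕ, Y.nonDegenerate n) →₀ R) :
    chainsD R Y (chainsD R Y x) = 0 := by
  have h : chainsD R Y ∘ₗ chainsD R Y = 0 := ext_single fun b => ?_
  · exact LinearMap.congr_fun h x
  rw [LinearMap.comp_apply]
  obtain ⟨_ | _ | n, σ⟩ := b
  · rw [chainsD_zero, map_zero]; rfl
  · rw [chainsD_succ, boundary, map_sum]
    exact Finset.sum_eq_zero fun i _ => by rw [map_smul, chainsD_nd_zero, smul_zero]
  · rw [chainsD_succ, boundary, map_sum]
    refine Eq.trans (Finset.sum_congr rfl fun i _ => ?_) (sum_boundary R σ.1)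
    rw [map_smul, chainsD_nd_succ]

theorem boundary_mem_homog {n : ℕ} (τ : Y _⦋n + 1⦌) :
    boundary R τ ∈ homog (fun b : Σ n : ℕ, Y.nonDegenerate n => (b.1 : ℤ)) n := by
  refine Submodule.sum_mem _ fun i _ => Submodule.smul_mem _ _ ?_
  by_cases h : Y.δ i τ ∈ Y.nonDegenerate n
  · rw [nd_of_nonDegenerate R ⟨_, h⟩]
    exact single_mem_homog rfl
  · rw [← SSet.mem_degenerate_iff_notMem_nonDegenerate] at h
    rw [nd_of_degenerate R h]
    exact zero_mem _

theorem hasDegree_chainsD :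
    HasDegree (fun b : Σ n : ℕ, Y.nonDegenerate n => (b.1 : ℤ))
      (fun b : Σ n : ℕ, Y.nonDegenerate n => (b.1 : ℤ)) (-1) (chainsD R Y) := by
  rw [hasDegree_iff]
  rintro ⟨_ | n, σ⟩
  · rw [chainsD_zero]; exact zero_mem _
  · have h : ((n + 1 : ℕ) : ℤ) + -1 = n := by push_cast; ring
    rw [chainsD_succ, h]
    exact boundary_mem_homog R σ.1

end NormalizedChains

end

end DoubleCobar

namespace DoubleCobar

open Finsupp (single)

noncomputable section

/-! ### Nondegenerate simplices of a suspension -/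

section SuspensionSimplices

variable {X : SSet.{u}} {x₀ : X _⦋0⦌}

variable (X x₀) in
/-- The simplex of a suspension represented by a cell, or the base simplex. -/
def suspMk {n : ℕ} (c : Option (Suspension.Cell X n)) : (suspension X x₀) _⦋n⦌ :=
  Quotient.mk (Suspension.rel x₀ n) c

theorem suspMk_surjective {n : ℕ} (σ : (suspension X x₀) _⦋n⦌) : ∃ c, suspMk X x₀ c = σ :=
  Quotient.exists_rep σ

theorem map_suspMk {m n : ℕ} (f : ⦋m⦌ ⟶ ⦋n⦌) (c : Option (Suspension.Cell X n)) :
    (suspension X x₀).map f.op (suspMk X x₀ c) = suspMk X x₀ (Suspension.pull f c) := rfl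

theorem suspMk_of_isBase {n : ℕ} {c : Option (Suspension.Cell X n)}
    (h : Suspension.IsBase x₀ c) : suspMk X x₀ c = suspMk X x₀ none :=
  Quotient.sound (Or.inr ⟨h, trivial⟩)

theorem suspension_vertex (σ : (suspension X x₀) _⦋0⦌) : σ = suspensionBase X x₀ := by
  obtain ⟨_ | c, rfl⟩ := suspMk_surjective σ
  · rfl
  · exact absurd (c.pos.trans c.le) (by norm_num)

theorem suspMk_none_mem_degenerate {n : ℕ} (hn : 0 < n) :
    suspMk X x₀ (none : Option (Suspension.Cell X n)) ∈ (suspension X x₀).degenerate n :=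
  ⟨0, hn, SimplexCategory.const ⦋n⦌ ⦋0⦌ 0, suspMk X x₀ none, rfl⟩

/-- The cell `(1, x)`. -/
abbrev coneCell {n : ℕ} (x : X _⦋n⦌) : Suspension.Cell X (n + 1) :=
  ⟨1, le_rfl, Nat.le_add_left 1 n, x⟩

variable (x₀) in
/-- The class of the cell `(1, x)`. -/
def cone {n : ℕ} (x : X _⦋n⦌) : (suspension X x₀) _⦋n + 1⦌ := suspMk X x₀ (some (coneCell x))

/-- Only vertex `0` lies at the cone point. An operator that avoids it has cut `0`, and `pull` sends
such cells to the base simplex. -/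
theorem map_cone_of_pos {m n : ℕ} (f : ⦋m⦌ ⟶ ⦋n + 1⦌) (x : X _⦋n⦌)
    (hf : ∀ j, f.toOrderHom j ≠ 0) :
    (suspension X x₀).map f.op (cone x₀ x) = suspMk X x₀ none := by
  have h : Suspension.cut f 1 = 0 := Suspension.cut_eq_of f 1 0 (Nat.zero_le _) fun j => by
    have := hf j
    simp only [Nat.not_lt_zero, false_iff, Nat.lt_one_iff]
    exact fun h => this (Fin.ext h)
  rw [cone, map_suspMk]
  exact congrArg (suspMk X x₀) (dif_neg (fun h' => by
    have := h'.1
    change 1 ≤ Suspension.cut f 1 at this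
    omega))

/-- The join of a monotone map with a vertex. -/
def coneMap {m n : ℕ} (g : ⦋m⦌ ⟶ ⦋n⦌) : ⦋m + 1⦌ ⟶ ⦋n + 1⦌ :=
  SimplexCategory.mkHom ⟨fun j => Fin.cases 0 (fun i => (g.toOrderHom i).succ) j, by
    intro a b hab
    induction a using Fin.cases with
    | zero => exact Fin.zero_le _
    | succ a =>
      induction b using Fin.cases with
      | zero => exact absurd hab (by simp)
      | succ b => exact Fin.succ_le_succ_iff.2 (g.toOrderHom.monotone (Fin.succ_le_succ_iff.1 hab))⟩

theorem map_coneMap_cone {m n : ℕ} (g : ⦋m⦌ ⟶ ⦋n⦌) (x : X _⦋n⦌) :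
    (suspension X x₀).map (coneMap g).op (cone x₀ x) = cone x₀ (X.map g.op x) := by
  have h : Suspension.cut (coneMap g) 1 = 1 := Suspension.cut_eq_of _ 1 1 (by omega) fun j => by
    induction j using Fin.cases with
    | zero => exact iff_of_true (by simp) Nat.one_pos
    | succ j =>
      refine iff_of_false (by simp) ?_
      change ¬ (((g.toOrderHom j).succ : Fin _) : ℕ) < 1
      simp
  rw [cone, map_suspMk]
  refine (congrArg (suspMk X x₀) (dif_pos (by
    change 1 ≤ Suspension.cut (coneMap g) 1 ∧ Suspension.cut (coneMap g) 1 ≤ m + 1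
    omega))).trans ?_
  refine congrArg (fun c => suspMk X x₀ (some c)) ?_
  refine Suspension.Cell.ext_map (n := m + 1) x h _ _ _ _ _ (show ⦋m + 1 - 1⦌ ⟶ ⦋n⦌ from g)
    fun j h1 h2 => ?_
  apply Fin.ext
  rw [Suspension.upper_val]
  have h3 : (⟨min (Suspension.cut (coneMap g) 1 + j) (m + 1),
      Nat.lt_succ_of_le (min_le_right _ _)⟩ : Fin (m + 1 + 1)) = Fin.succ ⟨j, h2⟩ := by
    apply Fin.ext
    simp only [Fin.succ_mk]
    omega
  rw [h3]
  change ((g.toOrderHom ⟨j, h2⟩).succ : ℕ) - 1 = _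
  rw [Fin.val_succ, Nat.add_sub_cancel]

/-- With at least two vertices at the cone point, `(k + 1, x)` is the zeroth degeneracy of `(k, x)`.
-/
theorem cell_mem_degenerate {n : ℕ} (c : Suspension.Cell X (n + 1)) (hc : 2 ≤ c.i) :
    suspMk X x₀ (some c) ∈ (suspension X x₀).degenerate (n + 1) := by
  obtain ⟨_ | k, h1, h2, x⟩ := c
  · exact absurd h1 (by norm_num)
  have hk : 1 ≤ k := Nat.le_of_succ_le_succ hc
  -- The two dimensions are equal but not syntactically so; `h` is the identity map between them.
  let h : ⦋n - k⦌ ⟶ ⦋n + 1 - (k + 1)⦌ :=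
    SimplexCategory.mkHom ⟨fun j => ⟨j, by have := j.2; omega⟩, fun a b hab => hab⟩
  let f : ⦋n + 1⦌ ⟶ ⦋n⦌ := SimplexCategory.σ 0
  have hf : ∀ j : Fin (n + 1 + 1), (f.toOrderHom j : ℕ) = j - 1 := fun j => by
    change ((Fin.predAbove 0 j : Fin (n + 1)) : ℕ) = j - 1
    induction j using Fin.cases with
    | zero => simp
    | succ j => simp
  have hcut : Suspension.cut f k = k + 1 := Suspension.cut_eq_of f k (k + 1) (by omega) fun j => by
    rw [hf]; omega
  refine ⟨n, n.lt_succ_self, f, suspMk X x₀ (some ⟨k, hk, by omega, X.map h.op x⟩), ?_⟩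
  rw [map_suspMk]
  refine (congrArg (suspMk X x₀) (dif_pos (show 1 ≤ Suspension.cut f k ∧
    Suspension.cut f k ≤ n + 1 by omega))).trans ?_
  refine congrArg (fun c => suspMk X x₀ (some c)) ?_
  have hx : (⟨k + 1, h1, h2, x⟩ : Suspension.Cell X (n + 1)) =
      ⟨k + 1, h1, h2, X.map (𝟙 ⦋n + 1 - (k + 1)⦌ : _ ⟶ _).op x⟩ := by
    rw [op_id, X.map_id]; rfl
  rw [hx]
  have hcomp : X.map (Suspension.upper f k).op (X.map h.op x) =
      X.map (Suspension.upper f k ≫ h).op x := by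
    rw [op_comp, X.map_comp]; rfl
  refine (congrArg (fun y => (⟨_, _, _, y⟩ : Suspension.Cell X (n + 1))) hcomp).trans ?_
  refine Suspension.Cell.ext_map x hcut _ _ _ _ _ _ fun j h3 h4 => ?_
  apply Fin.ext
  change ((Suspension.upper f k).toOrderHom ⟨j, h3⟩ : ℕ) = j
  rw [Suspension.upper_val, hf]
  simp only
  omega

/-- All other simplices degenerate: the cone on a degenerate simplex by functoriality
(`map_coneMap_cone`), the cone on a base simplex because it is identified with one, and cells with
`i ≥ 2` by `cell_mem_degenerate`. -/
theorem exists_cone {n : ℕ} {σ : (suspension X x₀) _⦋n + 1⦌}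
    (hσ : σ ∈ (suspension X x₀).nonDegenerate (n + 1)) :
    ∃ x : X _⦋n⦌, x ∈ X.nonDegenerate n ∧ x ≠ Suspension.baseSimplex X x₀ n ∧ σ = cone x₀ x := by
  obtain ⟨_ | ⟨i, h1, h2, x⟩, rfl⟩ := suspMk_surjective σ
  · exact absurd (suspMk_none_mem_degenerate n.succ_pos) hσ
  · obtain rfl | h := h1.eq_or_lt
    · refine ⟨x, fun h => hσ ?_, fun h => hσ ?_, rfl⟩
      · obtain ⟨m, hm, g, y, rfl⟩ := h
        exact ⟨m + 1, Nat.succ_lt_succ hm, coneMap g, cone x₀ y, map_coneMap_cone g y⟩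
      · rw [suspMk_of_isBase (show Suspension.IsBase x₀ (some (coneCell x)) from h)]
        exact suspMk_none_mem_degenerate n.succ_pos
    · exact absurd (cell_mem_degenerate ⟨i, h1, h2, x⟩ h) hσ

end SuspensionSimplices

/-! ### Simplices of the double suspension -/

section DoubleSuspension

variable {X : SSet.{u}} {x₀ : X _⦋0⦌}

local notation "S¹" => suspension X x₀
local notation "S²" => suspension (suspension X x₀) (suspensionBase X x₀)

/-- Vertex `1` is the cone point of the inner suspension. Away from the outer cone point, an
operator avoiding it restricts to one avoiding the inner cone point, and so yields a cell over a
base simplex, which is again a base simplex. -/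
theorem map_cone_cone_of_ne_one {m n : ℕ} (f : ⦋m⦌ ⟶ ⦋n + 2⦌) (x : X _⦋n⦌)
    (hf : ∀ j, f.toOrderHom j ≠ 1) :
    S².map f.op (cone (suspensionBase X x₀) (cone x₀ x)) = suspMk _ _ none := by
  rw [cone, map_suspMk]
  apply suspMk_of_isBase
  -- If the image avoids vertex `0` or consists of it only, `pull` returns the base simplex
  -- directly.
  by_cases h : 1 ≤ Suspension.cut f 1 ∧ Suspension.cut f 1 ≤ m
  · have : Suspension.pull f (some (coneCell (cone x₀ x))) = some ⟨_, h.1, h.2, _⟩ := dif_pos h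
    rw [this]
    change S¹.map (Suspension.upper f 1).op (cone x₀ x) = _
    rw [map_cone_of_pos]
    · rfl
    · intro j hj
      have h1 := congrArg Fin.val hj
      rw [Suspension.upper_val] at h1
      have hjm : (j : ℕ) < m - Suspension.cut f 1 + 1 := j.2
      have hlt : Suspension.cut f 1 + j < m + 1 := by omega
      have hmin : (⟨min (Suspension.cut f 1 + j) m, Nat.lt_succ_of_le (min_le_right _ _)⟩ :
          Fin (m + 1)) = ⟨Suspension.cut f 1 + j, hlt⟩ := by
        apply Fin.ext; simp only; omega
      rw [hmin] at h1
      have h2 := (Suspension.lt_cut_iff f 1 ⟨Suspension.cut f 1 + j, hlt⟩).not.1 (by simp)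
      refine hf ⟨Suspension.cut f 1 + j, hlt⟩ (Fin.ext ?_)
      change _ = 1
      change _ = 0 at h1
      omega
  · have : Suspension.pull f (some (coneCell (cone x₀ x))) = none := dif_neg h
    rw [this]
    trivial

/-- `exists_cone` is applied twice. Low dimensions drop out: the only vertex of `ΣX`, and by `hX`
the only vertex of `X`, are base simplices, over which cones collapse. So dimension `3` is the first
one after the base vertex. -/
theorem nonDegenerate_doubleSuspension (hX : ∀ x : X _⦋0⦌, x = x₀)
    (b : Σ n : ℕ, S².nonDegenerate n) :
    b = ⟨0, suspensionBase _ _, by simp⟩ ∨ ∃ (m : ℕ) (x : X _⦋m + 1⦌)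
      (h : cone (suspensionBase X x₀) (cone x₀ x) ∈ S².nonDegenerate (m + 3)),
      b = ⟨m + 3, _, h⟩ := by
  obtain ⟨_ | n, σ, hσ⟩ := b
  · left
    obtain rfl := suspension_vertex σ
    rfl
  right
  obtain ⟨y, hy, hy', rfl⟩ := exists_cone hσ
  rcases n with _ | n
  · exact absurd ((suspension_vertex y).trans (suspension_vertex _).symm) hy'
  obtain ⟨x, hx, hx', rfl⟩ := exists_cone hy
  rcases n with _ | n
  · exact absurd ((hX x).trans (hX _).symm) hx'
  exact ⟨n, x, hσ, rfl⟩

end DoubleSuspension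

end

end DoubleCobar

namespace DoubleCobar

open Finsupp (single)

noncomputable section

/-! ### The cobar differential as a derivation -/

section CobarDifferential

variable {R : Type v} [CommRing R]

theorem cobar_d (M : DGMod.{u} R) (Δ : M.V →ₗ[R] (M.B × M.B →₀ R)) :
    (M.cobar Δ).d = der (fun c : M.Red => M.deg c.1 - 1) (-1) (M.cobarGen Δ) := by
  refine ext_single fun w => ?_
  refine (lin_single _ _).trans (Eq.trans ?_ (lin_single _ _).symm)
  induction w with
  | nil => rfl
  | cons a w ih =>
    refine congrArg₂ _ rfl (congrArg₂ (fun (c : R) (z : List M.Red →₀ R) =>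
      c • single [a] 1 ⋄ z) ?_ ih)
    rw [neg_one_mul, sgn_neg]

theorem tensorAlgebra_cobar_d {α : Type u} (d : α → ℤ) (δ : α → (α →₀ R)) :
    ((tensorAlgebra d (letterD d δ)).cobar (shuffleCoproduct d)).d = cobarDiff d δ :=
  cobar_d (tensorAlgebra d (letterD d δ)) (shuffleCoproduct d)

end CobarDifferential

/-! ### Coalgebras in which every reduced basis element is primitive -/

section Primitive

variable {R : Type v} [CommRing R] {M : DGMod.{u} R}

theorem red_single (c : M.Red) : M.red (single c.1 1) = single c 1 := by
  ext c'
  change (single c.1 (1 : R)) c'.1 = single c (1 : R) c'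
  classical
  simp only [Finsupp.single_apply, Subtype.ext_iff]

theorem red_one : M.red (single M.one 1) = 0 := by
  ext c
  exact Finsupp.single_eq_of_ne c.2

theorem word_eq (x : M.V) : M.word x = letter (M.red x) := rfl

theorem word_single (c : M.Red) : M.word (single c.1 1) = single [c] 1 := by
  rw [word_eq, red_single, letter_single]

theorem word_one : M.word (single M.one 1) = 0 := by
  rw [word_eq, red_one, map_zero]

/-- The coproduct `Δ`, for which all reduced basis elements are primitive. -/
structure IsPrimitive (M : DGMod.{u} R) (Δ : M.V →ₗ[R] (M.B × M.B →₀ R)) : Prop where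
  one : Δ (single M.one 1) = single (M.one, M.one) 1
  red : ∀ c : M.Red, Δ (single c.1 1) = single (c.1, M.one) 1 + single (M.one, c.1) 1

variable {Δ : M.V →ₗ[R] (M.B × M.B →₀ R)}

theorem IsPrimitive.apply (h : IsPrimitive M Δ) (x : M.V) :
    Δ x = tmul x (single M.one 1) + tmul (single M.one 1) x -
      M.counit x • single (M.one, M.one) 1 := by
  refine eq_of_single Δ (tmulL.flip (single M.one 1) + tmulL (single M.one 1) -
    M.counit.smulRight (single (M.one, M.one) 1)) (fun b => ?_) x
  rw [LinearMap.sub_apply, LinearMap.add_apply, LinearMap.flip_apply, tmulL_apply, tmulL_apply,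
    LinearMap.smulRight_apply, tmul_single, tmul_single]
  by_cases hb : b = M.one
  · subst hb
    rw [h.one, show M.counit (single M.one 1) = 1 from Finsupp.single_eq_same, one_smul,
      add_sub_cancel_right]
  · rw [h.red ⟨b, hb⟩, show M.counit (single b 1) = 0 from Finsupp.single_eq_of_ne' hb, zero_smul,
      sub_zero]

theorem IsPrimitive.isDGCoalgebra (h : IsPrimitive M Δ) (hM : M.IsComplex) :
    M.IsDGCoalgebra Δ := by
  have hone : M.counit (single M.one 1) = 1 := Finsupp.single_eq_same
  have hred : ∀ c : M.Red, M.counit (single c.1 1) = 0 := fun c => Finsupp.single_eq_of_ne' c.2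
  have basis : ∀ {p : M.B → Prop}, p M.one → (∀ c : M.Red, p c.1) → ∀ b, p b := fun h1 h2 b => by
    by_cases hb : b = M.one
    · subst hb; exact h1
    · exact h2 ⟨b, hb⟩
  constructor
  · exact hM
  · constructor
    · change HasDegree M.deg (fun p : M.B × M.B => M.deg p.1 + M.deg p.2) 0 Δ
      rw [hasDegree_iff]
      refine basis ?_ fun c => ?_
      · rw [h.one]; exact single_mem_homog (by change _ + _ = _; rw [hM.deg_one])
      · rw [h.red]
        exact add_mem (single_mem_homog (by change _ + _ = _; rw [hM.deg_one]))
          (single_mem_homog (by change _ + _ = _; rw [hM.deg_one]; ring))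
    · intro x
      rw [sgn_zero, one_smul]
      refine eq_of_single (tensorD M.deg M.d M.d ∘ₗ Δ) (Δ ∘ₗ M.d) (basis ?_ fun c => ?_) x
      · rw [LinearMap.comp_apply, LinearMap.comp_apply, hM.d_one, h.one, map_zero, ← tmul_single,
          tensorD_tmul, hM.d_one, zero_tmul, tmul_zero, add_zero]
      · rw [LinearMap.comp_apply, LinearMap.comp_apply, h.red, h.apply, map_add, ← tmul_single,
          ← tmul_single, tensorD_tmul, tensorD_tmul, hM.d_one, hM.counit_d, zero_smul, sub_zero,
          gr_single, gr_single, hM.deg_one, mul_zero, sgn_zero, one_smul, zero_tmul, tmul_zero, add_zero,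
          zero_add]
  · intro x
    refine eq_of_single (lin (fun p : M.B × M.B => M.counit (M.e p.1) • M.e p.2) ∘ₗ Δ)
      LinearMap.id (basis ?_ fun c => ?_) x
    · rw [LinearMap.comp_apply, h.one, lin_single, hone, one_smul]; rfl
    · rw [LinearMap.comp_apply, h.red, map_add, lin_single, lin_single, hone, hred, one_smul,
        zero_smul, zero_add]; rfl
  · intro x
    refine eq_of_single (lin (fun p : M.B × M.B => M.counit (M.e p.2) • M.e p.1) ∘ₗ Δ)
      LinearMap.id (basis ?_ fun c => ?_) x
    · rw [LinearMap.comp_apply, h.one, lin_single, hone, one_smul]; rfl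
    · rw [LinearMap.comp_apply, h.red, map_add, lin_single, lin_single, hone, hred, one_smul,
        zero_smul, add_zero]; rfl
  · intro x
    refine eq_of_single (assoc ∘ₗ tmap Δ LinearMap.id ∘ₗ Δ) (tmap LinearMap.id Δ ∘ₗ Δ)
      (basis ?_ fun c => ?_) x
    · simp only [LinearMap.comp_apply, h.one, ← tmul_single, tmap_tmul, LinearMap.id_apply]
      simp [tmul_single, assoc, Finsupp.mapDomain_single]
    · simp only [LinearMap.comp_apply, h.red, map_add, ← tmul_single, tmap_tmul,
        LinearMap.id_apply, h.one, add_tmul, tmul_add]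
      simp [tmul_single, assoc, Finsupp.mapDomain_single, add_assoc]
  · exact h.one.trans (tmul_single _ _).symm

/-- The reduced coproduct of a primitive element is zero, so the quadratic part of the cobar
differential disappears. -/
theorem IsPrimitive.cobarGen (h : IsPrimitive M Δ) (c : M.Red) :
    M.cobarGen Δ c = letter (-M.red (M.d (M.e c.1))) := by
  rw [DGMod.cobarGen, h.red, map_add, lin_single, lin_single, word_single, word_one, word_eq,
    tmul_zero, zero_tmul, map_zero, smul_zero, smul_zero, add_zero, add_zero, map_neg]

variable (M) in
/-- The differential of the desuspended augmentation ideal. -/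
def redDiff : M.Red → (M.Red →₀ R) := fun c => -M.red (M.d (M.e c.1))

variable (M) in
/-- The degree on the desuspended augmentation ideal. -/
def redDeg : M.Red → ℤ := fun c => M.deg c.1 - 1

theorem IsPrimitive.cobar_d (h : IsPrimitive M Δ) :
    (M.cobar Δ).d = letterD (redDeg M) (redDiff M) := by
  rw [DoubleCobar.cobar_d, show M.cobarGen Δ = _ from funext h.cobarGen]
  rfl

theorem redDiff_mem_homog (hM : M.IsComplex) (c : M.Red) :
    redDiff M c ∈ homog (redDeg M) (redDeg M c - 1) := by
  rw [mem_homog]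
  intro b hb
  have := hM.degree c.1 b.1 (fun h => hb ((congrArg Neg.neg h).trans neg_zero))
  rw [redDeg, redDeg, this]; ring

theorem lin_redDiff (hM : M.IsComplex) (x : M.V) :
    lin (redDiff M) (M.red x) = -M.red (M.d x) := by
  refine eq_of_single (lin (redDiff M) ∘ₗ M.red) (-(M.red ∘ₗ M.d)) (fun b => ?_) x
  rw [LinearMap.comp_apply, LinearMap.neg_apply, LinearMap.comp_apply]
  by_cases hb : b = M.one
  · subst hb
    rw [red_one, hM.d_one, map_zero, map_zero, neg_zero]
  · rw [red_single ⟨b, hb⟩, lin_single]; rfl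

theorem redDiff_redDiff (hM : M.IsComplex) (c : M.Red) : lin (redDiff M) (redDiff M c) = 0 := by
  rw [redDiff, map_neg, lin_redDiff hM, hM.d_d, map_zero, neg_zero, neg_zero]

end Primitive

end

end DoubleCobar

namespace DoubleCobar

open Finsupp (single)

noncomputable section

/-! ### Faces spanned by sets of vertices -/

section Subface

variable {Y : SSet.{u}}

theorem subface_eq {n : ℕ} (σ : Y _⦋n⦌) {T : Finset (Fin (n + 1))} (h : T.Nonempty) :
    subface σ T = ⟨T.card - 1, Y.map (SimplexCategory.mkHom
      (T.orderEmbOfFin (Nat.sub_add_cancel h.card_pos).symm).toOrderHom).op σ⟩ := dif_pos h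

theorem subface_univ {n : ℕ} (σ : Y _⦋n⦌) : subface σ Finset.univ = ⟨n, σ⟩ := by
  -- The face has dimension `card - 1`, which equals `n` only after a rewrite; so the dimension is
  -- made a variable, and a monomorphism from `⦋n⦌` to itself is the identity.
  have key : ∀ (k : ℕ) (_ : k = n) (f : ⦋k⦌ ⟶ ⦋n⦌), StrictMono f.toOrderHom →
      (⟨k, Y.map f.op σ⟩ : Σ k : ℕ, Y _⦋k⦌) = ⟨n, σ⟩ := by
    rintro _ rfl f hf
    have : Mono f := SimplexCategory.mono_iff_injective.2 hf.injective
    rw [SimplexCategory.eq_id_of_mono f, op_id, Y.map_id]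
    rfl
  rw [subface_eq σ Finset.univ_nonempty]
  exact key _ (by simp) _ (OrderEmbedding.strictMono _)

theorem subface_dim {n : ℕ} (σ : Y _⦋n⦌) {T : Finset (Fin (n + 1))} (h : T.Nonempty) :
    (subface σ T).1 = T.card - 1 := by rw [subface_eq σ h]

end Subface

/-! ### Chains of the double suspension: every reduced chain is primitive -/

section DoubleSuspensionChains

variable (R : Type v) [CommRing R] {X : SSet.{u}} {x₀ : X _⦋0⦌}

local notation "y₀" => suspensionBase X x₀
local notation "S²" => suspension (suspension X x₀) y₀
local notation "z₀" => suspensionBase (suspension X x₀) y₀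

/-- Without one of the suspension points the face is a base simplex. The bound on the cardinality
makes its dimension positive, hence the simplex degenerate. -/
theorem nd_subface_of_forall_ne {m : ℕ} (x : X _⦋m + 1⦌) {T : Finset (Fin (m + 4))}
    (hT : 2 ≤ T.card) (h : 0 ∉ T ∨ 1 ∉ T) :
    nd R S² (subface (n := m + 3) (cone y₀ (cone x₀ x)) T) = 0 := by
  have hT' : T.Nonempty := Finset.card_pos.1 (by omega)
  apply nd_of_degenerate
  rw [subface_eq (n := m + 3) _ hT']
  have hmem : ∀ j, T.orderEmbOfFin (Nat.sub_add_cancel hT'.card_pos).symm j ∈ T :=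
    fun j => Finset.orderEmbOfFin_mem _ _ _
  have hbase := suspMk_none_mem_degenerate (X := suspension X x₀) (x₀ := y₀)
    (n := T.card - 1) (by omega)
  rcases h with h | h
  · rw [map_cone_of_pos]
    · exact hbase
    · intro j hj
      exact h (hj ▸ hmem j)
  · rw [map_cone_cone_of_ne_one]
    · exact hbase
    · intro j hj
      exact h (hj ▸ hmem j)

theorem nd_of_dim_zero (τ : Σ n : ℕ, S² _⦋n⦌) (h : τ.1 = 0) :
    nd R S² τ = single ⟨0, z₀, by simp⟩ 1 := by
  obtain ⟨n, τ⟩ := τ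
  obtain rfl : n = 0 := h
  obtain rfl := suspension_vertex τ
  exact nd_of_nonDegenerate R (⟨z₀, by simp⟩ : S².nonDegenerate 0)

theorem nd_subface_of_card_one {n : ℕ} (σ : S² _⦋n⦌) {T : Finset (Fin (n + 1))}
    (hT : T.card = 1) : nd R S² (subface σ T) = single ⟨0, z₀, by simp⟩ 1 :=
  nd_of_dim_zero R _ (by rw [subface_dim σ (Finset.card_pos.1 (by omega)), hT])

theorem isPrimitive_alexanderWhitney (hX : ∀ x : X _⦋0⦌, x = x₀) :
    IsPrimitive (chains R S² z₀) (alexanderWhitney R z₀) where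
  one := by
    refine (lin_single _ _).trans ?_
    refine (Fin.sum_univ_one (fun i : Fin 1 => tmul (nd R S² (subface (n := 0) z₀ (Finset.Iic i)))
      (nd R S² (subface (n := 0) z₀ (Finset.Ici i))))).trans ?_
    rw [nd_subface_of_card_one R _ (by simp), nd_subface_of_card_one R _ (by simp), tmul_single]
    rfl
  red := by
    rintro ⟨b, hb⟩
    obtain rfl | ⟨m, x, h, rfl⟩ := nonDegenerate_doubleSuspension hX b
    · exact absurd rfl hb
    refine (lin_single _ _).trans ?_
    have h0 : nd R S² (subface (n := m + 3) (cone y₀ (cone x₀ x)) Finset.univ) =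
        single ⟨m + 3, _, h⟩ 1 := by
      rw [subface_univ]; exact nd_of_nonDegenerate R ⟨_, h⟩
    refine (Finset.sum_eq_add (Fin.last (m + 3)) 0 (by simp [Fin.ext_iff])
      (f := fun i : Fin (m + 4) =>
        tmul (nd R S² (subface (n := m + 3) (cone y₀ (cone x₀ x)) (Finset.Iic i)))
          (nd R S² (subface (n := m + 3) (cone y₀ (cone x₀ x)) (Finset.Ici i)))) ?_
      (fun h => absurd (Finset.mem_univ _) h) (fun h => absurd (Finset.mem_univ _) h)).trans ?_
    -- The back face `σ(i, …, n)` omits vertex `0` as `i ≠ 0` and has positive dimension as `i` is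
    -- not the last vertex.
    · rintro i - ⟨h1, h2⟩
      rw [nd_subface_of_forall_ne R x (T := Finset.Ici i), tmul_zero]
      · rw [Fin.card_Ici]
        have := i.2
        have : (i : ℕ) ≠ m + 3 := fun h => h1 (Fin.ext h)
        omega
      · left; simpa using h2
    · rw [show Finset.Iic (Fin.last (m + 3)) = Finset.univ from Finset.Iic_top,
        show Finset.Ici (0 : Fin (m + 4)) = Finset.univ from Finset.Ici_bot, h0,
        nd_subface_of_card_one R (n := m + 3) _ (by rw [Fin.card_Ici]; simp),
        nd_subface_of_card_one R (n := m + 3) _ (by rw [Fin.card_Iic]; simp), tmul_single, tmul_single]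
      rfl

theorem three_le_deg (hX : ∀ x : X _⦋0⦌, x = x₀) (c : (chains R S² z₀).Red) :
    3 ≤ (chains R S² z₀).deg c.1 := by
  obtain ⟨b, hb⟩ := c
  obtain rfl | ⟨m, x, h, rfl⟩ := nonDegenerate_doubleSuspension hX b
  · exact absurd rfl hb
  · change (3 : ℤ) ≤ ((m + 3 : ℕ) : ℤ)
    omega

theorem chains_isComplex (hX : ∀ x : X _⦋0⦌, x = x₀) : (chains R S² z₀).IsComplex where
  deg_one := rfl
  degree := hasDegree_chainsD R
  d_d := chainsD_chainsD R
  d_one := chainsD_zero R _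
  counit_d := fun x => by
    have h : (chains R S² z₀).counit ∘ₗ (chains R S² z₀).d = 0 := by
      refine Finsupp.lhom_ext' fun b => LinearMap.ext_ring ?_
      -- A boundary with a component at the base vertex would come from a chain of degree one, and
      -- there is none.
      by_contra hne
      have hdeg := hasDegree_chainsD (Y := S²) R b (chains R S² z₀).one hne
      by_cases hb : b = (chains R S² z₀).one
      · subst hb; exact absurd hdeg (by change ¬ ((0 : ℤ) = 0 + -1); norm_num)
      · have := three_le_deg R hX ⟨b, hb⟩
        change (0 : ℤ) = (chains R S² z₀).deg b + -1 at hdeg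
        change 3 ≤ (chains R S² z₀).deg b at this
        omega
    exact LinearMap.congr_fun h x

end DoubleSuspensionChains

end

end DoubleCobar

namespace DoubleCobar

open Finsupp (single)

noncomputable section

/-- For the full subset all gaps are `1`, and this triangular number cancels the correction `r(r +
1)/2` in the exponent `ζ`. -/
theorem weight_replicate_one (k : ℕ) :
    weight (List.replicate k 1) = ((k * (k - 1) / 2 : ℕ) : ℤ) := by
  induction k with
  | zero => rfl
  | succ k ih =>
    rw [List.replicate_succ, weight, ih, List.length_replicate, mul_one, ← Nat.cast_add,
      Nat.triangle_succ, add_comm]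

/-! ### Baues' coproduct when faces without vertex `0` or vertex `1` vanish -/

section Baues

variable (R : Type v) [CommRing R] {Y : SSet.{u}} (w₀ : Y _⦋0⦌)

/-- The product of the elements `[σ(p, …, q)]` over the consecutive pairs of a list. -/
def edgeProd {n : ℕ} (σ : Y _⦋n⦌) (L : List (Fin (n + 1))) : List (chains R Y w₀).Red →₀ R :=
  (L.zipWith (fun p q => brk R w₀ (subface σ (Finset.Icc p q))) L.tail).foldr
    (fun u v => concat (tmul u v)) (single [] 1)

theorem edgeProd_singleton {n : ℕ} (σ : Y _⦋n⦌) (p : Fin (n + 1)) :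
    edgeProd R w₀ σ [p] = single [] 1 := rfl

theorem edgeProd_cons {n : ℕ} (σ : Y _⦋n⦌) (p q : Fin (n + 1)) (L : List (Fin (n + 1))) :
    edgeProd R w₀ σ (p :: q :: L) =
      brk R w₀ (subface σ (Finset.Icc p q)) ⋄ edgeProd R w₀ σ (q :: L) := rfl

theorem brk_of_card_two {n : ℕ} (σ : Y _⦋n⦌) {T : Finset (Fin (n + 1))} (hT : T.card = 2) :
    brk R w₀ (subface σ T) = single [] 1 := by
  rw [brk, if_pos]
  rw [subface_dim σ (Finset.card_pos.1 (by omega)), hT]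

theorem brk_edge {n : ℕ} (σ : Y _⦋n⦌) {p q : Fin (n + 1)} (h : (q : ℕ) = p + 1) :
    brk R w₀ (subface σ (Finset.Icc p q)) = single [] 1 :=
  brk_of_card_two R w₀ σ (by rw [Fin.card_Icc]; omega)

theorem edgeProd_of_isChain {n : ℕ} (σ : Y _⦋n⦌) {L : List (Fin (n + 1))}
    (hL : L.IsChain fun p q : Fin (n + 1) => (q : ℕ) = p + 1) : edgeProd R w₀ σ L = single [] 1 := by
  induction L with
  | nil => rfl
  | cons p L ih =>
    rcases L with _ | ⟨q, L⟩
    · rfl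
    · rw [List.isChain_cons_cons] at hL
      rw [edgeProd_cons, brk_edge R w₀ σ hL.1, one_cat, ih hL.2]

theorem brk_of_nd_eq_zero {n : ℕ} (σ : Y _⦋n⦌) {T : Finset (Fin (n + 1))} (hT : 3 ≤ T.card)
    (h : nd R Y (subface σ T) = 0) : brk R w₀ (subface σ T) = 0 := by
  rw [brk, if_neg, h]
  · exact map_zero _
  · rw [subface_dim σ (Finset.card_pos.1 (by omega))]; omega

/-- A list that starts at `p`, misses `x` and contains some `y` above it has a gap of length at
least two. The face over the gap has dimension at least two and omits vertex `0`, so one factor of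
the product is zero. -/
theorem edgeProd_eq_zero {n : ℕ} (σ : Y _⦋n⦌)
    (hσ : ∀ T : Finset (Fin (n + 1)), 2 ≤ T.card → 0 ∉ T → nd R Y (subface σ T) = 0)
    {p : Fin (n + 1)} {L : List (Fin (n + 1))} (hp : p ≠ 0) (hL : (p :: L).SortedLT)
    {x y : Fin (n + 1)} (hx : p ≤ x) (hxy : x ≤ y) (hy : y ∈ p :: L) (hxL : x ∉ p :: L) :
    edgeProd R w₀ σ (p :: L) = 0 := by
  induction L generalizing p with
  | nil =>
    obtain rfl := List.mem_singleton.1 hy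
    exact absurd (List.mem_singleton.2 (le_antisymm hxy hx)) hxL
  | cons q L ih =>
    rw [List.sortedLT_iff_pairwise, List.pairwise_cons] at hL
    have hpq := hL.1 q List.mem_cons_self
    rw [edgeProd_cons]
    by_cases h : (q : ℕ) = p + 1
    · have hxp : x ≠ p := fun h => hxL (h ▸ List.mem_cons_self)
      have hyp : y ≠ p := fun h => hxp (le_antisymm (h ▸ hxy) hx)
      rw [ih (fun h => by subst h; exact absurd hpq (Fin.not_lt_zero p))
        (List.sortedLT_iff_pairwise.2 hL.2) ?_ ((List.mem_cons.1 hy).resolve_left hyp)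
        (fun h => hxL (List.mem_cons_of_mem _ h)), cat_zero]
      have : p < x := lt_of_le_of_ne hx (Ne.symm hxp)
      rw [Fin.lt_def] at this
      rw [Fin.le_def]
      omega
    · have hc : 3 ≤ (Finset.Icc p q).card := by
        rw [Fin.card_Icc]; rw [Fin.lt_def] at hpq; omega
      rw [brk_of_nd_eq_zero R w₀ σ hc (hσ _ (by omega) ?_), zero_cat]
      rw [Finset.mem_Icc]
      exact fun h => hp (le_antisymm h.1 (Fin.zero_le p))

/-- A term of Baues' coproduct. -/
def bauesTerm {n : ℕ} (σ : Y _⦋n⦌) (b : Finset (Fin (n + 1))) :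
    List (chains R Y w₀).Red × List (chains R Y w₀).Red →₀ R :=
  let T : Finset (Fin (n + 1)) := insert 0 (insert (Fin.last n) b)
  sgn R (weight (T.sort.zipWith (fun p q => ((q : ℕ) : ℤ) - ((p : ℕ) : ℤ)) T.sort.tail) -
      ((b.card * (b.card + 1) / 2 : ℕ) : ℤ)) •
    tmul (edgeProd R w₀ σ T.sort) (brk R w₀ (subface σ T))

theorem bauesGen_eq_sum {n : ℕ} (σ : Y _⦋n⦌) :
    bauesGen R w₀ σ = ∑ b ∈ (Finset.Ioo 0 (Fin.last n)).powerset, bauesTerm R w₀ σ b := rfl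

theorem sort_insert_zero {n : ℕ} {T : Finset (Fin (n + 1))} (h : 0 ∉ T) :
    (insert 0 T).sort = 0 :: T.sort :=
  Finset.sort_insert _ (fun _ _ => Fin.zero_le _) h

theorem bauesTerm_empty {n : ℕ} (hn : 0 < n) (σ : Y _⦋n⦌) :
    bauesTerm R w₀ σ ∅ = tmul (brk R w₀ ⟨n, σ⟩) (single [] 1) := by
  have h0 : (0 : Fin (n + 1)) ∉ ({Fin.last n} : Finset (Fin (n + 1))) := by
    simp [Fin.ext_iff]; omega
  have hs : (insert 0 (insert (Fin.last n) ∅) : Finset (Fin (n + 1))).sort = [0, Fin.last n] := by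
    rw [insert_empty_eq, sort_insert_zero h0, Finset.sort_singleton]
  rw [bauesTerm, hs, brk_of_card_two R w₀ σ (by rw [insert_empty_eq, Finset.card_pair]; simpa using h0),
    edgeProd_cons, edgeProd_singleton, cat_one, show Finset.Icc 0 (Fin.last n) = Finset.univ from
      Finset.Icc_bot_top, subface_univ]
  simp [weight, sgn_zero]

theorem insert_insert_Ioo (n : ℕ) :
    (insert 0 (insert (Fin.last n) (Finset.Ioo 0 (Fin.last n))) : Finset (Fin (n + 1))) =
      Finset.univ := by
  ext x
  simp only [Finset.mem_insert, Finset.mem_Ioo, Finset.mem_univ, iff_true, Fin.ext_iff,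
    Fin.lt_def, Fin.val_zero, Fin.val_last]
  have := x.2
  omega

theorem bauesTerm_full {n : ℕ} (hn : 0 < n) (σ : Y _⦋n⦌) :
    bauesTerm R w₀ σ (Finset.Ioo 0 (Fin.last n)) = tmul (single [] 1) (brk R w₀ ⟨n, σ⟩) := by
  have hz : (List.finRange (n + 1)).zipWith (fun p q => ((q : ℕ) : ℤ) - ((p : ℕ) : ℤ))
      (List.finRange (n + 1)).tail = List.replicate n 1 := by
    -- In the exponent the list of vertices is coerced to natural numbers, which elaborates to a
    -- `flatMap`.
    have hm : ∀ l : List (Fin (n + 1)), (l.flatMap fun a : Fin (n + 1) => [a.val]) =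
        l.map Fin.val := fun l => by induction l <;> simp_all
    refine List.ext_getElem (by simp) fun i h1 h2 => ?_
    simp [hm]
  have hc : (List.finRange (n + 1)).IsChain fun p q : Fin (n + 1) => (q : ℕ) = p + 1 := by
    rw [List.isChain_iff_getElem]
    intro i hi
    simp
  rw [bauesTerm, insert_insert_Ioo, Fin.sort_univ, hz, weight_replicate_one,
    edgeProd_of_isChain R w₀ σ hc, subface_univ, Fin.card_Ioo]
  obtain ⟨n, rfl⟩ := Nat.exists_eq_succ_of_ne_zero hn.ne'
  rw [Fin.val_last, Fin.val_zero, Nat.sub_zero, Nat.succ_sub_one, mul_comm n, sub_self, sgn_zero, one_smul]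

/-- A subset that is neither empty nor full gives zero. If it lacks `1`, so does the face in the
right factor, which has dimension at least two. If it contains `1`, the missing vertex forces a gap
behind `1`, and the left factor vanishes by `edgeProd_eq_zero`. -/
theorem bauesGen_eq {n : ℕ} (hn : 3 ≤ n) (σ : Y _⦋n⦌)
    (hσ : ∀ T : Finset (Fin (n + 1)), 2 ≤ T.card → 0 ∉ T ∨ 1 ∉ T → nd R Y (subface σ T) = 0) :
    bauesGen R w₀ σ = tmul (brk R w₀ ⟨n, σ⟩) (single [] 1) +
      tmul (single [] 1) (brk R w₀ ⟨n, σ⟩) := by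
  have h1 : ((1 : Fin (n + 1)) : ℕ) = 1 := by rw [Fin.val_one']; exact Nat.mod_eq_of_lt (by omega)
  have hmem : (1 : Fin (n + 1)) ∈ Finset.Ioo 0 (Fin.last n) := by
    rw [Finset.mem_Ioo, Fin.lt_def, Fin.lt_def, h1, Fin.val_last, Fin.val_zero]
    omega
  rw [bauesGen_eq_sum, ← bauesTerm_empty R w₀ (by omega) σ, ← bauesTerm_full R w₀ (by omega) σ]
  refine Finset.sum_eq_add _ _ (Finset.ne_empty_of_mem hmem).symm ?_
    (fun h => absurd (Finset.empty_mem_powerset _) h)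
    (fun h => absurd (Finset.mem_powerset_self _) h)
  rintro b hb ⟨hb0, hb1⟩
  rw [Finset.mem_powerset] at hb
  have hlast : Fin.last n ∉ b := fun h => lt_irrefl _ (Finset.mem_Ioo.1 (hb h)).2
  have hzero : 0 ∉ insert (Fin.last n) b := by
    rw [Finset.mem_insert]
    rintro (h | h)
    · have := congrArg Fin.val h; simp at this; omega
    · exact lt_irrefl _ (Finset.mem_Ioo.1 (hb h)).1
  rw [bauesTerm]
  by_cases h : 1 ∈ b
  · obtain ⟨x, hx, hxb⟩ := Finset.exists_of_ssubset (lt_of_le_of_ne hb hb1)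
    -- As `1` is the smallest element after `0`, the first gap is an edge, and the remaining gaps
    -- belong to a list starting at `1`.
    have hs : ∃ L, (insert (Fin.last n) b).sort = 1 :: L := by
      have h1L : ∀ x ∈ (insert (Fin.last n) b).erase 1, 1 ≤ x := fun x hx => by
        have : x ≠ 0 := fun h => hzero (h ▸ Finset.mem_of_mem_erase hx)
        rw [Fin.le_def, h1]
        exact Nat.one_le_iff_ne_zero.2 fun h => this (Fin.ext h)
      rw [← Finset.insert_erase (Finset.mem_insert_of_mem h),
        Finset.sort_insert _ h1L (Finset.notMem_erase _ _)]
      exact ⟨_, rfl⟩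
    obtain ⟨L, hL⟩ := hs
    have hsort : (1 :: L).SortedLT := hL ▸ Finset.sortedLT_sort _
    have hx1 : 1 ≤ x := by
      have : 0 < (x : ℕ) := (Finset.mem_Ioo.1 hx).1
      rw [Fin.le_def, h1]; exact this
    rw [sort_insert_zero hzero, hL, edgeProd_cons, edgeProd_eq_zero R w₀ σ
      (fun T hT h0 => hσ T hT (Or.inl h0)) (Finset.mem_Ioo.1 hmem).1.ne'
      hsort hx1 (Fin.le_last x), cat_zero, zero_tmul, smul_zero]
    · rw [← hL, Finset.mem_sort]; exact Finset.mem_insert_self _ _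
    · rw [← hL, Finset.mem_sort, Finset.mem_insert]
      rintro (h | h)
      · exact lt_irrefl _ (h ▸ (Finset.mem_Ioo.1 hx).2)
      · exact hxb h
  · have hc : 3 ≤ (insert 0 (insert (Fin.last n) b)).card := by
      rw [Finset.card_insert_of_notMem hzero, Finset.card_insert_of_notMem hlast]
      have := Finset.card_pos.2 (Finset.nonempty_iff_ne_empty.2 hb0)
      omega
    have h1' : 1 ∉ insert 0 (insert (Fin.last n) b) := by
      rw [Finset.mem_insert, Finset.mem_insert]
      have := Finset.mem_Ioo.1 hmem
      exact fun h' => h'.elim this.1.ne' fun h' => h'.elim this.2.ne h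
    rw [brk_of_nd_eq_zero R w₀ σ hc (hσ _ (by omega) (Or.inr h1')), tmul_zero, smul_zero]

end Baues

end

end DoubleCobar

namespace DoubleCobar

open Finsupp (single)

noncomputable section

/-! ### The homotopy BV-structure for the cobar construction of the general definition -/

section DoubleCobarConstruction

variable {R : Type v} [CommRing R] {α : Type u} {d : α → ℤ} {δ : α → (α →₀ R)}

theorem doubleCobar_isHomotopyBVAlgebra (hδ : ∀ a, δ a ∈ homog d (d a - 1))
    (hδ' : ∀ a, lin δ (δ a) = 0) (hd : ∀ a, 2 ≤ d a) :
    ((tensorAlgebra d (letterD d δ)).cobar (shuffleCoproduct d)).IsHomotopyBVAlgebra concat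
      (braceMul d) ((tensorAlgebra d (letterD d δ)).connesMoscovici concat (shuffleCoproduct d)
        (antipode d)) := by
  have h : ∀ (f : List (NE α) → ℤ) (D Δ : (List (NE α) →₀ R) →ₗ[R] (List (NE α) →₀ R)),
      f = wdeg (sdeg d) → D = cobarDiff d δ → Δ = cmOp d →
      (DGMod.mk (List (NE α)) f [] D).IsHomotopyBVAlgebra concat (braceMul d) Δ := by
    rintro _ _ _ rfl rfl rfl
    exact cobar_isHomotopyBVAlgebra hδ hδ' hd
  exact h _ _ _ (cobar_deg (tensorAlgebra d (letterD d δ)) (shuffleCoproduct d)) (tensorAlgebra_cobar_d d δ)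
    (connesMoscovici_eq d _)

theorem doubleCobar_op (x : NE (NE α)) (ys : List (NE (NE α))) :
    ((tensorAlgebra d (letterD d δ)).cobar (shuffleCoproduct d)).op (braceMul d) [x] ys =
      (tensorAlgebra d (letterD d δ)).kadeishvili concat (shuffleCoproduct d) x.1
        (ys.map Subtype.val) := by
  have h := (kadeishvili_eq_kadRec (d := d) (letterD d δ) x.1 (ys.map Subtype.val)).trans
    (kadRec_eq x.1 ys)
  exact (braceMul_op (d := d) (cobarDiff d δ) x ys).trans h.symm

/-- The cobar construction of the chains has the basis of the tensor algebra model, but its degree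
and differential agree with the model only propositionally. Since the types of `nabla` and `mul`
mention `Ω`, all data are abstracted, with heterogeneous equalities, and then substituted. -/
theorem exists_doubleCobar (hδ : ∀ a, δ a ∈ homog d (d a - 1)) (hδ' : ∀ a, lin δ (δ a) = 0)
    (hd : ∀ a, 2 ≤ d a) (Ω : DGMod.{u} R) {f : List α → ℤ}
    {D : (List α →₀ R) →ₗ[R] (List α →₀ R)} (hΩ : Ω = DGMod.mk (List α) f [] D)
    (hf : f = wdeg d) (hD : D = letterD d δ)
    (nabla : Ω.V →ₗ[R] (Ω.B × Ω.B →₀ R)) (mul : (Ω.B × Ω.B →₀ R) →ₗ[R] Ω.V)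
    (hnabla : HEq nabla (shuffleCoproduct (R := R) d)) (hmul : HEq mul (concat (R := R) (α := α))) :
    ∃ S : Ω.V →ₗ[R] Ω.V, Ω.IsInvolutiveDGHopf mul nabla S ∧
      ∃ μ : (List (Ω.cobar nabla).Red × List (Ω.cobar nabla).Red →₀ R) →ₗ[R]
          (List (Ω.cobar nabla).Red →₀ R),
        (∀ (x : (Ω.cobar nabla).Red) (ys : List (Ω.cobar nabla).Red), 1 ≤ ys.length →
          (Ω.cobar nabla).op μ [x] ys = Ω.kadeishvili mul nabla x.1 (ys.map Subtype.val)) ∧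
        (Ω.cobar nabla).IsHomotopyBVAlgebra concat μ (Ω.connesMoscovici mul nabla S) := by
  subst hf hD hΩ
  obtain rfl := eq_of_heq hnabla
  obtain rfl := eq_of_heq hmul
  exact ⟨antipode d, tensorAlgebra_isInvolutiveDGHopf hδ hδ', braceMul d,
    fun x ys _ => doubleCobar_op x ys, doubleCobar_isHomotopyBVAlgebra hδ hδ' hd⟩

end DoubleCobarConstruction

/-! ### Baues' coproduct on the double suspension -/

section DoubleSuspensionCobar

variable (R : Type v) [CommRing R] {X : SSet.{u}} {x₀ : X _⦋0⦌}

local notation "y₀" => suspensionBase X x₀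
local notation "S²" => suspension (suspension X x₀) y₀
local notation "z₀" => suspensionBase (suspension X x₀) y₀

theorem bauesGen_doubleSuspension (hX : ∀ x : X _⦋0⦌, x = x₀) (c : (chains R S² z₀).Red) :
    bauesGen R z₀ c.1.2.1 = single ([c], []) 1 + single ([], [c]) 1 := by
  obtain ⟨b, hb⟩ := c
  obtain rfl | ⟨m, x, h, rfl⟩ := nonDegenerate_doubleSuspension hX b
  · exact absurd rfl hb
  have hbrk : brk R z₀ ⟨m + 3, cone y₀ (cone x₀ x)⟩ =
      single [(⟨⟨m + 3, _, h⟩, hb⟩ : (chains R S² z₀).Red)] 1 := by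
    rw [brk, if_neg (by simp), nd_of_nonDegenerate R (⟨_, h⟩ : S².nonDegenerate (m + 3))]
    exact word_single (M := chains R S² z₀) ⟨⟨m + 3, _, h⟩, hb⟩
  refine (bauesGen_eq R z₀ (n := m + 3) (by omega) (cone y₀ (cone x₀ x))
    fun T hT h => nd_subface_of_forall_ne R x hT h).trans ?_
  rw [hbrk, tmul_single, tmul_single]

/-- Both coproducts are multiplicative on words, and on a letter both are primitive by
`bauesGen_doubleSuspension`. -/
theorem baues_doubleSuspension (hX : ∀ x : X _⦋0⦌, x = x₀) :
    baues R z₀ = shuffleCoproduct (redDeg (chains R S² z₀)) := by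
  refine ext_single fun w => (lin_single _ _).trans ?_
  induction w with
  | nil => exact (shuffle_nil _).symm
  | cons c w ih =>
    rw [single_cons, shuffle_cat, shuffle_letter, ← bauesGen_doubleSuspension R hX c, ← ih]
    exact congrArg (fun f : List (chains R S² z₀).Red → ℤ => mulT f concat
      (tmul (bauesGen R z₀ c.1.2.1) (bauesWord R z₀ w)))
        (cobar_deg (chains R S² z₀) (alexanderWhitney R z₀))

theorem coOp_shuffleCoproduct {M : DGMod.{u} R} (s : M.Red → ℤ) {i j : ℕ} (hi : 1 ≤ i)
    (hj : 1 ≤ j) (c : M.Red) : M.coOp (shuffleCoproduct s) i j c = 0 := by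
  rw [DGMod.coOp, shuffle_letter, Finsupp.filter_add, Finsupp.filter_single_of_neg,
    Finsupp.filter_single_of_neg, add_zero]
  · rintro ⟨h, -⟩; rw [← h] at hi; simp at hi
  · rintro ⟨-, h⟩; rw [← h] at hj; simp at hj

end DoubleSuspensionCobar

end

end DoubleCobar

/-! ### The theorem -/

theorem mainTheorem1 (R : Type v) [CommRing R] (X : SSet.{u}) (x₀ : X _⦋0⦌)
    (hX : ∀ x : X _⦋0⦌, x = x₀) :
    let y₀ := suspensionBase X x₀
    let z₀ := suspensionBase (suspension X x₀) y₀
    let C := chains.{u, v} R (suspension (suspension X x₀) y₀) z₀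
    let AW := alexanderWhitney R z₀
    let nabla := baues R z₀
    let ΩC := C.cobar AW
    let ΩΩC := ΩC.cobar nabla
    C.IsHomotopyGCoalgebra AW nabla ∧
    (∀ i j : ℕ, 1 ≤ i → 1 ≤ j → ∀ c, C.coOp nabla i j c = 0) ∧
    nabla = shuffleCoproduct (fun c : C.Red => C.deg c.1 - 1) ∧
    ∃ S : ΩC.V →ₗ[R] ΩC.V, ΩC.IsInvolutiveDGHopf concat nabla S ∧
      ∃ μ : (List ΩΩC.Red × List ΩΩC.Red →₀ R) →ₗ[R] (List ΩΩC.Red →₀ R),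
        (∀ (x : ΩΩC.Red) (ys : List ΩΩC.Red), 1 ≤ ys.length →
          ΩΩC.op μ [x] ys = ΩC.kadeishvili concat nabla x.1 (ys.map Subtype.val)) ∧
        ΩΩC.IsHomotopyBVAlgebra concat μ (ΩC.connesMoscovici concat nabla S) := by
  intro y₀ z₀ C AW nabla ΩC ΩΩC
  have hC : C.IsComplex := chains_isComplex R hX
  have hAW : IsPrimitive C AW := isPrimitive_alexanderWhitney R hX
  have hnabla : nabla = shuffleCoproduct (redDeg C) := baues_doubleSuspension R hX
  -- Reduced simplices have dimension at least `3`. After one desuspension the letters of `ΩC` have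
  -- degree at least `2`, the bound that makes the double cobar construction connected.
  have hdeg : ∀ c : C.Red, 2 ≤ redDeg C c := fun c => by
    have : 3 ≤ C.deg c.1 := three_le_deg R hX c
    rw [redDeg]; omega
  have hop : ∀ i j : ℕ, 1 ≤ i → 1 ≤ j → ∀ c, C.coOp nabla i j c = 0 := fun i j hi hj c => by
    rw [hnabla]; exact coOp_shuffleCoproduct R _ hi hj c
  have key := exists_doubleCobar (redDiff_mem_homog hC) (redDiff_redDiff hC) hdeg ΩC rfl
    (cobar_deg C AW) hAW.cobar_d nabla concat (heq_of_eq hnabla) HEq.rfl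
  refine ⟨⟨hAW.isDGCoalgebra hC, fun b hb => ?_, ?_, fun i j hi hj c =>
    hop i j hi (by omega) c⟩, hop, hnabla, key⟩
  · have : 2 ≤ C.deg b - 1 := hdeg ⟨b, hb⟩
    omega
  · obtain ⟨S, hS, -⟩ := key
    exact hS.bialgebra
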